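/- Let $(M,g)$ be a closed (compact, without boundary) smooth four-dimensional Riemannian manifold with Ricci tensor $Ric_g$, scalar curvature $R_g$, Laplace–Beltrami operator $\Delta_g$ and volume measure $dV_g$, and let $K:M\to\mathbb R$ be a smooth positive function. Put $$Q_g=-\tfrac1{12}\left(\Delta_gR_g-R_g^2+3|Ric_g|^2\right),\qquad \kappa_g=\int_MQ_g\,dV_g,$$ $$P_g\varphi=\Delta_g^2\varphi-\mathrm{div}_g\left(\left(\tfrac23R_g\,g-2Ric_g\right)\nabla_g\varphi\right)\quad(\varphi\in C^\infty(M)).$$ Let $H^2(M)$ be the Sobolev space of functions that are in $L^2$ together with their weak first and second derivatives (functions being identified, and inequalities understood, almost everywhere), let $H^2_Q(M)=\{u\in H^2(M):\int_MQ_gu\,dV_g=0\}$, and for $u,v\in H^2(M)$ let $$\langle u,v\rangle_g=\int_M\Delta_gu\,\Delta_gv\,dV_g+\tfrac23\int_MR_g\,\nabla_gu\cdot\nabla_gv\,dV_g-\int_M2Ric_g(\nabla_gu,\nabla_gv)\,dV_g .$$ Assume that $P_g\ge0$, i.e. $\int_M\varphi\,P_g\varphi\,dV_g\ge0$ for all $\varphi\in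 C^\infty(M)$; that $\ker P_g\simeq\mathbb R$, i.e. the only $u\in H^2(M)$ with $P_gu=0$ weakly ($\int_Mu\,P_g\varphi\,dV_g=0$ for all $\varphi\in C^\infty(M)$) are the constants; that $0<\kappa_g\le8\pi^2$; and that $0<t\le1$. For $u\in H^2_Q(M)$ let $T_g(u)$ denote the unique minimizer of $\langle v,v\rangle_g$ among all $v\in H^2_Q(M)$ with $v\ge u$, and set $$J_t(u)=\langle u,u\rangle_g+4t\int_MQ_gu\,dV_g-t\kappa_g\log\int_MKe^{4u}\,dV_g,$$ $$I_t(u)=\langle u,u\rangle_g-t\kappa_g\log\int_MKe^{4T_g(u)}\,dV_g .$$ Then $u\in H^2_Q(M)$ is a minimizer of $J_t$ on $H^2_Q(M)$ if and only if $u\in H^2_Q(M)$ is a minimizer of $I_t$ on $H^2_Q(M)$. -/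

import Mathlib

open scoped Manifold ContDiff Topology
open MeasureTheory

namespace Paneitz

/-- The model space of four-dimensional manifolds. -/
abbrev E4 : Type := EuclideanSpace ℝ (Fin 4)

noncomputable section

/-! ### Weak derivatives on open subsets of Euclidean space -/

/-- The `i`-th standard basis vector. -/
def stdVec (i : Fin 4) : E4 := EuclideanSpace.single i 1

/-- `f` belongs to `L²_loc(Ω)`. -/
def LocL2 (Ω : Set E4) (f : E4 → ℝ) : Prop :=
  ∀ C : Set E4, C ⊆ Ω → IsCompact C → MemLp f 2 (volume.restrict C)

/-- `f, f' ∈ L²_loc(Ω)` and `f'` is the weak partial derivative `∂_i f` on the open set `Ω`. -/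
def HasWeakPartial (Ω : Set E4) (i : Fin 4) (f f' : E4 → ℝ) : Prop :=
  LocL2 Ω f ∧ LocL2 Ω f' ∧
    ∀ φ : E4 → ℝ, ContDiff ℝ ∞ φ → HasCompactSupport φ → tsupport φ ⊆ Ω →
      ∫ y, f y * fderiv ℝ φ y (stdVec i) = - ∫ y, f' y * φ y

section Manifold

variable {M : Type*} [TopologicalSpace M] [ChartedSpace E4 M]

/-- `∂_i f` at `x`, in the coordinates of the chart at `p` (meaningful for `x` in the domain of
that chart). -/
def pderiv (p : M) (i : Fin 4) (f : M → ℝ) (x : M) : ℝ :=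
  fderiv ℝ (f ∘ (extChartAt (𝓡 4) p).symm) (extChartAt (𝓡 4) p x) (stdVec i)

/-- `u ∈ H²(M)`, for `M` compact: in every chart, `u` has weak derivatives of orders one and two,
and `u` and these derivatives are locally square integrable. -/
def MemH2 (u : M → ℝ) : Prop :=
  ∀ p : M, ∃ (f : Fin 4 → E4 → ℝ) (h : Fin 4 → Fin 4 → E4 → ℝ),
    (∀ i, HasWeakPartial (extChartAt (𝓡 4) p).target i (u ∘ (extChartAt (𝓡 4) p).symm) (f i)) ∧
    ∀ i j, HasWeakPartial (extChartAt (𝓡 4) p).target j (f i) (h i j)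

variable [IsManifold (𝓡 4) ∞ M]

/-- The coordinate vector field `∂_i` of the chart at `p`, at the point `x`. -/
def coordVec (p : M) (i : Fin 4) (x : M) : TangentSpace (𝓡 4) x :=
  (trivializationAt E4 (TangentSpace (𝓡 4) : M → Type _) p).symmL ℝ x (stdVec i)

/-- The `i`-th component of the tangent vector `v` at `x`, in the coordinates of the chart
at `p`. -/
def coordComp (p : M) (i : Fin 4) (x : M) (v : TangentSpace (𝓡 4) x) : ℝ :=
  ((trivializationAt E4 (TangentSpace (𝓡 4) : M → Type _) p).continuousLinearMapAt ℝ x v : E4) i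

variable (M) in
/-- Smooth Riemannian metrics on `M`. -/
abbrev Metric : Type _ :=
  Bundle.ContMDiffRiemannianMetric (𝓡 4) ∞ E4 (TangentSpace (𝓡 4) : M → Type _)

variable (g : Metric M)

/-! ### Curvature and differential operators

Quantities with an argument `p` are expressed in the coordinates of the chart at `p`, as
functions on the domain of this chart. Invariant quantities are evaluated at `x` in the
chart at `x`. -/

/-- The matrix `(g_ij)`. -/
def gram (p x : M) : Matrix (Fin 4) (Fin 4) ℝ :=
  Matrix.of fun i j => g.inner x (coordVec p i x) (coordVec p j x)

/-- The inverse matrix `(g^ij)`. -/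
def gramInv (p x : M) : Matrix (Fin 4) (Fin 4) ℝ := (gram g p x)⁻¹

/-- The density `√(det g_ij)`. -/
def density (p x : M) : ℝ := √(gram g p x).det

/-- The Christoffel symbol `Γ^k_ij`. -/
def christoffel (p : M) (k i j : Fin 4) (x : M) : ℝ :=
  (1 / 2) * ∑ l, gramInv g p x k l *
    (pderiv p i (fun z => gram g p z j l) x + pderiv p j (fun z => gram g p z i l) x
      - pderiv p l (fun z => gram g p z i j) x)

/-- The component `Ric_ij` of the Ricci tensor. -/
def ricciComp (p : M) (i j : Fin 4) (x : M) : ℝ :=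
  ∑ k, (pderiv p k (christoffel g p k i j) x - pderiv p j (christoffel g p k i k) x
    + ∑ l, (christoffel g p k k l x * christoffel g p l i j x
      - christoffel g p k j l x * christoffel g p l i k x))

/-- The Ricci tensor `Ric_g` at `x`. -/
def ricci (x : M) (v w : TangentSpace (𝓡 4) x) : ℝ :=
  ∑ i, ∑ j, ricciComp g x i j x * coordComp x i x v * coordComp x j x w

/-- The scalar curvature `R_g`. -/
def scalarCurv (x : M) : ℝ := ∑ i, ∑ j, gramInv g x x i j * ricciComp g x i j x

/-- `|Ric_g|²`. -/
def ricciNormSq (x : M) : ℝ :=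
  ∑ i, ∑ j, ∑ k, ∑ l, gramInv g x x i k * gramInv g x x j l
    * ricciComp g x i j x * ricciComp g x k l x

/-- The gradient `∇_g f`. -/
def grad (f : M → ℝ) (x : M) : TangentSpace (𝓡 4) x :=
  ∑ i, (∑ j, gramInv g x x i j * pderiv x j f x) • coordVec x i x

/-- The endomorphism `Ric_g^♯` of the tangent space: `g(Ric^♯ v, w) = Ric(v, w)`. -/
def ricciSharp (x : M) (v : TangentSpace (𝓡 4) x) : TangentSpace (𝓡 4) x :=
  ∑ i, (∑ j, gramInv g x x i j * ricci g x v (coordVec x j x)) • coordVec x i x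

/-- The divergence `div_g X` of a vector field. -/
def div (X : ∀ x : M, TangentSpace (𝓡 4) x) (x : M) : ℝ :=
  (density g x x)⁻¹ * ∑ i, pderiv x i (fun z => density g x z * coordComp x i z (X z)) x

/-- The Laplace-Beltrami operator `Δ_g = div_g ∇_g`. -/
def laplacian (f : M → ℝ) : M → ℝ := div g (grad g f)

/-- The `Q`-curvature `Q_g = -(1/12) (Δ_g R_g - R_g² + 3 |Ric_g|²)`. -/
def qCurv (x : M) : ℝ :=
  -(1 / 12) * (laplacian g (scalarCurv g) x - scalarCurv g x ^ 2 + 3 * ricciNormSq g x)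

/-- The Paneitz operator on smooth functions,
`P_g φ = Δ_g² φ - div_g (((2/3) R_g g - 2 Ric_g) ∇_g φ)`. -/
def paneitz (φ : M → ℝ) (x : M) : ℝ :=
  laplacian g (laplacian g φ) x
    - div g (fun z => (2 / 3 * scalarCurv g z) • grad g φ z
        - (2 : ℝ) • ricciSharp g z (grad g φ z)) x

/-! ### Riemannian volume -/

variable [MeasurableSpace M]

/-- The measure `√(det g_ij) dx` of the chart at `p`, carried to the domain of that chart. -/
def chartVolume (p : M) : Measure M :=
  ((volume.restrict (extChartAt (𝓡 4) p).target).withDensity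
    (fun y => ENNReal.ofReal (density g p ((extChartAt (𝓡 4) p).symm y)))).map
    (extChartAt (𝓡 4) p).symm

/-- The Riemannian volume measure `dV_g`. The measures of the charts are the restrictions of `dV_g`
to the chart domains, and `dV_g` is the least measure above all of them. -/
def vol : Measure M := ⨆ p : M, chartVolume g p

/-! ### Sobolev functions and the Paneitz form -/

/-- The vector field `X` is the weak gradient of `u`: in each chart, `g(X, ∂_i)` is the weak
partial derivative `∂_i u`. -/
def IsWeakGrad (u : M → ℝ) (X : ∀ x : M, TangentSpace (𝓡 4) x) : Prop :=
  ∀ (p : M) (i : Fin 4), HasWeakPartial (extChartAt (𝓡 4) p).target i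
    (u ∘ (extChartAt (𝓡 4) p).symm)
    ((fun x => g.inner x (X x) (coordVec p i x)) ∘ (extChartAt (𝓡 4) p).symm)

/-- The weak gradient `∇_g u` of `u ∈ H²(M)` (it is unique almost everywhere). -/
def weakGrad (u : M → ℝ) : ∀ x : M, TangentSpace (𝓡 4) x :=
  Classical.epsilon (IsWeakGrad g u)

/-- `w ∈ L²(M)` is the weak Laplacian of `u`. -/
def IsWeakLaplacian (u w : M → ℝ) : Prop :=
  MemLp w 2 (vol g) ∧ ∀ φ : M → ℝ, ContMDiff (𝓡 4) 𝓘(ℝ, ℝ) ∞ φ →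
    ∫ x, w x * φ x ∂(vol g) = ∫ x, u x * laplacian g φ x ∂(vol g)

/-- The weak Laplacian `Δ_g u` of `u ∈ H²(M)` (it is unique almost everywhere). -/
def weakLaplacian (u : M → ℝ) : M → ℝ := Classical.epsilon (IsWeakLaplacian g u)

/-- The bilinear form `⟨u, v⟩_g` on `H²(M)`. -/
def form (u v : M → ℝ) : ℝ :=
  (∫ x, weakLaplacian g u x * weakLaplacian g v x ∂(vol g))
    + 2 / 3 * (∫ x, scalarCurv g x * g.inner x (weakGrad g u x) (weakGrad g v x) ∂(vol g))
    - ∫ x, 2 * ricci g x (weakGrad g u x) (weakGrad g v x) ∂(vol g)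

/-- The total `Q`-curvature `κ_g`. -/
def kappa : ℝ := ∫ x, qCurv g x ∂(vol g)

/-- The space `H²_Q(M)`. -/
def H2Q : Set (M → ℝ) := {u | MemH2 u ∧ ∫ x, qCurv g x * u x ∂(vol g) = 0}

/-- `P_g ≥ 0`. -/
def PaneitzNonneg : Prop :=
  ∀ φ : M → ℝ, ContMDiff (𝓡 4) 𝓘(ℝ, ℝ) ∞ φ → 0 ≤ ∫ x, φ x * paneitz g φ x ∂(vol g)

/-- The kernel of `P_g` on `H²(M)`: the functions `u ∈ H²(M)` with `P_g u = 0` weakly. -/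
def paneitzKer : Set (M → ℝ) :=
  {u | MemH2 u ∧ ∀ φ : M → ℝ, ContMDiff (𝓡 4) 𝓘(ℝ, ℝ) ∞ φ →
    ∫ x, u x * paneitz g φ x ∂(vol g) = 0}

/-- `v` solves the obstacle problem: it minimizes `⟨v, v⟩_g` among `v ∈ H²_Q(M)` with `v ≥ u`. -/
def IsObstacleSol (u v : M → ℝ) : Prop :=
  (v ∈ H2Q g ∧ u ≤ᵐ[vol g] v) ∧ ∀ w ∈ H2Q g, u ≤ᵐ[vol g] w → form g v v ≤ form g w w

/-- The obstacle solution map `T_g` (the solution is unique almost everywhere). -/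
def obstacleMap (u : M → ℝ) : M → ℝ := Classical.epsilon (IsObstacleSol g u)

/-- The functional `J_t`. -/
def J (K : M → ℝ) (t : ℝ) (u : M → ℝ) : ℝ :=
  form g u u + 4 * t * (∫ x, qCurv g x * u x ∂(vol g))
    - t * kappa g * Real.log (∫ x, K x * Real.exp (4 * u x) ∂(vol g))

/-- The functional `I_t`. -/
def I (K : M → ℝ) (t : ℝ) (u : M → ℝ) : ℝ :=
  form g u u
    - t * kappa g * Real.log (∫ x, K x * Real.exp (4 * obstacleMap g u x) ∂(vol g))

end Manifold

end

end Paneitz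

/-! On H²_Q the linear term of J_t vanishes, so J_t(u) and I_t(u) differ only in that u is replaced
by T(u) inside the exponential. Since T(u) ≥ u, K > 0 and tκ > 0, one has I_t(u) ≤ J_t(u). Since u
competes in its own obstacle problem, ⟨T(u),T(u)⟩ ≤ ⟨u,u⟩, hence J_t(T(u)) ≤ I_t(u). If u minimizes
J_t, then I_t(u) ≤ J_t(u) ≤ J_t(T(v)) ≤ I_t(v). If u minimizes I_t, put w = T(u). Uniqueness in the
obstacle problem gives T(w) = w, so I_t(w) = J_t(w). The logarithmic terms of I_t(u) and I_t(w) then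
coincide, and I_t(u) ≤ I_t(w) forces ⟨u,u⟩ ≤ ⟨w,w⟩. Thus u solves its own obstacle problem, u = T(u)
almost everywhere, and J_t(u) = I_t(u) ≤ I_t(v) ≤ J_t(v).

This argument rests on two analytic facts: T is well defined up to null sets, and the exponential
integrals are finite. Existence and uniqueness for T (`exists_isObstacleSol`, `IsObstacleSol.ae_eq`)
follow from the parallelogram identity once the form is coercive on H²_Q (`exists_coercive`).
Coercivity combines Gårding's inequality with a quantitative substitute for Rellich's theorem
(`exists_compactness_inequality`): a sequence violating it would converge to an element of the
kernel, hence to a constant, which must be 0 because κ ≠ 0. The finiteness of the integrals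
(`MemH2.integrable_exp_abs`) needs no sharp constant: u differs from a smooth function by something
small in H², and smallness of the gradient in L⁴ suffices (`exists_exp_bound`).

Everything must also be extracted from definitions in coordinates, where invariants at a point use
the chart at that very point and weak derivatives are arbitrary choices. Hence the transformation
laws (`ricE_transform`, `vol_restrict_src`, `divIn_eq_divIn`), which give smoothness and integration
by parts. Interior elliptic estimates (`elliptic_estimate`, `exists_setIntegral_pd_pd_sq_le`) show
that L² convergence of smooth functions and of their Laplacians controls all second derivatives.
With the density of smooth functions (`MemH2.exists_approx`), the form becomes a limit of ∫ φ P_g ψ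
over smooth functions (`Approx.tendsto_form`), and its algebraic properties follow by passing to the
limit. -/

namespace Paneitz

/-! ### Partial derivatives on Euclidean space -/

/-- The `i`-th partial derivative. -/
noncomputable def pd (i : Fin 4) (f : E4 → ℝ) (y : E4) : ℝ := fderiv ℝ f y (stdVec i)

lemma pd_contDiffOn {U : Set E4} (hU : IsOpen U) {f : E4 → ℝ} (hf : ContDiffOn ℝ ∞ f U)
    (i : Fin 4) : ContDiffOn ℝ ∞ (pd i f) U :=
  (hf.fderiv_of_isOpen hU (m := ∞) (by simp)).clm_apply contDiffOn_const

lemma pd_contDiff {f : E4 → ℝ} (hf : ContDiff ℝ ∞ f) (i : Fin 4) : ContDiff ℝ ∞ (pd i f) :=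
  (hf.fderiv_right (m := ∞) (by simp)).clm_apply contDiff_const

lemma pd_congr {f g : E4 → ℝ} {y : E4} (h : f =ᶠ[𝓝 y] g) (i : Fin 4) : pd i f y = pd i g y := by
  simp only [pd, h.fderiv_eq]

lemma pd_congr_of_eqOn {U : Set E4} (hU : IsOpen U) {f g : E4 → ℝ} (h : Set.EqOn f g U) {y : E4}
    (hy : y ∈ U) (i : Fin 4) : pd i f y = pd i g y :=
  pd_congr (h.eventuallyEq_of_mem (hU.mem_nhds hy)) i

lemma pd_add {f g : E4 → ℝ} {y : E4} (hf : DifferentiableAt ℝ f y) (hg : DifferentiableAt ℝ g y)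
    (i : Fin 4) : pd i (fun z => f z + g z) y = pd i f y + pd i g y := by
  simp only [pd, fderiv_fun_add hf hg, _root_.add_apply]

lemma pd_sub {f g : E4 → ℝ} {y : E4} (hf : DifferentiableAt ℝ f y) (hg : DifferentiableAt ℝ g y)
    (i : Fin 4) : pd i (fun z => f z - g z) y = pd i f y - pd i g y := by
  simp only [pd, fderiv_fun_sub hf hg, _root_.sub_apply]

lemma pd_mul {f g : E4 → ℝ} {y : E4} (hf : DifferentiableAt ℝ f y) (hg : DifferentiableAt ℝ g y)
    (i : Fin 4) : pd i (fun z => f z * g z) y = pd i f y * g y + f y * pd i g y := by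
  simp only [pd, fderiv_fun_mul hf hg, _root_.add_apply,
    _root_.smul_apply, smul_eq_mul]
  ring

/-- No differentiability is needed: for c ≠ 0 the functions f and c f are differentiable at the same
points, and for c = 0 both sides vanish. -/
lemma pd_const_mul (c : ℝ) (f : E4 → ℝ) (y : E4) (i : Fin 4) :
    pd i (fun z => c * f z) y = c * pd i f y := by
  have h := congrArg (fun L : E4 →L[ℝ] ℝ => L (stdVec i))
    (congrFun (fderiv_const_smul_field (𝕜 := ℝ) (f := f) c) y)
  exact h

lemma pd_const (c : ℝ) (y : E4) (i : Fin 4) : pd i (fun _ => c) y = 0 := by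
  simp [pd]

lemma pd_sum {ι : Type*} (s : Finset ι) {f : ι → E4 → ℝ} {y : E4}
    (hf : ∀ a ∈ s, DifferentiableAt ℝ (f a) y) (i : Fin 4) :
    pd i (fun z => ∑ a ∈ s, f a z) y = ∑ a ∈ s, pd i (f a) y := by
  simp only [pd, fderiv_fun_sum hf, _root_.sum_apply]

lemma pd_comm {f : E4 → ℝ} {y : E4} (hf : ContDiffAt ℝ 2 f y) (i j : Fin 4) :
    pd i (pd j f) y = pd j (pd i f) y := by
  have hs := hf.isSymmSndFDerivAt (by simp)
  have h1 : DifferentiableAt ℝ (fderiv ℝ f) y :=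
    (hf.fderiv_right (m := 1) (by norm_num)).differentiableAt (by simp)
  have key : ∀ i j : Fin 4, pd i (pd j f) y = fderiv ℝ (fderiv ℝ f) y (stdVec i) (stdVec j) := by
    intro i j
    unfold pd
    rw [fderiv_clm_apply h1 (differentiableAt_const _)]
    simp
  rw [key, key, hs.eq]

lemma eq_sum_stdVec (v : E4) : v = ∑ i, v i • stdVec i := by
  ext j
  simp [stdVec, Finset.sum_apply, Pi.single_apply]

lemma fderiv_eq_sum_pd (f : E4 → ℝ) (y v : E4) : fderiv ℝ f y v = ∑ i, v i * pd i f y := by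
  conv_lhs => rw [eq_sum_stdVec v]
  simp [pd]

lemma pd_coord {τ : E4 → E4} {y : E4} (hτ : DifferentiableAt ℝ τ y) (i a : Fin 4) :
    pd i (fun z => τ z a) y = fderiv ℝ τ y (stdVec i) a := by
  have := ((EuclideanSpace.proj (𝕜 := ℝ) a : E4 →L[ℝ] ℝ).hasFDerivAt (x := τ y)).comp y
    hτ.hasFDerivAt
  unfold pd
  have h2 : fderiv ℝ (fun z => τ z a) y = (EuclideanSpace.proj (𝕜 := ℝ) a : E4 →L[ℝ] ℝ).comp
      (fderiv ℝ τ y) := this.fderiv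
  rw [h2]; rfl

lemma pd_comp {f : E4 → ℝ} {τ : E4 → E4} {y : E4} (hf : DifferentiableAt ℝ f (τ y))
    (hτ : DifferentiableAt ℝ τ y) (i : Fin 4) :
    pd i (fun z => f (τ z)) y = ∑ a, pd i (fun z => τ z a) y * pd a f (τ y) := by
  have h : pd i (fun z => f (τ z)) y = fderiv ℝ f (τ y) (fderiv ℝ τ y (stdVec i)) := by
    unfold pd
    rw [show (fun z => f (τ z)) = f ∘ τ from rfl, fderiv_comp y hf hτ]; rfl
  rw [h, fderiv_eq_sum_pd]
  simp only [pd_coord hτ]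

/-! ### Matrix-valued functions -/

/-- Smoothness of the entries of a matrix-valued function. -/
def MSmooth (U : Set E4) (A : E4 → Matrix (Fin 4) (Fin 4) ℝ) : Prop :=
  ∀ a b, ContDiffOn ℝ ∞ (fun z => A z a b) U

/-- The entrywise `i`-th partial derivative. -/
noncomputable def dM (i : Fin 4) (A : E4 → Matrix (Fin 4) (Fin 4) ℝ) (y : E4) :
    Matrix (Fin 4) (Fin 4) ℝ :=
  Matrix.of fun a b => pd i (fun z => A z a b) y

lemma differentiableAt_of_contDiffOn {U : Set E4} (hU : IsOpen U) {F : Type*}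
    [NormedAddCommGroup F] [NormedSpace ℝ F] {f : E4 → F}
    (hf : ContDiffOn ℝ ∞ f U) {y : E4} (hy : y ∈ U) : DifferentiableAt ℝ f y :=
  (hf.contDiffAt (hU.mem_nhds hy)).differentiableAt (by simp)

lemma MSmooth.mul {U : Set E4} {A B : E4 → Matrix (Fin 4) (Fin 4) ℝ} (hA : MSmooth U A)
    (hB : MSmooth U B) : MSmooth U (fun z => A z * B z) := by
  intro a b
  simp only [Matrix.mul_apply]
  exact ContDiffOn.sum fun c _ => (hA a c).mul (hB c b)

lemma MSmooth.transpose {U : Set E4} {A : E4 → Matrix (Fin 4) (Fin 4) ℝ} (hA : MSmooth U A) :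
    MSmooth U (fun z => (A z).transpose) := fun a b => hA b a

lemma MSmooth.dM {U : Set E4} (hU : IsOpen U) {A : E4 → Matrix (Fin 4) (Fin 4) ℝ}
    (hA : MSmooth U A) (i : Fin 4) : MSmooth U (dM i A) :=
  fun a b => pd_contDiffOn hU (hA a b) i

lemma MSmooth.det {U : Set E4} {A : E4 → Matrix (Fin 4) (Fin 4) ℝ} (hA : MSmooth U A) :
    ContDiffOn ℝ ∞ (fun z => (A z).det) U := by
  simp only [Matrix.det_apply']
  exact ContDiffOn.sum fun σ _ => contDiffOn_const.mul (contDiffOn_prod fun i _ => hA _ _)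

/-- Cramer's rule: each entry of the inverse is the determinant of a modified matrix divided by the
determinant. -/
lemma MSmooth.inv {U : Set E4} {A : E4 → Matrix (Fin 4) (Fin 4) ℝ} (hA : MSmooth U A)
    (hdet : ∀ y ∈ U, (A y).det ≠ 0) : MSmooth U (fun z => (A z)⁻¹) := by
  intro a b
  simp only [Matrix.inv_def, Matrix.smul_apply, Matrix.adjugate_apply, Ring.inverse_eq_inv',
    smul_eq_mul]
  refine (hA.det.inv hdet).mul (MSmooth.det (A := fun z => (A z).updateRow b (Pi.single a 1)) ?_)
  intro c d
  by_cases hc : c = b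
  · subst hc
    simpa using contDiffOn_const
  · simpa [Matrix.updateRow_ne hc] using hA c d

lemma dM_mul {U : Set E4} (hU : IsOpen U) {A B : E4 → Matrix (Fin 4) (Fin 4) ℝ}
    (hA : MSmooth U A) (hB : MSmooth U B) {y : E4} (hy : y ∈ U) (i : Fin 4) :
    dM i (fun z => A z * B z) y = dM i A y * B y + A y * dM i B y := by
  ext a b
  have hA' := fun a b => differentiableAt_of_contDiffOn hU (hA a b) hy
  have hB' := fun a b => differentiableAt_of_contDiffOn hU (hB a b) hy
  simp only [dM, Matrix.of_apply, Matrix.mul_apply, Matrix.add_apply]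
  rw [pd_sum _ (fun c _ => (hA' a c).fun_mul (hB' c b)), ← Finset.sum_add_distrib]
  exact Finset.sum_congr rfl fun c _ => pd_mul (hA' a c) (hB' c b) i

lemma dM_add {U : Set E4} (hU : IsOpen U) {A B : E4 → Matrix (Fin 4) (Fin 4) ℝ}
    (hA : MSmooth U A) (hB : MSmooth U B) {y : E4} (hy : y ∈ U) (i : Fin 4) :
    dM i (fun z => A z + B z) y = dM i A y + dM i B y := by
  ext a b
  exact pd_add (differentiableAt_of_contDiffOn hU (hA a b) hy)
    (differentiableAt_of_contDiffOn hU (hB a b) hy) i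

lemma dM_congr {U : Set E4} (hU : IsOpen U) {A B : E4 → Matrix (Fin 4) (Fin 4) ℝ}
    (h : Set.EqOn A B U) {y : E4} (hy : y ∈ U) (i : Fin 4) : dM i A y = dM i B y := by
  ext a b
  exact pd_congr_of_eqOn hU (fun z hz => by simp only [h hz]) hy i

lemma MSmooth.comp {U V : Set E4} {A : E4 → Matrix (Fin 4) (Fin 4) ℝ} (hA : MSmooth V A)
    {τ : E4 → E4} (hτ : ContDiffOn ℝ ∞ τ U) (hm : Set.MapsTo τ U V) :
    MSmooth U (fun z => A (τ z)) := fun a b => (hA a b).comp hτ hm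

lemma dM_comp {U V : Set E4} (hU : IsOpen U) (hV : IsOpen V)
    {A : E4 → Matrix (Fin 4) (Fin 4) ℝ} (hA : MSmooth V A)
    {τ : E4 → E4} (hτ : ContDiffOn ℝ ∞ τ U) (hm : Set.MapsTo τ U V) {y : E4} (hy : y ∈ U)
    (i : Fin 4) :
    dM i (fun z => A (τ z)) y = ∑ a, pd i (fun z => τ z a) y • dM a A (τ y) := by
  ext c d
  simp only [dM, Matrix.of_apply, Matrix.sum_apply, Matrix.smul_apply, smul_eq_mul]
  exact pd_comp (differentiableAt_of_contDiffOn hV (hA c d) (hm hy))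
    (differentiableAt_of_contDiffOn hU hτ hy) i

/-- The Jacobian matrix. -/
noncomputable def jac (τ : E4 → E4) (y : E4) : Matrix (Fin 4) (Fin 4) ℝ :=
  Matrix.of fun a i => pd i (fun z => τ z a) y

lemma contDiffOn_coord {U : Set E4} {τ : E4 → E4} (hτ : ContDiffOn ℝ ∞ τ U) (a : Fin 4) :
    ContDiffOn ℝ ∞ (fun z => τ z a) U :=
  (EuclideanSpace.proj (𝕜 := ℝ) a : E4 →L[ℝ] ℝ).contDiff.comp_contDiffOn hτ

lemma MSmooth.jac {U : Set E4} (hU : IsOpen U) {τ : E4 → E4} (hτ : ContDiffOn ℝ ∞ τ U) :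
    MSmooth U (jac τ) := fun a i => pd_contDiffOn hU (contDiffOn_coord hτ a) i

/-! ### Christoffel symbols and Ricci tensor of a metric on an open subset of Euclidean space -/

section EuclideanRicci

variable (G : E4 → Matrix (Fin 4) (Fin 4) ℝ)

/-- Christoffel symbols `Γ^k_ij` of the metric with Gram matrix `G`. -/
noncomputable def chr (k i j : Fin 4) (y : E4) : ℝ :=
  (1 / 2) * ∑ l, (G y)⁻¹ k l * (pd i (fun z => G z j l) y + pd j (fun z => G z i l) y
    - pd l (fun z => G z i j) y)

/-- Ricci tensor of the metric with Gram matrix `G`. -/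
noncomputable def ricE (i j : Fin 4) (y : E4) : ℝ :=
  ∑ k, (pd k (chr G k i j) y - pd j (chr G k i k) y
    + ∑ l, (chr G k k l y * chr G l i j y - chr G k j l y * chr G l i k y))

/-- The connection matrices `(Γ_i)^k_j`. -/
noncomputable def conn (i : Fin 4) (y : E4) : Matrix (Fin 4) (Fin 4) ℝ :=
  Matrix.of fun k j => chr G k i j y

/-- The curvature matrices. -/
noncomputable def curv (k j : Fin 4) (y : E4) : Matrix (Fin 4) (Fin 4) ℝ :=
  dM k (conn G j) y - dM j (conn G k) y + conn G k y * conn G j y - conn G j y * conn G k y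

end EuclideanRicci

/-- Symmetric smooth invertible matrix functions on `U`. -/
structure IsGram (U : Set E4) (G : E4 → Matrix (Fin 4) (Fin 4) ℝ) : Prop where
  smooth : MSmooth U G
  symm : ∀ y ∈ U, ∀ i j, G y i j = G y j i
  det_ne : ∀ y ∈ U, (G y).det ≠ 0

namespace IsGram

variable {U : Set E4} {G : E4 → Matrix (Fin 4) (Fin 4) ℝ}

lemma pd_symm (hG : IsGram U G) (hU : IsOpen U) {y : E4} (hy : y ∈ U) (l i j : Fin 4) :
    pd l (fun z => G z i j) y = pd l (fun z => G z j i) y :=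
  pd_congr_of_eqOn hU (fun z hz => hG.symm z hz i j) hy l

lemma inv_smooth (hG : IsGram U G) : MSmooth U (fun z => (G z)⁻¹) := hG.smooth.inv hG.det_ne

lemma chr_smooth (hG : IsGram U G) (hU : IsOpen U) (k i j : Fin 4) :
    ContDiffOn ℝ ∞ (chr G k i j) U := by
  unfold chr
  refine contDiffOn_const.mul (ContDiffOn.sum fun l _ => (hG.inv_smooth k l).mul ?_)
  exact ((pd_contDiffOn hU (hG.smooth _ _) _).add (pd_contDiffOn hU (hG.smooth _ _) _)).sub
    (pd_contDiffOn hU (hG.smooth _ _) _)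

lemma conn_smooth (hG : IsGram U G) (hU : IsOpen U) (i : Fin 4) : MSmooth U (conn G i) :=
  fun k j => hG.chr_smooth hU k i j

lemma ricE_smooth (hG : IsGram U G) (hU : IsOpen U) (i j : Fin 4) :
    ContDiffOn ℝ ∞ (ricE G i j) U := by
  unfold ricE
  refine ContDiffOn.sum fun k _ => ?_
  refine ((pd_contDiffOn hU (hG.chr_smooth hU _ _ _) _).sub
    (pd_contDiffOn hU (hG.chr_smooth hU _ _ _) _)).add (ContDiffOn.sum fun l _ => ?_)
  exact ((hG.chr_smooth hU _ _ _).mul (hG.chr_smooth hU _ _ _)).sub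
    ((hG.chr_smooth hU _ _ _).mul (hG.chr_smooth hU _ _ _))

lemma chr_symm (hG : IsGram U G) (hU : IsOpen U) {y : E4} (hy : y ∈ U) (k i j : Fin 4) :
    chr G k i j y = chr G k j i y := by
  unfold chr
  congr 1
  refine Finset.sum_congr rfl fun l _ => ?_
  rw [hG.pd_symm hU hy l i j]; ring

/-- Lowering the upper index removes the inverse matrix and leaves the Christoffel symbols of the
first kind, which are linear in the derivatives of G. -/
lemma mul_conn (hG : IsGram U G) {y : E4} (hy : y ∈ U) (i l j : Fin 4) :
    (G y * conn G i y) l j = (1 / 2) * (pd i (fun z => G z j l) y + pd j (fun z => G z i l) y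
    - pd l (fun z => G z i j) y) := by
  set v : Fin 4 → ℝ := fun l => (1 / 2) * (pd i (fun z => G z j l) y + pd j (fun z => G z i l) y
    - pd l (fun z => G z i j) y) with hv
  have h1 : ∀ k, conn G i y k j = ((G y)⁻¹.mulVec v) k := by
    intro k
    simp only [conn, chr, Matrix.of_apply, Matrix.mulVec, dotProduct, hv, Finset.mul_sum]
    exact Finset.sum_congr rfl fun l _ => by ring
  have h2 : (G y * conn G i y) l j = ((G y).mulVec ((G y)⁻¹.mulVec v)) l := by
    simp only [Matrix.mul_apply, h1]; rfl
  rw [h2, Matrix.mulVec_mulVec, Matrix.mul_nonsing_inv _ (isUnit_iff_ne_zero.2 (hG.det_ne y hy)),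
    Matrix.one_mulVec]

lemma transpose_eq (hG : IsGram U G) {y : E4} (hy : y ∈ U) : (G y).transpose = G y := by
  ext a b; exact hG.symm y hy b a

/-- The connection is metric. -/
lemma dM_eq (hG : IsGram U G) (hU : IsOpen U) {y : E4} (hy : y ∈ U) (i : Fin 4) :
    dM i G y = G y * conn G i y + (G y * conn G i y).transpose := by
  ext l j
  simp only [Matrix.add_apply, Matrix.transpose_apply, hG.mul_conn hy]
  simp only [dM, Matrix.of_apply]
  rw [hG.pd_symm hU hy i l j, hG.pd_symm hU hy j i l, hG.pd_symm hU hy l i j]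
  ring

/-- The Levi-Civita connection is the only torsion-free metric connection. -/
lemma conn_unique (hG : IsGram U G) (hU : IsOpen U) {y : E4} (hy : y ∈ U)
    {D : Fin 4 → Matrix (Fin 4) (Fin 4) ℝ}
    (hD : ∀ i, dM i G y = G y * D i + (G y * D i).transpose)
    (ht : ∀ i j k, D i k j = D j k i) (i : Fin 4) : D i = conn G i y := by
  have h1 : G y * D i = G y * conn G i y := by
    ext l j
    rw [hG.mul_conn hy]
    -- Torsion-freeness, with the index lowered.
    have hs : ∀ a b c, (G y * D a) b c = (G y * D c) b a := by
      intro a b c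
      simp only [Matrix.mul_apply]
      exact Finset.sum_congr rfl fun k _ => by rw [ht]
    have hd : ∀ a b c, pd a (fun z => G z b c) y = (G y * D a) b c + (G y * D a) c b := by
      intro a b c
      have := congrFun (congrFun (hD a) b) c
      simpa only [dM, Matrix.add_apply, Matrix.transpose_apply, Matrix.of_apply] using this
    -- Koszul's formula: in this combination of three compatibility equations all but one of the
    -- lowered symbols cancel.
    rw [hd, hd, hd, hs i l j, hs i j l, hs j i l]
    ring
  have h2 := congrArg ((G y)⁻¹ * ·) h1
  have hu := isUnit_iff_ne_zero.2 (hG.det_ne y hy)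
  simpa [← Matrix.mul_assoc, Matrix.nonsing_inv_mul _ hu] using h2

/-- Expressing the Ricci tensor as a trace of curvature matrices turns its transformation law into
an identity between noncommuting matrices, the one provided by `curvature_gauge`. -/
lemma ricE_eq_curv (hG : IsGram U G) (hU : IsOpen U) {y : E4} (hy : y ∈ U) (i j : Fin 4) :
    ricE G i j y = ∑ k, curv G k j y k i := by
  refine Finset.sum_congr rfl fun k _ => ?_
  simp only [curv, Matrix.sub_apply, Matrix.add_apply, Matrix.mul_apply, dM, Matrix.of_apply, conn]
  rw [pd_congr_of_eqOn hU (fun z hz => hG.chr_symm hU hz k i j) hy k,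
    pd_congr_of_eqOn hU (fun z hz => hG.chr_symm hU hz k i k) hy j]
  rw [Finset.sum_sub_distrib, ← add_sub_assoc]
  congr 1
  · congr 1
    exact Finset.sum_congr rfl fun l _ => by rw [hG.chr_symm hU hy l i j]
  · exact Finset.sum_congr rfl fun l _ => by rw [hG.chr_symm hU hy l i k]

/-- The Ricci tensor is symmetric. -/
lemma ricE_symm (hG : IsGram U G) (hU : IsOpen U) {y : E4} (hy : y ∈ U) (i j : Fin 4) :
    ricE G i j y = ricE G j i y := by
  have hinv := hG.inv_smooth
  -- The contracted symbols are half the logarithmic derivative of det G. The derivative of this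
  -- contraction is the only part of the Ricci tensor whose symmetry is not immediate.
  have htr : ∀ a, ∀ z ∈ U, ∑ k, chr G k a k z
      = (1 / 2) * ((G z)⁻¹ * dM a G z).trace := by
    intro a z hz
    have hu := isUnit_iff_ne_zero.2 (hG.det_ne z hz)
    have hTi : ((G z)⁻¹).transpose = (G z)⁻¹ := by
      rw [Matrix.transpose_nonsing_inv, hG.transpose_eq hz]
    have e1 : ((G z)⁻¹ * dM a G z).trace = (conn G a z).trace + (conn G a z).trace := by
      rw [hG.dM_eq hU hz, Matrix.mul_add, Matrix.trace_add, ← Matrix.mul_assoc,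
        Matrix.nonsing_inv_mul _ hu, Matrix.one_mul]
      congr 1
      rw [← Matrix.trace_transpose, Matrix.transpose_mul, Matrix.transpose_transpose, hTi,
        Matrix.trace_mul_comm, ← Matrix.mul_assoc, Matrix.nonsing_inv_mul _ hu, Matrix.one_mul]
    rw [e1]
    simp only [Matrix.trace, Matrix.diag, conn, Matrix.of_apply]
    ring
  have hd : ∀ a b, ∑ k, pd b (chr G k a k) y = (1 / 2) * ((dM b (fun z => (G z)⁻¹) y *
      dM a G y).trace + ((G y)⁻¹ * dM b (dM a G) y).trace) := by
    intro a b
    rw [← pd_sum _ (fun k _ => differentiableAt_of_contDiffOn hU (hG.chr_smooth hU k a k) hy),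
      pd_congr_of_eqOn hU (htr a) hy, pd_const_mul, ← Matrix.trace_add,
      ← dM_mul hU hinv (hG.smooth.dM hU a) hy]
    congr 1
    simp only [Matrix.trace, Matrix.diag]
    rw [pd_sum _ (fun k _ => differentiableAt_of_contDiffOn hU
      ((hinv.mul (hG.smooth.dM hU a)) k k) hy)]
    rfl
  have hdinv : ∀ b, dM b (fun z => (G z)⁻¹) y = -((G y)⁻¹ * dM b G y * (G y)⁻¹) := by
    intro b
    have hu := isUnit_iff_ne_zero.2 (hG.det_ne y hy)
    have h1 : dM b (fun z => (G z)⁻¹ * G z) y = 0 := by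
      rw [dM_congr hU (B := fun _ => 1) (fun z hz =>
        Matrix.nonsing_inv_mul _ (isUnit_iff_ne_zero.2 (hG.det_ne z hz))) hy]
      ext c d
      simp [dM, pd_const]
    rw [dM_mul hU hinv hG.smooth hy] at h1
    have h2 := congrArg (· * (G y)⁻¹) (eq_neg_of_add_eq_zero_left h1)
    simpa [Matrix.mul_assoc, Matrix.mul_nonsing_inv _ hu] using h2
  have hcomm : dM i (dM j G) y = dM j (dM i G) y := by
    ext c d
    exact pd_comm (((hG.smooth c d).contDiffAt (hU.mem_nhds hy)).of_le (by norm_cast)) i j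
  -- The Hessian of log √(det G) is symmetric. In matrix form this is commutation of second
  -- derivatives together with cyclicity of the trace.
  have key : ∑ k, pd j (chr G k i k) y = ∑ k, pd i (chr G k j k) y := by
    rw [hd, hd, hdinv, hdinv, hcomm]
    congr 2
    rw [Matrix.neg_mul, Matrix.neg_mul, Matrix.trace_neg, Matrix.trace_neg,
      Matrix.mul_assoc ((G y)⁻¹ * dM j G y), Matrix.trace_mul_comm]
    simp only [Matrix.mul_assoc]
  unfold ricE
  simp only [Finset.sum_add_distrib, Finset.sum_sub_distrib]
  rw [key]
  congr 1
  · congr 1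
    exact Finset.sum_congr rfl fun k _ =>
      pd_congr_of_eqOn hU (fun z hz => hG.chr_symm hU hz k i j) hy k
  · congr 1
    · exact Finset.sum_congr rfl fun k _ => Finset.sum_congr rfl fun l _ => by
        rw [hG.chr_symm hU hy l i j]
    · rw [Finset.sum_comm]
      exact Finset.sum_congr rfl fun k _ => Finset.sum_congr rfl fun l _ => by
        exact mul_comm _ _

end IsGram

/-- The first two hypotheses say that C is the gauge transform of A by J, the last two are their
derivatives. The mixed second derivative `Jkj` is the same in both of the latter, so it cancels and
the curvature transforms without derivatives of J. -/
lemma curvature_gauge {R : Type*} [Ring R] {J Ck Cj dkCj djCk Jk Jj Jkj Ak Aj dkAj djAk : R}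
    (h1k : J * Ck = Jk + Ak * J) (h1j : J * Cj = Jj + Aj * J)
    (h2kj : Jk * Cj + J * dkCj = Jkj + (dkAj * J + Aj * Jk))
    (h2jk : Jj * Ck + J * djCk = Jkj + (djAk * J + Ak * Jj)) :
    J * (dkCj - djCk + Ck * Cj - Cj * Ck) = (dkAj - djAk + Ak * Aj - Aj * Ak) * J := by
  have e1 : J * (Ck * Cj) = Jk * Cj + Ak * (Jj + Aj * J) := by
    rw [← mul_assoc, h1k, add_mul, mul_assoc Ak, h1j]
  have e2 : J * (Cj * Ck) = Jj * Ck + Aj * (Jk + Ak * J) := by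
    rw [← mul_assoc, h1j, add_mul, mul_assoc Aj, h1k]
  have e3 := eq_sub_of_add_eq' h2kj
  have e4 := eq_sub_of_add_eq' h2jk
  rw [mul_sub, mul_add, mul_sub, e1, e2, e3, e4]
  noncomm_ring

section Transformation

variable {U V : Set E4} {G G' : E4 → Matrix (Fin 4) (Fin 4) ℝ} {τ : E4 → E4}

/-- Transformation law of the Levi-Civita connection under a change of coordinates. -/
lemma jac_mul_conn (hU : IsOpen U) (hV : IsOpen V) (hG : IsGram U G) (hG' : IsGram V G')
    (hτ : ContDiffOn ℝ ∞ τ U) (hm : Set.MapsTo τ U V) (hJ : ∀ y ∈ U, (jac τ y).det ≠ 0)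
    (h : ∀ y ∈ U, G y = (jac τ y).transpose * G' (τ y) * jac τ y) {y : E4} (hy : y ∈ U)
    (i : Fin 4) :
    jac τ y * conn G i y = dM i (jac τ) y + (∑ b, jac τ y b i • conn G' b (τ y)) * jac τ y := by
  have hu := isUnit_iff_ne_zero.2 (hJ y hy)
  have hJs := MSmooth.jac hU hτ
  set A : Fin 4 → Matrix (Fin 4) (Fin 4) ℝ := fun i => ∑ b, jac τ y b i • conn G' b (τ y) with hA
  -- The pulled back connection. It is torsion-free, and differentiating G = Jᵀ G' J shows that it
  -- is metric for G, so uniqueness identifies it with the Levi-Civita connection of G.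
  set D : Fin 4 → Matrix (Fin 4) (Fin 4) ℝ :=
    fun i => (jac τ y)⁻¹ * (dM i (jac τ) y + A i * jac τ y) with hD
  have hJD : ∀ i, jac τ y * D i = dM i (jac τ) y + A i * jac τ y := fun i => by
    rw [hD, ← Matrix.mul_assoc, Matrix.mul_nonsing_inv _ hu, Matrix.one_mul]
  -- The first summand is symmetric because second derivatives of τ commute, the second because the
  -- symbols of G' are symmetric.
  have hsymm : ∀ i j k, (dM i (jac τ) y + A i * jac τ y) k j
      = (dM j (jac τ) y + A j * jac τ y) k i := by
    intro i j k
    simp only [Matrix.add_apply]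
    congr 1
    · exact pd_comm (((contDiffOn_coord hτ k).contDiffAt (hU.mem_nhds hy)).of_le
        (by norm_cast)) i j
    · simp only [hA, Matrix.mul_apply, Matrix.sum_apply, Matrix.smul_apply, smul_eq_mul,
        Finset.sum_mul]
      rw [Finset.sum_comm]
      refine Finset.sum_congr rfl fun b _ => Finset.sum_congr rfl fun c _ => ?_
      simp only [conn, Matrix.of_apply]
      rw [hG'.chr_symm hV (hm hy)]; ring
  have hDt : ∀ i j k, D i k j = D j k i := by
    intro i j k
    simp only [hD, Matrix.mul_apply (M := (jac τ y)⁻¹)]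
    exact Finset.sum_congr rfl fun l _ => by rw [hsymm i j l]
  have hcompat : ∀ i, dM i G y = G y * D i + (G y * D i).transpose := by
    intro i
    have e : G y * D i = (jac τ y).transpose * G' (τ y) * (dM i (jac τ) y + A i * jac τ y) := by
      rw [h y hy, Matrix.mul_assoc _ (jac τ y), hJD]
    have hGc := hG'.smooth.comp hτ hm
    rw [e, dM_congr hU h hy, dM_mul hU (hJs.transpose.mul hGc) hJs hy,
      dM_mul hU hJs.transpose hGc hy, dM_comp hU hV hG'.smooth hτ hm hy]
    have e2 : ∑ a, pd i (fun z => τ z a) y • dM a G' (τ y)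
        = G' (τ y) * A i + (G' (τ y) * A i).transpose := by
      simp only [hA, Matrix.mul_sum, Matrix.transpose_sum, ← Finset.sum_add_distrib,
        Matrix.mul_smul, Matrix.transpose_smul, ← smul_add, ← hG'.dM_eq hV (hm hy)]
      rfl
    have e3 : dM i (fun z => (jac τ z).transpose) y = (dM i (jac τ) y).transpose := rfl
    rw [e2, e3]
    simp only [Matrix.mul_add, Matrix.transpose_add, Matrix.transpose_mul, hG'.transpose_eq (hm hy),
      Matrix.transpose_transpose, Matrix.add_mul, Matrix.mul_assoc]
    abel
  rw [← hJD, hG.conn_unique hU hy hcompat hDt]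

/-- Transformation law of the Ricci tensor under a change of coordinates. -/
theorem ricE_transform (hU : IsOpen U) (hV : IsOpen V) (hG : IsGram U G) (hG' : IsGram V G')
    (hτ : ContDiffOn ℝ ∞ τ U) (hm : Set.MapsTo τ U V) (hJ : ∀ y ∈ U, (jac τ y).det ≠ 0)
    (h : ∀ y ∈ U, G y = (jac τ y).transpose * G' (τ y) * jac τ y) {y : E4} (hy : y ∈ U)
    (i j : Fin 4) :
    ricE G i j y = ∑ a, ∑ b, jac τ y a i * jac τ y b j * ricE G' a b (τ y) := by
  have hu := isUnit_iff_ne_zero.2 (hJ y hy)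
  have hJs := MSmooth.jac hU hτ
  set A : Fin 4 → E4 → Matrix (Fin 4) (Fin 4) ℝ :=
    fun i y => ∑ b, jac τ y b i • conn G' b (τ y) with hA
  have hAs : ∀ i, MSmooth U (A i) := by
    intro i c d
    simp only [hA, Matrix.sum_apply, Matrix.smul_apply, smul_eq_mul]
    exact ContDiffOn.sum fun b _ => (hJs b i).mul ((hG'.conn_smooth hV b).comp hτ hm c d)
  have h1 : ∀ i, ∀ z ∈ U, jac τ z * conn G i z = dM i (jac τ) z + A i z * jac τ z :=
    fun i z hz => jac_mul_conn hU hV hG hG' hτ hm hJ h hz i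
  -- The derivative of the transformation law of the connection, as required by `curvature_gauge`.
  have h2 : ∀ k j, dM k (jac τ) y * conn G j y + jac τ y * dM k (conn G j) y
      = dM k (dM j (jac τ)) y + (dM k (A j) y * jac τ y + A j y * dM k (jac τ) y) := by
    intro k j
    rw [← dM_mul hU hJs (hG.conn_smooth hU j) hy, dM_congr hU (h1 j) hy,
      dM_add hU (hJs.dM hU j) ((hAs j).mul hJs) hy, dM_mul hU (hAs j) hJs hy]
  have hsymm3 : ∀ k j, dM k (dM j (jac τ)) y = dM j (dM k (jac τ)) y := by
    intro k j
    ext c d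
    exact pd_comm (((hJs c d).contDiffAt (hU.mem_nhds hy)).of_le (by norm_cast)) k j
  have hsymm2 : ∀ k j b, dM k (jac τ) y b j = dM j (jac τ) y b k := by
    intro k j b
    exact pd_comm (((contDiffOn_coord hτ b).contDiffAt (hU.mem_nhds hy)).of_le
        (by norm_cast)) k j
  have hgauge : ∀ k j, jac τ y * curv G k j y
      = (dM k (A j) y - dM j (A k) y + A k y * A j y - A j y * A k y) * jac τ y := by
    intro k j
    refine curvature_gauge (h1 k y hy) (h1 j y hy) (h2 k j) ?_
    rw [h2 j k, hsymm3]
  -- The first sum contains second derivatives of τ and is symmetric in k and j; it drops out of the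
  -- antisymmetrized expression below.
  have hdA : ∀ k j, dM k (A j) y = ∑ b, dM k (jac τ) y b j • conn G' b (τ y)
      + ∑ b, ∑ c, (jac τ y b j * jac τ y c k) • dM c (conn G' b) (τ y) := by
    intro k j
    rw [← Finset.sum_add_distrib]
    ext p q
    have hd : ∀ b, DifferentiableAt ℝ (fun z => conn G' b (τ z) p q) y := fun b =>
      differentiableAt_of_contDiffOn hU ((hG'.conn_smooth hV b).comp hτ hm p q) hy
    have hdJ : ∀ b, DifferentiableAt ℝ (fun z => jac τ z b j) y := fun b =>
      differentiableAt_of_contDiffOn hU (hJs b j) hy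
    simp only [hA, dM, Matrix.of_apply, Matrix.sum_apply, Matrix.smul_apply, Matrix.add_apply,
      smul_eq_mul]
    rw [pd_sum _ fun b _ => (hdJ b).fun_mul (hd b)]
    refine Finset.sum_congr rfl fun b _ => ?_
    rw [pd_mul (hdJ b) (hd b)]
    congr 1
    rw [pd_comp (differentiableAt_of_contDiffOn hV (hG'.conn_smooth hV b p q) (hm hy))
      (differentiableAt_of_contDiffOn hU hτ hy), Finset.mul_sum]
    exact Finset.sum_congr rfl fun c _ => by simp only [jac, Matrix.of_apply]; ring
  have hF : ∀ k j, dM k (A j) y - dM j (A k) y + A k y * A j y - A j y * A k y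
      = ∑ c, jac τ y c k • ∑ b, jac τ y b j • curv G' c b (τ y) := by
    intro k j
    have e1 : A k y * A j y = ∑ c, ∑ b, (jac τ y c k * jac τ y b j) •
        (conn G' c (τ y) * conn G' b (τ y)) := by
      simp only [hA, Finset.sum_mul_sum, smul_mul_smul_comm]
    have e2 : A j y * A k y = ∑ c, ∑ b, (jac τ y c k * jac τ y b j) •
        (conn G' b (τ y) * conn G' c (τ y)) := by
      simp only [hA, Finset.sum_mul_sum, smul_mul_smul_comm]
      rw [Finset.sum_comm]
      exact Finset.sum_congr rfl fun c _ => Finset.sum_congr rfl fun b _ => by rw [mul_comm]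
    have e3 : ∑ b, ∑ c, (jac τ y b j * jac τ y c k) • dM c (conn G' b) (τ y)
        = ∑ c, ∑ b, (jac τ y c k * jac τ y b j) • dM c (conn G' b) (τ y) := by
      rw [Finset.sum_comm]
      exact Finset.sum_congr rfl fun c _ => Finset.sum_congr rfl fun b _ => by rw [mul_comm]
    rw [hdA, hdA, e1, e2, e3]
    simp only [hsymm2 k j]
    simp only [curv, smul_sub, smul_add, Finset.smul_sum, smul_smul, Finset.sum_sub_distrib,
      Finset.sum_add_distrib]
    abel
  have hcurv : ∀ k j, curv G k j y = ∑ c, jac τ y c k •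
      ((jac τ y)⁻¹ * (∑ b, jac τ y b j • curv G' c b (τ y)) * jac τ y) := by
    intro k j
    have := congrArg ((jac τ y)⁻¹ * ·) (hgauge k j)
    simp only [← Matrix.mul_assoc, Matrix.nonsing_inv_mul _ hu, Matrix.one_mul, hF] at this
    rw [this]
    simp only [Matrix.mul_sum, Matrix.sum_mul, Matrix.mul_smul, Matrix.smul_mul]
  rw [hG.ricE_eq_curv hU hy]
  simp only [hcurv, Matrix.sum_apply, Matrix.smul_apply, smul_eq_mul]
  rw [Finset.sum_comm]
  -- The contraction over k pairs the Jacobian with its inverse, so only two Jacobian factors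
  -- survive.
  have e4 : ∀ c, ∑ k, jac τ y c k *
      ((jac τ y)⁻¹ * (∑ b, jac τ y b j • curv G' c b (τ y)) * jac τ y) k i
      = ∑ b, ∑ a, jac τ y b j * curv G' c b (τ y) c a * jac τ y a i := by
    intro c
    rw [← Matrix.mul_apply, ← Matrix.mul_assoc, ← Matrix.mul_assoc, Matrix.mul_nonsing_inv _ hu,
      Matrix.one_mul]
    simp only [Matrix.mul_apply, Matrix.sum_apply, Matrix.smul_apply, smul_eq_mul, Finset.sum_mul]
    rw [Finset.sum_comm]
  simp only [e4]
  simp only [hG'.ricE_eq_curv hV (hm hy), Finset.mul_sum]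
  have e5 : ∀ f : Fin 4 → Fin 4 → Fin 4 → ℝ,
      ∑ c, ∑ b, ∑ a, f c b a = ∑ a, ∑ b, ∑ c, f c b a := by
    intro f
    rw [Finset.sum_comm]
    simp only [Finset.sum_comm (f := fun c a => f c _ a)]
    exact Finset.sum_comm
  rw [e5]
  exact Finset.sum_congr rfl fun a _ => Finset.sum_congr rfl fun b _ =>
    Finset.sum_congr rfl fun k _ => by ring

end Transformation

/-! ### Smooth functions with support in a compact set -/

/-- Smooth functions on Euclidean space whose support is a compact subset of `K`. -/
structure TestFn (K : Set E4) (v : E4 → ℝ) : Prop where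
  smooth : ContDiff ℝ ∞ v
  compact : HasCompactSupport v
  supp : tsupport v ⊆ K

namespace TestFn

variable {K : Set E4} {v w : E4 → ℝ}

lemma mono {L : Set E4} (hv : TestFn K v) (h : K ⊆ L) : TestFn L v :=
  ⟨hv.smooth, hv.compact, hv.supp.trans h⟩

lemma pd (hv : TestFn K v) (i : Fin 4) : TestFn K (pd i v) where
  smooth := pd_contDiff hv.smooth i
  compact := hv.compact.fderiv_apply (𝕜 := ℝ) (stdVec i)
  supp := (tsupport_fderiv_apply_subset ℝ (stdVec i)).trans hv.supp

lemma mul_left (hv : TestFn K v) {f : E4 → ℝ} (hf : ContDiff ℝ ∞ f) :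
    TestFn K (fun y => f y * v y) where
  smooth := hf.mul hv.smooth
  compact := hv.compact.mul_left
  supp := (tsupport_mul_subset_right).trans hv.supp

lemma mul_right (hv : TestFn K v) {f : E4 → ℝ} (hf : ContDiff ℝ ∞ f) :
    TestFn K (fun y => v y * f y) where
  smooth := hv.smooth.mul hf
  compact := hv.compact.mul_right
  supp := (tsupport_mul_subset_left).trans hv.supp

/-- Smoothness of f outside U is irrelevant: near any point off the support of v the product
vanishes identically. -/
lemma mul_contDiffOn (hv : TestFn K v) {U : Set E4} (hU : IsOpen U) (hK : K ⊆ U) {f : E4 → ℝ}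
    (hf : ContDiffOn ℝ ∞ f U) : TestFn K (fun y => v y * f y) where
  smooth := by
    rw [contDiff_iff_contDiffAt]
    intro y
    by_cases hy : y ∈ tsupport v
    · exact hv.smooth.contDiffAt.mul (hf.contDiffAt (hU.mem_nhds (hK (hv.supp hy))))
    · have h0 : (fun y => v y * f y) =ᶠ[𝓝 y] fun _ => 0 := by
        filter_upwards [(isClosed_tsupport v).isOpen_compl.mem_nhds hy] with z hz
        rw [image_eq_zero_of_notMem_tsupport hz, zero_mul]
      exact contDiffAt_const.congr_of_eventuallyEq h0
  compact := hv.compact.mul_right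
  supp := (tsupport_mul_subset_left).trans hv.supp

lemma add (hv : TestFn K v) (hw : TestFn K w) : TestFn K (fun y => v y + w y) where
  smooth := hv.smooth.add hw.smooth
  compact := hv.compact.add hw.compact
  supp := (tsupport_add v w).trans (Set.union_subset hv.supp hw.supp)

lemma const_mul (hv : TestFn K v) (c : ℝ) : TestFn K (fun y => c * v y) :=
  hv.mul_left contDiff_const

lemma sub (hv : TestFn K v) (hw : TestFn K w) : TestFn K (fun y => v y - w y) := by
  simpa [sub_eq_add_neg] using hv.add (hw.const_mul (-1))

lemma continuous (hv : TestFn K v) : Continuous v := hv.smooth.continuous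

lemma integrable (hv : TestFn K v) : Integrable v :=
  hv.continuous.integrable_of_hasCompactSupport hv.compact

lemma memLp (hv : TestFn K v) (p : ENNReal) : MemLp v p :=
  hv.continuous.memLp_of_hasCompactSupport hv.compact

lemma integrable_sq (hv : TestFn K v) : Integrable (fun y => v y ^ 2) := by
  simpa [sq] using (hv.mul_left hv.smooth).integrable

lemma eq_zero (hv : TestFn K v) {y : E4} (hy : y ∉ K) : v y = 0 :=
  image_eq_zero_of_notMem_tsupport fun h => hy (hv.supp h)

lemma differentiableAt (hv : TestFn K v) (y : E4) : DifferentiableAt ℝ v y :=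
  (hv.smooth.differentiable (by simp)) y

end TestFn

lemma integral_mul_pd {K : Set E4} {f v : E4 → ℝ} (hf : ContDiff ℝ ∞ f) (hv : TestFn K v)
    (i : Fin 4) : ∫ y, f y * pd i v y = - ∫ y, pd i f y * v y :=
  integral_mul_fderiv_eq_neg_fderiv_mul_of_integrable
    (hv.mul_left (pd_contDiff hf i)).integrable ((hv.pd i).mul_left hf).integrable
    (hv.mul_left hf).integrable (fun y _ => hf.differentiable (by simp) y)
    (fun y _ => hv.differentiableAt y)

lemma integral_pd {K : Set E4} {v : E4 → ℝ} (hv : TestFn K v) (i : Fin 4) :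
    ∫ y, pd i v y = 0 := by
  have := integral_mul_pd (f := fun _ => 1) contDiff_const hv i
  simpa [pd_const] using this

/-- Smooth cutoff functions. -/
lemma exists_cutoff {K U : Set E4} (hK : IsCompact K) (hU : IsOpen U) (hKU : K ⊆ U) :
    ∃ (χ : E4 → ℝ) (C : Set E4), IsCompact C ∧ C ⊆ U ∧ TestFn C χ ∧ (∀ᶠ y in 𝓝ˢ K, χ y = 1) ∧
      ∀ y, χ y ∈ Set.Icc (0 : ℝ) 1 := by
  obtain ⟨L, hL, hKL, hLU⟩ := exists_compact_between hK hU hKU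
  obtain ⟨f, hf1, hf0, hf⟩ := exists_contMDiffMap_one_nhds_of_subset_interior (n := ⊤)
    (𝓘(ℝ, E4)) hK.isClosed hKL
  have hsupp : tsupport f ⊆ L := closure_minimal (fun y hy => by
    by_contra h; exact hy (hf0 y h)) hL.isClosed
  exact ⟨f, L, hL, hLU, ⟨f.contMDiff.contDiff, HasCompactSupport.of_support_subset_isCompact hL
    (subset_closure.trans hsupp), hsupp⟩, hf1, hf⟩

/-! ### The second derivatives of solutions of elliptic equations -/

section Elliptic

open scoped MatrixOrder in
-- Write A = BᵀB with B invertible. By cyclicity the trace equals tr(WᵀW), the sum of squares of the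
-- entries of the symmetric matrix W = BVBᵀ, and W vanishes only with V.
lemma PosDef_quartic_pos {A V : Matrix (Fin 4) (Fin 4) ℝ} (hA : A.PosDef)
    (hV : V.transpose = V) (hV0 : V ≠ 0) : 0 < (A * V * (A * V)).trace := by
  obtain ⟨B, hB⟩ := CStarAlgebra.nonneg_iff_eq_star_mul_self.mp hA.posSemidef.nonneg
  rw [Matrix.star_eq_conjTranspose, Matrix.conjTranspose_eq_transpose_of_trivial] at hB
  have hBu : IsUnit B := by
    have := hA.isUnit
    rw [hB] at this
    rw [Matrix.isUnit_iff_isUnit_det] at this ⊢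
    rw [Matrix.det_mul] at this
    exact isUnit_of_mul_isUnit_right this
  set W := B * V * B.transpose with hW
  have hWT : W.transpose = W := by
    simp only [hW, Matrix.transpose_mul, Matrix.transpose_transpose, hV, Matrix.mul_assoc]
  have e : (A * V * (A * V)).trace = (W.transpose * W).trace := by
    rw [hWT, hW, hB, Matrix.mul_assoc B.transpose, Matrix.mul_assoc B.transpose,
      Matrix.trace_mul_comm]
    simp only [Matrix.mul_assoc]
  have hnn : (W.transpose * W).trace = ∑ i, ∑ j, W j i ^ 2 := by
    simp [Matrix.trace, Matrix.mul_apply, sq]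
  have hW0 : W ≠ 0 := by
    intro h0
    apply hV0
    have hd := (Matrix.isUnit_iff_isUnit_det _).1 hBu
    have h1 : B⁻¹ * W * (B.transpose)⁻¹ = V := by
      rw [hW, ← Matrix.mul_assoc, ← Matrix.mul_assoc, Matrix.nonsing_inv_mul _ hd, Matrix.one_mul,
        Matrix.mul_assoc, Matrix.mul_nonsing_inv _ (by rwa [Matrix.det_transpose]), Matrix.mul_one]
    rw [← h1, h0]; simp
  rw [e, hnn]
  by_contra hle
  apply hW0
  have h0 : ∑ i, ∑ j, W j i ^ 2 = 0 := le_antisymm (not_lt.1 hle) (by positivity)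
  ext j i
  rw [Finset.sum_eq_zero_iff_of_nonneg (fun _ _ => by positivity)] at h0
  have := h0 i (Finset.mem_univ _)
  rw [Finset.sum_eq_zero_iff_of_nonneg (fun _ _ => by positivity)] at this
  exact pow_eq_zero_iff (two_ne_zero) |>.1 (this j (Finset.mem_univ _))

/-- The quantity is continuous and positive on the product of K with the unit sphere of symmetric
matrices, so it has a positive minimum there; the general case follows by homogeneity of degree two
in V. -/
lemma quartic_lower_bound {K : Set E4} (hK : IsCompact K) {A : E4 → Matrix (Fin 4) (Fin 4) ℝ}
    (hAc : ∀ i j, ContinuousOn (fun y => A y i j) K) (hA : ∀ y ∈ K, (A y).PosDef) :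
    ∃ c > 0, ∀ y ∈ K, ∀ V : Matrix (Fin 4) (Fin 4) ℝ, V.transpose = V →
      c * ∑ i, ∑ j, V i j ^ 2 ≤ (A y * V * (A y * V)).trace := by
  rcases K.eq_empty_or_nonempty with rfl | ⟨y0, hy0⟩
  · exact ⟨1, one_pos, fun y hy => by simp at hy⟩
  set S : Set (Fin 4 → Fin 4 → ℝ) := {V | (∀ i j, V i j = V j i) ∧ ∑ i, ∑ j, V i j ^ 2 = 1} with hS
  have hSc : IsCompact S := by
    refine Metric.isCompact_of_isClosed_isBounded ?_ ?_
    · rw [hS, Set.setOf_and]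
      refine IsClosed.inter ?_ (isClosed_eq (by fun_prop) continuous_const)
      simp only [Set.setOf_forall]
      exact isClosed_iInter fun i => isClosed_iInter fun j => isClosed_eq (by fun_prop) (by fun_prop)
    · refine (Metric.isBounded_closedBall (x := (0 : Fin 4 → Fin 4 → ℝ)) (r := 1)).subset ?_
      intro V hV
      rw [mem_closedBall_zero_iff, pi_norm_le_iff_of_nonneg zero_le_one]
      intro i
      rw [pi_norm_le_iff_of_nonneg zero_le_one]
      intro j
      rw [Real.norm_eq_abs, ← sq_le_one_iff_abs_le_one, ← hV.2]
      refine le_trans ?_ (Finset.single_le_sum (f := fun i => ∑ j, V i j ^ 2)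
        (fun _ _ => by positivity) (Finset.mem_univ i))
      exact Finset.single_le_sum (f := fun j => V i j ^ 2)
        (fun _ _ => by positivity) (Finset.mem_univ j)
  set F : E4 × (Fin 4 → Fin 4 → ℝ) → ℝ := fun p =>
    (A p.1 * Matrix.of p.2 * (A p.1 * Matrix.of p.2)).trace with hF
  have hFc : ContinuousOn F (K ×ˢ S) := by
    simp only [hF, Matrix.trace, Matrix.diag, Matrix.mul_apply, Matrix.of_apply]
    have hA' : ∀ i j, ContinuousOn (fun p : E4 × (Fin 4 → Fin 4 → ℝ) => A p.1 i j) (K ×ˢ S) :=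
      fun i j => (hAc i j).comp continuousOn_fst fun p hp => hp.1
    have hV' : ∀ i j, ContinuousOn (fun p : E4 × (Fin 4 → Fin 4 → ℝ) => p.2 i j) (K ×ˢ S) :=
      fun i j => by fun_prop
    refine continuousOn_finsetSum _ fun i _ => continuousOn_finsetSum _ fun j _ => ?_
    exact (continuousOn_finsetSum _ fun k _ => (hA' _ _).mul (hV' _ _)).mul
      (continuousOn_finsetSum _ fun k _ => (hA' _ _).mul (hV' _ _))
  have hne : (K ×ˢ S).Nonempty := by
    refine ⟨(y0, fun i j => if i = 0 ∧ j = 0 then 1 else 0), hy0, ?_, ?_⟩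
    · intro i j; simp only [and_comm]
    · simp [Fin.sum_univ_four]; decide
  obtain ⟨p, hp, hmin⟩ := (hK.prod hSc).exists_isMinOn hne hFc
  have hc : 0 < F p := by
    refine PosDef_quartic_pos (hA _ hp.1) ?_ ?_
    · ext i j; exact hp.2.1 j i
    · intro h0
      have : ∑ i, ∑ j, p.2 i j ^ 2 = 0 := by
        refine Finset.sum_eq_zero fun i _ => Finset.sum_eq_zero fun j _ => ?_
        have := congrFun (congrFun h0 i) j
        simp only [Matrix.of_apply, Matrix.zero_apply] at this
        simp [this]
      have h2 := hp.2.2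
      rw [this] at h2; exact zero_ne_one h2
  refine ⟨F p, hc, fun y hy V hV => ?_⟩
  set s := ∑ i, ∑ j, V i j ^ 2 with hs
  have hs0 : 0 ≤ s := by positivity
  rcases hs0.eq_or_lt with h0 | h0
  · rw [← h0, mul_zero]
    have hVz : V = 0 := by
      ext i j
      have h1 := (Finset.sum_eq_zero_iff_of_nonneg (fun i _ => by positivity)).1
        (hs.symm.trans h0.symm) i (Finset.mem_univ _)
      exact pow_eq_zero_iff two_ne_zero |>.1 ((Finset.sum_eq_zero_iff_of_nonneg
        (fun j _ => by positivity)).1 h1 j (Finset.mem_univ _))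
    simp [hVz]
  · have hr : 0 < √s := Real.sqrt_pos.2 h0
    have hsq : √s ^ 2 = s := Real.sq_sqrt hs0
    have hmem : (y, fun i j => (√s)⁻¹ * V i j) ∈ K ×ˢ S := by
      refine ⟨hy, ?_, ?_⟩
      · intro i j
        have := congrFun (congrFun hV j) i
        simp only [Matrix.transpose_apply] at this
        simp [this]
      · simp only [mul_pow, ← Finset.mul_sum]
        rw [← hs, inv_pow, hsq, inv_mul_cancel₀ h0.ne']
    have h1 := hmin hmem
    have h2 : F (y, fun i j => (√s)⁻¹ * V i j) = s⁻¹ * (A y * V * (A y * V)).trace := by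
      have : (Matrix.of fun i j => (√s)⁻¹ * V i j) = (√s)⁻¹ • V := by ext; simp
      simp only [hF, this, Matrix.mul_smul, Matrix.smul_mul, Matrix.trace_smul, smul_eq_mul,
        ← mul_assoc]
      rw [← sq, inv_pow, hsq]
    simp only [Set.mem_setOf_eq, h2] at h1
    rwa [inv_mul_eq_div, le_div_iff₀ h0] at h1

/-- Commutation of second derivatives, in integrated form. -/
lemma integral_swap {K : Set E4} {b v : E4 → ℝ} (hb : ContDiff ℝ ∞ b) (hv : TestFn K v)
    (i j k l : Fin 4) :
    ∫ y, b y * (pd i (pd k v) y * pd j (pd l v) y) = (∫ y, b y * (pd i (pd j v) y * pd k (pd l v) y))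
      + ∫ y, pd i v y * (pd j b y * pd k (pd l v) y - pd k b y * pd j (pd l v) y) := by
  have hij := fun i j => (hv.pd i).pd j
  -- The two integrands differ by a divergence and terms with one derivative on b: in ∂_j of the
  -- first function minus ∂_k of the second, the third derivatives of v cancel.
  have T1 : TestFn K (fun y => b y * (pd i v y * pd k (pd l v) y)) :=
    ((hij l k).mul_left (hv.pd i).smooth).mul_left hb
  have T2 : TestFn K (fun y => b y * (pd i v y * pd j (pd l v) y)) :=
    ((hij l j).mul_left (hv.pd i).smooth).mul_left hb
  have h1 := integral_pd T1 j
  have h2 := integral_pd T2 k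
  have hdb := fun y => hb.differentiable (by simp) y
  have c2 : ∀ {f : E4 → ℝ}, ContDiff ℝ ∞ f → ∀ i j y, pd i (pd j f) y = pd j (pd i f) y :=
    fun hf i j y => pd_comm (hf.contDiffAt.of_le (by norm_cast)) i j
  have e1 : ∀ y, pd j (fun y => b y * (pd i v y * pd k (pd l v) y)) y
      = pd j b y * (pd i v y * pd k (pd l v) y) + b y * (pd i (pd j v) y * pd k (pd l v) y
        + pd i v y * pd j (pd k (pd l v)) y) := by
    intro y
    rw [pd_mul (hdb y) (((hv.pd i).differentiableAt y).fun_mul ((hij l k).differentiableAt y)),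
      pd_mul ((hv.pd i).differentiableAt y) ((hij l k).differentiableAt y), c2 hv.smooth j i]
  have e2 : ∀ y, pd k (fun y => b y * (pd i v y * pd j (pd l v) y)) y
      = pd k b y * (pd i v y * pd j (pd l v) y) + b y * (pd i (pd k v) y * pd j (pd l v) y
        + pd i v y * pd j (pd k (pd l v)) y) := by
    intro y
    rw [pd_mul (hdb y) (((hv.pd i).differentiableAt y).fun_mul ((hij l j).differentiableAt y)),
      pd_mul ((hv.pd i).differentiableAt y) ((hij l j).differentiableAt y), c2 hv.smooth k i,
      c2 (hv.pd l).smooth k j]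
  have I1 := (T1.pd j).integrable
  have I2 := (T2.pd k).integrable
  have I3 := (((hij j i).mul_right (hij l k).smooth).mul_left hb).integrable
  have I4 : Integrable (fun y => pd i v y *
      (pd j b y * pd k (pd l v) y - pd k b y * pd j (pd l v) y)) :=
    ((hv.pd i).mul_right (((pd_contDiff hb j).mul (hij l k).smooth).sub
      ((pd_contDiff hb k).mul (hij l j).smooth))).integrable
  have e : ∀ y, b y * (pd i (pd k v) y * pd j (pd l v) y)
      = (b y * (pd i (pd j v) y * pd k (pd l v) y)
      + pd i v y * (pd j b y * pd k (pd l v) y - pd k b y * pd j (pd l v) y))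
      - (pd j (fun y => b y * (pd i v y * pd k (pd l v) y)) y
        - pd k (fun y => b y * (pd i v y * pd j (pd l v) y)) y) := by
    intro y; rw [e1, e2]; ring
  simp only [e]
  have hs := integral_sub (I3.add I4) (I1.sub I2)
  simp only [Pi.add_apply, Pi.sub_apply] at hs
  rw [hs, integral_add I3 I4, integral_sub I1 I2, h1, h2]
  ring

/-- The second derivatives of `v` are controlled by `∑ a_ij ∂_ij v` and first derivatives. -/
theorem elliptic_estimate {K : Set E4} (hK : IsCompact K) {A : E4 → Matrix (Fin 4) (Fin 4) ℝ}
    (hAs : ∀ i j, ContDiff ℝ ∞ (fun y => A y i j)) (hA : ∀ y ∈ K, (A y).PosDef) :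
    ∃ C, ∀ v, TestFn K v → ∑ i, ∑ j, ∫ y, pd i (pd j v) y ^ 2
      ≤ C * ((∫ y, (∑ i, ∑ j, A y i j * pd i (pd j v) y) ^ 2) + ∑ i, ∫ y, pd i v y ^ 2) := by
  obtain ⟨c, hc, hlow⟩ := quartic_lower_bound hK (fun i j => (hAs i j).continuous.continuousOn) hA
  set b : Fin 4 → Fin 4 → Fin 4 → Fin 4 → E4 → ℝ := fun i j k l y => A y i j * A y k l with hb
  have hbs : ∀ i j k l, ContDiff ℝ ∞ (b i j k l) := fun i j k l => (hAs i j).mul (hAs k l)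
  obtain ⟨B, hB0, hB⟩ : ∃ B > 0, ∀ m i j k l, ∀ y ∈ K, |pd m (b i j k l) y| ≤ B := by
    have h1 : ∀ x : Fin 4 × Fin 4 × Fin 4 × Fin 4 × Fin 4, ∃ B, ∀ y ∈ K,
        ‖pd x.1 (b x.2.1 x.2.2.1 x.2.2.2.1 x.2.2.2.2) y‖ ≤ B := fun x =>
      hK.exists_bound_of_continuousOn (pd_contDiff (hbs _ _ _ _) _).continuous.continuousOn
    choose B hB using h1
    refine ⟨(∑ x, |B x|) + 1, by positivity, fun m i j k l y hy => ?_⟩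
    refine (hB (m, i, j, k, l) y hy).trans ((le_abs_self _).trans ?_)
    have := Finset.single_le_sum (f := fun x => |B x|) (fun _ _ => abs_nonneg _)
      (Finset.mem_univ (m, i, j, k, l))
    linarith
  -- The remainder has 256 terms, each split by Young's inequality into two squares of second
  -- derivatives. Every second derivative is counted 16 times in each of the two, so the total is 32
  -- ε = c / 2, which can be absorbed.
  set ε : ℝ := c / 64 with hε
  have hε0 : 0 < ε := by positivity
  refine ⟨(2 / c) * (1 + 128 * (B ^ 2 / (4 * ε))), fun v hv => ?_⟩
  have hij := fun i j => (hv.pd i).pd j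
  set R : E4 → ℝ := fun y => ∑ i, ∑ j, ∑ k, ∑ l, pd i v y * (pd j (b i j k l) y * pd k (pd l v) y
    - pd k (b i j k l) y * pd j (pd l v) y) with hR
  have IR : ∀ i j k l, Integrable fun y => pd i v y * (pd j (b i j k l) y * pd k (pd l v) y
    - pd k (b i j k l) y * pd j (pd l v) y) := fun i j k l =>
    ((hv.pd i).mul_right (((pd_contDiff (hbs i j k l) j).mul (hij l k).smooth).sub
      ((pd_contDiff (hbs i j k l) k).mul (hij l j).smooth))).integrable
  have IL : ∀ i j k l m n p q, Integrable fun y => b i j k l y * (pd m (pd n v) y * pd p (pd q v) y) :=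
    fun i j k l m n p q => (((hij n m).mul_right (hij q p).smooth).mul_left (hbs i j k l)).integrable
  -- Exchanging j and k under the integral turns tr(AVAV), with V the Hessian, into the square of ∑
  -- a_ij ∂_ij v, at the price of terms containing a first derivative.
  have hmain : ∫ y, ∑ i, ∑ j, ∑ k, ∑ l, b i j k l y * (pd i (pd k v) y * pd j (pd l v) y)
      = (∫ y, (∑ i, ∑ j, A y i j * pd i (pd j v) y) ^ 2) + ∫ y, R y := by
    have e0 : ∀ y, (∑ i, ∑ j, A y i j * pd i (pd j v) y) ^ 2
        = ∑ i, ∑ j, ∑ k, ∑ l, b i j k l y * (pd i (pd j v) y * pd k (pd l v) y) := by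
      intro y
      simp only [sq, Finset.sum_mul, Finset.mul_sum, hb]
      exact Finset.sum_congr rfl fun i _ => Finset.sum_congr rfl fun j _ =>
        Finset.sum_congr rfl fun k _ => Finset.sum_congr rfl fun l _ => by ring
    have hsum : ∀ f : Fin 4 → Fin 4 → Fin 4 → Fin 4 → E4 → ℝ, (∀ i j k l, Integrable (f i j k l)) →
        ∫ y, ∑ i, ∑ j, ∑ k, ∑ l, f i j k l y = ∑ i, ∑ j, ∑ k, ∑ l, ∫ y, f i j k l y := by
      intro f hf
      rw [integral_finsetSum _ fun i _ => integrable_finsetSum _ fun j _ =>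
        integrable_finsetSum _ fun k _ => integrable_finsetSum _ fun l _ => hf i j k l]
      refine Finset.sum_congr rfl fun i _ => ?_
      rw [integral_finsetSum _ fun j _ =>
        integrable_finsetSum _ fun k _ => integrable_finsetSum _ fun l _ => hf i j k l]
      refine Finset.sum_congr rfl fun j _ => ?_
      rw [integral_finsetSum _ fun k _ => integrable_finsetSum _ fun l _ => hf i j k l]
      refine Finset.sum_congr rfl fun k _ => ?_
      rw [integral_finsetSum _ fun l _ => hf i j k l]
    simp only [e0, hR]
    rw [hsum _ fun i j k l => IL i j k l i k j l, hsum _ fun i j k l => IL i j k l i j k l,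
      hsum _ IR]
    simp only [← Finset.sum_add_distrib]
    exact Finset.sum_congr rfl fun i _ => Finset.sum_congr rfl fun j _ =>
        Finset.sum_congr rfl fun k _ => Finset.sum_congr rfl fun l _ =>
        integral_swap (hbs i j k l) hv i j k l
  set H : E4 → ℝ := fun y => ∑ i, ∑ j, pd i (pd j v) y ^ 2 with hH
  set D : E4 → ℝ := fun y => ∑ i, pd i v y ^ 2 with hD
  have hH0 : ∀ i j y, pd i (pd j v) y ^ 2 ≤ H y := by
    intro i j y
    refine le_trans ?_ (Finset.single_le_sum (f := fun i => ∑ j, pd i (pd j v) y ^ 2)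
        (fun _ _ => by positivity) (Finset.mem_univ i))
    exact Finset.single_le_sum (f := fun j => pd i (pd j v) y ^ 2)
        (fun _ _ => by positivity) (Finset.mem_univ j)
  -- On K the right side is the trace tr(AVAV) with V the Hessian of v; off K both sides vanish.
  have hlow' : ∀ y, c * H y ≤ ∑ i, ∑ j, ∑ k, ∑ l, b i j k l y * (pd i (pd k v) y * pd j (pd l v) y) := by
    intro y
    by_cases hy : y ∈ K
    · refine (hlow y hy (Matrix.of fun i j => pd i (pd j v) y) ?_).trans (le_of_eq ?_)
      · ext i j
        exact pd_comm (hv.smooth.contDiffAt.of_le (by norm_cast)) j i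
      · simp only [Matrix.trace, Matrix.diag, Matrix.mul_apply, Matrix.of_apply, Finset.sum_mul,
          Finset.mul_sum, hb]
        have hs : ∀ i j, A y i j = A y j i := fun i j => by
          have := congrFun (congrFun (hA y hy).isHermitian j) i
          simpa [Matrix.conjTranspose_apply] using this
        have hv' : ∀ i j, pd i (pd j v) y = pd j (pd i v) y := fun i j =>
          pd_comm (hv.smooth.contDiffAt.of_le (by norm_cast)) i j
        have e5 : ∀ f : Fin 4 → Fin 4 → Fin 4 → Fin 4 → ℝ,
            ∑ i, ∑ l, ∑ k, ∑ j, f i j k l = ∑ i, ∑ j, ∑ k, ∑ l, f i j k l := by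
          intro f
          refine Finset.sum_congr rfl fun i _ => ?_
          rw [Finset.sum_comm]
          rw [Finset.sum_comm (s := Finset.univ) (t := Finset.univ) (f := fun j k => ∑ l, f i j k l)]
          refine Finset.sum_congr rfl fun k _ => Finset.sum_comm
        symm
        rw [← e5]
        refine Finset.sum_congr rfl fun i _ => Finset.sum_congr rfl fun l _ =>
          Finset.sum_congr rfl fun k _ => Finset.sum_congr rfl fun j _ => ?_
        rw [hv' i k, hs k l]
        ring
    · have h0 : ∀ i j, pd i (pd j v) y = 0 := fun i j => (hij j i).eq_zero hy
      simp [hH, h0]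
  have hRb : ∀ y, R y ≤ (c / 2) * H y + 128 * (B ^ 2 / (4 * ε)) * D y := by
    intro y
    by_cases hy : y ∈ K
    · have hterm : ∀ i j k l, pd i v y * (pd j (b i j k l) y * pd k (pd l v) y
          - pd k (b i j k l) y * pd j (pd l v) y)
          ≤ ε * pd k (pd l v) y ^ 2 + ε * pd j (pd l v) y ^ 2 + 2 * (B ^ 2 / (4 * ε)) * pd i v y ^ 2 := by
        intro i j k l
        -- Young's inequality, with the weight ε on the second derivative.
        have hy2 : ∀ s x z : ℝ, |s| ≤ B → x * (s * z) ≤ ε * z ^ 2 + B ^ 2 / (4 * ε) * x ^ 2 := by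
          intro s x z hs
          have h1 : x * (s * z) ≤ ε * z ^ 2 + s ^ 2 / (4 * ε) * x ^ 2 := by
            have : 0 ≤ ε * (z - s * x / (2 * ε)) ^ 2 := by positivity
            have e : ε * (z - s * x / (2 * ε)) ^ 2
                = ε * z ^ 2 + s ^ 2 / (4 * ε) * x ^ 2 - x * (s * z) := by
              field_simp; ring
            linarith
          have h2 : s ^ 2 ≤ B ^ 2 := by
            rw [← sq_abs s]; exact pow_le_pow_left₀ (abs_nonneg _) hs 2
          have h3 : s ^ 2 / (4 * ε) * x ^ 2 ≤ B ^ 2 / (4 * ε) * x ^ 2 := by gcongr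
          linarith
        have h1 := hy2 _ (pd i v y) (pd k (pd l v) y) (hB j i j k l y hy)
        have h2 := hy2 (-pd k (b i j k l) y) (pd i v y) (pd j (pd l v) y)
          (by rw [abs_neg]; exact hB k i j k l y hy)
        linarith
      calc R y ≤ ∑ i, ∑ j, ∑ k, ∑ l, (ε * pd k (pd l v) y ^ 2 + ε * pd j (pd l v) y ^ 2
              + 2 * (B ^ 2 / (4 * ε)) * pd i v y ^ 2) :=
            Finset.sum_le_sum fun i _ => Finset.sum_le_sum fun j _ => Finset.sum_le_sum fun k _ =>
              Finset.sum_le_sum fun l _ => hterm i j k l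
        _ = (c / 2) * H y + 128 * (B ^ 2 / (4 * ε)) * D y := by
            simp only [Finset.sum_add_distrib, Finset.sum_const, Finset.card_univ, Fintype.card_fin,
              ← Finset.mul_sum, hH, hD, nsmul_eq_mul, hε]
            push_cast
            ring
    · have h0 : ∀ i j, pd i (pd j v) y = 0 := fun i j => (hij j i).eq_zero hy
      have h1 : ∀ i, pd i v y = 0 := fun i => (hv.pd i).eq_zero hy
      simp [hR, hH, hD, h0, h1]
  have IH : Integrable H := integrable_finsetSum _ fun i _ => integrable_finsetSum _ fun j _ =>
    (hij j i).integrable_sq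
  have ID : Integrable D := integrable_finsetSum _ fun i _ => (hv.pd i).integrable_sq
  have IRR : Integrable R := integrable_finsetSum _ fun i _ => integrable_finsetSum _ fun j _ =>
        integrable_finsetSum _ fun k _ => integrable_finsetSum _ fun l _ => IR i j k l
  have h1 : c * ∫ y, H y ≤ (∫ y, (∑ i, ∑ j, A y i j * pd i (pd j v) y) ^ 2) + ∫ y, R y := by
    rw [← hmain, ← integral_const_mul]
    exact integral_mono (IH.const_mul c) (integrable_finsetSum _ fun i _ =>
      integrable_finsetSum _ fun j _ => integrable_finsetSum _ fun k _ =>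
      integrable_finsetSum _ fun l _ => IL i j k l i k j l) hlow'
  have h2 : ∫ y, R y ≤ (c / 2) * (∫ y, H y) + 128 * (B ^ 2 / (4 * ε)) * ∫ y, D y := by
    rw [← integral_const_mul, ← integral_const_mul, ← integral_add (IH.const_mul _) (ID.const_mul _)]
    exact integral_mono IRR ((IH.const_mul _).add (ID.const_mul _)) hRb
  have eH : ∑ i, ∑ j, ∫ y, pd i (pd j v) y ^ 2 = ∫ y, H y := by
    rw [integral_finsetSum _ fun i _ => integrable_finsetSum _ fun j _ => (hij j i).integrable_sq]
    exact Finset.sum_congr rfl fun i _ => (integral_finsetSum _ fun j _ =>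
      (hij j i).integrable_sq).symm
  have eD : ∑ i, ∫ y, pd i v y ^ 2 = ∫ y, D y :=
    (integral_finsetSum _ fun i _ => (hv.pd i).integrable_sq).symm
  rw [eH, eD]
  set P := ∫ y, (∑ i, ∑ j, A y i j * pd i (pd j v) y) ^ 2
  have hP : 0 ≤ P := integral_nonneg fun y => by positivity
  have hDn : 0 ≤ ∫ y, D y := integral_nonneg fun y => by positivity
  set q := B ^ 2 / (4 * ε)
  have hq : 0 ≤ q := by positivity
  have h3 : (∫ y, H y) ≤ (2 / c) * (P + 128 * q * ∫ y, D y) := by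
    rw [div_mul_eq_mul_div, le_div_iff₀ hc]
    nlinarith
  have hc2 : 0 ≤ 2 / c := by positivity
  have h4 : P + 128 * q * ∫ y, D y ≤ (1 + 128 * q) * (P + ∫ y, D y) := by
    nlinarith [mul_nonneg hq hP]
  exact h3.trans ((mul_le_mul_of_nonneg_left h4 hc2).trans (le_of_eq (by ring)))

end Elliptic

/-! ### Exponential integrability -/

section Exponential

open scoped ENNReal NNReal

lemma eLpNorm_finset_sum_le {α ι : Type*} [MeasurableSpace α] {μ : Measure α} {p : ℝ≥0∞}
    {s : Finset ι} {f : ι → α → ℝ} (hf : ∀ i ∈ s, AEStronglyMeasurable (f i) μ) (hp : 1 ≤ p) :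
    eLpNorm (fun y => ∑ i ∈ s, f i y) p μ ≤ ∑ i ∈ s, eLpNorm (f i) p μ := by
  have := eLpNorm_sum_le hf hp
  rwa [Finset.sum_fn] at this

lemma norm_fderiv_fderiv_le (v : E4 → ℝ) (hv : ContDiff ℝ ∞ v) (y : E4) :
    ‖fderiv ℝ (fderiv ℝ v) y‖ ≤ ∑ i, ∑ j, ‖pd i (pd j v) y‖ := by
  have h1 : DifferentiableAt ℝ (fderiv ℝ v) y :=
    (hv.fderiv_right (m := ∞) (by simp)).differentiable (by simp) y
  have key : ∀ i j : Fin 4, pd i (pd j v) y = fderiv ℝ (fderiv ℝ v) y (stdVec i) (stdVec j) := by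
    intro i j
    unfold pd
    rw [fderiv_clm_apply h1 (differentiableAt_const _)]
    simp
  refine ContinuousLinearMap.opNorm_le_bound₂ _ (by positivity) fun a b => ?_
  have e : fderiv ℝ (fderiv ℝ v) y a b = ∑ i, ∑ j, a i * (b j * pd i (pd j v) y) := by
    conv_lhs => rw [eq_sum_stdVec a, eq_sum_stdVec b]
    simp only [map_sum, map_smul, _root_.sum_apply, _root_.smul_apply, smul_eq_mul, key,
      Finset.mul_sum]
    rw [Finset.sum_comm]
    exact Finset.sum_congr rfl fun i _ => Finset.sum_congr rfl fun j _ => by ring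
  rw [e]
  refine (norm_sum_le _ _).trans ?_
  rw [Finset.sum_mul, Finset.sum_mul]
  refine Finset.sum_le_sum fun i _ => (norm_sum_le _ _).trans ?_
  rw [Finset.sum_mul, Finset.sum_mul]
  refine Finset.sum_le_sum fun j _ => ?_
  rw [norm_mul, norm_mul]
  have ha := PiLp.norm_apply_le a i
  have hb := PiLp.norm_apply_le b j
  calc ‖a i‖ * (‖b j‖ * ‖pd i (pd j v) y‖) ≤ ‖a‖ * (‖b‖ * ‖pd i (pd j v) y‖) := by gcongr
    _ = _ := by ring

lemma TestFn.contDiff_one {K : Set E4} {v : E4 → ℝ} (hv : TestFn K v) : ContDiff ℝ 1 v :=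
  hv.smooth.of_le (by norm_cast)

lemma TestFn.fderiv_contDiff {K : Set E4} {v : E4 → ℝ} (hv : TestFn K v) :
    ContDiff ℝ ∞ (fderiv ℝ v) := hv.smooth.fderiv_right (m := ∞) (by simp)

/-- The Gagliardo–Nirenberg–Sobolev inequality with 1/4 = 1/2 − 1/4. Values in F are allowed because
it is applied to the differential of a function, and f is a free majorant so that the operator norm
of the second differential can be replaced by partial derivatives. -/
lemma exists_sobolev_two (F : Type*) [NormedAddCommGroup F] [NormedSpace ℝ F]
    [FiniteDimensional ℝ F] : ∃ C : ℝ≥0, ∀ u : E4 → F, ContDiff ℝ 1 u → HasCompactSupport u →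
      ∀ f : E4 → ℝ, (∀ y, ‖fderiv ℝ u y‖ ≤ f y) → eLpNorm u 4 volume ≤ C * eLpNorm f 2 volume := by
  refine ⟨SNormLESNormFDerivOfEqConst F (volume : Measure E4) ((2 : ℝ≥0) : ℝ),
    fun u hu hc f hf => ?_⟩
  have h := eLpNorm_le_eLpNorm_fderiv_of_eq (volume : Measure E4) hu hc (p := 2) (p' := 4)
    (by norm_num) (by simp) (by simp; norm_num)
  rw [show (((2 : ℝ≥0)) : ℝ≥0∞) = 2 by norm_num, show (((4 : ℝ≥0)) : ℝ≥0∞) = 4 by norm_num] at h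
  exact h.trans (mul_le_mul_right (eLpNorm_mono_real hf) _)

/-- The endpoint W^{1,1} → L^{4/3} in dimension four. Applied to the powers of a function, it yields
a recursion with factorial growth. -/
lemma exists_sobolev_one : ∃ C : ℝ≥0, ∀ u : E4 → ℝ, ContDiff ℝ 1 u → HasCompactSupport u →
      eLpNorm u (4 / 3) volume ≤ C * eLpNorm (fderiv ℝ u) 1 volume := by
  have h43 : (((4 / 3 : ℝ≥0)) : ℝ≥0∞) = 4 / 3 := by
    rw [ENNReal.coe_div (by norm_num)]; norm_num
  refine ⟨eLpNormLESNormFDerivOneConst (volume : Measure E4) (((4 / 3 : ℝ≥0)) : ℝ),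
    fun u hu hc => ?_⟩
  have := eLpNorm_le_eLpNorm_fderiv_one (volume : Measure E4) hu hc (p := 4 / 3) (by
          constructor
          · norm_num
          · norm_num
          · simp)
  rwa [h43] at this

lemma eLpNorm_sum_pd_pd_le {K : Set E4} {v : E4 → ℝ} (hv : TestFn K v) :
    eLpNorm (fun y => ∑ i, ∑ j, ‖pd i (pd j v) y‖) 2 volume ≤ ∑ i, ∑ j, eLpNorm (pd i (pd j v)) 2 volume := by
  have hc : ∀ i j, Continuous fun y => ‖pd i (pd j v) y‖ := fun i j =>
    ((hv.pd j).pd i).continuous.norm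
  refine (eLpNorm_finset_sum_le (f := fun i y => ∑ j, ‖pd i (pd j v) y‖) (fun i _ =>
    (continuous_finsetSum _ fun j _ => hc i j).aestronglyMeasurable) (by norm_num)).trans ?_
  refine Finset.sum_le_sum fun i _ => ?_
  refine (eLpNorm_finset_sum_le (f := fun j y => ‖pd i (pd j v) y‖) (fun j _ =>
    (hc i j).aestronglyMeasurable) (by norm_num)).trans (le_of_eq ?_)
  exact Finset.sum_congr rfl fun j _ => eLpNorm_norm (pd i (pd j v))

/-- The Sobolev inequality `‖∇v‖_4 ≤ C ‖∇²v‖_2` in dimension four. -/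
lemma exists_gradient_sobolev : ∃ C : ℝ≥0, ∀ (K : Set E4) (v : E4 → ℝ), TestFn K v →
    eLpNorm (fderiv ℝ v) 4 volume ≤ C * ∑ i, ∑ j, eLpNorm (pd i (pd j v)) 2 volume := by
  obtain ⟨C, hC⟩ := exists_sobolev_two (E4 →L[ℝ] ℝ)
  refine ⟨C, fun K v hv => ?_⟩
  have h1 : ContDiff ℝ 1 (fderiv ℝ v) := hv.smooth.fderiv_right (m := 1) (by norm_cast)
  have h2 := hC (fderiv ℝ v) h1 (hv.compact.fderiv (𝕜 := ℝ)) _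
    (norm_fderiv_fderiv_le v hv.smooth)
  exact h2.trans (mul_le_mul_right (eLpNorm_sum_pd_pd_le hv) _)

lemma holderTriple_four : ENNReal.HolderTriple (4 / 3) 4 1 where
  inv_add_inv_eq_inv := by
    rw [ENNReal.inv_div (by simp) (by simp), inv_one, ← one_div, ENNReal.div_add_div_same]
    norm_num
    exact ENNReal.div_self (by norm_num) (by norm_num)

/-- Hölder with 3/4 + 1/4 = 1, applied to ∇(v^{k+1}) = (k+1) v^k ∇v. The power is measured on B
only, since for k = 0 it is the constant 1. -/
lemma eLpNorm_fderiv_pow_le {B : Set E4} {v : E4 → ℝ} (hv : TestFn B v) (k : ℕ) :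
    eLpNorm (fderiv ℝ (fun y => v y ^ (k + 1))) 1 volume
      ≤ (k + 1 : ℕ) * (eLpNorm (fun y => v y ^ k) (4 / 3) (volume.restrict B)
        * eLpNorm (fderiv ℝ v) 4 volume) := by
  have hfd : ∀ y, ‖fderiv ℝ (fun y => v y ^ (k + 1)) y‖
      = ‖((k + 1 : ℕ) : ℝ) * (v y ^ k * ‖fderiv ℝ v y‖)‖ := by
    intro y
    rw [fderiv_fun_pow (k + 1) (hv.differentiableAt y), norm_smul, norm_mul, norm_mul, norm_norm,
      nsmul_eq_mul, norm_mul, add_tsub_cancel_right, mul_assoc]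
  have hs : ∀ y, y ∉ B → v y ^ k * ‖fderiv ℝ v y‖ = 0 := by
    intro y hyB
    have : fderiv ℝ v y = 0 := by
      have h0 : y ∉ tsupport (fderiv ℝ v) :=
        fun h => hyB (hv.supp (tsupport_fderiv_subset ℝ h))
      exact image_eq_zero_of_notMem_tsupport h0
    simp [this]
  rw [eLpNorm_congr_norm_ae (Filter.Eventually.of_forall hfd)]
  have e1 : eLpNorm (fun y => ((k + 1 : ℕ) : ℝ) * (v y ^ k * ‖fderiv ℝ v y‖)) 1 volume
      = (k + 1 : ℕ) * eLpNorm (fun y => v y ^ k * ‖fderiv ℝ v y‖) 1 volume := by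
    have := eLpNorm_const_smul ((k + 1 : ℕ) : ℝ) (fun y => v y ^ k * ‖fderiv ℝ v y‖) 1
      (volume : Measure E4)
    rwa [Real.enorm_natCast] at this
  have e2 : eLpNorm (fun y => v y ^ k * ‖fderiv ℝ v y‖) 1 volume
      = eLpNorm (fun y => v y ^ k * ‖fderiv ℝ v y‖) 1 (volume.restrict B) :=
    (eLpNorm_restrict_eq_of_support_subset fun y hy => by
      by_contra hyB; exact hy (hs y hyB)).symm
  rw [e1, e2]
  have := holderTriple_four
  have hc : Continuous fun y => ‖fderiv ℝ v y‖ := hv.fderiv_contDiff.continuous.norm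
  have h3 : eLpNorm (fun y => v y ^ k * ‖fderiv ℝ v y‖) 1 (volume.restrict B)
      ≤ eLpNorm (fun y => v y ^ k) (4 / 3) (volume.restrict B)
        * eLpNorm (fun y => ‖fderiv ℝ v y‖) 4 (volume.restrict B) :=
    eLpNorm_smul_le_mul_eLpNorm (p := 4 / 3) (q := 4) (𝕜 := ℝ) (E := ℝ)
      hc.aestronglyMeasurable (hv.continuous.pow k).aestronglyMeasurable
  have h4 : eLpNorm (fun y => ‖fderiv ℝ v y‖) 4 (volume.restrict B)
      ≤ eLpNorm (fderiv ℝ v) 4 volume := by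
    rw [eLpNorm_norm]
    exact eLpNorm_mono_measure _ Measure.restrict_le_self
  exact mul_le_mul_right (h3.trans (mul_le_mul_right h4 _)) _

/-- If `‖∇v‖_4` is small, `exp (3 |v|)` is bounded in `L^{4/3}`. -/
lemma exists_exp_bound : ∃ δ : ℝ≥0, 0 < δ ∧ ∀ (B : Set E4) (v : E4 → ℝ), IsCompact B → TestFn B v →
    eLpNorm (fderiv ℝ v) 4 volume ≤ δ →
    eLpNorm (fun y => Real.exp (3 * |v y|)) (4 / 3) (volume.restrict B)
      ≤ 2 * eLpNorm (fun _ : E4 => (1 : ℝ)) (4 / 3) (volume.restrict B) := by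
  obtain ⟨C, hC⟩ := exists_sobolev_one
  -- With this δ one has 3 C δ ≤ 1/2, the ratio of the geometric series below.
  refine ⟨(6 * (C + 1))⁻¹, by positivity, fun B v hB hv hD => ?_⟩
  set μ := (volume : Measure E4).restrict B with hμ
  set D := eLpNorm (fderiv ℝ v) 4 volume with hDdef
  set a : ℕ → ℝ≥0∞ := fun k => eLpNorm (fun y => v y ^ k) (4 / 3) μ with ha
  have hstep : ∀ k, a (k + 1) ≤ C * D * ((k + 1 : ℕ) * a k) := by
    intro k
    have hvk : TestFn B (fun y => v y ^ (k + 1)) := by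
      simpa [pow_succ] using hv.mul_left (hv.smooth.pow k)
    have h1 : a (k + 1) ≤ C * eLpNorm (fderiv ℝ (fun y => v y ^ (k + 1))) 1 volume :=
      (eLpNorm_mono_measure _ Measure.restrict_le_self).trans (hC _ hvk.contDiff_one hvk.compact)
    have h2 := eLpNorm_fderiv_pow_le hv k
    calc a (k + 1) ≤ C * ((k + 1 : ℕ) * (a k * D)) := h1.trans (mul_le_mul_right h2 _)
      _ = _ := by ring
  have hCD : 3 * (C * D) ≤ 2⁻¹ := by
    calc 3 * ((C : ℝ≥0∞) * D) ≤ 3 * (C * ((6 * (C + 1))⁻¹ : ℝ≥0)) := by gcongr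
      _ = ((3 * (C * (6 * (C + 1))⁻¹) : ℝ≥0) : ℝ≥0∞) := by push_cast; rfl
      _ ≤ ((2⁻¹ : ℝ≥0) : ℝ≥0∞) := by
        rw [ENNReal.coe_le_coe, ← NNReal.coe_le_coe]
        push_cast
        have : (0 : ℝ) ≤ C := C.2
        rw [← div_eq_mul_inv, ← mul_div_assoc, div_le_iff₀ (by positivity)]
        linarith
      _ = 2⁻¹ := by rw [ENNReal.coe_inv (by norm_num)]; norm_num
  -- Factorial growth of the norms of the powers is exactly compensated by the coefficients of the
  -- exponential series.
  have hak : ∀ k, a k ≤ (C * D) ^ k * k.factorial * a 0 := by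
    intro k
    induction k with
    | zero => simp
    | succ k ih =>
      calc a (k + 1) ≤ C * D * ((k + 1 : ℕ) * ((C * D) ^ k * k.factorial * a 0)) :=
            (hstep k).trans (by gcongr)
        _ = _ := by rw [Nat.factorial_succ]; push_cast; ring
  set S : ℕ → E4 → ℝ := fun n y => ∑ k ∈ Finset.range n, (3 * |v y|) ^ k / k.factorial with hS
  have hSn : ∀ n, eLpNorm (S n) (4 / 3) μ ≤ 2 * a 0 := by
    intro n
    have hterm : ∀ k, eLpNorm (fun y => (3 * |v y|) ^ k / k.factorial) (4 / 3) μ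
        ≤ (2⁻¹) ^ k * a 0 := by
      intro k
      have e1 : eLpNorm (fun y => (3 * |v y|) ^ k / k.factorial) (4 / 3) μ
          = ENNReal.ofReal (3 ^ k / k.factorial) * a k := by
        rw [ha]
        have := eLpNorm_const_smul ((3 : ℝ) ^ k / k.factorial) (fun y => v y ^ k) (4 / 3) μ
        rw [← Real.enorm_of_nonneg (by positivity), ← this]
        refine eLpNorm_congr_norm_ae (Filter.Eventually.of_forall fun y => ?_)
        simp [mul_pow, abs_pow]
        ring
      rw [e1]
      calc ENNReal.ofReal (3 ^ k / k.factorial) * a k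
          ≤ ENNReal.ofReal (3 ^ k / k.factorial) * ((C * D) ^ k * k.factorial * a 0) := by
            gcongr; exact hak k
        _ = (3 * (C * D)) ^ k * a 0 := by
            rw [ENNReal.ofReal_div_of_pos (by positivity), ENNReal.ofReal_pow (by norm_num),
              ENNReal.ofReal_natCast, mul_pow 3]
            have hf : (k.factorial : ℝ≥0∞) ≠ 0 := by exact_mod_cast k.factorial_ne_zero
            have hf' : (k.factorial : ℝ≥0∞) ≠ ⊤ := ENNReal.natCast_ne_top _
            rw [ENNReal.ofReal_ofNat, div_eq_mul_inv]
            calc (3 : ℝ≥0∞) ^ k * (k.factorial : ℝ≥0∞)⁻¹ * ((↑C * D) ^ k * k.factorial * a 0)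
                = 3 ^ k * (↑C * D) ^ k * a 0 * ((k.factorial : ℝ≥0∞)⁻¹ * k.factorial) := by ring
              _ = _ := by rw [ENNReal.inv_mul_cancel hf hf', mul_one]
        _ ≤ _ := by gcongr
    calc eLpNorm (S n) (4 / 3) μ
        ≤ ∑ k ∈ Finset.range n, eLpNorm (fun y => (3 * |v y|) ^ k / k.factorial) (4 / 3) μ := by
          refine eLpNorm_finset_sum_le (fun k _ => Continuous.aestronglyMeasurable ?_) ?_
          · have := hv.continuous
            fun_prop
          · rw [ENNReal.le_div_iff_mul_le (by simp) (by simp)]; norm_num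
      _ ≤ ∑ k ∈ Finset.range n, (2⁻¹) ^ k * a 0 := Finset.sum_le_sum fun k _ => hterm k
      _ ≤ ∑' k, (2⁻¹) ^ k * a 0 := ENNReal.sum_le_tsum _
      _ = 2 * a 0 := by
        rw [ENNReal.tsum_mul_right, ENNReal.tsum_geometric, ENNReal.one_sub_inv_two, inv_inv]
  -- Fatou's lemma along the partial sums of the exponential series.
  have hlim : eLpNorm (fun y => Real.exp (3 * |v y|)) (4 / 3) μ
      ≤ Filter.liminf (fun n => eLpNorm (S n) (4 / 3) μ) Filter.atTop := by
    refine Lp.eLpNorm_lim_le_liminf_eLpNorm (fun n => Continuous.aestronglyMeasurable ?_) _ ?_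
    · have := hv.continuous
      simp only [hS]; fun_prop
    · refine Filter.Eventually.of_forall fun y => ?_
      rw [Real.exp_eq_exp_ℝ]
      exact (NormedSpace.expSeries_div_hasSum_exp (3 * |v y|)).tendsto_sum_nat
  refine hlim.trans ?_
  have e0 : a 0 = eLpNorm (fun _ : E4 => (1 : ℝ)) (4 / 3) μ := by simp [ha]
  rw [← e0]
  exact (Filter.liminf_le_liminf (Filter.Eventually.of_forall hSn)).trans (by simp)

/-- Almost everywhere limits of sequences of test functions that are Cauchy in `W^{1,4}` are
exponentially integrable. -/
theorem integrableOn_exp_of_tendsto {B : Set E4} (hB : IsCompact B) {v : ℕ → E4 → ℝ} {w : E4 → ℝ}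
    (hv : ∀ n, TestFn B (v n))
    (hcau : ∀ ε : ℝ≥0, 0 < ε → ∃ N, ∀ n ≥ N, eLpNorm (fderiv ℝ (fun y => v n y - v N y)) 4 volume ≤ ε)
    (hlim : ∀ᵐ y ∂(volume.restrict B), Filter.Tendsto (fun n => v n y) Filter.atTop (𝓝 (w y))) :
    IntegrableOn (fun y => Real.exp (4 * |w y|)) B := by
  obtain ⟨δ, hδ, hexp⟩ := exists_exp_bound
  obtain ⟨N, hN⟩ := hcau δ hδ
  set μ := (volume : Measure E4).restrict B with hμ
  have : IsFiniteMeasure μ := ⟨by simpa [hμ] using hB.measure_lt_top⟩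
  have hwm : AEStronglyMeasurable w μ :=
    aestronglyMeasurable_of_tendsto_ae _ (fun n => (hv n).continuous.aestronglyMeasurable) hlim
  set a0 := eLpNorm (fun _ : E4 => (1 : ℝ)) (4 / 3) μ
  have ha0 : a0 < ⊤ := (memLp_const (1 : ℝ)).2
  -- Only the tail `v n - v N` has small gradient. Its bound passes to the limit by Fatou, and the
  -- bounded function `v N` is added back afterwards.
  have h1 : eLpNorm (fun y => Real.exp (3 * |w y - v N y|)) (4 / 3) μ ≤ 2 * a0 := by
    have hc := (hv N).continuous
    refine (Lp.eLpNorm_lim_le_liminf_eLpNorm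
      (f := fun n y => Real.exp (3 * |v (n + N) y - v N y|))
      (fun n => Continuous.aestronglyMeasurable ?_) _ ?_).trans ?_
    · have := (hv (n + N)).continuous
      fun_prop
    · filter_upwards [hlim] with y hy
      have h2 := hy.comp (Filter.tendsto_add_atTop_nat N)
      exact (Real.continuous_exp.tendsto _).comp (((h2.sub_const _).abs).const_mul 3)
    · refine (Filter.liminf_le_liminf (Filter.Eventually.of_forall fun n => ?_)).trans
        (Filter.liminf_const (f := Filter.atTop (α := ℕ)) (2 * a0)).le
      exact hexp B _ hB ((hv (n + N)).sub (hv N)) (hN (n + N) (by omega))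
  obtain ⟨b, hb⟩ := (hv N).compact.exists_bound_of_continuous (hv N).continuous
  have h2 : MemLp (fun y => Real.exp (3 * |w y|)) (4 / 3) μ := by
    have h3 : MemLp (fun y => Real.exp (3 * |w y - v N y|)) (4 / 3) μ := by
      refine ⟨?_, h1.trans_lt (ENNReal.mul_lt_top (by simp) ha0)⟩
      exact Real.continuous_exp.comp_aestronglyMeasurable
        (((hwm.sub (hv N).continuous.aestronglyMeasurable).norm).const_mul 3)
    refine (h3.const_mul (Real.exp (3 * b))).mono ?_ ?_
    · exact Real.continuous_exp.comp_aestronglyMeasurable ((hwm.norm).const_mul 3)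
    · refine Filter.Eventually.of_forall fun y => ?_
      rw [Real.norm_of_nonneg (Real.exp_pos _).le, Real.norm_of_nonneg (by positivity),
        ← Real.exp_add, Real.exp_le_exp]
      have h4 := hb y
      rw [Real.norm_eq_abs] at h4
      have h5 : |w y| ≤ |w y - v N y| + |v N y| := by
        simpa using abs_add_le (w y - v N y) (v N y)
      linarith
  -- The exponent 3 was chosen so that 3 · (4/3) = 4.
  have h3 := h2.integrable_norm_rpow (by simp) (ENNReal.div_ne_top (by simp) (by simp))
  refine h3.congr (Filter.Eventually.of_forall fun y => ?_)
  simp only [Real.norm_eq_abs, Real.abs_exp]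
  rw [← Real.exp_mul]
  congr 1
  rw [ENNReal.toReal_div]
  norm_num
  ring

end Exponential

/-! ### Mollification -/

section Mollification

open scoped ENNReal NNReal

lemma sq_lintegral_le {α : Type*} [MeasurableSpace α] {ν : Measure α} [IsProbabilityMeasure ν]
    {f : α → ℝ≥0∞} (hf : AEMeasurable f ν) : (∫⁻ a, f a ∂ν) ^ 2 ≤ ∫⁻ a, f a ^ 2 ∂ν := by
  have h := ENNReal.lintegral_mul_le_Lp_mul_Lq ν Real.HolderConjugate.two_two hf
    (aemeasurable_const (b := 1))
  simp only [Pi.mul_apply, mul_one, ENNReal.rpow_ofNat, one_pow, lintegral_const, measure_univ,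
    ENNReal.one_rpow] at h
  calc (∫⁻ a, f a ∂ν) ^ 2 ≤ ((∫⁻ a, f a ^ 2 ∂ν) ^ (1 / 2 : ℝ)) ^ 2 := by gcongr
    _ = _ := by rw [← ENNReal.rpow_ofNat, ← ENNReal.rpow_mul]; norm_num

lemma sq_eLpNorm_two {α F : Type*} [MeasurableSpace α] [NormedAddCommGroup F] {μ : Measure α}
    (f : α → F) : eLpNorm f 2 μ ^ 2 = ∫⁻ a, ‖f a‖ₑ ^ 2 ∂μ := by
  have h := eLpNorm_nnreal_pow_eq_lintegral (f := f) (μ := μ) (p := 2) (by norm_num)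
  simpa using h

lemma lintegral_enorm_sq {α : Type*} [MeasurableSpace α] {μ : Measure α} {f : α → ℝ}
    (hf : Integrable (fun a => f a ^ 2) μ) :
    ∫⁻ a, ‖f a‖ₑ ^ 2 ∂μ = ENNReal.ofReal (∫ a, f a ^ 2 ∂μ) := by
  rw [ofReal_integral_eq_lintegral_ofReal hf (Filter.Eventually.of_forall fun a => sq_nonneg _)]
  refine lintegral_congr fun a => ?_
  rw [← sq_abs, ENNReal.ofReal_pow (abs_nonneg _), Real.enorm_eq_ofReal_abs]

lemma eLpNorm_two_eq {α : Type*} [MeasurableSpace α] {μ : Measure α} {f : α → ℝ}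
    (hf : Integrable (fun a => f a ^ 2) μ) :
    eLpNorm f 2 μ = ENNReal.ofReal (√(∫ a, f a ^ 2 ∂μ)) := by
  have h := sq_eLpNorm_two f (μ := μ)
  rw [lintegral_enorm_sq hf, ← Real.sq_sqrt (integral_nonneg fun a => sq_nonneg (f a)),
    ENNReal.ofReal_pow (Real.sqrt_nonneg _)] at h
  exact (ENNReal.pow_right_strictMono two_ne_zero).injective h

/-- Smooth probability densities supported in the ball of radius `r`. -/
structure IsKernel (r : ℝ) (k : E4 → ℝ) : Prop where
  test : TestFn (Metric.closedBall 0 r) k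
  nonneg : ∀ t, 0 ≤ k t
  integral_eq : ∫ t, k t = 1

lemma exists_isKernel {r : ℝ} (hr : 0 < r) : ∃ k, IsKernel r k := by
  let ρ : ContDiffBump (0 : E4) := ⟨r / 2, r, by positivity, by linarith⟩
  exact ⟨ρ.normed volume, ⟨ρ.contDiff_normed, ρ.hasCompactSupport_normed,
    ρ.tsupport_normed_eq.subset⟩, ρ.nonneg_normed, ρ.integral_normed⟩

/-- Mollification of `G` with the kernel `k`. -/
noncomputable def moll (k G : E4 → ℝ) (x : E4) : ℝ := ∫ t, k t * G (x - t)

lemma moll_eq_convolution (k G : E4 → ℝ) :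
    moll k G = convolution k G (ContinuousLinearMap.lsmul ℝ ℝ) volume := by
  funext x; simp [moll, convolution]

lemma moll_eq (k G : E4 → ℝ) (x : E4) : moll k G x = ∫ s, G s * k (x - s) := by
  rw [← integral_sub_left_eq_self _ _ x]
  simp [moll, mul_comm]

variable {r : ℝ} {k G : E4 → ℝ}

lemma IsKernel.prob (hk : IsKernel r k) :
    IsProbabilityMeasure (volume.withDensity fun t => ENNReal.ofReal (k t)) := by
  constructor
  rw [withDensity_apply _ MeasurableSet.univ, Measure.restrict_univ,
    ← ofReal_integral_eq_lintegral_ofReal hk.test.integrable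
      (Filter.Eventually.of_forall hk.nonneg), hk.integral_eq, ENNReal.ofReal_one]

lemma TestFn.integrable_mul_sub {K : Set E4} {k : E4 → ℝ} (hk : TestFn K k)
    (hG : LocallyIntegrable G) (x : E4) : Integrable (fun t => k t * G (x - t)) := by
  have h := hk.compact.convolutionExists_left (ContinuousLinearMap.lsmul ℝ ℝ) hk.continuous hG x
  simpa [ConvolutionExistsAt] using h

lemma moll_contDiff {K : Set E4} (hk : TestFn K k) (hG : LocallyIntegrable G) :
    ContDiff ℝ ∞ (moll k G) := by
  rw [moll_eq_convolution]
  exact hk.compact.contDiff_convolution_left _ hk.smooth hG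

lemma moll_pd {K : Set E4} (hk : TestFn K k) (hG : LocallyIntegrable G) (i : Fin 4) :
    pd i (moll k G) = moll (pd i k) G := by
  funext x
  have h := (hk.compact.hasFDerivAt_convolution_left (ContinuousLinearMap.lsmul ℝ ℝ)
    hk.contDiff_one hG x).fderiv
  rw [pd, moll_eq_convolution, h]
  have hint := (hk.compact.fderiv (𝕜 := ℝ)).convolutionExists_left
    ((ContinuousLinearMap.lsmul ℝ ℝ : ℝ →L[ℝ] ℝ →L[ℝ] ℝ).precompL E4)
    hk.fderiv_contDiff.continuous hG x
  rw [convolution, ContinuousLinearMap.integral_apply hint]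
  simp [moll, pd, ContinuousLinearMap.precompL_apply]

/-- The reflected kernel s ↦ k(x − s) is an admissible test function; the sign from the reflection
cancels the sign in the definition of weak derivatives. -/
lemma HasWeakPartial.moll_pd {K : Set E4} {G' : E4 → ℝ} {i : Fin 4}
    (h : HasWeakPartial Set.univ i G G')
    (hk : TestFn K k) (hG : LocallyIntegrable G) : pd i (moll k G) = moll k G' := by
  rw [Paneitz.moll_pd hk hG]
  funext x
  rw [moll_eq, moll_eq]
  have hφs : ContDiff ℝ ∞ fun s => k (x - s) := hk.smooth.comp (contDiff_const.sub contDiff_id)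
  have hφc : HasCompactSupport fun s => k (x - s) := by
    have := hk.compact.comp_homeomorph (Homeomorph.subLeft x)
    exact this
  have h1 := h.2.2 _ hφs hφc (Set.subset_univ _)
  have e : ∀ s, fderiv ℝ (fun s => k (x - s)) s (stdVec i) = - pd i k (x - s) := by
    intro s
    have hd := (hk.differentiableAt (x - s)).hasFDerivAt.comp s
      ((hasFDerivAt_const x s).sub (hasFDerivAt_id s))
    have : fderiv ℝ (fun s => k (x - s)) s = _ := hd.fderiv
    rw [this]
    simp [pd]
  simp only [e, mul_neg, integral_neg, neg_inj] at h1
  exact h1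

lemma moll_testFn (hk : IsKernel r k) {K : Set E4} (hK : IsCompact K) (hG : LocallyIntegrable G)
    (hs : ∀ x ∉ K, G x = 0) : TestFn (Metric.cthickening r K) (moll k G) := by
  have hsupp : Function.support (moll k G) ⊆ Metric.cthickening r K := by
    intro x hx
    by_contra hx'
    apply hx
    unfold moll
    rw [integral_eq_zero_of_ae]
    refine Filter.Eventually.of_forall fun t => ?_
    by_cases ht : t ∈ Metric.closedBall (0 : E4) r
    · have : x - t ∉ K := fun hxt => hx' (Metric.mem_cthickening_of_dist_le x (x - t) r K hxt (by
        rw [dist_eq_norm]; simpa using ht))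
      simp [hs _ this]
    · simp [hk.test.eq_zero ht]
  have hc : IsCompact (Metric.cthickening r K) := hK.cthickening
  exact ⟨moll_contDiff hk.test hG, HasCompactSupport.of_support_subset_isCompact hc hsupp,
    closure_minimal hsupp hc.isClosed⟩

lemma moll_congr {G' : E4 → ℝ} (h : G =ᵐ[volume] G') : moll k G = moll k G' := by
  funext x
  rw [moll_eq, moll_eq]
  exact integral_congr_ae (by filter_upwards [h] with s hs; rw [hs])

lemma ae_comp_sub {p : E4 → Prop} (h : ∀ᵐ x, p x) (t : E4) : ∀ᵐ x, p (x - t) :=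
  (measurePreserving_sub_right volume t).quasiMeasurePreserving.ae h

/-- The mollification is an average of translates with respect to the probability density k, so
Jensen's inequality and Tonelli's theorem reduce its L² distance from G to that of small translates.
-/
lemma lintegral_moll_sub_sq_le (hk : IsKernel r k) (hG : LocallyIntegrable G) {B : ℝ≥0∞}
    (hB : ∀ t ∈ Metric.closedBall (0 : E4) r, ∫⁻ x, ‖G (x - t) - G x‖ₑ ^ 2 ≤ B) :
    ∫⁻ x, ‖moll k G x - G x‖ₑ ^ 2 ≤ B := by
  -- A measurable representative is needed for the joint measurability of G(x − t) in Tonelli's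
  -- theorem. Neither side changes on passing to it.
  wlog hm : StronglyMeasurable G generalizing G
  · have hGm := hG.aestronglyMeasurable
    have hae := hGm.ae_eq_mk
    set G' := hGm.mk G with hG'
    have hLI : LocallyIntegrable G' := hG.congr hae
    have h1 : ∫⁻ x, ‖moll k G x - G x‖ₑ ^ 2 = ∫⁻ x, ‖moll k G' x - G' x‖ₑ ^ 2 := by
      refine lintegral_congr_ae ?_
      filter_upwards [hae] with x hx
      rw [hx, moll_congr hae]
    rw [h1]
    refine this hLI (fun t ht => ?_) hGm.stronglyMeasurable_mk
    refine le_of_eq_of_le (lintegral_congr_ae ?_) (hB t ht)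
    filter_upwards [hae, ae_comp_sub hae t] with x h1 h2
    rw [h1, h2]
  have := hk.prob
  set ν := volume.withDensity fun t => ENNReal.ofReal (k t) with hν
  have hkm : Measurable fun t => ENNReal.ofReal (k t) := hk.test.continuous.measurable.ennreal_ofReal
  have hmeas : Measurable fun p : E4 × E4 => ‖G (p.1 - p.2) - G p.1‖ₑ :=
    ((hm.measurable.comp (measurable_fst.sub measurable_snd)).sub
      (hm.measurable.comp measurable_fst)).enorm
  have hpt : ∀ x, ‖moll k G x - G x‖ₑ ^ 2 ≤ ∫⁻ t, ENNReal.ofReal (k t) * ‖G (x - t) - G x‖ₑ ^ 2 := by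
    intro x
    have e1 : moll k G x - G x = ∫ t, k t * (G (x - t) - G x) := by
      have : G x = ∫ t, k t * G x := by rw [integral_mul_const, hk.integral_eq, one_mul]
      conv_lhs => rw [this]
      rw [moll, ← integral_sub (hk.test.integrable_mul_sub hG x) (hk.test.integrable.mul_const _)]
      simp only [mul_sub]
    have hmx : Measurable fun t => ‖G (x - t) - G x‖ₑ := hmeas.comp measurable_prodMk_left
    have e2 : ‖moll k G x - G x‖ₑ ≤ ∫⁻ t, ‖G (x - t) - G x‖ₑ ∂ν := by
      rw [e1]
      refine (enorm_integral_le_lintegral_enorm _).trans (le_of_eq ?_)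
      rw [hν, lintegral_withDensity_eq_lintegral_mul _ hkm hmx]
      refine lintegral_congr fun t => ?_
      rw [enorm_mul, Real.enorm_of_nonneg (hk.nonneg t)]; rfl
    calc ‖moll k G x - G x‖ₑ ^ 2 ≤ (∫⁻ t, ‖G (x - t) - G x‖ₑ ∂ν) ^ 2 := by gcongr
      _ ≤ ∫⁻ t, ‖G (x - t) - G x‖ₑ ^ 2 ∂ν := sq_lintegral_le hmx.aemeasurable
      _ = _ := by
        rw [hν, lintegral_withDensity_eq_lintegral_mul _ hkm (hmx.pow_const 2)]; rfl
  calc ∫⁻ x, ‖moll k G x - G x‖ₑ ^ 2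
      ≤ ∫⁻ x, ∫⁻ t, ENNReal.ofReal (k t) * ‖G (x - t) - G x‖ₑ ^ 2 := lintegral_mono hpt
    _ = ∫⁻ t, ∫⁻ x, ENNReal.ofReal (k t) * ‖G (x - t) - G x‖ₑ ^ 2 := by
        refine lintegral_lintegral_swap (Measurable.aemeasurable ?_)
        exact (hkm.comp measurable_snd).mul (hmeas.pow_const 2)
    _ = ∫⁻ t, ENNReal.ofReal (k t) * ∫⁻ x, ‖G (x - t) - G x‖ₑ ^ 2 :=
        lintegral_congr fun t => lintegral_const_mul _
          ((hmeas.comp measurable_prodMk_right).pow_const 2)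
    _ ≤ ∫⁻ t, ENNReal.ofReal (k t) * B := by
        refine lintegral_mono fun t => ?_
        by_cases ht : t ∈ Metric.closedBall (0 : E4) r
        · exact mul_le_mul_right (hB t ht) _
        · simp [hk.test.eq_zero ht]
    _ = B := by
        rw [lintegral_mul_const _ hkm, ← ofReal_integral_eq_lintegral_ofReal hk.test.integrable
          (Filter.Eventually.of_forall hk.nonneg), hk.integral_eq, ENNReal.ofReal_one, one_mul]

/-- Translations act continuously on `L²`. -/
lemma exists_translation_le (hG : MemLp G 2) {ε : ℝ≥0∞} (hε : 0 < ε) :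
    ∃ δ > 0, ∀ t : E4, ‖t‖ ≤ δ → eLpNorm (fun x => G (x - t) - G x) 2 volume ≤ ε := by
  have : Fact ((2 : ℝ≥0∞) ≠ ⊤) := ⟨by norm_num⟩
  have hcont : Continuous fun t : E4 => (DomAddAct.mk (-t)) +ᵥ (hG.toLp G) := by
    have h1 : Continuous fun t : E4 => DomAddAct.mk (-t) :=
      DomAddAct.continuous_mk.comp continuous_neg
    exact h1.vadd continuous_const
  have h0 : Filter.Tendsto (fun t : E4 => edist ((DomAddAct.mk (-t)) +ᵥ (hG.toLp G)) (hG.toLp G))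
      (𝓝 0) (𝓝 0) := by
    have := (hcont.edist (continuous_const (y := hG.toLp G))).tendsto (0 : E4)
    simpa using this
  have h1 := h0.eventually (Iic_mem_nhds hε)
  obtain ⟨δ, hδ, h2⟩ := Metric.eventually_nhds_iff_ball.1 h1
  refine ⟨δ / 2, by positivity, fun t ht => ?_⟩
  have h3 := h2 t (by simp; linarith)
  rw [DomAddAct.mk_vadd_toLp, Lp.edist_toLp_toLp] at h3
  refine le_trans (le_of_eq ?_) h3
  refine eLpNorm_congr_ae (Filter.Eventually.of_forall fun x => ?_)
  simp [sub_eq_neg_add]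

lemma tendsto_moll (hG : MemLp G 2) {r : ℕ → ℝ} (hr : Filter.Tendsto r Filter.atTop (𝓝 0))
    {k : ℕ → E4 → ℝ} (hk : ∀ n, IsKernel (r n) (k n)) :
    Filter.Tendsto (fun n => eLpNorm (fun x => moll (k n) G x - G x) 2 volume)
      Filter.atTop (𝓝 0) := by
  rw [ENNReal.tendsto_atTop_zero]
  intro ε hε
  obtain ⟨δ, hδ, h⟩ := exists_translation_le hG hε
  obtain ⟨N, hN⟩ := Filter.eventually_atTop.1 (hr.eventually (Iic_mem_nhds hδ))
  refine ⟨N, fun n hn => ?_⟩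
  have h1 : eLpNorm (fun x => moll (k n) G x - G x) 2 volume ^ 2 ≤ ε ^ 2 := by
    rw [sq_eLpNorm_two]
    refine lintegral_moll_sub_sq_le (hk n) (hG.locallyIntegrable (by norm_num)) fun t ht => ?_
    rw [← sq_eLpNorm_two (fun x => G (x - t) - G x)]
    have := h t ((mem_closedBall_zero_iff.1 ht).trans (hN n hn))
    gcongr
  exact (ENNReal.pow_right_strictMono two_ne_zero).le_iff_le.1 h1

end Mollification

/-! ### A compactness inequality -/

section Compactness

open scoped ENNReal NNReal

lemma norm_fderiv_sq_le (v : E4 → ℝ) (y : E4) : ‖fderiv ℝ v y‖ ^ 2 ≤ ∑ i, pd i v y ^ 2 := by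
  have h : ‖fderiv ℝ v y‖ ≤ √(∑ i, pd i v y ^ 2) := by
    refine ContinuousLinearMap.opNorm_le_bound _ (Real.sqrt_nonneg _) fun a => ?_
    rw [fderiv_eq_sum_pd, EuclideanSpace.norm_eq, Real.norm_eq_abs]
    refine Real.abs_le_sqrt ?_ |>.trans (le_of_eq (Real.sqrt_mul (by positivity) _))
    simp only [Real.norm_eq_abs, sq_abs]
    rw [mul_comm]
    exact Finset.sum_mul_sq_le_sq_mul_sq _ _ _
  calc ‖fderiv ℝ v y‖ ^ 2 ≤ (√(∑ i, pd i v y ^ 2)) ^ 2 := by gcongr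
    _ = _ := Real.sq_sqrt (by positivity)

/-- The difference is the integral of the derivative along the segment from x to x − t.
Cauchy–Schwarz in the parameter and translation invariance of the measure give the bound. -/
lemma lintegral_translation_le {K : Set E4} {v : E4 → ℝ} (hv : TestFn K v) (t : E4) :
    ∫⁻ x, ‖v (x - t) - v x‖ₑ ^ 2 ≤ ENNReal.ofReal (‖t‖ ^ 2 * ∑ i, ∫ y, pd i v y ^ 2) := by
  set ν : Measure ℝ := volume.restrict (Set.Ioc 0 1) with hν
  have : IsProbabilityMeasure ν := ⟨by simp [hν]⟩
  set D : E4 → ℝ := fun y => ∑ i, pd i v y ^ 2 with hD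
  have hDc : Continuous D := continuous_finsetSum _ fun i _ => (hv.pd i).continuous.pow 2
  have hDi : Integrable D := integrable_finsetSum _ fun i _ => (hv.pd i).integrable_sq
  have hcf : Continuous (fderiv ℝ v) := hv.fderiv_contDiff.continuous
  have hpt : ∀ x, ‖v (x - t) - v x‖ₑ ^ 2
      ≤ ∫⁻ s, ENNReal.ofReal (‖t‖ ^ 2 * D (x - s • t)) ∂ν := by
    intro x
    have hder : ∀ s ∈ Set.uIcc (0 : ℝ) 1, HasDerivAt (fun s : ℝ => v (x - s • t))
        (fderiv ℝ v (x - s • t) (-t)) s := by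
      intro s _
      have h1 : HasDerivAt (fun s : ℝ => x - s • t) (-t) s := by
        simpa using ((hasDerivAt_id s).smul_const t).const_sub x
      exact (hv.differentiableAt _).hasFDerivAt.comp_hasDerivAt s h1
    have hc : Continuous fun s : ℝ => fderiv ℝ v (x - s • t) (-t) := by fun_prop
    have h1 := intervalIntegral.integral_eq_sub_of_hasDerivAt hder (hc.intervalIntegrable 0 1)
    simp only [one_smul, zero_smul, sub_zero] at h1
    rw [intervalIntegral.integral_of_le zero_le_one] at h1
    calc ‖v (x - t) - v x‖ₑ ^ 2 ≤ (∫⁻ s, ‖fderiv ℝ v (x - s • t) (-t)‖ₑ ∂ν) ^ 2 := by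
          rw [← h1]
          gcongr
          exact enorm_integral_le_lintegral_enorm _
      _ ≤ ∫⁻ s, ‖fderiv ℝ v (x - s • t) (-t)‖ₑ ^ 2 ∂ν :=
          sq_lintegral_le hc.measurable.enorm.aemeasurable
      _ ≤ _ := by
          refine lintegral_mono fun s => ?_
          rw [Real.enorm_eq_ofReal_abs, ← ENNReal.ofReal_pow (abs_nonneg _)]
          refine ENNReal.ofReal_le_ofReal ?_
          have h2 := (fderiv ℝ v (x - s • t)).le_opNorm (-t)
          rw [norm_neg, Real.norm_eq_abs] at h2
          calc |fderiv ℝ v (x - s • t) (-t)| ^ 2 ≤ (‖fderiv ℝ v (x - s • t)‖ * ‖t‖) ^ 2 := by gcongr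
            _ = ‖t‖ ^ 2 * ‖fderiv ℝ v (x - s • t)‖ ^ 2 := by ring
            _ ≤ _ := by gcongr; exact norm_fderiv_sq_le v _
  have hDm : Measurable fun p : E4 × ℝ => ENNReal.ofReal (‖t‖ ^ 2 * D (p.1 - p.2 • t)) :=
    (Continuous.measurable (by fun_prop)).ennreal_ofReal
  calc ∫⁻ x, ‖v (x - t) - v x‖ₑ ^ 2
      ≤ ∫⁻ x, ∫⁻ s, ENNReal.ofReal (‖t‖ ^ 2 * D (x - s • t)) ∂ν := lintegral_mono hpt
    _ = ∫⁻ s, ∫⁻ x, ENNReal.ofReal (‖t‖ ^ 2 * D (x - s • t)) ∂volume ∂ν :=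
        lintegral_lintegral_swap hDm.aemeasurable
    _ = ∫⁻ _s, ENNReal.ofReal (‖t‖ ^ 2 * ∑ i, ∫ y, pd i v y ^ 2) ∂ν := by
        refine lintegral_congr fun s => ?_
        rw [lintegral_sub_right_eq_self (fun x => ENNReal.ofReal (‖t‖ ^ 2 * D x)),
          ← ofReal_integral_eq_lintegral_ofReal (hDi.const_mul _)
            (Filter.Eventually.of_forall fun y => by positivity), integral_const_mul,
          integral_finsetSum _ fun i _ => (hv.pd i).integrable_sq]
    _ = _ := by simp

/-- The `L²` norm is controlled by a small multiple of the `H¹` norm and finitely many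
functionals. -/
theorem exists_compactness_inequality {K : Set E4} (hK : IsCompact K) {ε : ℝ} (hε : 0 < ε) :
    ∃ (s : Finset E4) (w : E4 → E4 → ℝ) (C : ℝ), (∀ m, Continuous (w m)) ∧
      ∀ v, TestFn K v → ∫ y, v y ^ 2 ≤ ε * ((∫ y, v y ^ 2) + ∑ i, ∫ y, pd i v y ^ 2)
        + C * ∑ m ∈ s, (∫ y, w m y * v y) ^ 2 := by
  -- Mollification at scale r costs at most r² times the Dirichlet integral in squared L² norm; this
  -- enters with a factor 2 below, and 2 r² = ε.
  set r : ℝ := √(ε / 2) with hr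
  have hr0 : 0 < r := Real.sqrt_pos.2 (by positivity)
  have hr2 : 2 * r ^ 2 = ε := by rw [hr, Real.sq_sqrt (by positivity)]; ring
  obtain ⟨k, hk⟩ := exists_isKernel hr0
  set A : ℝ := (volume K).toReal with hA
  have hA0 : 0 ≤ A := ENNReal.toReal_nonneg
  obtain ⟨L, hL⟩ := (hk.test.contDiff_one).lipschitzWith_of_hasCompactSupport hk.test.compact
    (by simp)
  -- Chosen so that (2 A L δ)² ≤ ε, where L is the Lipschitz constant of the kernel and A the volume
  -- of K. The added ones avoid division by zero.
  set δ : ℝ := √ε / (2 * (A + 1) * (L + 1)) with hδ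
  have hδ0 : 0 < δ := by positivity
  obtain ⟨T, hTK, hTf, hT⟩ := hK.finite_cover_balls hδ0
  -- The functionals are the values of the mollification at the points of a finite δ-net of K.
  refine ⟨hTf.toFinset, fun m y => k (m - y), 4 * A, fun m =>
    hk.test.continuous.comp (continuous_const.sub continuous_id), fun v hv => ?_⟩
  set V : E4 → ℝ := moll k v with hV
  have hLI : LocallyIntegrable v := hv.continuous.locallyIntegrable
  have hVc : Continuous V := (moll_contDiff hk.test hLI).continuous
  set N := ∫ y, v y ^ 2 with hN
  set D := ∑ i, ∫ y, pd i v y ^ 2 with hD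
  set P := ∑ m ∈ hTf.toFinset, (∫ y, k (m - y) * v y) ^ 2 with hP
  have hN0 : 0 ≤ N := integral_nonneg fun y => sq_nonneg _
  have hD0 : 0 ≤ D := Finset.sum_nonneg fun i _ => integral_nonneg fun y => sq_nonneg _
  have hVm : ∀ x, V x = ∫ y, k (x - y) * v y := fun x => by
    rw [hV, moll_eq]; simp only [mul_comm]
  have hVT : TestFn (Metric.cthickening r K) V := moll_testFn hk hK hLI fun x hx => hv.eq_zero hx
  -- the mollification is close to `v`
  have h1 : ∫ y, (V y - v y) ^ 2 ≤ r ^ 2 * D := by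
    have hi : Integrable fun y => (V y - v y) ^ 2 :=
      ((hVT.mono (Set.subset_univ _)).sub (hv.mono (Set.subset_univ _))).integrable_sq
    have h2 := lintegral_moll_sub_sq_le hk hLI (B := ENNReal.ofReal (r ^ 2 * D)) fun t ht =>
      (lintegral_translation_le hv t).trans (ENNReal.ofReal_le_ofReal (by
        have := mem_closedBall_zero_iff.1 ht
        gcongr))
    rw [lintegral_enorm_sq hi] at h2
    exact (ENNReal.ofReal_le_ofReal_iff (by positivity)).1 h2
  -- `L¹` bound
  have hL1 : (∫ y, |v y|) ^ 2 ≤ A * N := by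
    have e : ∫ y, |v y| = ∫ y in K, |v y| :=
      (setIntegral_eq_integral_of_forall_compl_eq_zero fun y hy => by simp [hv.eq_zero hy]).symm
    have e2 : N = ∫ y in K, v y ^ 2 :=
      (setIntegral_eq_integral_of_forall_compl_eq_zero fun y hy => by simp [hv.eq_zero hy]).symm
    have : IsFiniteMeasure (volume.restrict K) := ⟨by simpa using hK.measure_lt_top⟩
    have hm1 : MemLp (fun _ : E4 => (1 : ℝ)) (ENNReal.ofReal 2) (volume.restrict K) := memLp_const _
    have hm2 : MemLp (fun y => |v y|) (ENNReal.ofReal 2) (volume.restrict K) :=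
      ((hv.memLp _).restrict K).norm
    have := integral_mul_le_Lp_mul_Lq_of_nonneg (μ := volume.restrict K)
      Real.HolderConjugate.two_two
      (Filter.Eventually.of_forall fun _ => zero_le_one)
      (Filter.Eventually.of_forall fun y => abs_nonneg (v y)) hm1 hm2
    simp only [one_mul, Real.rpow_ofNat, one_pow, sq_abs, integral_const, smul_eq_mul, mul_one,
      ← Real.sqrt_eq_rpow, measureReal_restrict_apply_univ] at this
    rw [e]
    calc (∫ y in K, |v y|) ^ 2 ≤ (√(volume.real K) * √(∫ y in K, v y ^ 2)) ^ 2 := by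
          gcongr
      _ = A * N := by
          rw [mul_pow, Real.sq_sqrt measureReal_nonneg, Real.sq_sqrt
            (integral_nonneg fun y => sq_nonneg _), e2]; rfl
  -- The mollification inherits the Lipschitz constant of the kernel, multiplied by the L¹ norm of
  -- v, so its values on K are controlled by those on the net.
  have hLip : ∀ x z, dist x z ≤ δ → |V x - V z| ≤ L * δ * ∫ y, |v y| := by
    intro x z hxz
    have hi : ∀ x, Integrable fun y => k (x - y) * v y := fun x => by
      refine Continuous.integrable_of_hasCompactSupport ?_ (hv.compact.mul_left)
      exact (hk.test.continuous.comp (continuous_const.sub continuous_id)).mul hv.continuous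
    rw [hVm, hVm, ← integral_sub (hi x) (hi z), ← integral_const_mul]
    refine (abs_integral_le_integral_abs).trans (integral_mono ((hi x).sub (hi z)).abs
      (hv.integrable.abs.const_mul _) fun y => ?_)
    simp only [Pi.sub_apply]
    rw [← sub_mul, abs_mul]
    have := hL.dist_le_mul (x - y) (z - y)
    rw [Real.dist_eq, dist_sub_right] at this
    have h2 : (L : ℝ) * dist x z ≤ L * δ := by gcongr
    have := this.trans h2
    gcongr
  have hVb : ∀ x ∈ K, V x ^ 2 ≤ 2 * P + 2 * ((L * δ) ^ 2 * (A * N)) := by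
    intro x hx
    obtain ⟨m, hm, hxm⟩ := Set.mem_iUnion₂.1 (hT hx)
    have h2 := hLip x m (Metric.mem_ball.1 hxm).le
    have h3 : (V x - V m) ^ 2 ≤ (L * δ) ^ 2 * (A * N) := by
      rw [← sq_abs]
      calc |V x - V m| ^ 2 ≤ (L * δ * ∫ y, |v y|) ^ 2 := by gcongr
        _ = (L * δ) ^ 2 * (∫ y, |v y|) ^ 2 := by ring
        _ ≤ _ := by gcongr
    have h4 : V m ^ 2 ≤ P := by
      rw [hVm]
      exact Finset.single_le_sum (f := fun m => (∫ y, k (m - y) * v y) ^ 2)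
        (fun _ _ => sq_nonneg _) (hTf.mem_toFinset.2 hm)
    nlinarith [sq_nonneg (V x - 2 * V m)]
  have h5 : ∫ y in K, V y ^ 2 ≤ A * (2 * P + 2 * ((L * δ) ^ 2 * (A * N))) := by
    have hfin : volume K ≠ ⊤ := hK.measure_lt_top.ne
    calc ∫ y in K, V y ^ 2 ≤ ∫ _y in K, (2 * P + 2 * ((L * δ) ^ 2 * (A * N))) :=
          setIntegral_mono_on hVT.integrable_sq.integrableOn
            (integrableOn_const hfin) hK.measurableSet hVb
      _ = _ := by simp [hA, Measure.real]
  have h6 : N ≤ 2 * (∫ y, (V y - v y) ^ 2) + 2 * ∫ y in K, V y ^ 2 := by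
    have hi : Integrable fun y => (V y - v y) ^ 2 :=
      ((hVT.mono (Set.subset_univ _)).sub (hv.mono (Set.subset_univ _))).integrable_sq
    have e2 : N = ∫ y in K, v y ^ 2 :=
      (setIntegral_eq_integral_of_forall_compl_eq_zero fun y hy => by simp [hv.eq_zero hy]).symm
    have h7 : ∫ y in K, (V y - v y) ^ 2 ≤ ∫ y, (V y - v y) ^ 2 :=
      setIntegral_le_integral hi (Filter.Eventually.of_forall fun y => sq_nonneg _)
    have h8 : N ≤ ∫ y in K, (2 * (V y - v y) ^ 2 + 2 * V y ^ 2) := by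
      rw [e2]
      refine integral_mono hv.integrable_sq.integrableOn
        ((hi.integrableOn.const_mul 2).add (hVT.integrable_sq.integrableOn.const_mul 2))
        fun y => ?_
      nlinarith [sq_nonneg (v y - 2 * V y)]
    rw [integral_add (hi.integrableOn.const_mul 2) (hVT.integrable_sq.integrableOn.const_mul 2),
      integral_const_mul, integral_const_mul] at h8
    linarith
  have h9 : 4 * A * ((L * δ) ^ 2 * A) ≤ ε := by
    have e : L * δ * A * 2 ≤ √ε := by
      have hL0 : (0 : ℝ) ≤ L := L.2
      rw [hδ]
      rw [show (L : ℝ) * (√ε / (2 * (A + 1) * (L + 1))) * A * 2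
        = √ε * ((L * A) / ((A + 1) * (L + 1))) by field_simp]
      refine mul_le_of_le_one_right (Real.sqrt_nonneg _) ((div_le_one (by positivity)).2 ?_)
      nlinarith
    have h10 : (L * δ * A * 2) ^ 2 ≤ (√ε) ^ 2 := by
      have : (0 : ℝ) ≤ L := L.2
      gcongr
    rw [Real.sq_sqrt hε.le] at h10
    linarith
  have h10 : 4 * A * ((L * δ) ^ 2 * A) * N ≤ ε * N := by gcongr
  nlinarith

end Compactness

/-! ### Weak derivatives -/

section Weak

open scoped ENNReal

variable {Ω : Set E4} {f f' g g' : E4 → ℝ} {i : Fin 4}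

lemma LocL2.add (hf : LocL2 Ω f) (hg : LocL2 Ω g) : LocL2 Ω (fun y => f y + g y) :=
  fun C hC hc => (hf C hC hc).add (hg C hC hc)

lemma LocL2.const_mul (hf : LocL2 Ω f) (c : ℝ) : LocL2 Ω (fun y => c * f y) :=
  fun C hC hc => (hf C hC hc).const_mul c

lemma LocL2.integrableOn (hf : LocL2 Ω f) {C : Set E4} (hC : C ⊆ Ω) (hc : IsCompact C) :
    IntegrableOn f C := by
  have : IsFiniteMeasure (volume.restrict C) := ⟨by simpa using hc.measure_lt_top⟩
  exact (hf C hC hc).integrable (by norm_num)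

lemma LocL2.memLp_mul (hf : LocL2 Ω f) {K : Set E4} {η : E4 → ℝ} (hη : TestFn K η)
    (hK : IsCompact K) (hKΩ : K ⊆ Ω) : MemLp (fun y => η y * f y) 2 := by
  obtain ⟨b, hb⟩ := hη.compact.exists_bound_of_continuous hη.continuous
  have h1 : MemLp (K.indicator f) 2 := (memLp_indicator_iff_restrict hK.measurableSet).2 (hf K hKΩ hK)
  have e : (fun y => η y * f y) = fun y => η y * K.indicator f y := by
    funext y
    by_cases hy : y ∈ K
    · simp [hy]
    · simp [hy, hη.eq_zero hy]
  rw [e]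
  refine h1.of_le_mul (c := b) (hη.continuous.aestronglyMeasurable.mul h1.1)
    (Filter.Eventually.of_forall fun y => ?_)
  rw [norm_mul]
  exact mul_le_mul_of_nonneg_right (hb y) (norm_nonneg _)

lemma LocL2.integrable_mul (hf : LocL2 Ω f) {K : Set E4} {η : E4 → ℝ} (hη : TestFn K η)
    (hK : IsCompact K) (hKΩ : K ⊆ Ω) : Integrable (fun y => η y * f y) := by
  have h1 := (hf.memLp_mul hη hK hKΩ).locallyIntegrable (by norm_num)
  have h2 := h1.integrableOn_isCompact hK
  rwa [integrableOn_iff_integrable_of_support_subset] at h2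
  intro y hy
  by_contra h
  exact hy (by simp [hη.eq_zero h])

lemma MemLp.locL2 (hf : MemLp f 2) : LocL2 Ω f := fun _ _ _ => hf.restrict _

lemma HasWeakPartial.add (hf : HasWeakPartial Ω i f f') (hg : HasWeakPartial Ω i g g') :
    HasWeakPartial Ω i (fun y => f y + g y) (fun y => f' y + g' y) := by
  refine ⟨hf.1.add hg.1, hf.2.1.add hg.2.1, fun φ hφ hc hs => ?_⟩
  have hT : TestFn (tsupport φ) φ := ⟨hφ, hc, subset_rfl⟩
  have I1 : ∀ {f}, LocL2 Ω f → Integrable fun y => f y * φ y := fun h => by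
    simpa only [mul_comm] using h.integrable_mul hT hc hs
  have I2 : ∀ {f}, LocL2 Ω f → Integrable fun y => f y * fderiv ℝ φ y (stdVec i) := fun h => by
    simpa only [mul_comm, pd] using h.integrable_mul (hT.pd i) hc hs
  simp only [add_mul]
  rw [integral_add (I2 hf.1) (I2 hg.1), integral_add (I1 hf.2.1) (I1 hg.2.1), hf.2.2 φ hφ hc hs,
    hg.2.2 φ hφ hc hs]
  ring

/-- Leibniz rule, obtained by testing with ηφ. After the cutoff the weak derivative lives on the
whole space, where mollification is available. -/
lemma HasWeakPartial.mul_testFn (hf : HasWeakPartial Ω i f f') {K : Set E4} {η : E4 → ℝ}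
    (hη : TestFn K η) (hK : IsCompact K) (hKΩ : K ⊆ Ω) :
    HasWeakPartial Set.univ i (fun y => η y * f y) (fun y => pd i η y * f y + η y * f' y) := by
  refine ⟨MemLp.locL2 (hf.1.memLp_mul hη hK hKΩ),
    MemLp.locL2 ((hf.1.memLp_mul (hη.pd i) hK hKΩ).add (hf.2.1.memLp_mul hη hK hKΩ)),
    fun φ hφ hc _ => ?_⟩
  have hT : TestFn (tsupport φ) φ := ⟨hφ, hc, subset_rfl⟩
  have hp : TestFn K fun y => η y * φ y := hη.mul_right hφ
  have h1 := hf.2.2 _ hp.smooth hp.compact (hp.supp.trans hKΩ)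
  have e1 : ∀ y, f y * fderiv ℝ (fun y => η y * φ y) y (stdVec i)
      = (pd i η y * φ y) * f y + (η y * pd i φ y) * f y := by
    intro y
    have := pd_mul (hη.differentiableAt y) (hT.differentiableAt y) i
    rw [pd] at this
    rw [this]; ring
  have J1 := hf.1.integrable_mul ((hη.pd i).mul_right hφ) hK hKΩ
  have J2 := hf.1.integrable_mul (hη.mul_right (pd_contDiff hφ i)) hK hKΩ
  have J3 := hf.2.1.integrable_mul (hη.mul_right hφ) hK hKΩ
  simp only [e1] at h1
  rw [integral_add J1 J2] at h1
  have e2 : ∀ y, (pd i η y * f y + η y * f' y) * φ y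
      = (pd i η y * φ y) * f y + (η y * φ y) * f' y := fun y => by ring
  have e3 : ∀ y, η y * f y * fderiv ℝ φ y (stdVec i) = (η y * pd i φ y) * f y := fun y => by
    rw [pd]; ring
  have e4 : ∀ y, f' y * (η y * φ y) = (η y * φ y) * f' y := fun y => by ring
  simp only [e4] at h1
  simp only [e2, e3]
  rw [integral_add J1 J3]
  linarith

lemma LocL2.locallyIntegrableOn (hΩ : IsOpen Ω) (hf : LocL2 Ω f) : LocallyIntegrableOn f Ω := by
  rw [locallyIntegrableOn_iff hΩ.isLocallyClosed]
  exact fun C hC hc => hf.integrableOn hC hc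

lemma HasWeakPartial.ae_unique (hΩ : IsOpen Ω) (h : HasWeakPartial Ω i f f')
    (h' : HasWeakPartial Ω i f g') : ∀ᵐ y, y ∈ Ω → f' y = g' y := by
  have hl : LocL2 Ω (fun y => f' y + (-1) * g' y) := h.2.1.add (h'.2.1.const_mul (-1))
  have := hΩ.ae_eq_zero_of_integral_contDiff_smul_eq_zero (μ := volume) (hl.locallyIntegrableOn hΩ) ?_
  · filter_upwards [this] with y hy hyΩ
    linarith [hy hyΩ]
  · intro φ hφ hc hs
    have hT : TestFn (tsupport φ) φ := ⟨hφ, hc, subset_rfl⟩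
    have e : ∀ y, φ y • (f' y + (-1) * g' y) = φ y * f' y - φ y * g' y := fun y => by
      simp only [smul_eq_mul]; ring
    simp only [e]
    rw [integral_sub (h.2.1.integrable_mul hT hc hs) (h'.2.1.integrable_mul hT hc hs)]
    have h1 := h.2.2 φ hφ hc hs
    rw [h'.2.2 φ hφ hc hs] at h1
    simp only [mul_comm (φ _)]
    linarith

/-- Localized `H²` functions are limits of test functions. -/
theorem exists_testFn_approx (hΩ : IsOpen Ω) {u : E4 → ℝ} {f : Fin 4 → E4 → ℝ}
    {h : Fin 4 → Fin 4 → E4 → ℝ} (hf : ∀ i, HasWeakPartial Ω i u (f i))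
    (hh : ∀ i j, HasWeakPartial Ω j (f i) (h i j)) {K : Set E4} {η : E4 → ℝ} (hη : TestFn K η)
    (hK : IsCompact K) (hKΩ : K ⊆ Ω) :
    ∃ (K' : Set E4) (ψ : ℕ → E4 → ℝ) (F : Fin 4 → E4 → ℝ) (H : Fin 4 → Fin 4 → E4 → ℝ),
      IsCompact K' ∧ K' ⊆ Ω ∧ (∀ n, TestFn K' (ψ n)) ∧ (∀ i, MemLp (F i) 2) ∧
      (∀ i j, MemLp (H i j) 2) ∧
      Filter.Tendsto (fun n => eLpNorm (fun y => ψ n y - η y * u y) 2 volume) Filter.atTop (𝓝 0) ∧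
      (∀ i, Filter.Tendsto (fun n => eLpNorm (fun y => pd i (ψ n) y - F i y) 2 volume)
        Filter.atTop (𝓝 0)) ∧
      ∀ i j, Filter.Tendsto (fun n => eLpNorm (fun y => pd j (pd i (ψ n)) y - H i j y) 2 volume)
        Filter.atTop (𝓝 0) := by
  obtain ⟨δ, hδ, hδΩ⟩ := hK.exists_cthickening_subset_open hΩ hKΩ
  -- The radii stay below δ, so all mollifications are supported in one compact thickening of K
  -- inside Ω.
  set r : ℕ → ℝ := fun n => δ / (n + 1) with hr
  have hr0 : ∀ n, 0 < r n := fun n => by positivity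
  have hrδ : ∀ n, r n ≤ δ := fun n => div_le_self hδ.le (by simp)
  have hrt : Filter.Tendsto r Filter.atTop (𝓝 0) :=
    tendsto_const_div_atTop_nhds_zero_nat δ |>.comp (Filter.tendsto_add_atTop_nat 1) |>.congr
      fun n => by simp [hr]
  choose k hk using fun n => exists_isKernel (hr0 n)
  set G : E4 → ℝ := fun y => η y * u y with hG
  -- The first and second weak derivatives of η u, by the Leibniz rule.
  set F : Fin 4 → E4 → ℝ := fun i y => pd i η y * u y + η y * f i y with hF
  set H : Fin 4 → Fin 4 → E4 → ℝ := fun i j y => (pd j (pd i η) y * u y + pd i η y * f j y)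
    + (pd j η y * f i y + η y * h i j y) with hH
  have w1 : ∀ i, HasWeakPartial Set.univ i G (F i) := fun i => (hf i).mul_testFn hη hK hKΩ
  have w2 : ∀ i j, HasWeakPartial Set.univ j (F i) (H i j) := fun i j =>
    ((hf j).mul_testFn (hη.pd i) hK hKΩ).add ((hh i j).mul_testFn hη hK hKΩ)
  have hu : LocL2 Ω u := (hf 0).1
  have m0 : MemLp G 2 := hu.memLp_mul hη hK hKΩ
  have m1 : ∀ i, MemLp (F i) 2 := fun i => (hu.memLp_mul (hη.pd i) hK hKΩ).add
    ((hf i).2.1.memLp_mul hη hK hKΩ)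
  have m2 : ∀ i j, MemLp (H i j) 2 := fun i j => ((hu.memLp_mul ((hη.pd i).pd j) hK hKΩ).add
    ((hf j).2.1.memLp_mul (hη.pd i) hK hKΩ)).add (((hf i).2.1.memLp_mul (hη.pd j) hK hKΩ).add
    ((hh i j).2.1.memLp_mul hη hK hKΩ))
  have l0 := m0.locallyIntegrable (by norm_num)
  have l1 := fun i => (m1 i).locallyIntegrable (by norm_num)
  refine ⟨Metric.cthickening δ K, fun n => moll (k n) G, F, H, hK.cthickening, hδΩ, fun n => ?_,
    m1, m2, tendsto_moll m0 hrt hk, fun i => ?_, fun i j => ?_⟩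
  · exact (moll_testFn (hk n) hK l0 fun x hx => by simp [hG, hη.eq_zero hx]).mono
      (Metric.cthickening_mono (hrδ n) _)
  · simp only [(w1 i).moll_pd (hk _).test l0]
    exact tendsto_moll (m1 i) hrt hk
  · simp only [(w1 i).moll_pd (hk _).test l0, (w2 i j).moll_pd (hk _).test (l1 i)]
    exact tendsto_moll (m2 i j) hrt hk

end Weak

/-! ### Charts and coordinate changes -/

section Charts

variable {M : Type*} [TopologicalSpace M] [ChartedSpace E4 M]

/-- The domain of the chart at `p`. -/
noncomputable abbrev src (p : M) : Set M := (extChartAt (𝓡 4) p).source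

/-- The image of the chart at `p`. -/
noncomputable abbrev dom (p : M) : Set E4 := (extChartAt (𝓡 4) p).target

/-- The function `f` read in the chart at `p`. -/
noncomputable abbrev loc {α : Type*} (p : M) (f : M → α) : E4 → α := f ∘ (extChartAt (𝓡 4) p).symm

/-- The coordinate change from the chart at `p` to the chart at `q`. -/
noncomputable def trans (p q : M) : E4 → E4 := extChartAt (𝓡 4) q ∘ (extChartAt (𝓡 4) p).symm

/-- The domain of the coordinate change from the chart at `p` to the chart at `q`. -/
noncomputable def overlap (p q : M) : Set E4 := dom p ∩ (extChartAt (𝓡 4) p).symm ⁻¹' src q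

lemma isOpen_src (p : M) : IsOpen (src p) := isOpen_extChartAt_source p

lemma isOpen_dom (p : M) : IsOpen (dom p) := isOpen_extChartAt_target p

lemma mem_src (p : M) : p ∈ src p := mem_extChartAt_source p

lemma chart_mem_dom {p x : M} (hx : x ∈ src p) : extChartAt (𝓡 4) p x ∈ dom p :=
  (extChartAt (𝓡 4) p).map_source hx

lemma symm_mem_src {p : M} {y : E4} (hy : y ∈ dom p) : (extChartAt (𝓡 4) p).symm y ∈ src p :=
  (extChartAt (𝓡 4) p).map_target hy

lemma chart_symm {p : M} {y : E4} (hy : y ∈ dom p) :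
    extChartAt (𝓡 4) p ((extChartAt (𝓡 4) p).symm y) = y :=
  (extChartAt (𝓡 4) p).right_inv hy

lemma symm_chart {p x : M} (hx : x ∈ src p) :
    (extChartAt (𝓡 4) p).symm (extChartAt (𝓡 4) p x) = x :=
  (extChartAt (𝓡 4) p).left_inv hx

lemma isOpen_overlap (p q : M) : IsOpen (overlap p q) :=
  (continuousOn_extChartAt_symm p).isOpen_inter_preimage (isOpen_dom p) (isOpen_src q)

lemma overlap_subset (p q : M) : overlap p q ⊆ dom p := Set.inter_subset_left

lemma chart_mem_overlap {p q x : M} (hp : x ∈ src p) (hq : x ∈ src q) :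
    extChartAt (𝓡 4) p x ∈ overlap p q :=
  ⟨chart_mem_dom hp, by rw [Set.mem_preimage, symm_chart hp]; exact hq⟩

lemma trans_chart {p q x : M} (hp : x ∈ src p) :
    trans p q (extChartAt (𝓡 4) p x) = extChartAt (𝓡 4) q x := by
  simp only [trans, Function.comp_apply, symm_chart hp]

lemma mapsTo_trans (p q : M) : Set.MapsTo (trans p q) (overlap p q) (overlap q p) := by
  intro y hy
  exact chart_mem_overlap hy.2 (symm_mem_src hy.1)

lemma symm_trans {p q : M} {y : E4} (hy : y ∈ overlap p q) :
    (extChartAt (𝓡 4) q).symm (trans p q y) = (extChartAt (𝓡 4) p).symm y :=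
  symm_chart hy.2

lemma trans_trans {p q : M} {y : E4} (hy : y ∈ overlap p q) : trans q p (trans p q y) = y := by
  rw [trans, Function.comp_apply, symm_trans hy, chart_symm hy.1]

lemma loc_eq_comp_trans {α : Type*} (f : M → α) {p q : M} {y : E4} (hy : y ∈ overlap p q) :
    loc p f y = loc q f (trans p q y) := by
  simp only [loc, Function.comp_apply, symm_trans hy]

variable [IsManifold (𝓡 4) ∞ M]

lemma contDiffOn_trans (p q : M) : ContDiffOn ℝ ∞ (trans p q) (overlap p q) := by
  have h := contDiffOn_ext_coord_change (I := 𝓡 4) (n := ∞) q p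
  rw [PartialEquiv.trans_source] at h
  exact h

/-- The criterion by which all geometric quantities are shown to be smooth: a formula valid
throughout one fixed chart is enough. -/
lemma contMDiff_iff_loc {f : M → ℝ} :
    ContMDiff (𝓡 4) 𝓘(ℝ, ℝ) ∞ f ↔ ∀ p : M, ContDiffOn ℝ ∞ (loc p f) (dom p) := by
  constructor
  · intro h p
    exact (h.comp_contMDiffOn (contMDiffOn_extChartAt_symm p)).contDiffOn
  · intro h x
    have h1 : ContMDiffAt 𝓘(ℝ, E4) 𝓘(ℝ, ℝ) ∞ (loc x f) (extChartAt (𝓡 4) x x) :=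
      ((h x).contDiffAt ((isOpen_dom x).mem_nhds (chart_mem_dom (mem_src x)))).contMDiffAt
    have h2 := h1.comp x (contMDiffAt_extChartAt (I := 𝓡 4) (n := ∞))
    refine h2.congr_of_eventuallyEq ?_
    filter_upwards [(isOpen_src x).mem_nhds (mem_src x)] with z hz
    simp only [Function.comp_apply, symm_chart hz]

/-- Links the transition maps of the tangent bundle, through which `coordVec` and `coordComp` are
defined, to partial derivatives of coordinate changes. -/
lemma jac_mulVec (p q : M) {x : M} (hp : x ∈ src p) (hq : x ∈ src q) (v : E4) (a : Fin 4) :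
    tangentCoordChange (𝓡 4) p q x v a
      = ∑ i, jac (trans p q) (extChartAt (𝓡 4) p x) a i * v i := by
  have h1 : HasFDerivAt (trans p q) (tangentCoordChange (𝓡 4) p q x) (extChartAt (𝓡 4) p x) := by
    have := hasFDerivWithinAt_tangentCoordChange (I := 𝓡 4) (x := p) (y := q) (z := x) ⟨hp, hq⟩
    rwa [ModelWithCorners.range_eq_univ, hasFDerivWithinAt_univ] at this
  have h2 : HasFDerivAt (fun z => trans p q z a)
      ((EuclideanSpace.proj a : E4 →L[ℝ] ℝ).comp (tangentCoordChange (𝓡 4) p q x))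
      (extChartAt (𝓡 4) p x) := (EuclideanSpace.proj a : E4 →L[ℝ] ℝ).hasFDerivAt.comp _ h1
  have h3 := fderiv_eq_sum_pd (fun z => trans p q z a) (extChartAt (𝓡 4) p x) v
  rw [h2.fderiv] at h3
  simp only [ContinuousLinearMap.comp_apply, EuclideanSpace.coe_proj] at h3
  rw [h3]
  exact Finset.sum_congr rfl fun i _ => mul_comm _ _

lemma coordVec_eq {p x : M} (hx : x ∈ src p) (i : Fin 4) :
    coordVec p i x = tangentCoordChange (𝓡 4) p x x (stdVec i) := by
  unfold coordVec
  rw [TangentBundle.symmL_trivializationAt_eq_core (by rwa [← extChartAt_source (𝓡 4)])]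
  rfl

lemma coordComp_eq {p x : M} (hx : x ∈ src p) (i : Fin 4) (v : TangentSpace (𝓡 4) x) :
    coordComp p i x v = (tangentCoordChange (𝓡 4) x p x v : E4) i := by
  unfold coordComp
  rw [TangentBundle.continuousLinearMapAt_trivializationAt_eq_core (by rwa [← extChartAt_source (𝓡 4)])]
  rfl

lemma coordComp_add (p : M) (i : Fin 4) (x : M) (v w : TangentSpace (𝓡 4) x) :
    coordComp p i x (v + w) = coordComp p i x v + coordComp p i x w := by
  simp [coordComp]

lemma coordComp_smul (p : M) (i : Fin 4) (x : M) (c : ℝ) (v : TangentSpace (𝓡 4) x) :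
    coordComp p i x (c • v) = c * coordComp p i x v := by
  simp [coordComp]

lemma coordComp_sum {ι : Type*} (s : Finset ι) (p : M) (i : Fin 4) (x : M)
    (v : ι → TangentSpace (𝓡 4) x) :
    coordComp p i x (∑ a ∈ s, v a) = ∑ a ∈ s, coordComp p i x (v a) := by
  simp [coordComp]

lemma coordComp_coordVec {p q x : M} (hp : x ∈ src p) (hq : x ∈ src q) (a i : Fin 4) :
    coordComp q a x (coordVec p i x) = jac (trans p q) (extChartAt (𝓡 4) p x) a i := by
  rw [coordComp_eq hq, coordVec_eq hp, tangentCoordChange_comp ⟨⟨hp, mem_src x⟩, hq⟩,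
    jac_mulVec p q hp hq]
  simp [stdVec]

lemma coordComp_coordVec_self {p x : M} (hp : x ∈ src p) (a i : Fin 4) :
    coordComp p a x (coordVec p i x) = if a = i then 1 else 0 := by
  rw [coordComp_eq hp, coordVec_eq hp, tangentCoordChange_comp ⟨⟨hp, mem_src x⟩, hp⟩,
    tangentCoordChange_self hp]
  simp [stdVec]

lemma sum_coordComp_smul {p x : M} (hp : x ∈ src p) (v : TangentSpace (𝓡 4) x) :
    ∑ i, coordComp p i x v • coordVec p i x = v := by
  have h1 : ∀ i, coordComp p i x v • coordVec p i x = tangentCoordChange (𝓡 4) p x x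
      (((tangentCoordChange (𝓡 4) x p x v : E4) i) • stdVec i) := by
    intro i
    rw [map_smul, coordVec_eq hp, coordComp_eq hp]
    rfl
  have h2 : ∀ w : E4, ∑ i, tangentCoordChange (𝓡 4) p x x
      (((tangentCoordChange (𝓡 4) x p x w : E4) i) • stdVec i) = w := by
    intro w
    rw [← map_sum, ← eq_sum_stdVec,
      tangentCoordChange_comp ⟨⟨mem_src x, hp⟩, mem_src x⟩, tangentCoordChange_self (mem_src x)]
  exact (Finset.sum_congr rfl fun i _ => h1 i).trans (h2 v)

lemma coordVec_change {p q x : M} (hp : x ∈ src p) (hq : x ∈ src q) (i : Fin 4) :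
    coordVec p i x = ∑ a, jac (trans p q) (extChartAt (𝓡 4) p x) a i • coordVec q a x := by
  rw [← sum_coordComp_smul hq (coordVec p i x)]
  exact Finset.sum_congr rfl fun a _ => by rw [coordComp_coordVec hp hq]

lemma coordComp_change {p q x : M} (hp : x ∈ src p) (hq : x ∈ src q) (a : Fin 4)
    (v : TangentSpace (𝓡 4) x) :
    coordComp q a x v = ∑ i, jac (trans p q) (extChartAt (𝓡 4) p x) a i * coordComp p i x v := by
  conv_lhs => rw [← sum_coordComp_smul hp v]
  rw [coordComp_sum]
  exact Finset.sum_congr rfl fun i _ => by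
    rw [coordComp_smul, coordComp_coordVec hp hq, mul_comm]

lemma jac_mul_jac {p q x : M} (hp : x ∈ src p) (hq : x ∈ src q) :
    jac (trans q p) (extChartAt (𝓡 4) q x) * jac (trans p q) (extChartAt (𝓡 4) p x) = 1 := by
  ext a i
  rw [Matrix.mul_apply, Matrix.one_apply, ← coordComp_coordVec_self hp a i,
    coordComp_change hq hp]
  exact Finset.sum_congr rfl fun b _ => by rw [coordComp_coordVec hp hq]

lemma jac_det_ne {p q : M} {y : E4} (hy : y ∈ overlap p q) : (jac (trans p q) y).det ≠ 0 := by
  have h := jac_mul_jac (symm_mem_src hy.1) hy.2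
  rw [chart_symm hy.1] at h
  intro h0
  have := congrArg Matrix.det h
  rw [Matrix.det_mul, h0] at this
  simp at this

lemma pderiv_eq_pd (p : M) (i : Fin 4) (f : M → ℝ) (x : M) :
    pderiv p i f x = pd i (loc p f) (extChartAt (𝓡 4) p x) := rfl

lemma pderiv_symm (p : M) (i : Fin 4) (f : M → ℝ) {y : E4} (hy : y ∈ dom p) :
    pderiv p i f ((extChartAt (𝓡 4) p).symm y) = pd i (loc p f) y := by
  rw [pderiv_eq_pd, chart_symm hy]

lemma pderiv_change {p q x : M} (hp : x ∈ src p) (hq : x ∈ src q) {f : M → ℝ}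
    (hf : DifferentiableAt ℝ (loc q f) (extChartAt (𝓡 4) q x)) (i : Fin 4) :
    pderiv p i f x
      = ∑ a, jac (trans p q) (extChartAt (𝓡 4) p x) a i * pderiv q a f x := by
  have hy := chart_mem_overlap hp hq
  rw [pderiv_eq_pd, pd_congr_of_eqOn (isOpen_overlap p q)
    (fun z hz => loc_eq_comp_trans f hz) hy i]
  rw [pd_comp (by rw [trans_chart hp]; exact hf)
    (differentiableAt_of_contDiffOn (isOpen_overlap p q) (contDiffOn_trans p q) hy), trans_chart hp]
  rfl

end Charts

/-! ### The metric and the Ricci tensor in charts -/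

section MetricInCharts

variable {M : Type*} [TopologicalSpace M] [ChartedSpace E4 M] [IsManifold (𝓡 4) ∞ M]
  (g : Metric M)

/-- The coordinate field is the image of a constant section under the inverse of a smooth
trivialization. -/
lemma contMDiffOn_coordVec (p : M) (i : Fin 4) :
    ContMDiffOn (𝓡 4) ((𝓡 4).prod 𝓘(ℝ, E4)) ∞
      (fun x => Bundle.TotalSpace.mk' E4 x (coordVec p i x)) (src p) := by
  have h := (trivializationAt E4 (TangentSpace (𝓡 4) : M → Type _) p).contMDiffOn_symmL
    (𝕜 := ℝ) (n := ∞) (IB := 𝓡 4)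
  have h2 := h.clm_bundle_apply (v := fun _ => stdVec i) (b := fun x => x) (F₂ := E4)
    (E₁ := Bundle.Trivial M E4) (E₂ := (TangentSpace (𝓡 4) : M → Type _)) (F₁ := E4)
    (fun x hx => by
      simp only [Bundle.contMDiffWithinAt_totalSpace]
      exact ⟨contMDiffWithinAt_id, by simpa using contMDiffWithinAt_const⟩)
  rw [TangentBundle.trivializationAt_baseSet, ← extChartAt_source (𝓡 4)] at h2
  exact h2

lemma contDiffOn_loc_gram (p : M) (i j : Fin 4) :
    ContDiffOn ℝ ∞ (loc p fun x => gram g p x i j) (dom p) := by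
  have h1 : ContMDiffOn (𝓡 4) ((𝓡 4).prod 𝓘(ℝ, ℝ)) ∞ (fun x => Bundle.TotalSpace.mk' ℝ
      (E := Bundle.Trivial M ℝ) x (g.inner x (coordVec p i x) (coordVec p j x))) (src p) := by
    apply ContMDiffOn.clm_bundle_apply₂ (F₁ := E4) (F₂ := E4)
    · exact g.contMDiff.contMDiffOn
    · exact contMDiffOn_coordVec p i
    · exact contMDiffOn_coordVec p j
  have h2 : ContMDiffOn (𝓡 4) 𝓘(ℝ, ℝ) ∞ (fun x => gram g p x i j) (src p) := by
    intro x hx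
    have := h1 x hx
    rw [Bundle.contMDiffWithinAt_totalSpace] at this
    exact this.2
  exact (h2.comp (contMDiffOn_extChartAt_symm p) fun y hy => symm_mem_src hy).contDiffOn

lemma inner_eq_sum {p x : M} (hx : x ∈ src p) (v w : TangentSpace (𝓡 4) x) :
    g.inner x v w = ∑ i, ∑ j, gram g p x i j * coordComp p i x v * coordComp p j x w := by
  conv_lhs => rw [← sum_coordComp_smul hx v, ← sum_coordComp_smul hx w]
  simp only [map_sum, map_smul, _root_.sum_apply, _root_.smul_apply, smul_eq_mul,
    Finset.mul_sum]
  refine Finset.sum_comm.trans (Finset.sum_congr rfl fun i _ => Finset.sum_congr rfl fun j _ => ?_)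
  simp only [gram, Matrix.of_apply]
  ring

lemma gram_symm (p x : M) (i j : Fin 4) : gram g p x i j = gram g p x j i :=
  g.symm x _ _

lemma gram_transpose (p x : M) : (gram g p x).transpose = gram g p x := by
  ext i j; exact gram_symm g p x j i

/-- A nontrivial combination of the coordinate vectors is nonzero, since its components recover the
coefficients. -/
lemma gram_posDef {p x : M} (hx : x ∈ src p) : (gram g p x).PosDef := by
  refine Matrix.PosDef.of_dotProduct_mulVec_pos (by
    ext i j; simpa using gram_symm g p x j i) fun v hv => ?_
  have hne : ∑ i, v i • coordVec p i x ≠ 0 := by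
    intro h0
    refine hv (funext fun a => ?_)
    have := congrArg (coordComp p a x) h0
    rw [coordComp_sum] at this
    simp only [coordComp_smul, coordComp_coordVec_self hx] at this
    simpa [coordComp] using this
  have h := g.pos x _ hne
  simp only [map_sum, map_smul, _root_.sum_apply, _root_.smul_apply, smul_eq_mul] at h
  refine h.trans_eq ?_
  simp only [dotProduct, Matrix.mulVec, Finset.mul_sum, Pi.star_apply, star_trivial]
  refine Finset.sum_comm.trans
    (Finset.sum_congr rfl fun i _ => Finset.sum_congr rfl fun j _ => ?_)
  simp only [gram, Matrix.of_apply]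
  ring

lemma gram_det_pos {p x : M} (hx : x ∈ src p) : 0 < (gram g p x).det := (gram_posDef g hx).det_pos

lemma isGram (p : M) : IsGram (dom p) (loc p (gram g p)) where
  smooth i j := contDiffOn_loc_gram g p i j
  symm y _ i j := gram_symm g p _ i j
  det_ne y hy := (gram_det_pos g (symm_mem_src hy)).ne'

lemma gramInv_mul {p x : M} (hx : x ∈ src p) : gramInv g p x * gram g p x = 1 :=
  Matrix.nonsing_inv_mul _ (isUnit_iff_ne_zero.2 (gram_det_pos g hx).ne')

lemma mul_gramInv {p x : M} (hx : x ∈ src p) : gram g p x * gramInv g p x = 1 :=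
  Matrix.mul_nonsing_inv _ (isUnit_iff_ne_zero.2 (gram_det_pos g hx).ne')

lemma gramInv_symm (p x : M) (i j : Fin 4) : gramInv g p x i j = gramInv g p x j i := by
  have : (gramInv g p x).transpose = gramInv g p x := by
    rw [gramInv, Matrix.transpose_nonsing_inv, gram_transpose]
  exact congrFun (congrFun this.symm i) j

lemma gramInv_posDef {p x : M} (hx : x ∈ src p) : (gramInv g p x).PosDef := (gram_posDef g hx).inv

lemma contDiffOn_loc_gramInv (p : M) (i j : Fin 4) :
    ContDiffOn ℝ ∞ (loc p fun x => gramInv g p x i j) (dom p) :=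
  (isGram g p).inv_smooth i j

lemma density_pos {p x : M} (hx : x ∈ src p) : 0 < density g p x :=
  Real.sqrt_pos.2 (gram_det_pos g hx)

lemma contDiffOn_loc_density (p : M) : ContDiffOn ℝ ∞ (loc p (density g p)) (dom p) :=
  (isGram g p).smooth.det.sqrt fun _ hy => (isGram g p).det_ne _ hy

lemma gram_change {p q x : M} (hp : x ∈ src p) (hq : x ∈ src q) :
    gram g p x = (jac (trans p q) (extChartAt (𝓡 4) p x)).transpose * gram g q x
      * jac (trans p q) (extChartAt (𝓡 4) p x) := by
  ext i j
  rw [Matrix.mul_apply]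
  simp only [Matrix.mul_apply, Matrix.transpose_apply, Finset.sum_mul]
  have h : gram g p x i j = g.inner x (coordVec p i x) (coordVec p j x) := rfl
  rw [h, inner_eq_sum g hq, Finset.sum_comm]
  refine Finset.sum_congr rfl fun a _ => Finset.sum_congr rfl fun b _ => ?_
  rw [coordComp_coordVec hp hq, coordComp_coordVec hp hq]
  ring

lemma density_change {p q x : M} (hp : x ∈ src p) (hq : x ∈ src q) :
    density g p x = |(jac (trans p q) (extChartAt (𝓡 4) p x)).det| * density g q x := by
  rw [density, density, gram_change g hp hq, Matrix.det_mul, Matrix.det_mul, Matrix.det_transpose,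
    show ∀ a b : ℝ, a * b * a = a ^ 2 * b by intros; ring,
    Real.sqrt_mul (sq_nonneg _), Real.sqrt_sq_eq_abs]

lemma loc_christoffel {p : M} (k i j : Fin 4) {y : E4} (hy : y ∈ dom p) :
    loc p (christoffel g p k i j) y = chr (loc p (gram g p)) k i j y := by
  simp only [loc, Function.comp_apply, christoffel, chr, pderiv_symm _ _ _ hy]
  rfl

lemma loc_ricciComp {p : M} (i j : Fin 4) {y : E4} (hy : y ∈ dom p) :
    loc p (ricciComp g p i j) y = ricE (loc p (gram g p)) i j y := by
  have h : ∀ a k i j, pd a (loc p (christoffel g p k i j)) y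
      = pd a (chr (loc p (gram g p)) k i j) y := fun a k i j =>
    pd_congr_of_eqOn (isOpen_dom p) (fun z hz => loc_christoffel g k i j hz) hy a
  have h2 : ∀ k i j, christoffel g p k i j ((extChartAt (𝓡 4) p).symm y)
    = chr (loc p (gram g p)) k i j y := fun k i j => loc_christoffel g k i j hy
  simp only [loc, Function.comp_apply, ricciComp, ricE, pderiv_symm _ _ _ hy, h2]
  simp only [loc] at h
  simp only [h]

lemma contDiffOn_loc_ricciComp (p : M) (i j : Fin 4) :
    ContDiffOn ℝ ∞ (loc p (ricciComp g p i j)) (dom p) :=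
  ((isGram g p).ricE_smooth (isOpen_dom p) i j).congr fun _ hy => loc_ricciComp g i j hy

lemma ricciComp_eq {p x : M} (hx : x ∈ src p) (i j : Fin 4) :
    ricciComp g p i j x = ricE (loc p (gram g p)) i j (extChartAt (𝓡 4) p x) := by
  rw [← loc_ricciComp g i j (chart_mem_dom hx)]
  simp only [loc, Function.comp_apply, symm_chart hx]

lemma ricciComp_symm {p x : M} (hx : x ∈ src p) (i j : Fin 4) :
    ricciComp g p i j x = ricciComp g p j i x := by
  rw [ricciComp_eq g hx, ricciComp_eq g hx,
    (isGram g p).ricE_symm (isOpen_dom p) (chart_mem_dom hx)]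

lemma IsGram.mono {U V : Set E4} {G : E4 → Matrix (Fin 4) (Fin 4) ℝ} (h : IsGram V G)
    (hUV : U ⊆ V) : IsGram U G :=
  ⟨fun i j => (h.smooth i j).mono hUV, fun y hy => h.symm y (hUV hy),
    fun y hy => h.det_ne y (hUV hy)⟩

/-- `ricE_transform` for the coordinate change on the overlap of the two charts. -/
lemma ricciComp_change {p q x : M} (hp : x ∈ src p) (hq : x ∈ src q) (i j : Fin 4) :
    ricciComp g p i j x = ∑ a, ∑ b, jac (trans p q) (extChartAt (𝓡 4) p x) a i
      * jac (trans p q) (extChartAt (𝓡 4) p x) b j * ricciComp g q a b x := by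
  have h := ricE_transform (isOpen_overlap p q) (isOpen_overlap q p)
    ((isGram g p).mono (overlap_subset p q)) ((isGram g q).mono (overlap_subset q p))
    (contDiffOn_trans p q) (mapsTo_trans p q) (fun y hy => jac_det_ne hy) (fun y hy => by
      have := gram_change g (symm_mem_src hy.1) hy.2
      rw [chart_symm hy.1] at this
      rw [loc_eq_comp_trans (gram g p) hy, ← loc_eq_comp_trans (gram g q) hy,
        ← loc_eq_comp_trans (gram g p) hy]
      exact this) (chart_mem_overlap hp hq) i j
  rw [ricciComp_eq g hp, h]
  simp only [ricciComp_eq g hq, trans_chart hp]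

/-- The matrix of the Ricci tensor. -/
noncomputable def ricMat (p x : M) : Matrix (Fin 4) (Fin 4) ℝ :=
  Matrix.of fun i j => ricciComp g p i j x

lemma ricMat_change {p q x : M} (hp : x ∈ src p) (hq : x ∈ src q) :
    ricMat g p x = (jac (trans p q) (extChartAt (𝓡 4) p x)).transpose * ricMat g q x
      * jac (trans p q) (extChartAt (𝓡 4) p x) := by
  ext i j
  simp only [ricMat, Matrix.mul_apply, Matrix.transpose_apply, Matrix.of_apply, Finset.sum_mul]
  rw [ricciComp_change g hp hq, Finset.sum_comm]
  exact Finset.sum_congr rfl fun a _ => Finset.sum_congr rfl fun b _ => by ring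

lemma gramInv_change {p q x : M} (hp : x ∈ src p) (hq : x ∈ src q) :
    jac (trans p q) (extChartAt (𝓡 4) p x) * gramInv g p x
      * (jac (trans p q) (extChartAt (𝓡 4) p x)).transpose = gramInv g q x := by
  have h := gram_change g hp hq
  set A := jac (trans p q) (extChartAt (𝓡 4) p x)
  have hA : A.det ≠ 0 := jac_det_ne (chart_mem_overlap hp hq)
  have hu := isUnit_iff_ne_zero.2 hA
  have hut : IsUnit A.transpose.det := by rwa [Matrix.det_transpose]
  rw [gramInv, h, Matrix.mul_inv_rev, Matrix.mul_inv_rev, ← mul_assoc, Matrix.mul_nonsing_inv _ hu,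
    one_mul, mul_assoc, Matrix.nonsing_inv_mul _ hut, mul_one]
  rfl

/-- Raising one index turns the Ricci tensor into an endomorphism, which changes by conjugation. The
scalar curvature is its trace and |Ric|² the trace of its square, so both are invariant. -/
lemma gramInv_mul_ricMat_change {p q x : M} (hp : x ∈ src p) (hq : x ∈ src q) :
    jac (trans p q) (extChartAt (𝓡 4) p x) * (gramInv g p x * ricMat g p x)
      = gramInv g q x * ricMat g q x * jac (trans p q) (extChartAt (𝓡 4) p x) := by
  rw [ricMat_change g hp hq, ← gramInv_change g hp hq]
  simp only [mul_assoc]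

lemma trace_eq_of_mul_eq {A B B' : Matrix (Fin 4) (Fin 4) ℝ} (hA : A.det ≠ 0)
    (h : A * B = B' * A) : B.trace = B'.trace := by
  have hu := isUnit_iff_ne_zero.2 hA
  have : B = A⁻¹ * (B' * A) := by rw [← h, ← mul_assoc, Matrix.nonsing_inv_mul _ hu, one_mul]
  rw [this, Matrix.trace_mul_comm, mul_assoc, Matrix.mul_nonsing_inv _ hu, mul_one]

/-- The definition uses the chart at x, which varies discontinuously with x. An expression in one
fixed chart is what makes smoothness visible. -/
lemma scalarCurv_eq {p x : M} (hp : x ∈ src p) :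
    scalarCurv g x = ∑ i, ∑ j, gramInv g p x i j * ricciComp g p i j x := by
  have h : ∀ q : M, x ∈ src q → ∑ i, ∑ j, gramInv g q x i j * ricciComp g q i j x
      = (gramInv g q x * ricMat g q x).trace := by
    intro q hq
    simp only [Matrix.trace, Matrix.diag, Matrix.mul_apply, ricMat, Matrix.of_apply]
    exact Finset.sum_congr rfl fun i _ => Finset.sum_congr rfl fun j _ => by
      rw [ricciComp_symm g hq]
  rw [scalarCurv, h x (mem_src x), h p hp]
  exact trace_eq_of_mul_eq (jac_det_ne (chart_mem_overlap (mem_src x) hp))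
    (gramInv_mul_ricMat_change g (mem_src x) hp)

lemma ricciNormSq_eq {p x : M} (hp : x ∈ src p) :
    ricciNormSq g x = ∑ i, ∑ j, ∑ k, ∑ l, gramInv g p x i k * gramInv g p x j l
      * ricciComp g p i j x * ricciComp g p k l x := by
  have h : ∀ q : M, x ∈ src q → ∑ i, ∑ j, ∑ k, ∑ l, gramInv g q x i k * gramInv g q x j l
      * ricciComp g q i j x * ricciComp g q k l x
      = ((gramInv g q x * ricMat g q x) * (gramInv g q x * ricMat g q x)).trace := by
    intro q hq
    simp only [Matrix.trace, Matrix.diag, Matrix.mul_apply, ricMat, Matrix.of_apply,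
      Finset.sum_mul_sum]
    refine Finset.sum_congr rfl fun i _ => ?_
    have e1 : ∀ F : Fin 4 → Fin 4 → Fin 4 → ℝ, ∑ j, ∑ k, ∑ l, F j k l
        = ∑ l, ∑ k, ∑ j, F j k l := by
      intro F
      rw [Finset.sum_comm, Finset.sum_congr rfl fun k _ => Finset.sum_comm, Finset.sum_comm]
    rw [e1]
    refine Finset.sum_congr rfl fun l _ => Finset.sum_congr rfl fun k _ =>
      Finset.sum_congr rfl fun j _ => ?_
    rw [ricciComp_symm g hq i j, gramInv_symm g q x j l]
    ring
  rw [ricciNormSq, h x (mem_src x), h p hp]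
  refine trace_eq_of_mul_eq (jac_det_ne (chart_mem_overlap (mem_src x) hp)) ?_
  rw [← mul_assoc, gramInv_mul_ricMat_change g (mem_src x) hp, mul_assoc,
    gramInv_mul_ricMat_change g (mem_src x) hp]
  simp only [mul_assoc]

lemma contMDiff_scalarCurv : ContMDiff (𝓡 4) 𝓘(ℝ, ℝ) ∞ (scalarCurv g) := by
  refine contMDiff_iff_loc.2 fun p => ?_
  have h : ContDiffOn ℝ ∞ (fun y => ∑ i, ∑ j, loc p (fun x => gramInv g p x i j) y
      * loc p (ricciComp g p i j) y) (dom p) :=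
    ContDiffOn.sum fun i _ => ContDiffOn.sum fun j _ =>
      (contDiffOn_loc_gramInv g p i j).mul (contDiffOn_loc_ricciComp g p i j)
  exact h.congr fun y hy => scalarCurv_eq g (symm_mem_src hy)

lemma contMDiff_ricciNormSq : ContMDiff (𝓡 4) 𝓘(ℝ, ℝ) ∞ (ricciNormSq g) := by
  refine contMDiff_iff_loc.2 fun p => ?_
  have h : ContDiffOn ℝ ∞ (fun y => ∑ i, ∑ j, ∑ k, ∑ l, loc p (fun x => gramInv g p x i k) y
      * loc p (fun x => gramInv g p x j l) y * loc p (ricciComp g p i j) y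
      * loc p (ricciComp g p k l) y) (dom p) :=
    ContDiffOn.sum fun i _ => ContDiffOn.sum fun j _ => ContDiffOn.sum fun k _ =>
      ContDiffOn.sum fun l _ => (((contDiffOn_loc_gramInv g p i k).mul
      (contDiffOn_loc_gramInv g p j l)).mul (contDiffOn_loc_ricciComp g p i j)).mul
      (contDiffOn_loc_ricciComp g p k l)
  exact h.congr fun y hy => ricciNormSq_eq g (symm_mem_src hy)

lemma ricci_eq {p x : M} (hp : x ∈ src p) (v w : TangentSpace (𝓡 4) x) :
    ricci g x v w = ∑ i, ∑ j, ricciComp g p i j x * coordComp p i x v * coordComp p j x w := by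
  have h : ∀ q : M, ∑ i, ∑ j, ricciComp g q i j x * coordComp q i x v * coordComp q j x w
      = (fun i => coordComp q i x v) ⬝ᵥ (ricMat g q x).mulVec (fun j => coordComp q j x w) := by
    intro q
    simp only [dotProduct, Matrix.mulVec, ricMat, Matrix.of_apply, Finset.mul_sum]
    exact Finset.sum_congr rfl fun i _ => Finset.sum_congr rfl fun j _ => by ring
  have hc : ∀ v : TangentSpace (𝓡 4) x, (fun i => coordComp p i x v)
      = (jac (trans x p) (extChartAt (𝓡 4) x x)).mulVec (fun i => coordComp x i x v) :=
    fun v => funext fun a => coordComp_change (mem_src x) hp a v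
  rw [ricci, h x, h p, hc v, hc w, ricMat_change g (mem_src x) hp, ← Matrix.mulVec_mulVec,
    ← Matrix.mulVec_mulVec, Matrix.dotProduct_mulVec, Matrix.vecMul_transpose]

lemma ricci_symm (x : M) (v w : TangentSpace (𝓡 4) x) : ricci g x v w = ricci g x w v := by
  rw [ricci, ricci, Finset.sum_comm]
  refine Finset.sum_congr rfl fun i _ => Finset.sum_congr rfl fun j _ => ?_
  rw [ricciComp_symm g (mem_src x)]
  ring

lemma ricci_add_left (x : M) (u v w : TangentSpace (𝓡 4) x) :
    ricci g x (u + v) w = ricci g x u w + ricci g x v w := by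
  simp only [ricci, coordComp_add, ← Finset.sum_add_distrib]
  exact Finset.sum_congr rfl fun i _ => Finset.sum_congr rfl fun j _ => by ring

lemma ricci_smul_left (x : M) (c : ℝ) (v w : TangentSpace (𝓡 4) x) :
    ricci g x (c • v) w = c * ricci g x v w := by
  simp only [ricci, coordComp_smul, Finset.mul_sum]
  exact Finset.sum_congr rfl fun i _ => Finset.sum_congr rfl fun j _ => by ring

lemma ricci_add_right (x : M) (u v w : TangentSpace (𝓡 4) x) :
    ricci g x u (v + w) = ricci g x u v + ricci g x u w := by
  rw [ricci_symm, ricci_add_left, ricci_symm g x v, ricci_symm g x w]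

lemma ricci_smul_right (x : M) (c : ℝ) (v w : TangentSpace (𝓡 4) x) :
    ricci g x v (c • w) = c * ricci g x v w := by
  rw [ricci_symm, ricci_smul_left, ricci_symm]

lemma ricci_sum_right {ι : Type*} (s : Finset ι) (x : M) (v : TangentSpace (𝓡 4) x)
    (w : ι → TangentSpace (𝓡 4) x) :
    ricci g x v (∑ a ∈ s, w a) = ∑ a ∈ s, ricci g x v (w a) := by
  classical
  induction s using Finset.induction_on with
  | empty => simp [ricci, coordComp]
  | insert a s ha ih => rw [Finset.sum_insert ha, Finset.sum_insert ha, ricci_add_right, ih]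

lemma inner_coordVec {p x : M} (hx : x ∈ src p) (v : TangentSpace (𝓡 4) x) (i : Fin 4) :
    g.inner x v (coordVec p i x) = ∑ j, gram g p x i j * coordComp p j x v := by
  conv_lhs => rw [← sum_coordComp_smul hx v]
  simp only [map_sum, map_smul, _root_.sum_apply, _root_.smul_apply, smul_eq_mul]
  refine Finset.sum_congr rfl fun j _ => ?_
  rw [gram_symm, mul_comm]
  rfl

lemma coordComp_eq_sum {p x : M} (hx : x ∈ src p) (v : TangentSpace (𝓡 4) x) (i : Fin 4) :
    coordComp p i x v = ∑ j, gramInv g p x i j * g.inner x v (coordVec p j x) := by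
  have h : (fun i => g.inner x v (coordVec p i x))
      = (gram g p x).mulVec (fun j => coordComp p j x v) :=
    funext fun i => inner_coordVec g hx v i
  have h2 : (gramInv g p x).mulVec (fun i => g.inner x v (coordVec p i x))
      = fun j => coordComp p j x v := by
    rw [h, Matrix.mulVec_mulVec, gramInv_mul g hx, Matrix.one_mulVec]
  exact (congrFun h2 i).symm

lemma inner_sum_gramInv {p x : M} (hx : x ∈ src p) (a : Fin 4 → ℝ) (i : Fin 4) :
    g.inner x (∑ k, (∑ j, gramInv g p x k j * a j) • coordVec p k x) (coordVec p i x) = a i := by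
  simp only [map_sum, map_smul, _root_.sum_apply, _root_.smul_apply, smul_eq_mul]
  have h : (gram g p x).mulVec ((gramInv g p x).mulVec a) = a := by
    rw [Matrix.mulVec_mulVec, mul_gramInv g hx, Matrix.one_mulVec]
  refine Eq.trans ?_ (congrFun h i)
  simp only [Matrix.mulVec, dotProduct]
  refine Finset.sum_congr rfl fun j _ => ?_
  rw [gram_symm, mul_comm]
  rfl

/-- The gradient is defined in the chart at x. Its covariant components in another chart are again
partial derivatives, by the chain rule. -/
lemma inner_grad {p x : M} (hx : x ∈ src p) {f : M → ℝ}
    (hf : DifferentiableAt ℝ (loc p f) (extChartAt (𝓡 4) p x)) (i : Fin 4) :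
    g.inner x (grad g f x) (coordVec p i x) = pderiv p i f x := by
  have hfx : DifferentiableAt ℝ (loc x f) (extChartAt (𝓡 4) x x) := by
    have hy := chart_mem_overlap (mem_src x) hx
    have h1 : DifferentiableAt ℝ (loc p f ∘ trans x p) (extChartAt (𝓡 4) x x) := by
      refine DifferentiableAt.comp _ (by rw [trans_chart (mem_src x)]; exact hf) ?_
      exact differentiableAt_of_contDiffOn (isOpen_overlap x p) (contDiffOn_trans x p) hy
    refine h1.congr_of_eventuallyEq ?_
    filter_upwards [(isOpen_overlap x p).mem_nhds hy] with z hz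
    exact loc_eq_comp_trans f hz
  rw [pderiv_change hx (mem_src x) hfx, coordVec_change hx (mem_src x) i, map_sum]
  refine Finset.sum_congr rfl fun a _ => ?_
  rw [map_smul, grad, inner_sum_gramInv g (mem_src x), smul_eq_mul]

lemma coordComp_grad {p x : M} (hx : x ∈ src p) {f : M → ℝ}
    (hf : DifferentiableAt ℝ (loc p f) (extChartAt (𝓡 4) p x)) (i : Fin 4) :
    coordComp p i x (grad g f x) = ∑ j, gramInv g p x i j * pderiv p j f x := by
  rw [coordComp_eq_sum g hx]
  simp only [inner_grad g hx hf]

lemma inner_ricciSharp (x : M) (v w : TangentSpace (𝓡 4) x) :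
    g.inner x (ricciSharp g x v) w = ricci g x v w := by
  conv_lhs => rw [← sum_coordComp_smul (mem_src x) w]
  conv_rhs => rw [← sum_coordComp_smul (mem_src x) w]
  rw [map_sum, ricci_sum_right]
  refine Finset.sum_congr rfl fun i _ => ?_
  rw [map_smul, ricci_smul_right, ricciSharp, inner_sum_gramInv g (mem_src x), smul_eq_mul]

end MetricInCharts

/-! ### The Riemannian volume in charts -/

section Volume

variable {M : Type*} [TopologicalSpace M] [ChartedSpace E4 M] [IsManifold (𝓡 4) ∞ M]
  [MeasurableSpace M] [BorelSpace M] (g : Metric M)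

lemma measurableSet_inter_preimage_symm (p : M) {A : Set M} (hA : MeasurableSet A) :
    MeasurableSet (dom p ∩ (extChartAt (𝓡 4) p).symm ⁻¹' A) := by
  have h := MeasurableSet.subtype_image (isOpen_dom p).measurableSet
    ((continuousOn_extChartAt_symm (I := 𝓡 4) p).restrict.measurable hA)
  convert! h using 1
  ext y
  constructor
  · rintro ⟨h1, h2⟩
    exact ⟨⟨y, h1⟩, h2, rfl⟩
  · rintro ⟨⟨y, h1⟩, h2, rfl⟩
    exact ⟨h1, h2⟩

lemma aemeasurable_symm (p : M) :
    AEMeasurable (extChartAt (𝓡 4) p).symm (volume.restrict (dom p)) := by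
  have h : Measurable ((dom p).restrict (extChartAt (𝓡 4) p).symm) :=
    (continuousOn_extChartAt_symm (I := 𝓡 4) p).restrict.measurable
  exact (aemeasurable_restrict_of_measurable_subtype (isOpen_dom p).measurableSet h)

/-- The Riemannian measure of the chart at `p`, on the image of the chart. -/
noncomputable def domVolume (p : M) : Measure E4 :=
  (volume.restrict (dom p)).withDensity fun y => ENNReal.ofReal (loc p (density g p) y)

lemma chartVolume_eq (p : M) :
    chartVolume g p = (domVolume g p).map (extChartAt (𝓡 4) p).symm := rfl

lemma domVolume_ac (p : M) : domVolume g p ≪ volume.restrict (dom p) :=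
  withDensity_absolutelyContinuous _ _

lemma aemeasurable_loc_density (p : M) :
    AEMeasurable (loc p (density g p)) (volume.restrict (dom p)) :=
  (contDiffOn_loc_density g p).continuousOn.aemeasurable (isOpen_dom p).measurableSet

lemma ac_domVolume (p : M) : volume.restrict (dom p) ≪ domVolume g p := by
  refine withDensity_absolutelyContinuous' (aemeasurable_loc_density g p).ennreal_ofReal ?_
  filter_upwards [ae_restrict_mem (isOpen_dom p).measurableSet] with y hy
  exact (ENNReal.ofReal_pos.2 (density_pos g (symm_mem_src hy))).ne'

lemma chartVolume_apply (p : M) {A : Set M} (hA : MeasurableSet A) :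
    chartVolume g p A = ∫⁻ y in dom p ∩ (extChartAt (𝓡 4) p).symm ⁻¹' A,
      ENNReal.ofReal (loc p (density g p) y) := by
  rw [chartVolume_eq, Measure.map_apply_of_aemeasurable
    ((aemeasurable_symm p).mono_ac (domVolume_ac g p)) hA, domVolume, withDensity_apply',
    Measure.restrict_restrict' (isOpen_dom p).measurableSet, Set.inter_comm]

lemma det_fderiv_eq_det_jac {τ : E4 → E4} {y : E4} (hτ : DifferentiableAt ℝ τ y) :
    (fderiv ℝ τ y).det = (jac τ y).det := by
  have h : LinearMap.toMatrix (EuclideanSpace.basisFun (Fin 4) ℝ).toBasis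
      (EuclideanSpace.basisFun (Fin 4) ℝ).toBasis (fderiv ℝ τ y : E4 →ₗ[ℝ] E4) = jac τ y := by
    ext a i
    rw [LinearMap.toMatrix_apply]
    have h2 : HasFDerivAt (fun z => τ z a)
      ((EuclideanSpace.proj a : E4 →L[ℝ] ℝ).comp (fderiv ℝ τ y)) y :=
      (EuclideanSpace.proj a : E4 →L[ℝ] ℝ).hasFDerivAt.comp _ hτ.hasFDerivAt
    simp [jac, pd, h2.fderiv, stdVec]
  rw [← h, LinearMap.det_toMatrix]

/-- Change of variables: the factor |det| of the coordinate change is exactly the quotient of the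
two densities. -/
lemma chartVolume_overlap (p q : M) {A : Set M} (hA : MeasurableSet A) (hAp : A ⊆ src p)
    (hAq : A ⊆ src q) : chartVolume g p A = chartVolume g q A := by
  rw [chartVolume_apply g p hA, chartVolume_apply g q hA]
  set S := dom p ∩ (extChartAt (𝓡 4) p).symm ⁻¹' A with hS
  have hSU : S ⊆ overlap p q := fun y hy => ⟨hy.1, hAq hy.2⟩
  have himg : trans p q '' S = dom q ∩ (extChartAt (𝓡 4) q).symm ⁻¹' A := by
    ext z
    constructor
    · rintro ⟨y, hy, rfl⟩
      exact ⟨(mapsTo_trans p q (hSU hy)).1, by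
        rw [Set.mem_preimage, symm_trans (hSU hy)]; exact hy.2⟩
    · rintro ⟨hz, hzA⟩
      have hz' : z ∈ overlap q p := ⟨hz, hAp hzA⟩
      exact ⟨trans q p z, ⟨(mapsTo_trans q p hz').1, by
        rw [Set.mem_preimage, symm_trans hz']; exact hzA⟩, trans_trans hz'⟩
  have hd : ∀ y ∈ S, DifferentiableAt ℝ (trans p q) y := fun y hy =>
    ((contDiffOn_trans p q).contDiffAt ((isOpen_overlap p q).mem_nhds (hSU hy))).differentiableAt
      (by simp)
  rw [← himg, lintegral_image_eq_lintegral_abs_det_fderiv_mul volume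
    (measurableSet_inter_preimage_symm p hA)
    (fun y hy => (hd y hy).hasFDerivAt.hasFDerivWithinAt)
    (fun y hy z hz h => by
      rw [← trans_trans (hSU hy), ← trans_trans (hSU hz), h])]
  refine setLIntegral_congr_fun (measurableSet_inter_preimage_symm p hA) fun y hy => ?_
  have h := density_change g (symm_mem_src (hSU hy).1) (hSU hy).2
  rw [chart_symm (hSU hy).1] at h
  rw [det_fderiv_eq_det_jac (hd y hy), ← ENNReal.ofReal_mul (abs_nonneg _),
    ← loc_eq_comp_trans (density g q) (hSU hy)]
  exact congrArg _ h

lemma chartVolume_restrict_src (p : M) : (chartVolume g p).restrict (src p) = chartVolume g p := by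
  ext A hA
  rw [Measure.restrict_apply hA, chartVolume_apply g p (hA.inter (isOpen_src p).measurableSet),
    chartVolume_apply g p hA]
  congr 2
  ext y
  exact ⟨fun h => ⟨h.1, h.2.1⟩, fun h => ⟨h.1, h.2, symm_mem_src h.1⟩⟩

lemma chartVolume_restrict_comm (p q : M) {D : Set M} (hD : MeasurableSet D) (hDq : D ⊆ src q) :
    (chartVolume g p).restrict D = (chartVolume g q).restrict (D ∩ src p) := by
  ext A hA
  have hp := (isOpen_src p).measurableSet
  have hm := (hA.inter hD).inter hp
  rw [Measure.restrict_apply hA, Measure.restrict_apply hA]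
  conv_lhs => rw [← chartVolume_restrict_src, Measure.restrict_apply (hA.inter hD)]
  rw [chartVolume_overlap g p q hm Set.inter_subset_right fun x hx => hDq hx.1.2, Set.inter_assoc]

lemma exists_seq_src [CompactSpace M] [Nonempty M] :
    ∃ q : ℕ → M, ⋃ n, src (q n) = Set.univ := by
  obtain ⟨t, ht⟩ := isCompact_univ.elim_finite_subcover (fun p : M => src p)
    (fun p => isOpen_src p) (fun x _ => Set.mem_iUnion.2 ⟨x, mem_src x⟩)
  obtain ⟨q, hq⟩ := t.countable_toSet.exists_eq_range (by
    obtain ⟨a, ha, -⟩ := Set.mem_iUnion₂.1 (ht (Set.mem_univ (Classical.arbitrary M)))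
    exact ⟨a, ha⟩)
  refine ⟨q, Set.eq_univ_of_forall fun x => ?_⟩
  obtain ⟨a, ha, hx⟩ := Set.mem_iUnion₂.1 (ht (Set.mem_univ x))
  obtain ⟨n, rfl⟩ : a ∈ Set.range q := hq ▸ ha
  exact Set.mem_iUnion.2 ⟨n, hx⟩

/-- A countable cover by charts is made disjoint, and the chart measures of the pieces are summed.
The sum restricts to the chart measure on every chart, so it is an upper bound and dominates the
supremum `vol g`. Conversely, `vol g` lies above every chart measure by definition. -/
theorem vol_restrict_src [CompactSpace M] (p : M) :
    (vol g).restrict (src p) = chartVolume g p := by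
  haveI : Nonempty M := ⟨p⟩
  obtain ⟨q, hq⟩ := exists_seq_src (M := M)
  have hm : ∀ p : M, MeasurableSet (src p) := fun p => (isOpen_src p).measurableSet
  set D := disjointed fun n => src (q n) with hD
  have hDm : ∀ n, MeasurableSet (D n) := fun n => MeasurableSet.disjointed (fun n => hm _) n
  have hDs : ∀ n, D n ⊆ src (q n) := fun n => disjointed_subset _ n
  have hsplit : ∀ ν : Measure M, Measure.sum (fun n => ν.restrict (D n)) = ν := by
    intro ν
    rw [← Measure.restrict_iUnion (disjoint_disjointed _) hDm, iUnion_disjointed, hq,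
      Measure.restrict_univ]
  set μ : Measure M := Measure.sum fun n => (chartVolume g (q n)).restrict (D n) with hμ
  have hr : ∀ p : M, μ.restrict (src p) = chartVolume g p := by
    intro p
    rw [hμ, Measure.restrict_sum _ (hm p), ← hsplit (chartVolume g p)]
    congr 1
    funext n
    rw [Measure.restrict_restrict (hm p), Set.inter_comm,
      ← chartVolume_restrict_comm g p (q n) (hDm n) (hDs n)]
  have hle : vol g ≤ μ := iSup_le fun p => by
    rw [← hr p]; exact Measure.restrict_le_self
  refine le_antisymm ((Measure.restrict_mono_measure hle _).trans_eq (hr p)) ?_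
  rw [← chartVolume_restrict_src]
  exact Measure.restrict_mono_measure (le_iSup (chartVolume g) p) _

variable [CompactSpace M]

lemma map_symm_domVolume (p : M) :
    (domVolume g p).map (extChartAt (𝓡 4) p).symm = (vol g).restrict (src p) :=
  (vol_restrict_src g p).symm

lemma aemeasurable_symm_domVolume (p : M) :
    AEMeasurable (extChartAt (𝓡 4) p).symm (domVolume g p) :=
  (aemeasurable_symm p).mono_ac (domVolume_ac g p)

lemma aemeasurable_chart (p : M) (μ : Measure M) :
    AEMeasurable (extChartAt (𝓡 4) p) (μ.restrict (src p)) :=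
  aemeasurable_restrict_of_measurable_subtype (isOpen_src p).measurableSet
    (continuousOn_extChartAt (I := 𝓡 4) p).restrict.measurable

lemma map_chart_vol (p : M) :
    ((vol g).restrict (src p)).map (extChartAt (𝓡 4) p) = domVolume g p := by
  have h : AEMeasurable (extChartAt (𝓡 4) p)
      ((domVolume g p).map (extChartAt (𝓡 4) p).symm) := by
    rw [map_symm_domVolume]; exact aemeasurable_chart p _
  rw [← map_symm_domVolume, AEMeasurable.map_map_of_aemeasurable h
    (aemeasurable_symm_domVolume g p)]
  conv_rhs => rw [← Measure.map_id (μ := domVolume g p)]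
  refine Measure.map_congr ?_
  filter_upwards [(domVolume_ac g p).ae_le (ae_restrict_mem (isOpen_dom p).measurableSet)]
    with y hy using chart_symm hy

/-- The density is positive, so the Riemannian and Lebesgue null sets of a chart correspond. -/
lemma ae_src_iff (p : M) {P : M → Prop} :
    (∀ᵐ x ∂(vol g), x ∈ src p → P x)
      ↔ ∀ᵐ y, y ∈ dom p → P ((extChartAt (𝓡 4) p).symm y) := by
  rw [← ae_restrict_iff' (isOpen_src p).measurableSet,
    ← ae_restrict_iff' (isOpen_dom p).measurableSet]
  constructor
  · intro h
    rw [← map_symm_domVolume] at h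
    exact (ac_domVolume g p).ae_le (ae_of_ae_map (aemeasurable_symm_domVolume g p) h)
  · intro h
    have h2 := (domVolume_ac g p).ae_le h
    rw [← map_chart_vol] at h2
    filter_upwards [ae_of_ae_map (aemeasurable_chart p _) h2,
      ae_restrict_mem (isOpen_src p).measurableSet] with x hx hxs
    rwa [symm_chart hxs] at hx

lemma ae_dom_of_ae {P : M → Prop} (h : ∀ᵐ x ∂(vol g), P x) (p : M) :
    ∀ᵐ y, y ∈ dom p → P ((extChartAt (𝓡 4) p).symm y) :=
  (ae_src_iff g p).1 (h.mono fun _ hx _ => hx)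

lemma aestronglyMeasurable_src_iff (p : M) {f : M → ℝ} :
    AEStronglyMeasurable f ((vol g).restrict (src p))
      ↔ AEStronglyMeasurable (loc p f) (volume.restrict (dom p)) := by
  constructor
  · intro h
    rw [← map_symm_domVolume] at h
    exact (h.comp_aemeasurable (aemeasurable_symm_domVolume g p)).mono_ac (ac_domVolume g p)
  · intro h
    have h2 := h.mono_ac (domVolume_ac g p)
    rw [← map_chart_vol] at h2
    refine (h2.comp_aemeasurable (aemeasurable_chart p _)).congr ?_
    filter_upwards [ae_restrict_mem (isOpen_src p).measurableSet] with x hx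
    simp only [Function.comp_apply, symm_chart hx]

lemma setLIntegral_src (p : M) {f : M → ENNReal} (hf : AEMeasurable f ((vol g).restrict (src p))) :
    ∫⁻ x in src p, f x ∂(vol g)
      = ∫⁻ y in dom p, ENNReal.ofReal (loc p (density g p) y) * loc p f y := by
  rw [← map_symm_domVolume] at hf ⊢
  rw [lintegral_map' hf (aemeasurable_symm_domVolume g p)]
  exact lintegral_withDensity_eq_lintegral_mul₀' (aemeasurable_loc_density g p).ennreal_ofReal
      (hf.comp_aemeasurable (aemeasurable_symm_domVolume g p))

lemma setIntegral_src (p : M) (f : M → ℝ) :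
    ∫ x in src p, f x ∂(vol g) = ∫ y in dom p, loc p (density g p) y * loc p f y := by
  have hρ : ∀ᵐ y ∂(volume.restrict (dom p)), loc p (density g p) y ≠ 0 := by
    filter_upwards [ae_restrict_mem (isOpen_dom p).measurableSet] with y hy
    exact (density_pos g (symm_mem_src hy)).ne'
  by_cases hf : AEStronglyMeasurable f ((vol g).restrict (src p))
  · rw [← map_symm_domVolume] at hf ⊢
    rw [integral_map (aemeasurable_symm_domVolume g p) hf, domVolume,
      integral_withDensity_eq_integral_toReal_smul₀
        (aemeasurable_loc_density g p).ennreal_ofReal (by simp)]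
    refine integral_congr_ae ?_
    filter_upwards [ae_restrict_mem (isOpen_dom p).measurableSet] with y hy
    rw [ENNReal.toReal_ofReal (show 0 ≤ loc p (density g p) y from
      (density_pos g (symm_mem_src hy)).le), smul_eq_mul]
    rfl
  -- If f is not measurable, neither is its chart expression, because the positive density can be
  -- divided out. Both integrals then have the default value 0.
  · rw [integral_non_aestronglyMeasurable hf, integral_non_aestronglyMeasurable]
    intro h
    refine hf ((aestronglyMeasurable_src_iff g p).2 ?_)
    refine ((aemeasurable_loc_density g p).inv.aestronglyMeasurable.mul h).congr ?_
    filter_upwards [hρ] with y hy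
    simp only [Pi.mul_apply, Pi.inv_apply]
    rw [← mul_assoc, inv_mul_cancel₀ hy, one_mul]

end Volume

/-! ### Functions supported in a chart, finite atlases -/

section Supported

variable {M : Type*} [TopologicalSpace M] [ChartedSpace E4 M]

/-- `f` vanishes outside the part `B` of the domain of the chart at `p`. -/
def SuppIn (p : M) (B : Set E4) (f : M → ℝ) : Prop :=
  ∀ x, f x ≠ 0 → x ∈ src p ∧ extChartAt (𝓡 4) p x ∈ B

/-- The function `f` read in the chart at `p`, extended by zero. -/
noncomputable def ext0 (p : M) (f : M → ℝ) : E4 → ℝ := (dom p).indicator (loc p f)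

/-- The function on `M` which is given by `ψ` in the chart at `p`, and vanishes elsewhere. -/
noncomputable def push (p : M) (ψ : E4 → ℝ) : M → ℝ :=
  (src p).indicator (ψ ∘ extChartAt (𝓡 4) p)

lemma ext0_apply {p : M} (f : M → ℝ) {y : E4} (hy : y ∈ dom p) : ext0 p f y = loc p f y :=
  Set.indicator_of_mem hy _

lemma ext0_eqOn (p : M) (f : M → ℝ) : Set.EqOn (ext0 p f) (loc p f) (dom p) :=
  fun _ hy => ext0_apply f hy

lemma SuppIn.ext0_eq_zero {p : M} {B : Set E4} {f : M → ℝ} (h : SuppIn p B f) {y : E4}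
    (hy : y ∉ B) : ext0 p f y = 0 := by
  by_cases hd : y ∈ dom p
  · rw [ext0_apply f hd]
    by_contra h0
    exact hy (by simpa only [chart_symm hd] using (h _ h0).2)
  · exact Set.indicator_of_notMem hd _

/-- B is closed in the whole space and contained in the image of the chart, so the extension by zero
vanishes near every point outside that image. -/
lemma SuppIn.testFn {p : M} {B : Set E4} {f : M → ℝ} (h : SuppIn p B f) (hB : IsCompact B)
    (hBd : B ⊆ dom p) (hf : ContDiffOn ℝ ∞ (loc p f) (dom p)) : TestFn B (ext0 p f) := by
  have hs : tsupport (ext0 p f) ⊆ B := closure_minimal (fun y hy => by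
    by_contra h0; exact hy (h.ext0_eq_zero h0)) hB.isClosed
  refine ⟨contDiff_iff_contDiffAt.2 fun y => ?_, hB.of_isClosed_subset (isClosed_tsupport _) hs, hs⟩
  by_cases hy : y ∈ dom p
  · refine (hf.contDiffAt ((isOpen_dom p).mem_nhds hy)).congr_of_eventuallyEq ?_
    exact (ext0_eqOn p f).eventuallyEq_of_mem ((isOpen_dom p).mem_nhds hy)
  · refine (contDiffAt_const (c := (0 : ℝ))).congr_of_eventuallyEq ?_
    filter_upwards [hB.isClosed.isOpen_compl.mem_nhds fun h => hy (hBd h)] with z hz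
    exact h.ext0_eq_zero hz

lemma SuppIn.mul_right {p : M} {B : Set E4} {f : M → ℝ} (h : SuppIn p B f) (k : M → ℝ) :
    SuppIn p B (fun x => f x * k x) := fun x hx => h x (left_ne_zero_of_mul hx)

lemma push_apply {p x : M} (ψ : E4 → ℝ) (hx : x ∈ src p) :
    push p ψ x = ψ (extChartAt (𝓡 4) p x) := Set.indicator_of_mem hx _

lemma loc_push {p : M} (ψ : E4 → ℝ) {y : E4} (hy : y ∈ dom p) : loc p (push p ψ) y = ψ y := by
  rw [loc, Function.comp_apply, push_apply ψ (symm_mem_src hy), chart_symm hy]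

lemma suppIn_push {p : M} {B : Set E4} {ψ : E4 → ℝ} (h : ∀ y, y ∉ B → ψ y = 0) :
    SuppIn p B (push p ψ) := by
  intro x hx
  have hs : x ∈ src p := by
    by_contra h0; exact hx (Set.indicator_of_notMem h0 _)
  refine ⟨hs, ?_⟩
  by_contra h0
  exact hx (by rw [push_apply ψ hs, h _ h0])

lemma ext0_push {p : M} {B : Set E4} {ψ : E4 → ℝ} (h : ∀ y, y ∉ B → ψ y = 0) (hBd : B ⊆ dom p) :
    ext0 p (push p ψ) = ψ := by
  funext y
  by_cases hy : y ∈ dom p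
  · rw [ext0_apply _ hy, loc_push ψ hy]
  · rw [ext0, Set.indicator_of_notMem hy, h y fun hB => hy (hBd hB)]

variable [IsManifold (𝓡 4) ∞ M]

/-- Compact sets are closed in a Hausdorff space. The image of the support is therefore closed in M,
and the function vanishes near every point outside the chart. -/
lemma contMDiff_push [T2Space M] {p : M} {B : Set E4} {ψ : E4 → ℝ} (hψ : TestFn B ψ)
    (hBd : B ⊆ dom p) : ContMDiff (𝓡 4) 𝓘(ℝ, ℝ) ∞ (push p ψ) := by
  intro x
  by_cases hx : x ∈ src p
  · have h1 : ContMDiffAt (𝓡 4) 𝓘(ℝ, ℝ) ∞ (ψ ∘ extChartAt (𝓡 4) p) x :=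
      hψ.smooth.contMDiff.contMDiffAt.comp x (contMDiffAt_extChartAt' (I := 𝓡 4) (n := ∞)
        (by rwa [← extChartAt_source (𝓡 4)]))
    refine h1.congr_of_eventuallyEq ?_
    filter_upwards [(isOpen_src p).mem_nhds hx] with z hz using push_apply ψ hz
  · have hc : IsCompact ((extChartAt (𝓡 4) p).symm '' tsupport ψ) :=
      IsCompact.image_of_continuousOn hψ.compact
        ((continuousOn_extChartAt_symm p).mono (hψ.supp.trans hBd))
    have hx' : x ∉ (extChartAt (𝓡 4) p).symm '' tsupport ψ := by
      rintro ⟨y, hy, rfl⟩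
      exact hx (symm_mem_src (hBd (hψ.supp hy)))
    refine (contMDiffAt_const (c := (0 : ℝ))).congr_of_eventuallyEq ?_
    filter_upwards [hc.isClosed.isOpen_compl.mem_nhds hx'] with z hz
    by_contra h0
    obtain ⟨h1, h2⟩ := suppIn_push (B := tsupport ψ)
      (fun y hy => image_eq_zero_of_notMem_tsupport hy) z h0
    exact hz ⟨_, h2, symm_chart h1⟩

variable (M) in
/-- A finite atlas with a subordinate smooth partition of unity. -/
structure FinAtlas where
  /-- the charts -/
  ι : Finset M
  /-- the compact parts of the charts which carry the partition of unity -/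
  B : M → Set E4
  /-- the partition of unity -/
  θ : M → M → ℝ
  compact : ∀ p, IsCompact (B p)
  subset : ∀ p, B p ⊆ dom p
  smooth : ∀ p, ContMDiff (𝓡 4) 𝓘(ℝ, ℝ) ∞ (θ p)
  supp : ∀ p, SuppIn p (B p) (θ p)
  sum : ∀ x, ∑ p ∈ ι, θ p x = 1

/-- A partition of unity is taken subordinate to open coordinate balls whose closures lie in the
chart images; these closures are the compact sets B. Local finiteness on a compact space leaves only
finitely many nonzero members. -/
theorem exists_finAtlas [T2Space M] [CompactSpace M] : Nonempty (FinAtlas M) := by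
  have hball : ∀ p : M, ∃ r > 0, Metric.closedBall (extChartAt (𝓡 4) p p) r ⊆ dom p := fun p =>
    Metric.nhds_basis_closedBall.mem_iff.1 ((isOpen_dom p).mem_nhds (chart_mem_dom (mem_src p)))
  choose r hr hrd using hball
  set U : M → Set M := fun p => src p ∩
    extChartAt (𝓡 4) p ⁻¹' Metric.ball (extChartAt (𝓡 4) p p) (r p) with hU
  obtain ⟨f, hf⟩ := SmoothPartitionOfUnity.exists_isSubordinate (𝓡 4) (isClosed_univ (X := M)) U
    (fun p => (continuousOn_extChartAt p).isOpen_inter_preimage (isOpen_src p) Metric.isOpen_ball)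
    (fun x _ => Set.mem_iUnion.2 ⟨x, mem_src x, Metric.mem_ball_self (hr x)⟩)
  have hfin : {p : M | (Function.support (f p)).Nonempty}.Finite :=
    f.locallyFinite.finite_nonempty_of_compact
  refine ⟨⟨hfin.toFinset, fun p => Metric.closedBall (extChartAt (𝓡 4) p p) (r p), fun p x => f p x,
    fun p => isCompact_closedBall _ _, hrd, fun p => (f p).contMDiff, fun p x hx => ?_, fun x => ?_⟩⟩
  · have := hf p (subset_tsupport _ hx)
    exact ⟨this.1, Metric.ball_subset_closedBall this.2⟩
  · rw [← f.sum_eq_one (Set.mem_univ x)]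
    refine (finsum_eq_sum_of_support_subset _ fun p hp => ?_).symm
    simp only [Set.Finite.coe_toFinset, Set.mem_setOf_eq]
    exact ⟨x, hp⟩

namespace FinAtlas

variable (𝒜 : FinAtlas M)

lemma eq_sum (f : M → ℝ) (x : M) : f x = ∑ p ∈ 𝒜.ι, 𝒜.θ p x * f x := by
  rw [← Finset.sum_mul, 𝒜.sum, one_mul]

lemma exists_mem (x : M) : ∃ p ∈ 𝒜.ι, x ∈ src p ∧ extChartAt (𝓡 4) p x ∈ 𝒜.B p := by
  obtain ⟨p, hp, h⟩ := Finset.exists_ne_zero_of_sum_ne_zero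
    (by rw [𝒜.sum x]; exact one_ne_zero : ∑ p ∈ 𝒜.ι, 𝒜.θ p x ≠ 0)
  exact ⟨p, hp, 𝒜.supp p x h⟩

end FinAtlas

end Supported

/-! ### Integrals over compact pieces of charts and finiteness of the volume -/

section VolumeFinite

variable {M : Type*} [TopologicalSpace M] [ChartedSpace E4 M] [IsManifold (𝓡 4) ∞ M]
  [MeasurableSpace M] [BorelSpace M] [CompactSpace M] (g : Metric M)

/-- The part of `M` which is given by the subset `B` of the chart at `p`. -/
def piece (p : M) (B : Set E4) : Set M := src p ∩ extChartAt (𝓡 4) p ⁻¹' B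

lemma measurableSet_piece {p : M} {B : Set E4} (hB : MeasurableSet B) :
    MeasurableSet (piece p B) := by
  have h := MeasurableSet.subtype_image (isOpen_src p).measurableSet
    ((continuousOn_extChartAt (I := 𝓡 4) p).restrict.measurable hB)
  convert! h using 1
  ext y
  constructor
  · rintro ⟨h1, h2⟩
    exact ⟨⟨y, h1⟩, h2, rfl⟩
  · rintro ⟨⟨y, h1⟩, h2, rfl⟩
    exact ⟨h1, h2⟩

lemma lintegral_piece {p : M} {B : Set E4} (hB : MeasurableSet B) (hBd : B ⊆ dom p)
    {f : M → ENNReal} (hf : AEMeasurable f ((vol g).restrict (src p))) :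
    ∫⁻ x in piece p B, f x ∂(vol g)
      = ∫⁻ y in B, ENNReal.ofReal (loc p (density g p) y) * loc p f y := by
  have hm := measurableSet_piece (p := p) hB
  have h1 : ∫⁻ x in piece p B, f x ∂(vol g)
      = ∫⁻ x in src p, (piece p B).indicator f x ∂(vol g) := by
    rw [lintegral_indicator hm, Measure.restrict_restrict hm,
      Set.inter_eq_left.2 (show piece p B ⊆ src p from Set.inter_subset_left)]
  rw [h1, setLIntegral_src g p (hf.indicator hm)]
  have h2 : ∫⁻ y in B, ENNReal.ofReal (loc p (density g p) y) * loc p f y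
      = ∫⁻ y in dom p, B.indicator
        (fun y => ENNReal.ofReal (loc p (density g p) y) * loc p f y) y := by
    rw [lintegral_indicator hB, Measure.restrict_restrict hB, Set.inter_eq_left.2 hBd]
  rw [h2]
  refine setLIntegral_congr_fun (isOpen_dom p).measurableSet fun y hy => ?_
  have hiff : (extChartAt (𝓡 4) p).symm y ∈ piece p B ↔ y ∈ B :=
    ⟨fun h => by simpa only [chart_symm hy] using (show _ ∈ B from h.2),
      fun h => ⟨symm_mem_src hy, by rw [Set.mem_preimage, chart_symm hy]; exact h⟩⟩
  by_cases hyB : y ∈ B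
  · simp only [loc, Function.comp_apply, Set.indicator_of_mem hyB,
      Set.indicator_of_mem (hiff.2 hyB)]
  · simp only [loc, Function.comp_apply, Set.indicator_of_notMem hyB,
      Set.indicator_of_notMem (fun h => hyB (hiff.1 h)), mul_zero]

lemma exists_density_bounds {p : M} {B : Set E4} (hB : IsCompact B) (hBd : B ⊆ dom p) :
    ∃ c > 0, ∃ C > 0, ∀ y ∈ B, c ≤ loc p (density g p) y ∧ loc p (density g p) y ≤ C := by
  have hcont := (contDiffOn_loc_density g p).continuousOn.mono hBd
  have hpos : ∀ y ∈ B, 0 < loc p (density g p) y := fun y hy => density_pos g (symm_mem_src (hBd hy))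
  rcases B.eq_empty_or_nonempty with rfl | hne
  · exact ⟨1, one_pos, 1, one_pos, fun y hy => hy.elim⟩
  obtain ⟨a, ha, h1⟩ := hB.exists_isMinOn hne hcont
  obtain ⟨b, hb, h2⟩ := hB.exists_isMaxOn hne hcont
  exact ⟨_, hpos a ha, _, hpos b hb, fun y hy => ⟨h1 hy, h2 hy⟩⟩

/-- On a compact part of a chart the density lies between two positive constants, so Riemannian and
Lebesgue integrals are comparable in both directions. -/
lemma exists_lintegral_le {p : M} {B : Set E4} (hB : IsCompact B) (hBd : B ⊆ dom p) :
    ∃ C : ENNReal, C ≠ ⊤ ∧ ∀ f : M → ENNReal, AEMeasurable f ((vol g).restrict (src p)) →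
      (∫⁻ x in piece p B, f x ∂(vol g) ≤ C * ∫⁻ y in B, loc p f y)
      ∧ ∫⁻ y in B, loc p f y ≤ C * ∫⁻ x in piece p B, f x ∂(vol g) := by
  obtain ⟨c, hc, C, hC, h⟩ := exists_density_bounds g hB hBd
  refine ⟨ENNReal.ofReal C + ENNReal.ofReal c⁻¹, by simp, fun f hf => ⟨?_, ?_⟩⟩
  · rw [lintegral_piece g hB.measurableSet hBd hf, ← lintegral_const_mul' _ _ (by simp)]
    refine setLIntegral_mono' hB.measurableSet fun y hy => ?_
    gcongr
    exact (ENNReal.ofReal_le_ofReal (h y hy).2).trans le_self_add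
  · rw [lintegral_piece g hB.measurableSet hBd hf, ← lintegral_const_mul' _ _ (by simp)]
    refine setLIntegral_mono' hB.measurableSet fun y hy => ?_
    rw [← mul_assoc]
    refine le_mul_of_one_le_left zero_le ?_
    calc (1 : ENNReal) = ENNReal.ofReal (c⁻¹ * c) := by rw [inv_mul_cancel₀ hc.ne']; simp
      _ = ENNReal.ofReal c⁻¹ * ENNReal.ofReal c := ENNReal.ofReal_mul (by positivity)
      _ ≤ _ := by
        gcongr
        · exact le_add_self
        · exact (h y hy).1

instance [T2Space M] : IsFiniteMeasure (vol g) := by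
  obtain ⟨𝒜⟩ := exists_finAtlas (M := M)
  refine ⟨?_⟩
  have hcov : (Set.univ : Set M) ⊆ ⋃ p ∈ 𝒜.ι, piece p (𝒜.B p) := fun x _ => by
    obtain ⟨p, hp, h⟩ := 𝒜.exists_mem x
    exact Set.mem_iUnion₂.2 ⟨p, hp, h⟩
  refine (measure_mono hcov).trans_lt ((measure_biUnion_finset_le _ _).trans_lt ?_)
  refine ENNReal.sum_lt_top.2 fun p _ => ?_
  obtain ⟨C, hC, h⟩ := exists_lintegral_le g (𝒜.compact p) (𝒜.subset p)
  have h1 := (h (fun _ => 1) aemeasurable_const).1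
  rw [setLIntegral_one] at h1
  refine h1.trans_lt (ENNReal.mul_lt_top hC.lt_top ?_)
  simpa [Function.comp_def] using (𝒜.compact p).measure_lt_top

lemma integral_eq_dom {p : M} {f : M → ℝ} (h : ∀ x, f x ≠ 0 → x ∈ src p) :
    ∫ x, f x ∂(vol g) = ∫ y in dom p, loc p (density g p) y * loc p f y := by
  rw [← setIntegral_src, setIntegral_eq_integral_of_forall_compl_eq_zero]
  intro x hx
  by_contra h0
  exact hx (h x h0)

/-- Integrals of functions supported in a chart. -/
lemma SuppIn.integral_mul {p : M} {B : Set E4} {f : M → ℝ} (h : SuppIn p B f) (k : M → ℝ) :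
    ∫ x, f x * k x ∂(vol g) = ∫ y, ext0 p f y * (loc p (density g p) y * loc p k y) := by
  rw [integral_eq_dom g (p := p) (fun x hx => (h.mul_right k x hx).1)]
  refine Eq.trans (setIntegral_congr_fun (isOpen_dom p).measurableSet fun y hy => ?_)
    (setIntegral_eq_integral_of_forall_compl_eq_zero (s := dom p) fun y hy => ?_)
  · simp only [ext0_apply f hy, loc, Function.comp_apply]
    ring
  · have : ext0 p f y = 0 := Set.indicator_of_notMem hy _
    rw [this, zero_mul]

end VolumeFinite

/-! ### Divergence and Laplacian -/

section Divergence

variable {M : Type*} [TopologicalSpace M] [ChartedSpace E4 M] [IsManifold (𝓡 4) ∞ M]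
  (g : Metric M)

/-- Smooth vector fields. -/
def SmoothField (X : ∀ x : M, TangentSpace (𝓡 4) x) : Prop :=
  ∀ (p : M) (i : Fin 4), ContDiffOn ℝ ∞ (loc p fun x => coordComp p i x (X x)) (dom p)

/-- The formula for the divergence in the chart at `p`. -/
noncomputable def divIn (p : M) (X : ∀ x : M, TangentSpace (𝓡 4) x) (x : M) : ℝ :=
  (density g p x)⁻¹ * ∑ i, pderiv p i (fun z => density g p z * coordComp p i z (X z)) x

variable {g}

lemma SmoothField.density_mul {X : ∀ x : M, TangentSpace (𝓡 4) x} (hX : SmoothField X) (p : M)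
    (i : Fin 4) :
    ContDiffOn ℝ ∞ (loc p fun z => density g p z * coordComp p i z (X z)) (dom p) :=
  (contDiffOn_loc_density g p).mul (hX p i)

lemma loc_density_pos {p : M} {y : E4} (hy : y ∈ dom p) : 0 < loc p (density g p) y :=
  density_pos g (symm_mem_src hy)

lemma loc_divIn (p : M) (X : ∀ x : M, TangentSpace (𝓡 4) x) {y : E4} (hy : y ∈ dom p) :
    loc p (divIn g p X) y = (loc p (density g p) y)⁻¹
      * ∑ i, pd i (loc p fun z => density g p z * coordComp p i z (X z)) y := by
  simp only [loc, Function.comp_apply, divIn, pderiv_symm _ _ _ hy]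

lemma contDiffOn_loc_divIn {X : ∀ x : M, TangentSpace (𝓡 4) x} (hX : SmoothField X) (p : M) :
    ContDiffOn ℝ ∞ (loc p (divIn g p X)) (dom p) := by
  have h : ContDiffOn ℝ ∞ (fun y => (loc p (density g p) y)⁻¹
      * ∑ i, pd i (loc p fun z => density g p z * coordComp p i z (X z)) y) (dom p) :=
    ((contDiffOn_loc_density g p).inv fun y hy => (loc_density_pos hy).ne').mul
      (ContDiffOn.sum fun i _ => pd_contDiffOn (isOpen_dom p) (hX.density_mul p i) i)
  exact h.congr fun y hy => loc_divIn p X hy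

lemma ContMDiff.loc {f : M → ℝ} (hf : ContMDiff (𝓡 4) 𝓘(ℝ, ℝ) ∞ f) (p : M) :
    ContDiffOn ℝ ∞ (loc p f) (dom p) := contMDiff_iff_loc.1 hf p

lemma ContMDiff.differentiableAt_loc {f : M → ℝ} (hf : ContMDiff (𝓡 4) 𝓘(ℝ, ℝ) ∞ f) {p : M}
    {y : E4} (hy : y ∈ dom p) : DifferentiableAt ℝ (Paneitz.loc p f) y :=
  differentiableAt_of_contDiffOn (isOpen_dom p) (contMDiff_iff_loc.1 hf p) hy

lemma inner_eq_sum_coordVec {p x : M} (hx : x ∈ src p) (v w : TangentSpace (𝓡 4) x) :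
    g.inner x v w = ∑ i, g.inner x v (coordVec p i x) * coordComp p i x w := by
  conv_lhs => rw [← sum_coordComp_smul hx w]
  simp only [map_sum, map_smul, smul_eq_mul]
  exact Finset.sum_congr rfl fun i _ => mul_comm _ _

lemma inner_grad_left {p x : M} (hx : x ∈ src p) {f : M → ℝ}
    (hf : ContMDiff (𝓡 4) 𝓘(ℝ, ℝ) ∞ f) (v : TangentSpace (𝓡 4) x) :
    g.inner x (grad g f x) v = ∑ i, pderiv p i f x * coordComp p i x v := by
  rw [inner_eq_sum_coordVec hx]
  simp only [inner_grad g hx (ContMDiff.differentiableAt_loc hf (chart_mem_dom hx))]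

lemma smoothField_grad {f : M → ℝ} (hf : ContMDiff (𝓡 4) 𝓘(ℝ, ℝ) ∞ f) :
    SmoothField (grad g f) := by
  intro p i
  have h : ContDiffOn ℝ ∞ (fun y => ∑ j, loc p (fun x => gramInv g p x i j) y
      * pd j (loc p f) y) (dom p) :=
    ContDiffOn.sum fun j _ => (contDiffOn_loc_gramInv g p i j).mul
      (pd_contDiffOn (isOpen_dom p) (ContMDiff.loc hf p) j)
  refine h.congr fun y hy => ?_
  simp only [loc, Function.comp_apply]
  rw [coordComp_grad g (symm_mem_src hy)
    (ContMDiff.differentiableAt_loc hf (chart_mem_dom (symm_mem_src hy)))]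
  simp only [pderiv_symm _ _ _ hy]

lemma contMDiff_inner_grad {f : M → ℝ} (hf : ContMDiff (𝓡 4) 𝓘(ℝ, ℝ) ∞ f)
    {X : ∀ x : M, TangentSpace (𝓡 4) x} (hX : SmoothField X) :
    ContMDiff (𝓡 4) 𝓘(ℝ, ℝ) ∞ (fun x => g.inner x (grad g f x) (X x)) := by
  refine contMDiff_iff_loc.2 fun p => ?_
  have h : ContDiffOn ℝ ∞ (fun y => ∑ i, pd i (loc p f) y
      * loc p (fun x => coordComp p i x (X x)) y) (dom p) :=
    ContDiffOn.sum fun i _ => (pd_contDiffOn (isOpen_dom p) (ContMDiff.loc hf p) i).mul (hX p i)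
  refine h.congr fun y hy => ?_
  simp only [loc, Function.comp_apply]
  rw [inner_grad_left (symm_mem_src hy) hf]
  simp only [pderiv_symm _ _ _ hy]

lemma grad_congr {f h : M → ℝ} {x : M} (hfh : f =ᶠ[𝓝 x] h) : grad g f x = grad g h x := by
  have : ∀ j, pderiv x j f x = pderiv x j h x := by
    intro j
    refine pd_congr ?_ j
    have hc := continuousAt_extChartAt_symm (I := 𝓡 4) x
    have h1 := hc.eventually (p := fun z => f z = h z)
      (by rw [symm_chart (mem_src x)]; exact hfh)
    exact h1
  simp only [grad, this]

lemma grad_zero (x : M) : grad g (fun _ => (0 : ℝ)) x = 0 := by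
  have : ∀ j, pderiv x j (fun _ => (0 : ℝ)) x = 0 := fun j => pd_const 0 _ j
  simp [grad, this]

lemma isClosed_piece [T2Space M] {p : M} {B : Set E4} (hB : IsCompact B) (hBd : B ⊆ dom p) :
    IsClosed (piece p B) := by
  have : piece p B = (extChartAt (𝓡 4) p).symm '' B := by
    ext x
    constructor
    · rintro ⟨h1, h2⟩
      exact ⟨_, h2, symm_chart h1⟩
    · rintro ⟨y, hy, rfl⟩
      exact ⟨symm_mem_src (hBd hy), by rw [Set.mem_preimage, chart_symm (hBd hy)]; exact hy⟩
  rw [this]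
  exact (hB.image_of_continuousOn ((continuousOn_extChartAt_symm p).mono hBd)).isClosed

lemma SuppIn.grad_eq_zero [T2Space M] {p : M} {B : Set E4} (hB : IsCompact B) (hBd : B ⊆ dom p)
    {f : M → ℝ} (h : SuppIn p B f) {x : M} (hx : x ∉ piece p B) : grad g f x = 0 := by
  rw [← grad_zero (g := g) x]
  refine grad_congr ?_
  filter_upwards [(isClosed_piece hB hBd).isOpen_compl.mem_nhds hx] with z hz
  by_contra h0
  exact hz (h z h0)

lemma pd_ext0 {p : M} (f : M → ℝ) (i : Fin 4) {y : E4} (hy : y ∈ dom p) :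
    pd i (ext0 p f) y = pd i (loc p f) y :=
  pd_congr_of_eqOn (isOpen_dom p) (ext0_eqOn p f) hy i

variable [T2Space M] [CompactSpace M] [MeasurableSpace M] [BorelSpace M]

lemma integrable_of_contMDiff {f : M → ℝ} (hf : ContMDiff (𝓡 4) 𝓘(ℝ, ℝ) ∞ f) :
    Integrable f (vol g) :=
  hf.continuous.integrable_of_hasCompactSupport (HasCompactSupport.of_compactSpace f)

/-- Integration by parts for functions supported in a chart. -/
lemma SuppIn.integral_mul_divIn {p : M} {B : Set E4} (hB : IsCompact B) (hBd : B ⊆ dom p)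
    {f : M → ℝ} (h : SuppIn p B f) (hf : ContMDiff (𝓡 4) 𝓘(ℝ, ℝ) ∞ f)
    {X : ∀ x : M, TangentSpace (𝓡 4) x} (hX : SmoothField X) :
    ∫ x, f x * divIn g p X x ∂(vol g) = - ∫ x, g.inner x (grad g f x) (X x) ∂(vol g) := by
  have hv := h.testFn hB hBd (ContMDiff.loc hf p)
  set v := ext0 p f with hvdef
  set W : Fin 4 → E4 → ℝ := fun i => loc p fun z => density g p z * coordComp p i z (X z) with hW
  have hWs : ∀ i, ContDiffOn ℝ ∞ (W i) (dom p) := fun i => hX.density_mul p i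
  -- The density of the volume cancels the inverse density in the divergence, and Euclidean
  -- integration by parts remains.
  have h1 : ∫ x, f x * divIn g p X x ∂(vol g) = ∫ y, ∑ i, v y * pd i (W i) y := by
    rw [h.integral_mul]
    refine integral_congr_ae (Filter.Eventually.of_forall fun y => ?_)
    simp only
    by_cases hy : y ∈ B
    · rw [loc_divIn p X (hBd hy), ← mul_assoc (loc p (density g p) y),
        mul_inv_cancel₀ (loc_density_pos (hBd hy)).ne', one_mul, Finset.mul_sum]
    · rw [show ext0 p f y = 0 from hv.eq_zero hy]; simp [hv.eq_zero hy]
  have h2 : ∫ x, g.inner x (grad g f x) (X x) ∂(vol g) = ∫ y, ∑ i, pd i v y * W i y := by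
    rw [integral_eq_dom g (p := p) (fun x hx => by
      by_contra h0
      refine hx ?_
      rw [h.grad_eq_zero hB hBd fun hp => h0 hp.1]; simp)]
    refine Eq.trans (setIntegral_congr_fun (isOpen_dom p).measurableSet fun y hy => ?_)
      (setIntegral_eq_integral_of_forall_compl_eq_zero (s := dom p) fun y hy => ?_)
    · simp only [loc, Function.comp_apply, W]
      rw [inner_grad_left (symm_mem_src hy) hf, Finset.mul_sum]
      refine Finset.sum_congr rfl fun i _ => ?_
      rw [pderiv_symm _ _ _ hy, ← pd_ext0 f i hy]
      ring
    · exact Finset.sum_eq_zero fun i _ => by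
        rw [(hv.pd i).eq_zero fun hyB => hy (hBd hyB), zero_mul]
  have hi1 : ∀ i, TestFn B (fun y => v y * pd i (W i) y) := fun i =>
    hv.mul_contDiffOn (isOpen_dom p) hBd (pd_contDiffOn (isOpen_dom p) (hWs i) i)
  have hi2 : ∀ i, TestFn B (fun y => pd i v y * W i y) := fun i =>
    (hv.pd i).mul_contDiffOn (isOpen_dom p) hBd (hWs i)
  rw [h1, h2, integral_finsetSum _ fun i _ => (hi1 i).integrable,
    integral_finsetSum _ fun i _ => (hi2 i).integrable, ← Finset.sum_neg_distrib]
  refine Finset.sum_congr rfl fun i _ => ?_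
  have h3 := integral_pd (hv.mul_contDiffOn (isOpen_dom p) hBd (hWs i)) i
  rw [← integral_neg]
  have h4 : ∫ y, pd i (fun z => v z * W i z) y
      = (∫ y, pd i v y * W i y) + ∫ y, v y * pd i (W i) y := by
    rw [← integral_add (hi2 i).integrable (hi1 i).integrable]
    refine integral_congr_ae (Filter.Eventually.of_forall fun y => ?_)
    simp only
    by_cases hy : y ∈ B
    · exact pd_mul (hv.differentiableAt y)
        (differentiableAt_of_contDiffOn (isOpen_dom p) (hWs i) (hBd hy)) i
    · rw [((hv.mul_contDiffOn (isOpen_dom p) hBd (hWs i)).pd i).eq_zero hy, (hi1 i).eq_zero hy,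
        (hi2 i).eq_zero hy, add_zero]
  rw [integral_neg]
  linarith

/-- The divergence can be computed in any chart. -/
theorem divIn_eq_divIn {p q x : M} (hp : x ∈ src p) (hq : x ∈ src q)
    {X : ∀ x : M, TangentSpace (𝓡 4) x} (hX : SmoothField X) :
    divIn g p X x = divIn g q X x := by
  have hUo := isOpen_overlap p q
  set F : E4 → ℝ := fun y => loc p (density g p) y * (loc p (divIn g p X) y
    - loc p (divIn g q X) y) with hF
  have hq' : ContinuousOn (loc p (divIn g q X)) (overlap p q) := by
    have h1 : ContinuousOn (loc q (divIn g q X) ∘ trans p q) (overlap p q) :=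
      (contDiffOn_loc_divIn hX q).continuousOn.comp (contDiffOn_trans p q).continuousOn
        fun y hy => overlap_subset q p (mapsTo_trans p q hy)
    exact h1.congr fun y hy => loc_eq_comp_trans _ hy
  have hFc : ContinuousOn F (overlap p q) :=
    ((contDiffOn_loc_density g p).continuousOn.mono (overlap_subset p q)).mul
      (((contDiffOn_loc_divIn hX p).continuousOn.mono (overlap_subset p q)).sub hq')
  -- Instead of computing with coordinate changes: integrated against a function supported in both
  -- charts, each formula gives the same invariant integral −∫ g(∇f, X). Hence the difference of the
  -- formulas vanishes against all test functions.
  have hae : ∀ᵐ y, y ∈ overlap p q → F y = 0 := by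
    refine hUo.ae_eq_zero_of_integral_contDiff_smul_eq_zero
      (hFc.locallyIntegrableOn hUo.measurableSet) fun ψ hψ hψc hψs => ?_
    set B := tsupport ψ with hB
    have hBd : B ⊆ dom p := hψs.trans (overlap_subset p q)
    have hψt : TestFn B ψ := ⟨hψ, hψc, subset_rfl⟩
    have hψ0 : ∀ y, y ∉ B → ψ y = 0 := fun y hy => hψt.eq_zero hy
    have hs := suppIn_push (p := p) hψ0
    have hsm := contMDiff_push hψt hBd
    have hB' : IsCompact (trans p q '' B) :=
      IsCompact.image_of_continuousOn hψc ((contDiffOn_trans p q).continuousOn.mono hψs)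
    have hB'd : trans p q '' B ⊆ dom q := by
      rintro z ⟨y, hy, rfl⟩
      exact overlap_subset q p (mapsTo_trans p q (hψs hy))
    have hs' : SuppIn q (trans p q '' B) (push p ψ) := by
      intro x hx
      obtain ⟨h1, h2⟩ := hs x hx
      have h3 : x ∈ src q := by simpa only [Set.mem_preimage, symm_chart h1] using (hψs h2).2
      exact ⟨h3, _, h2, trans_chart h1⟩
    have e1 := hs.integral_mul_divIn hψc hBd hsm hX (g := g)
    have e2 := hs'.integral_mul_divIn hB' hB'd hsm hX (g := g)
    rw [← e2, hs.integral_mul, hs.integral_mul, ext0_push hψ0 hBd] at e1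
    have hint : ∀ {G : E4 → ℝ}, ContinuousOn G (overlap p q) →
        Integrable (fun y => ψ y * (loc p (density g p) y * G y)) := by
      intro G hG
      have hc : ContinuousOn (fun y => ψ y * (loc p (density g p) y * G y)) B :=
        (hψ.continuous.continuousOn).mul
          (((contDiffOn_loc_density g p).continuousOn.mono hBd).mul (hG.mono hψs))
      refine (integrableOn_iff_integrable_of_support_subset fun y hy => ?_).1
        (hc.integrableOn_compact hψc)
      by_contra h0
      exact hy (by simp [hψ0 y h0])
    have i1 := hint ((contDiffOn_loc_divIn (g := g) hX p).continuousOn.mono (overlap_subset p q))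
    have i2 := hint hq'
    have : ∀ y, ψ y • F y = ψ y * (loc p (density g p) y * loc p (divIn g p X) y)
        - ψ y * (loc p (density g p) y * loc p (divIn g q X) y) := fun y => by
      simp only [hF, smul_eq_mul]; ring
    simp only [this]
    rw [integral_sub i1 i2, e1, sub_self]
  -- Both formulas are continuous, so equality almost everywhere is equality everywhere on the
  -- overlap.
  have hF0 : Set.EqOn F (fun _ => 0) (overlap p q) :=
    Measure.eqOn_open_of_ae_eq (μ := volume) ((ae_restrict_iff' hUo.measurableSet).2 hae) hUo hFc
      continuousOn_const
  have h0 := hF0 (chart_mem_overlap hp hq)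
  have h1 : loc p (density g p) (extChartAt (𝓡 4) p x) ≠ 0 :=
    (loc_density_pos (chart_mem_dom hp)).ne'
  have h2 := (mul_eq_zero.1 h0).resolve_left h1
  simp only [loc, Function.comp_apply, symm_chart hp] at h2
  linarith

lemma div_eq_divIn {p x : M} (hp : x ∈ src p) {X : ∀ x : M, TangentSpace (𝓡 4) x}
    (hX : SmoothField X) : div g X x = divIn g p X x :=
  divIn_eq_divIn (mem_src x) hp hX

lemma contMDiff_div {X : ∀ x : M, TangentSpace (𝓡 4) x} (hX : SmoothField X) :
    ContMDiff (𝓡 4) 𝓘(ℝ, ℝ) ∞ (div g X) :=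
  contMDiff_iff_loc.2 fun p => (contDiffOn_loc_divIn hX p).congr fun _ hy =>
    div_eq_divIn (symm_mem_src hy) hX

lemma pderiv_sum {ι : Type*} (s : Finset ι) {f : ι → M → ℝ}
    (hf : ∀ a ∈ s, ContMDiff (𝓡 4) 𝓘(ℝ, ℝ) ∞ (f a)) {p x : M} (hx : x ∈ src p) (i : Fin 4) :
    pderiv p i (fun x => ∑ a ∈ s, f a x) x = ∑ a ∈ s, pderiv p i (f a) x :=
  pd_sum s (fun a ha => ContMDiff.differentiableAt_loc (hf a ha) (chart_mem_dom hx)) i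

/-- The divergence theorem. -/
theorem integral_mul_div {f : M → ℝ} (hf : ContMDiff (𝓡 4) 𝓘(ℝ, ℝ) ∞ f)
    {X : ∀ x : M, TangentSpace (𝓡 4) x} (hX : SmoothField X) :
    ∫ x, f x * div g X x ∂(vol g) = - ∫ x, g.inner x (grad g f x) (X x) ∂(vol g) := by
  obtain ⟨𝒜⟩ := exists_finAtlas (M := M)
  have hs : ∀ p, ContMDiff (𝓡 4) 𝓘(ℝ, ℝ) ∞ (fun x => 𝒜.θ p x * f x) := fun p =>
    (𝒜.smooth p).mul hf
  have h1 : ∀ x, f x * div g X x = ∑ p ∈ 𝒜.ι, 𝒜.θ p x * f x * div g X x := fun x => by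
    rw [← Finset.sum_mul, ← 𝒜.eq_sum]
  -- The partition of unity multiplies f inside the gradient, so no derivatives of it are left over:
  -- the sum of the localized functions is f itself.
  have h2 : ∀ x, g.inner x (grad g f x) (X x)
      = ∑ p ∈ 𝒜.ι, g.inner x (grad g (fun x => 𝒜.θ p x * f x) x) (X x) := by
    intro x
    have hfe : f = fun x => ∑ p ∈ 𝒜.ι, 𝒜.θ p x * f x := funext fun x => 𝒜.eq_sum f x
    simp only [inner_grad_left (mem_src x) (hs _)]
    rw [inner_grad_left (mem_src x) hf, Finset.sum_comm]
    refine Finset.sum_congr rfl fun i _ => ?_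
    conv_lhs => rw [hfe]
    rw [pderiv_sum 𝒜.ι (fun a _ => hs a) (mem_src x), Finset.sum_mul]
  have h3 : ∀ p ∈ 𝒜.ι, Integrable (fun x => 𝒜.θ p x * f x * div g X x) (vol g) := fun p _ =>
    integrable_of_contMDiff ((hs p).mul (contMDiff_div hX))
  simp only [h1, h2]
  rw [integral_finsetSum _ h3,
    integral_finsetSum _ fun p _ => integrable_of_contMDiff (contMDiff_inner_grad (hs p) hX),
    ← Finset.sum_neg_distrib]
  refine Finset.sum_congr rfl fun p _ => ?_
  have hsp := (𝒜.supp p).mul_right f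
  rw [← hsp.integral_mul_divIn (𝒜.compact p) (𝒜.subset p) (hs p) hX]
  refine integral_congr_ae (Filter.Eventually.of_forall fun x => ?_)
  simp only
  by_cases h0 : 𝒜.θ p x * f x = 0
  · rw [h0, zero_mul, zero_mul]
  · rw [div_eq_divIn (hsp x h0).1 hX]

end Divergence

/-! ### The Laplacian and the Paneitz operator on smooth functions -/

section Laplacian

variable {M : Type*} [TopologicalSpace M] [ChartedSpace E4 M] [IsManifold (𝓡 4) ∞ M]
  {g : Metric M}

lemma SmoothField.add {X Y : ∀ x : M, TangentSpace (𝓡 4) x} (hX : SmoothField X)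
    (hY : SmoothField Y) : SmoothField (fun x => X x + Y x) := fun p i =>
  ((hX p i).add (hY p i)).congr fun y _ => by
    simp only [loc, Function.comp_apply, coordComp_add]

lemma SmoothField.smul {X : ∀ x : M, TangentSpace (𝓡 4) x} (hX : SmoothField X) {f : M → ℝ}
    (hf : ContMDiff (𝓡 4) 𝓘(ℝ, ℝ) ∞ f) : SmoothField (fun x => f x • X x) := fun p i =>
  ((ContMDiff.loc hf p).mul (hX p i)).congr fun y _ => by
    simp only [loc, Function.comp_apply, coordComp_smul]

lemma SmoothField.ricciSharp {X : ∀ x : M, TangentSpace (𝓡 4) x} (hX : SmoothField X) :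
    SmoothField (fun x => ricciSharp g x (X x)) := by
  intro p i
  have h : ContDiffOn ℝ ∞ (fun y => ∑ j, loc p (fun x => gramInv g p x i j) y
      * ∑ a, loc p (ricciComp g p a j) y * loc p (fun x => coordComp p a x (X x)) y) (dom p) :=
    ContDiffOn.sum fun j _ => (contDiffOn_loc_gramInv g p i j).mul
      (ContDiffOn.sum fun a _ => (contDiffOn_loc_ricciComp g p a j).mul (hX p a))
  refine h.congr fun y hy => ?_
  simp only [loc, Function.comp_apply]
  rw [coordComp_eq_sum g (symm_mem_src hy)]
  refine Finset.sum_congr rfl fun j _ => ?_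
  rw [inner_ricciSharp, ricci_eq g (symm_mem_src hy)]
  simp only [coordComp_coordVec_self (symm_mem_src hy), mul_ite, mul_one, mul_zero,
    Finset.sum_ite_eq', Finset.mem_univ, if_true]

/-- The vector field in the divergence term of the Paneitz operator. -/
noncomputable def paneitzField (g : Metric M) (φ : M → ℝ) (z : M) : TangentSpace (𝓡 4) z :=
  (2 / 3 * scalarCurv g z) • grad g φ z - (2 : ℝ) • ricciSharp g z (grad g φ z)

lemma smoothField_paneitzField {φ : M → ℝ} (hφ : ContMDiff (𝓡 4) 𝓘(ℝ, ℝ) ∞ φ) :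
    SmoothField (paneitzField g φ) := by
  have h1 := (smoothField_grad (g := g) hφ).smul
    ((contMDiff_const (c := (2 / 3 : ℝ))).mul (contMDiff_scalarCurv g))
  have h2 := (SmoothField.ricciSharp (g := g) (smoothField_grad (g := g) hφ)).smul
    (contMDiff_const (c := (-2 : ℝ)))
  have h3 := h1.add h2
  have : (fun x => (2 / 3 * scalarCurv g x) • grad g φ x
      + (-2 : ℝ) • Paneitz.ricciSharp g x (grad g φ x)) = paneitzField g φ := by
    funext x
    rw [paneitzField, neg_smul, sub_eq_add_neg]
  rw [← this]
  exact h3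

/-- The first order coefficients of the Laplacian in the chart at `p`. -/
noncomputable def drift (g : Metric M) (p : M) (j : Fin 4) (y : E4) : ℝ :=
  (loc p (density g p) y)⁻¹
    * ∑ i, pd i (fun z => loc p (density g p) z * loc p (fun x => gramInv g p x i j) z) y

lemma contDiffOn_drift (p : M) (j : Fin 4) : ContDiffOn ℝ ∞ (drift g p j) (dom p) :=
  ((contDiffOn_loc_density g p).inv fun _ hy => (loc_density_pos hy).ne').mul
    (ContDiffOn.sum fun i _ => pd_contDiffOn (isOpen_dom p)
      ((contDiffOn_loc_density g p).mul (contDiffOn_loc_gramInv g p i j)) i)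

variable [T2Space M] [CompactSpace M] [MeasurableSpace M] [BorelSpace M]

lemma contMDiff_laplacian {f : M → ℝ} (hf : ContMDiff (𝓡 4) 𝓘(ℝ, ℝ) ∞ f) :
    ContMDiff (𝓡 4) 𝓘(ℝ, ℝ) ∞ (laplacian g f) :=
  contMDiff_div (smoothField_grad hf)

lemma contMDiff_paneitz {f : M → ℝ} (hf : ContMDiff (𝓡 4) 𝓘(ℝ, ℝ) ∞ f) :
    ContMDiff (𝓡 4) 𝓘(ℝ, ℝ) ∞ (paneitz g f) :=
  (contMDiff_laplacian (contMDiff_laplacian hf)).sub (contMDiff_div (smoothField_paneitzField hf))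

lemma contMDiff_qCurv : ContMDiff (𝓡 4) 𝓘(ℝ, ℝ) ∞ (qCurv g) :=
  contMDiff_const.mul (((contMDiff_laplacian (contMDiff_scalarCurv g)).sub
    ((contMDiff_scalarCurv g).pow 2)).add (contMDiff_const.mul (contMDiff_ricciNormSq g)))

/-- Non-divergence form, with leading coefficients g^ij, as required by `elliptic_estimate`. -/
lemma loc_laplacian {f : M → ℝ} (hf : ContMDiff (𝓡 4) 𝓘(ℝ, ℝ) ∞ f) {p : M} {y : E4}
    (hy : y ∈ dom p) : loc p (laplacian g f) y
      = (∑ i, ∑ j, loc p (fun x => gramInv g p x i j) y * pd i (pd j (loc p f)) y)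
        + ∑ j, drift g p j y * pd j (loc p f) y := by
  have hd := isOpen_dom p
  have h1 : loc p (laplacian g f) y = loc p (divIn g p (grad g f)) y :=
    div_eq_divIn (symm_mem_src hy) (smoothField_grad hf)
  have h2 : ∀ i, Set.EqOn (loc p fun z => density g p z * coordComp p i z (grad g f z))
      (fun y => ∑ j, (loc p (density g p) y * loc p (fun x => gramInv g p x i j) y)
        * pd j (loc p f) y) (dom p) := by
    intro i z hz
    simp only [loc, Function.comp_apply]
    rw [coordComp_grad g (symm_mem_src hz)
      (ContMDiff.differentiableAt_loc hf (chart_mem_dom (symm_mem_src hz))), Finset.mul_sum]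
    simp only [pderiv_symm _ _ _ hz, mul_assoc]
  have hs1 := fun i j => (contDiffOn_loc_density g p).mul (contDiffOn_loc_gramInv g p i j)
  have hs2 := fun j => pd_contDiffOn hd (ContMDiff.loc hf p) j
  have h3 : ∀ i, pd i (loc p fun z => density g p z * coordComp p i z (grad g f z)) y
      = ∑ j, (pd i (fun z => loc p (density g p) z * loc p (fun x => gramInv g p x i j) z) y
        * pd j (loc p f) y
        + loc p (density g p) y * loc p (fun x => gramInv g p x i j) y
          * pd i (pd j (loc p f)) y) := by
    intro i
    rw [pd_congr_of_eqOn hd (h2 i) hy i, pd_sum _ fun j _ =>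
      differentiableAt_of_contDiffOn hd ((hs1 i j).mul (hs2 j)) hy]
    exact Finset.sum_congr rfl fun j _ => pd_mul (differentiableAt_of_contDiffOn hd (hs1 i j) hy)
      (differentiableAt_of_contDiffOn hd (hs2 j) hy) i
  have hρ := (loc_density_pos (g := g) hy).ne'
  rw [h1, loc_divIn p _ hy]
  simp only [h3, Finset.sum_add_distrib, mul_add]
  rw [add_comm]
  congr 1
  · simp only [Finset.mul_sum]
    refine Finset.sum_congr rfl fun i _ => Finset.sum_congr rfl fun j _ => ?_
    rw [← mul_assoc, ← mul_assoc, inv_mul_cancel₀ hρ, one_mul]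
  · simp only [drift, Finset.mul_sum, Finset.sum_mul]
    rw [Finset.sum_comm]
    exact Finset.sum_congr rfl fun j _ => Finset.sum_congr rfl fun i _ => by ring

lemma integral_mul_laplacian {ψ φ : M → ℝ} (hψ : ContMDiff (𝓡 4) 𝓘(ℝ, ℝ) ∞ ψ)
    (hφ : ContMDiff (𝓡 4) 𝓘(ℝ, ℝ) ∞ φ) : ∫ x, ψ x * laplacian g φ x ∂(vol g)
      = - ∫ x, g.inner x (grad g ψ x) (grad g φ x) ∂(vol g) :=
  integral_mul_div hψ (smoothField_grad hφ)

lemma integral_mul_laplacian_comm {ψ φ : M → ℝ} (hψ : ContMDiff (𝓡 4) 𝓘(ℝ, ℝ) ∞ ψ)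
    (hφ : ContMDiff (𝓡 4) 𝓘(ℝ, ℝ) ∞ φ) : ∫ x, ψ x * laplacian g φ x ∂(vol g)
      = ∫ x, laplacian g ψ x * φ x ∂(vol g) := by
  rw [integral_mul_laplacian hψ hφ]
  simp only [mul_comm (laplacian g ψ _)]
  rw [integral_mul_laplacian hφ hψ]
  simp only [g.symm _ (grad g ψ _)]

/-- Self-adjointness of the Laplacian handles the fourth order term and the divergence theorem the
second order term. The right side is the Paneitz form with classical derivatives. -/
lemma integral_mul_paneitz {ψ φ : M → ℝ} (hψ : ContMDiff (𝓡 4) 𝓘(ℝ, ℝ) ∞ ψ)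
    (hφ : ContMDiff (𝓡 4) 𝓘(ℝ, ℝ) ∞ φ) : ∫ x, ψ x * paneitz g φ x ∂(vol g)
      = (∫ x, laplacian g ψ x * laplacian g φ x ∂(vol g))
        + 2 / 3 * (∫ x, scalarCurv g x * g.inner x (grad g ψ x) (grad g φ x) ∂(vol g))
        - ∫ x, 2 * ricci g x (grad g ψ x) (grad g φ x) ∂(vol g) := by
  have hΔ := contMDiff_laplacian (g := g) hφ
  have hX := smoothField_paneitzField (g := g) hφ
  have i1 : Integrable (fun x => ψ x * laplacian g (laplacian g φ) x) (vol g) :=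
    integrable_of_contMDiff (hψ.mul (contMDiff_laplacian hΔ))
  have i2 : Integrable (fun x => ψ x * div g (paneitzField g φ) x) (vol g) :=
    integrable_of_contMDiff (hψ.mul (contMDiff_div hX))
  have h1 : ∀ x, ψ x * paneitz g φ x = ψ x * laplacian g (laplacian g φ) x
      - ψ x * div g (paneitzField g φ) x := fun x => mul_sub _ _ _
  simp only [h1]
  rw [integral_sub i1 i2, integral_mul_laplacian_comm hψ hΔ, integral_mul_div hψ hX]
  have h2 : ∀ x, g.inner x (grad g ψ x) (paneitzField g φ x)
      = 2 / 3 * (scalarCurv g x * g.inner x (grad g ψ x) (grad g φ x))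
        - 2 * ricci g x (grad g ψ x) (grad g φ x) := by
    intro x
    rw [paneitzField, map_sub, map_smul, map_smul, g.symm x _ (ricciSharp _ _ _),
      inner_ricciSharp, ricci_symm]
    simp only [smul_eq_mul]
    ring
  have i3 : Integrable (fun x => 2 / 3 * (scalarCurv g x * g.inner x (grad g ψ x) (grad g φ x)))
      (vol g) := integrable_of_contMDiff (contMDiff_const.mul ((contMDiff_scalarCurv g).mul
        (contMDiff_inner_grad hψ (smoothField_grad hφ))))
  -- The Ricci term is integrable as the difference of two smooth functions already at hand.
  have i4 : Integrable (fun x => 2 * ricci g x (grad g ψ x) (grad g φ x)) (vol g) := by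
    have := i3.sub (integrable_of_contMDiff (g := g)
      (contMDiff_inner_grad (g := g) hψ hX))
    refine this.congr (Filter.Eventually.of_forall fun x => ?_)
    simp only [Pi.sub_apply, h2]
    ring
  simp only [h2]
  rw [integral_sub i3 i4, integral_const_mul]
  ring

end Laplacian

/-! ### Local estimates for smooth functions -/

section LocalEstimates

variable {M : Type*} [TopologicalSpace M] [ChartedSpace E4 M] [IsManifold (𝓡 4) ∞ M]
  (g : Metric M)

lemma inner_self_nonneg (x : M) (v : TangentSpace (𝓡 4) x) : 0 ≤ g.inner x v v := by
  by_cases h : v = 0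
  · simp [h]
  · exact (g.pos x v h).le

lemma inner_sq_le (x : M) (v w : TangentSpace (𝓡 4) x) :
    g.inner x v w ^ 2 ≤ g.inner x v v * g.inner x w w := by
  have h : ∀ t : ℝ, 0 ≤ g.inner x w w * (t * t) + (2 * g.inner x v w) * t + g.inner x v v := by
    intro t
    have := inner_self_nonneg g x (v + t • w)
    simp only [map_add, map_smul, _root_.add_apply, _root_.smul_apply, smul_eq_mul] at this
    rw [g.symm x w v] at this
    linarith
  have := discrim_le_zero h
  rw [discrim] at this
  nlinarith

/-- Cauchy–Schwarz against the vector e dual to the i-th coordinate: g(e, v) is the i-th component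
of v, and g(e, e) = g^ii. -/
lemma coordComp_sq_le {p x : M} (hx : x ∈ src p) (v : TangentSpace (𝓡 4) x) (i : Fin 4) :
    coordComp p i x v ^ 2 ≤ gramInv g p x i i * g.inner x v v := by
  set e : TangentSpace (𝓡 4) x := ∑ k, (∑ j, gramInv g p x k j * (if j = i then 1 else 0))
    • coordVec p k x with he
  have h1 : ∀ k, g.inner x e (coordVec p k x) = if k = i then 1 else 0 := fun k =>
    inner_sum_gramInv g hx (fun j => if j = i then (1 : ℝ) else 0) k
  have h2 : ∀ w, g.inner x e w = coordComp p i x w := by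
    intro w
    rw [inner_eq_sum_coordVec hx]
    simp [h1]
  have h3 : g.inner x e e = gramInv g p x i i := by
    rw [h2, coordComp_eq_sum g hx]
    simp [h1]
  rw [← h2, ← h3]
  exact inner_sq_le g x e v

variable [T2Space M] [CompactSpace M] [MeasurableSpace M] [BorelSpace M]

lemma exists_setIntegral_le {p : M} {B : Set E4} (hB : IsCompact B) (hBd : B ⊆ dom p) :
    ∃ K, 0 ≤ K ∧ ∀ h : M → ℝ, Continuous h → (∀ x, 0 ≤ h x) →
      ∫ y in B, loc p h y ≤ K * ∫ x, h x ∂(vol g) := by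
  obtain ⟨C, hC, hle⟩ := exists_lintegral_le g hB hBd
  refine ⟨C.toReal, ENNReal.toReal_nonneg, fun h hh h0 => ?_⟩
  have hint : Integrable h (vol g) :=
    hh.integrable_of_hasCompactSupport (HasCompactSupport.of_compactSpace h)
  have hloc : ContinuousOn (loc p h) B :=
    hh.comp_continuousOn ((continuousOn_extChartAt_symm p).mono hBd)
  have h1 := (hle (fun x => ENNReal.ofReal (h x)) hh.measurable.ennreal_ofReal.aemeasurable).2
  have h2 : ∫ y in B, loc p h y = (∫⁻ y in B, ENNReal.ofReal (loc p h y)).toReal :=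
    integral_eq_lintegral_of_nonneg_ae (Filter.Eventually.of_forall fun y => h0 _)
      (hloc.aestronglyMeasurable hB.measurableSet)
  rw [h2, integral_eq_lintegral_of_nonneg_ae (Filter.Eventually.of_forall h0) hint.aestronglyMeasurable,
    ← ENNReal.toReal_mul]
  refine ENNReal.toReal_mono (ENNReal.mul_ne_top hC ?_) (h1.trans ?_)
  · rw [← ofReal_integral_eq_lintegral_ofReal hint (Filter.Eventually.of_forall h0)]
    exact ENNReal.ofReal_ne_top
  · exact mul_le_mul_right (setLIntegral_le_lintegral _ _) _

lemma exists_abs_le {B : Set E4} (hB : IsCompact B) {ι : Type*} [Finite ι] {f : ι → E4 → ℝ}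
    (hf : ∀ a, ContinuousOn (f a) B) : ∃ K, 0 ≤ K ∧ ∀ a, ∀ y ∈ B, |f a y| ≤ K := by
  have h : ∀ a, ∃ K, ∀ y ∈ B, |f a y| ≤ K := fun a => by
    obtain ⟨K, hK⟩ := hB.exists_bound_of_continuousOn (hf a)
    exact ⟨K, hK⟩
  choose K hK using h
  cases nonempty_fintype ι
  refine ⟨∑ a, |K a|, Finset.sum_nonneg fun a _ => abs_nonneg _, fun a y hy => ?_⟩
  exact ((hK a y hy).trans (le_abs_self _)).trans
    (Finset.single_le_sum (f := fun a => |K a|) (fun b _ => abs_nonneg _) (Finset.mem_univ a))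

/-- The square of the Sobolev norm of a smooth function. -/
noncomputable def sobSq (φ : M → ℝ) : ℝ :=
  (∫ x, φ x ^ 2 ∂(vol g)) + ∫ x, laplacian g φ x ^ 2 ∂(vol g)

variable {g}

lemma sobSq_nonneg (φ : M → ℝ) : 0 ≤ sobSq g φ :=
  add_nonneg (integral_nonneg fun _ => sq_nonneg _) (integral_nonneg fun _ => sq_nonneg _)

/-- The Dirichlet integral equals −∫ φ Δφ; Young's inequality splits the product with arbitrary
weight. -/
lemma integral_grad_sq_le {φ : M → ℝ} (hφ : ContMDiff (𝓡 4) 𝓘(ℝ, ℝ) ∞ φ) {ε : ℝ} (hε : 0 < ε) :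
    ∫ x, g.inner x (grad g φ x) (grad g φ x) ∂(vol g)
      ≤ ε * (∫ x, laplacian g φ x ^ 2 ∂(vol g)) + (4 * ε)⁻¹ * ∫ x, φ x ^ 2 ∂(vol g) := by
  have h1 := integral_mul_laplacian (g := g) hφ hφ
  have hΔ := contMDiff_laplacian (g := g) hφ
  have i1 : Integrable (fun x => φ x ^ 2) (vol g) := integrable_of_contMDiff (hφ.pow 2)
  have i2 : Integrable (fun x => laplacian g φ x ^ 2) (vol g) := integrable_of_contMDiff (hΔ.pow 2)
  have i3 : Integrable (fun x => φ x * laplacian g φ x) (vol g) :=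
    integrable_of_contMDiff (hφ.mul hΔ)
  rw [← integral_const_mul, ← integral_const_mul, ← integral_add (i2.const_mul _) (i1.const_mul _),
    ← neg_eq_iff_eq_neg.2 h1, ← integral_neg]
  refine integral_mono i3.neg ((i2.const_mul _).add (i1.const_mul _)) fun x => ?_
  simp only
  have h2 : 0 ≤ (4 * ε)⁻¹ * (φ x + 2 * ε * laplacian g φ x) ^ 2 := by positivity
  have h3 : (4 * ε)⁻¹ * (φ x + 2 * ε * laplacian g φ x) ^ 2
      = (4 * ε)⁻¹ * φ x ^ 2 + φ x * laplacian g φ x + ε * laplacian g φ x ^ 2 := by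
    field_simp
    ring
  linarith

lemma integral_grad_sq_le_sobSq {φ : M → ℝ} (hφ : ContMDiff (𝓡 4) 𝓘(ℝ, ℝ) ∞ φ) :
    ∫ x, g.inner x (grad g φ x) (grad g φ x) ∂(vol g) ≤ sobSq g φ := by
  have h := integral_grad_sq_le (g := g) hφ (ε := 1) one_pos
  have h1 : 0 ≤ ∫ x, φ x ^ 2 ∂(vol g) := integral_nonneg fun _ => sq_nonneg _
  unfold sobSq
  norm_num at h
  linarith

variable (g)

/-- Cauchy–Schwarz for the metric bounds (∂_i φ)² = g(∇φ, ∂_i)² by g_ii |∇φ|², and g_ii is bounded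
on B. -/
lemma exists_setIntegral_pd_sq_le {p : M} {B : Set E4} (hB : IsCompact B) (hBd : B ⊆ dom p) :
    ∃ K, 0 ≤ K ∧ ∀ φ : M → ℝ, ContMDiff (𝓡 4) 𝓘(ℝ, ℝ) ∞ φ → ∀ i,
      ∫ y in B, pd i (loc p φ) y ^ 2 ≤ K * sobSq g φ := by
  obtain ⟨K, hK, h⟩ := exists_setIntegral_le g hB hBd
  obtain ⟨L, hL, hgL⟩ := exists_abs_le hB
    (fun i => (contDiffOn_loc_gram g p i i).continuousOn.mono hBd)
  refine ⟨L * K, mul_nonneg hL hK, fun φ hφ i => ?_⟩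
  have hX := contMDiff_inner_grad (g := g) hφ (smoothField_grad (g := g) hφ)
  have h2 := h _ hX.continuous fun x => inner_self_nonneg g x _
  have hle : ∀ y ∈ B, pd i (loc p φ) y ^ 2
      ≤ L * loc p (fun x => g.inner x (grad g φ x) (grad g φ x)) y := by
    intro y hy
    have hs := symm_mem_src (hBd hy)
    rw [← pderiv_symm p i φ (hBd hy), ← inner_grad g hs
      (ContMDiff.differentiableAt_loc hφ (chart_mem_dom hs))]
    refine (inner_sq_le g _ _ _).trans ?_
    rw [mul_comm]
    exact mul_le_mul_of_nonneg_right ((le_abs_self _).trans (hgL i y hy))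
      (inner_self_nonneg g _ _)
  have hc1 : ContinuousOn (fun y => pd i (loc p φ) y ^ 2) B :=
    ((pd_contDiffOn (isOpen_dom p) (ContMDiff.loc hφ p) i).continuousOn.mono hBd).pow 2
  have hc2 : ContinuousOn (fun y => L * loc p (fun x => g.inner x (grad g φ x) (grad g φ x)) y) B :=
    continuousOn_const.mul ((ContMDiff.loc hX p).continuousOn.mono hBd)
  calc ∫ y in B, pd i (loc p φ) y ^ 2
      ≤ ∫ y in B, L * loc p (fun x => g.inner x (grad g φ x) (grad g φ x)) y :=
        setIntegral_mono_on (hc1.integrableOn_compact hB) (hc2.integrableOn_compact hB)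
          hB.measurableSet hle
    _ = L * ∫ y in B, loc p (fun x => g.inner x (grad g φ x) (grad g φ x)) y :=
        integral_const_mul _ _
    _ ≤ L * (K * sobSq g φ) := by
        gcongr
        exact h2.trans (mul_le_mul_of_nonneg_left (integral_grad_sq_le_sobSq hφ) hK)
    _ = L * K * sobSq g φ := by ring

lemma pd_pd_mul {χ f : E4 → ℝ} {U : Set E4} (hU : IsOpen U) (hχ : ContDiff ℝ ∞ χ)
    (hf : ContDiffOn ℝ ∞ f U) {y : E4} (hy : y ∈ U) (i j : Fin 4) :
    pd i (pd j (fun z => χ z * f z)) y = pd i (pd j χ) y * f y + pd j χ y * pd i f y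
      + (pd i χ y * pd j f y + χ y * pd i (pd j f) y) := by
  have d1 := fun z (hz : z ∈ U) => differentiableAt_of_contDiffOn hU hf hz
  have d2 : ∀ {k : E4 → ℝ}, ContDiff ℝ ∞ k → ∀ z, DifferentiableAt ℝ k z := fun hk z =>
    hk.differentiable (by simp) z
  have d3 := differentiableAt_of_contDiffOn hU (pd_contDiffOn hU hf j) hy
  rw [pd_congr_of_eqOn hU (fun z hz => pd_mul (d2 hχ z) (d1 z hz) j) hy i,
    pd_add ((d2 (pd_contDiff hχ j) y).fun_mul (d1 y hy)) ((d2 hχ y).fun_mul d3),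
    pd_mul (d2 (pd_contDiff hχ j) y) (d1 y hy), pd_mul (d2 hχ y) d3]

set_option maxHeartbeats 1000000 in
/-- The local `L²` estimate for the second derivatives. -/
theorem exists_setIntegral_pd_pd_sq_le {p : M} {B : Set E4} (hB : IsCompact B) (hBd : B ⊆ dom p) :
    ∃ K, 0 ≤ K ∧ ∀ φ : M → ℝ, ContMDiff (𝓡 4) 𝓘(ℝ, ℝ) ∞ φ → ∀ i j,
      ∫ y in B, pd i (pd j (loc p φ)) y ^ 2 ≤ K * sobSq g φ := by
  have hd := isOpen_dom p
  obtain ⟨χ, C, hC, hCd, hχ, hχ1, hχI⟩ := exists_cutoff hB hd hBd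
  -- A second cutoff extends the coefficients g^ij smoothly to the whole space without changing them
  -- on C, where the localized function lives.
  obtain ⟨χ', C', hC', hCd', hχ', hχ1', -⟩ := exists_cutoff hC hd hCd
  set G : Fin 4 → Fin 4 → E4 → ℝ := fun i j => loc p fun x => gramInv g p x i j with hG
  have hGs : ∀ i j, ContDiffOn ℝ ∞ (G i j) (dom p) := contDiffOn_loc_gramInv g p
  have hχ1C : ∀ y ∈ C, χ' y = 1 := fun y hy => hχ1'.self_of_nhdsSet y hy
  obtain ⟨K1, hK1⟩ := elliptic_estimate hC
    (A := fun y => Matrix.of fun i j => χ' y * G i j y)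
    (fun i j => (hχ'.mul_contDiffOn hd hCd' (hGs i j)).smooth) (fun y hy => by
      have : (Matrix.of fun i j => χ' y * G i j y)
          = gramInv g p ((extChartAt (𝓡 4) p).symm y) := by
        ext i j; simp only [Matrix.of_apply, hχ1C y hy, one_mul]; rfl
      rw [this]
      exact gramInv_posDef g (symm_mem_src (hCd hy)))
  obtain ⟨K2, hK2, hI⟩ := exists_setIntegral_le g hC hCd
  obtain ⟨K3, hK3, hD⟩ := exists_setIntegral_pd_sq_le g hC hCd
  -- coefficients
  set a : E4 → ℝ := fun y => ∑ i, ∑ j, G i j y * pd i (pd j χ) y with ha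
  set b : Fin 4 → E4 → ℝ := fun i y => (∑ j, (G i j y + G j i y) * pd j χ y)
    - χ y * drift g p i y with hb
  have hGc : ∀ i j, ContinuousOn (G i j) C := fun i j => (hGs i j).continuousOn.mono hCd
  obtain ⟨L1, hL1, ha1⟩ := exists_abs_le hC (ι := Unit) (f := fun _ => a) fun _ =>
    continuousOn_finsetSum _ fun i _ => continuousOn_finsetSum _ fun j _ =>
      (hGc i j).mul ((hχ.pd j).pd i).continuous.continuousOn
  obtain ⟨L2, hL2, hb1⟩ := exists_abs_le hC (f := b) fun i =>
    (continuousOn_finsetSum _ fun j _ => ((hGc i j).add (hGc j i)).mul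
      (hχ.pd j).continuous.continuousOn).sub
      (hχ.continuous.continuousOn.mul ((contDiffOn_drift p i).continuousOn.mono hCd))
  obtain ⟨L3, hL3, hc1⟩ := exists_abs_le hC (f := fun i => pd i χ) fun i =>
    (hχ.pd i).continuous.continuousOn
  set L := 1 + L1 ^ 2 + L2 ^ 2 + L3 ^ 2 with hLdef
  set Kt := |K1| * (12 * L * (2 * K2 + 4 * K3) + 8 * L * (K2 + K3)) with hKt
  have hL0 : 0 ≤ L := by positivity
  refine ⟨Kt, by positivity, fun φ hφ k l => ?_⟩
  set f := loc p φ with hf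
  have hfs : ContDiffOn ℝ ∞ f (dom p) := ContMDiff.loc hφ p
  have hΔ := contMDiff_laplacian (g := g) hφ
  have hv := hχ.mul_contDiffOn hd hCd hfs
  set v : E4 → ℝ := fun y => χ y * f y with hvdef
  set S := sobSq g φ with hS
  have hS0 : 0 ≤ S := sobSq_nonneg φ
  have hdf : ∀ y ∈ C, DifferentiableAt ℝ f y := fun y hy =>
    differentiableAt_of_contDiffOn hd hfs (hCd hy)
  -- the three basic integrals
  have J0 : ∫ y in C, f y ^ 2 ≤ K2 * S := by
    have := hI (fun x => φ x ^ 2) (hφ.continuous.pow 2) fun x => sq_nonneg _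
    refine this.trans (mul_le_mul_of_nonneg_left ?_ hK2)
    exact le_add_of_nonneg_right (integral_nonneg fun _ => sq_nonneg _)
  have J2 : ∫ y in C, loc p (laplacian g φ) y ^ 2 ≤ K2 * S := by
    have := hI (fun x => laplacian g φ x ^ 2) (hΔ.continuous.pow 2) fun x => sq_nonneg _
    refine this.trans (mul_le_mul_of_nonneg_left ?_ hK2)
    exact le_add_of_nonneg_left (integral_nonneg fun _ => sq_nonneg _)
  have J1 : ∀ i, ∫ y in C, pd i f y ^ 2 ≤ K3 * S := hD φ hφ
  have c0 : IntegrableOn (fun y => f y ^ 2) C :=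
    ((hfs.continuousOn.mono hCd).pow 2).integrableOn_compact hC
  have c2 : IntegrableOn (fun y => loc p (laplacian g φ) y ^ 2) C :=
    (((ContMDiff.loc hΔ p).continuousOn.mono hCd).pow 2).integrableOn_compact hC
  have c1 : ∀ i, IntegrableOn (fun y => pd i f y ^ 2) C := fun i =>
    (((pd_contDiffOn hd hfs i).continuousOn.mono hCd).pow 2).integrableOn_compact hC
  -- first derivatives of `v`
  have F1 : ∀ i, ∫ y, pd i v y ^ 2 ≤ 2 * L * (K2 + K3) * S := by
    intro i
    have e1 : ∫ y, pd i v y ^ 2 = ∫ y in C, pd i v y ^ 2 :=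
      (setIntegral_eq_integral_of_forall_compl_eq_zero fun y hy => by
        rw [(hv.pd i).eq_zero hy]; simp).symm
    rw [e1]
    calc ∫ y in C, pd i v y ^ 2 ≤ ∫ y in C, 2 * L * (f y ^ 2 + pd i f y ^ 2) := by
          refine setIntegral_mono_on ((hv.pd i).integrable_sq).integrableOn
            ((c0.add (c1 i)).const_mul _) hC.measurableSet fun y hy => ?_
          rw [pd_mul (hχ.differentiableAt y) (hdf y hy)]
          have e2 : pd i χ y ^ 2 ≤ L := by
            have := sq_le_sq' (abs_le.1 (hc1 i y hy)).1 (abs_le.1 (hc1 i y hy)).2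
            nlinarith [sq_nonneg L1, sq_nonneg L2]
          have e3 : χ y ^ 2 ≤ L := by
            have h1 := (hχI y).1
            have h2 := (hχI y).2
            nlinarith [sq_nonneg L1, sq_nonneg L2, sq_nonneg L3]
          have e4 := mul_le_mul_of_nonneg_right e2 (sq_nonneg (f y))
          have e5 := mul_le_mul_of_nonneg_right e3 (sq_nonneg (pd i f y))
          nlinarith [sq_nonneg (pd i χ y * f y - χ y * pd i f y)]
      _ = 2 * L * ((∫ y in C, f y ^ 2) + ∫ y in C, pd i f y ^ 2) := by
          rw [integral_const_mul, integral_add c0 (c1 i)]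
      _ ≤ 2 * L * (K2 * S + K3 * S) := by gcongr; exact J1 i
      _ = 2 * L * (K2 + K3) * S := by ring
  -- the second order operator
  have F2 : ∫ y, (∑ i, ∑ j, (Matrix.of fun i j => χ' y * G i j y) i j * pd i (pd j v) y) ^ 2
      ≤ 12 * L * (2 * K2 + 4 * K3) * S := by
    have e1 : ∫ y, (∑ i, ∑ j, (Matrix.of fun i j => χ' y * G i j y) i j * pd i (pd j v) y) ^ 2
        = ∫ y in C, (∑ i, ∑ j, (Matrix.of fun i j => χ' y * G i j y) i j * pd i (pd j v) y) ^ 2 :=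
      (setIntegral_eq_integral_of_forall_compl_eq_zero fun y hy => by
        simp [((hv.pd _).pd _).eq_zero hy]).symm
    -- The second order operator applied to χφ is χ Δφ plus lower order terms: derivatives falling
    -- on the cutoff, and the drift of the Laplacian.
    have e2 : ∀ y ∈ C, ∑ i, ∑ j, (Matrix.of fun i j => χ' y * G i j y) i j * pd i (pd j v) y
        = χ y * loc p (laplacian g φ) y + a y * f y + ∑ i, b i y * pd i f y := by
      intro y hy
      simp only [Matrix.of_apply, hχ1C y hy, one_mul]
      rw [loc_laplacian hφ (hCd hy)]
      have e3 : ∀ i j, G i j y * pd i (pd j v) y = G i j y * pd i (pd j χ) y * f y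
          + G i j y * pd j χ y * pd i f y + G i j y * pd i χ y * pd j f y
          + χ y * (G i j y * pd i (pd j f) y) := by
        intro i j
        rw [pd_pd_mul hd hχ.smooth hfs (hCd hy)]
        ring
      simp only [e3, Finset.sum_add_distrib, ha, hb, sub_mul, Finset.sum_sub_distrib, add_mul,
        Finset.sum_mul]
      have e4 : ∑ i, ∑ j, G i j y * pd i χ y * pd j f y
          = ∑ i, ∑ j, G j i y * pd j χ y * pd i f y := Finset.sum_comm
      rw [e4, mul_add, Finset.mul_sum, Finset.mul_sum]
      simp only [Finset.mul_sum]
      have e5 : ∑ i, χ y * (drift g p i y * pd i f y) = ∑ i, χ y * drift g p i y * pd i f y :=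
        Finset.sum_congr rfl fun i _ => by ring
      rw [← e5]
      ring
    rw [e1]
    -- The factor 12 is 3 · 4: three summands are squared, and the last is itself a sum of four
    -- terms.
    calc _ ≤ ∫ y in C, 12 * L * (loc p (laplacian g φ) y ^ 2 + f y ^ 2 + ∑ i, pd i f y ^ 2) := by
          refine setIntegral_mono_on ?_ (((c2.add c0).add
            (integrable_finsetSum _ fun i _ => c1 i)).const_mul _) hC.measurableSet fun y hy => ?_
          · refine ContinuousOn.integrableOn_compact hC ?_
            refine ContinuousOn.pow (continuousOn_finsetSum _ fun i _ =>
              continuousOn_finsetSum _ fun j _ => ?_) 2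
            exact (hχ'.continuous.continuousOn.mul (hGc i j)).mul
              ((hv.pd j).pd i).continuous.continuousOn
          · rw [e2 y hy]
            have q0 : χ y ^ 2 ≤ L := by
              have h1 := (hχI y).1
              have h2 := (hχI y).2
              nlinarith [sq_nonneg L1, sq_nonneg L2, sq_nonneg L3]
            have q1 : a y ^ 2 ≤ L := by
              have := sq_le_sq' (abs_le.1 (ha1 () y hy)).1 (abs_le.1 (ha1 () y hy)).2
              nlinarith [sq_nonneg L3, sq_nonneg L2]
            have q2 : ∀ i, b i y ^ 2 ≤ L := fun i => by
              have := sq_le_sq' (abs_le.1 (hb1 i y hy)).1 (abs_le.1 (hb1 i y hy)).2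
              nlinarith [sq_nonneg L3, sq_nonneg L1]
            have q3 : (∑ i, b i y * pd i f y) ^ 2 ≤ 4 * (L * ∑ i, pd i f y ^ 2) := by
              refine sq_sum_le_card_mul_sum_sq.trans ?_
              simp only [Finset.card_univ, Fintype.card_fin, Nat.cast_ofNat, mul_pow,
                Finset.mul_sum]
              gcongr with i
              exact q2 i
            have q4 := mul_le_mul_of_nonneg_right q0 (sq_nonneg (loc p (laplacian g φ) y))
            have q5 := mul_le_mul_of_nonneg_right q1 (sq_nonneg (f y))
            set X := χ y * loc p (laplacian g φ) y
            set Y := a y * f y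
            set Z := ∑ i, b i y * pd i f y
            have q6 : (X + Y + Z) ^ 2 ≤ 3 * (X ^ 2 + Y ^ 2 + Z ^ 2) := by
              nlinarith [sq_nonneg (X - Y), sq_nonneg (Y - Z), sq_nonneg (X - Z)]
            have q7 : X ^ 2 = χ y ^ 2 * loc p (laplacian g φ) y ^ 2 := mul_pow _ _ _
            have q8 : Y ^ 2 = a y ^ 2 * f y ^ 2 := mul_pow _ _ _
            have q9 : 0 ≤ L * loc p (laplacian g φ) y ^ 2 := by positivity
            have q10 : 0 ≤ L * f y ^ 2 := by positivity
            nlinarith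
      _ = 12 * L * ((∫ y in C, loc p (laplacian g φ) y ^ 2) + (∫ y in C, f y ^ 2)
            + ∑ i, ∫ y in C, pd i f y ^ 2) := by
          have c3 : IntegrableOn (fun y => loc p (laplacian g φ) y ^ 2 + f y ^ 2) C := c2.add c0
          rw [integral_const_mul, integral_add c3 (integrable_finsetSum _ fun i _ => c1 i),
            integral_add c2 c0, integral_finsetSum _ fun i _ => c1 i]
      _ ≤ 12 * L * (K2 * S + K2 * S + ∑ _i : Fin 4, K3 * S) := by
          gcongr with i
          exact J1 i
      _ = 12 * L * (2 * K2 + 4 * K3) * S := by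
          simp only [Finset.sum_const, Finset.card_univ, Fintype.card_fin, nsmul_eq_mul]
          push_cast
          ring
  have F3 := hK1 v hv
  -- The cutoff is 1 in a neighbourhood of B, so v and f have the same derivatives there.
  have F4 : ∫ y in B, pd k (pd l f) y ^ 2 ≤ ∫ y, pd k (pd l v) y ^ 2 := by
    have e1 : ∫ y in B, pd k (pd l f) y ^ 2 = ∫ y in B, pd k (pd l v) y ^ 2 := by
      refine setIntegral_congr_fun hB.measurableSet fun y hy => ?_
      have h1 : ∀ᶠ z in 𝓝 y, χ z = 1 := Filter.Eventually.filter_mono (nhds_le_nhdsSet hy) hχ1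
      have h2 : v =ᶠ[𝓝 y] f := h1.mono fun z hz => by simp only [hvdef, hz, one_mul]
      have h3 : pd l v =ᶠ[𝓝 y] pd l f := h2.eventually_nhds.mono fun z hz => pd_congr hz l
      simp only [pd_congr h3 k]
    rw [e1]
    exact setIntegral_le_integral ((hv.pd l).pd k).integrable_sq
      (Filter.Eventually.of_forall fun y => sq_nonneg _)
  have F5 : ∫ y, pd k (pd l v) y ^ 2 ≤ ∑ i, ∑ j, ∫ y, pd i (pd j v) y ^ 2 := by
    have n0 : ∀ i j, 0 ≤ ∫ y, pd i (pd j v) y ^ 2 := fun i j => integral_nonneg fun _ => sq_nonneg _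
    exact (Finset.single_le_sum (f := fun j => ∫ y, pd k (pd j v) y ^ 2) (fun j _ => n0 k j)
      (Finset.mem_univ l)).trans (Finset.single_le_sum
      (f := fun i => ∑ j, ∫ y, pd i (pd j v) y ^ 2)
      (fun i _ => Finset.sum_nonneg fun j _ => n0 i j) (Finset.mem_univ k))
  have F6 : ∑ i, ∫ y, pd i v y ^ 2 ≤ 8 * L * (K2 + K3) * S := by
    refine (Finset.sum_le_sum fun i _ => F1 i).trans_eq ?_
    simp only [Finset.sum_const, Finset.card_univ, Fintype.card_fin, nsmul_eq_mul]
    push_cast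
    ring
  have F7 : 0 ≤ (∫ y, (∑ i, ∑ j, (Matrix.of fun i j => χ' y * G i j y) i j * pd i (pd j v) y) ^ 2)
      + ∑ i, ∫ y, pd i v y ^ 2 :=
    add_nonneg (integral_nonneg fun _ => sq_nonneg _)
      (Finset.sum_nonneg fun i _ => integral_nonneg fun _ => sq_nonneg _)
  refine (F4.trans (F5.trans F3)).trans ?_
  refine (mul_le_mul_of_nonneg_right (le_abs_self K1) F7).trans ?_
  refine (mul_le_mul_of_nonneg_left (add_le_add F2 F6) (abs_nonneg K1)).trans_eq ?_
  rw [hKt]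
  ring

end LocalEstimates

/-! ### Limits in `L²` -/

section Limits

open Filter

lemma tendsto_integral_mul {α : Type*} [MeasurableSpace α] {μ : Measure α} {a b : ℕ → α → ℝ}
    {A B : α → ℝ} (ha : ∀ n, MemLp (a n) 2 μ) (hA : MemLp A 2 μ) (hb : ∀ n, MemLp (b n) 2 μ)
    (hB : MemLp B 2 μ) (h1 : Tendsto (fun n => eLpNorm (fun x => a n x - A x) 2 μ) atTop (𝓝 0))
    (h2 : Tendsto (fun n => eLpNorm (fun x => b n x - B x) 2 μ) atTop (𝓝 0)) :
    Tendsto (fun n => ∫ x, a n x * b n x ∂μ) atTop (𝓝 (∫ x, A x * B x ∂μ)) := by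
  have t1 := (Lp.tendsto_Lp_iff_tendsto_eLpNorm'' a ha A hA).2 h1
  have t2 := (Lp.tendsto_Lp_iff_tendsto_eLpNorm'' b hb B hB).2 h2
  have key : ∀ {c d : α → ℝ} (hc : MemLp c 2 μ) (hd : MemLp d 2 μ),
      inner ℝ (hd.toLp d) (hc.toLp c) = ∫ x, c x * d x ∂μ := by
    intro c d hc hd
    rw [L2.inner_def]
    refine integral_congr_ae ?_
    filter_upwards [hc.coeFn_toLp, hd.coeFn_toLp] with x hx1 hx2
    rw [hx1, hx2]
    rfl
  simpa only [key] using t2.inner (𝕜 := ℝ) t1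

lemma MemLp.of_tendsto {α : Type*} [MeasurableSpace α] {μ : Measure α} {a : ℕ → α → ℝ} {A : α → ℝ}
    (ha : ∀ n, MemLp (a n) 2 μ) (hA : AEStronglyMeasurable A μ)
    (h : Tendsto (fun n => eLpNorm (fun x => a n x - A x) 2 μ) atTop (𝓝 0)) : MemLp A 2 μ := by
  obtain ⟨n, hn⟩ := (h.eventually (gt_mem_nhds (by norm_num : (0 : ENNReal) < 1))).exists
  have h1 : MemLp (fun x => a n x - A x) 2 μ := ⟨(ha n).1.sub hA, hn.trans (by norm_num)⟩
  have := (ha n).sub h1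
  refine this.ae_eq (Eventually.of_forall fun x => ?_)
  simp

variable {Ω : Set E4}

lemma ContinuousOn.memLp_restrict {f : E4 → ℝ} {B : Set E4} (hf : ContinuousOn f B)
    (hB : IsCompact B) (p : ENNReal) : MemLp f p (volume.restrict B) := by
  have : IsFiniteMeasure (volume.restrict B) := ⟨by simpa using hB.measure_lt_top⟩
  obtain ⟨C, hC⟩ := hB.exists_bound_of_continuousOn hf
  refine MemLp.of_bound (hf.aestronglyMeasurable hB.measurableSet) C ?_
  filter_upwards [ae_restrict_mem hB.measurableSet] with y hy using hC y hy

lemma ContinuousOn.locL2 {f : E4 → ℝ} (hf : ContinuousOn f Ω) : LocL2 Ω f :=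
  fun _ hC hc => ContinuousOn.memLp_restrict (hf.mono hC) hc 2

lemma ae_of_ae_compact (hΩ : IsOpen Ω) {P : E4 → Prop}
    (h : ∀ B, IsCompact B → B ⊆ Ω → ∀ᵐ y, y ∈ B → P y) : ∀ᵐ y, y ∈ Ω → P y := by
  have h0 : volume {y | y ∈ Ω ∧ ¬ P y} = 0 := by
    refine measure_null_of_locally_null _ fun x hx => ?_
    obtain ⟨B, hB, hxB, hBΩ⟩ := exists_compact_subset hΩ hx.1
    refine ⟨{y | y ∈ Ω ∧ ¬ P y} ∩ B, Filter.inter_mem self_mem_nhdsWithin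
      (mem_nhdsWithin_of_mem_nhds (mem_interior_iff_mem_nhds.1 hxB)), ?_⟩
    refine measure_mono_null (fun y hy => ?_) (ae_iff.1 (h B hB hBΩ))
    simp only [Set.mem_setOf_eq, Classical.not_imp]
    exact ⟨hy.2, hy.1.2⟩
  rw [ae_iff]
  refine measure_mono_null (fun y hy => ?_) h0
  simpa only [Set.mem_setOf_eq, Classical.not_imp] using hy

/-- A sequence which converges fast in `L²` on compact sets converges almost everywhere. -/
theorem exists_limit_of_fast (hΩ : IsOpen Ω) {f : ℕ → E4 → ℝ} (hf : ∀ n, ContinuousOn (f n) Ω)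
    (hfast : ∀ B, IsCompact B → B ⊆ Ω → ∃ C : NNReal, ∀ N n m, N ≤ n → N ≤ m →
      eLpNorm (fun y => f n y - f m y) 2 (volume.restrict B) ≤ C * (2⁻¹ : ENNReal) ^ N) :
    (∀ᵐ y, y ∈ Ω → Tendsto (fun n => f n y) atTop (𝓝 (limUnder atTop fun n => f n y))) ∧
    LocL2 Ω (fun y => limUnder atTop fun n => f n y) ∧
    ∀ B, IsCompact B → B ⊆ Ω → Tendsto (fun n => eLpNorm
      (fun y => f n y - limUnder atTop fun n => f n y) 2 (volume.restrict B)) atTop (𝓝 0) := by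
  have key : ∀ B, IsCompact B → B ⊆ Ω →
      (∀ᵐ y ∂(volume.restrict B),
        Tendsto (fun n => f n y) atTop (𝓝 (limUnder atTop fun n => f n y))) ∧
      Tendsto (fun n => eLpNorm (fun y => f n y - limUnder atTop fun n => f n y) 2
        (volume.restrict B)) atTop (𝓝 0) := by
    intro B hB hBΩ
    obtain ⟨C, hC⟩ := hfast B hB hBΩ
    have hm : ∀ n, AEStronglyMeasurable (f n) (volume.restrict B) := fun n =>
      ((hf n).mono hBΩ).aestronglyMeasurable hB.measurableSet
    -- C is enlarged to C + 1 because the convergence criterion asks for strict inequalities.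
    have hsum : ∑' N : ℕ, ((C + 1 : NNReal) : ENNReal) * (2⁻¹ : ENNReal) ^ N ≠ ⊤ := by
      rw [ENNReal.tsum_mul_left, ENNReal.tsum_geometric, ENNReal.one_sub_inv_two, inv_inv]
      exact ENNReal.mul_ne_top ENNReal.coe_ne_top (by norm_num)
    have hcau : ∀ N n m : ℕ, N ≤ n → N ≤ m → eLpNorm (f n - f m) 2 (volume.restrict B)
        < ((C + 1 : NNReal) : ENNReal) * (2⁻¹ : ENNReal) ^ N := by
      intro N n m hn hm
      refine (hC N n m hn hm).trans_lt ?_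
      refine ENNReal.mul_lt_mul_left (pow_ne_zero _ (ENNReal.inv_ne_zero.2 (by norm_num)))
        (by finiteness) ?_
      exact_mod_cast lt_add_one C
    have hae : ∀ᵐ y ∂(volume.restrict B),
        Tendsto (fun n => f n y) atTop (𝓝 (limUnder atTop fun n => f n y)) := by
      filter_upwards [Lp.ae_tendsto_of_cauchy_eLpNorm hm (by norm_num) hsum hcau] with y hy
      exact tendsto_nhds_limUnder hy
    exact ⟨hae, Lp.cauchy_tendsto_of_tendsto hm _ hsum hcau hae⟩
  refine ⟨ae_of_ae_compact hΩ fun B hB hBΩ =>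
    (ae_restrict_iff' hB.measurableSet).1 (key B hB hBΩ).1, fun B hBΩ hB => ?_,
    fun B hB hBΩ => (key B hB hBΩ).2⟩
  have hm : ∀ n, MemLp (f n) 2 (volume.restrict B) := fun n =>
    ContinuousOn.memLp_restrict ((hf n).mono hBΩ) hB 2
  exact MemLp.of_tendsto hm
    (aestronglyMeasurable_of_tendsto_ae atTop (fun n => (hm n).1) (key B hB hBΩ).1)
    (key B hB hBΩ).2

lemma hasWeakPartial_pd (hΩ : IsOpen Ω) {f : E4 → ℝ} (hf : ContDiffOn ℝ ∞ f Ω) (i : Fin 4) :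
    HasWeakPartial Ω i f (pd i f) := by
  have hf' := pd_contDiffOn hΩ hf i
  refine ⟨ContinuousOn.locL2 hf.continuousOn, ContinuousOn.locL2 hf'.continuousOn,
    fun φ hφ hc hs => ?_⟩
  have hT : TestFn (tsupport φ) φ := ⟨hφ, hc, subset_rfl⟩
  have t1 := (hT.pd i).mul_contDiffOn hΩ hs hf
  have t2 := hT.mul_contDiffOn hΩ hs hf'
  have h := integral_pd (hT.mul_contDiffOn hΩ hs hf) i
  have h4 : ∫ y, pd i (fun z => φ z * f z) y = (∫ y, pd i φ y * f y) + ∫ y, φ y * pd i f y := by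
    rw [← integral_add t1.integrable t2.integrable]
    refine integral_congr_ae (Eventually.of_forall fun y => ?_)
    simp only
    by_cases hy : y ∈ tsupport φ
    · exact pd_mul (hT.differentiableAt y) (differentiableAt_of_contDiffOn hΩ hf (hs hy)) i
    · rw [((hT.mul_contDiffOn hΩ hs hf).pd i).eq_zero hy, t1.eq_zero hy, t2.eq_zero hy, add_zero]
  have e1 : ∫ y, f y * fderiv ℝ φ y (stdVec i) = ∫ y, pd i φ y * f y :=
    integral_congr_ae (Eventually.of_forall fun y => mul_comm _ _)
  have e2 : ∫ y, pd i f y * φ y = ∫ y, φ y * pd i f y :=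
    integral_congr_ae (Eventually.of_forall fun y => mul_comm _ _)
  rw [e1, e2]
  linarith

/-- The defining identity is continuous in the L² norm on the support of the test function, so weak
differentiation is a closed operation. -/
lemma HasWeakPartial.of_tendsto {i : Fin 4} {a b : ℕ → E4 → ℝ} {A B : E4 → ℝ}
    (h : ∀ n, HasWeakPartial Ω i (a n) (b n)) (hA : LocL2 Ω A) (hB : LocL2 Ω B)
    (h1 : ∀ K, IsCompact K → K ⊆ Ω →
      Tendsto (fun n => eLpNorm (fun y => a n y - A y) 2 (volume.restrict K)) atTop (𝓝 0))
    (h2 : ∀ K, IsCompact K → K ⊆ Ω →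
      Tendsto (fun n => eLpNorm (fun y => b n y - B y) 2 (volume.restrict K)) atTop (𝓝 0)) :
    HasWeakPartial Ω i A B := by
  refine ⟨hA, hB, fun φ hφ hc hs => ?_⟩
  have hT : TestFn (tsupport φ) φ := ⟨hφ, hc, subset_rfl⟩
  have key : ∀ {c : ℕ → E4 → ℝ} {D k : E4 → ℝ}, (∀ n, LocL2 Ω (c n)) → LocL2 Ω D →
      TestFn (tsupport φ) k → (∀ K, IsCompact K → K ⊆ Ω →
      Tendsto (fun n => eLpNorm (fun y => c n y - D y) 2 (volume.restrict K)) atTop (𝓝 0)) →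
      Tendsto (fun n => ∫ y, c n y * k y) atTop (𝓝 (∫ y, D y * k y)) := by
    intro c D k hcL hD hk ht
    have e : ∀ f : E4 → ℝ, ∫ y, f y * k y = ∫ y in tsupport φ, f y * k y := fun f =>
      (setIntegral_eq_integral_of_forall_compl_eq_zero fun y hy => by
        rw [hk.eq_zero hy, mul_zero]).symm
    simp only [e]
    have hkm : MemLp k 2 (volume.restrict (tsupport φ)) := (hk.memLp 2).restrict _
    refine tendsto_integral_mul (fun n => hcL n _ hs hc) (hD _ hs hc) (fun _ => hkm) hkm
      (ht _ hc hs) ?_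
    simp
  have t1 := key (fun n => (h n).1) hA (hT.pd i) h1
  have t2 := key (fun n => (h n).2.1) hB hT h2
  have t3 : Tendsto (fun n => ∫ y, a n y * pd i φ y) atTop (𝓝 (- ∫ y, B y * φ y)) := by
    refine t2.neg.congr fun n => ?_
    exact ((h n).2.2 φ hφ hc hs).symm
  exact tendsto_nhds_unique t1 t3

end Limits

/-! ### Comparison of norms on the manifold and in charts -/

section NormComparison

variable {M : Type*} [TopologicalSpace M] [ChartedSpace E4 M] [IsManifold (𝓡 4) ∞ M]
  [T2Space M] [CompactSpace M] [MeasurableSpace M] [BorelSpace M] (g : Metric M)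

lemma exists_eLpNorm_le {p : M} {B : Set E4} (hB : IsCompact B) (hBd : B ⊆ dom p) :
    ∃ C : NNReal, ∀ f : M → ℝ, AEStronglyMeasurable f ((vol g).restrict (src p)) →
      eLpNorm (loc p f) 2 (volume.restrict B) ≤ C * eLpNorm f 2 (vol g) ∧
      ((∀ x, x ∉ piece p B → f x = 0) →
        eLpNorm f 2 (vol g) ≤ C * eLpNorm (loc p f) 2 (volume.restrict B)) := by
  obtain ⟨C, hC, h⟩ := exists_lintegral_le g hB hBd
  lift C to NNReal using hC
  -- The comparison is between squared norms; C ≤ (C + 1)² avoids a square root.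
  have hCC : ∀ z : ENNReal, C * z ^ 2 ≤ (((C + 1 : NNReal) : ENNReal) * z) ^ 2 := by
    intro z
    rw [mul_pow]
    gcongr
    norm_cast
    nlinarith [C.2, sq_nonneg (C : ℝ)]
  have hm := measurableSet_piece (p := p) hB.measurableSet
  refine ⟨C + 1, fun f hf => ?_⟩
  obtain ⟨h1, h2⟩ := h (fun x => ‖f x‖ₑ ^ 2) (hf.enorm.pow_const 2)
  constructor
  · rw [← ENNReal.pow_le_pow_left_iff two_ne_zero]
    refine le_trans ?_ (hCC _)
    rw [sq_eLpNorm_two, sq_eLpNorm_two]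
    exact h2.trans (mul_le_mul_right (setLIntegral_le_lintegral _ _) _)
  · intro h0
    rw [← ENNReal.pow_le_pow_left_iff two_ne_zero]
    refine le_trans ?_ (hCC _)
    rw [sq_eLpNorm_two, sq_eLpNorm_two]
    refine le_trans (le_of_eq ?_) h1
    rw [← lintegral_indicator hm]
    refine lintegral_congr fun x => ?_
    by_cases hx : x ∈ piece p B
    · simp [hx]
    · simp [hx, h0 x hx]

lemma memLp_of_contMDiff {f : M → ℝ} (hf : ContMDiff (𝓡 4) 𝓘(ℝ, ℝ) ∞ f) : MemLp f 2 (vol g) :=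
  (memLp_two_iff_integrable_sq hf.continuous.aestronglyMeasurable).2
    (integrable_of_contMDiff (hf.pow 2))

variable {g}

lemma sqrt_sobSq_le {φ : M → ℝ} (hφ : ContMDiff (𝓡 4) 𝓘(ℝ, ℝ) ∞ φ) {K s : ℝ} (hK : 0 ≤ K)
    (hs : s ≤ K * sobSq g φ) : ENNReal.ofReal √s ≤ (Real.toNNReal √K : ENNReal)
      * (eLpNorm φ 2 (vol g) + eLpNorm (laplacian g φ) 2 (vol g)) := by
  have i1 : Integrable (fun x => φ x ^ 2) (vol g) := integrable_of_contMDiff (hφ.pow 2)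
  have i2 : Integrable (fun x => laplacian g φ x ^ 2) (vol g) :=
    integrable_of_contMDiff ((contMDiff_laplacian hφ).pow 2)
  rw [eLpNorm_two_eq i1, eLpNorm_two_eq i2, ← ENNReal.ofReal_add (by positivity) (by positivity),
    ← ENNReal.ofReal, ← ENNReal.ofReal_mul (by positivity)]
  refine ENNReal.ofReal_le_ofReal ((Real.sqrt_le_sqrt hs).trans ?_)
  rw [Real.sqrt_mul hK]
  gcongr
  rw [sobSq]
  have n1 : 0 ≤ ∫ x, φ x ^ 2 ∂(vol g) := integral_nonneg fun _ => sq_nonneg _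
  have n2 : 0 ≤ ∫ x, laplacian g φ x ^ 2 ∂(vol g) := integral_nonneg fun _ => sq_nonneg _
  refine Real.sqrt_le_iff.2 ⟨by positivity, ?_⟩
  rw [add_sq, Real.sq_sqrt n1, Real.sq_sqrt n2]
  have : 0 ≤ 2 * √(∫ x, φ x ^ 2 ∂(vol g)) * √(∫ x, laplacian g φ x ^ 2 ∂(vol g)) := by positivity
  linarith

variable (g)

/-- The interior estimates in terms of norms. Applied to differences of approximants, they make all
derivatives up to order two Cauchy in L² of compact sets. -/
theorem exists_eLpNorm_pd_le {p : M} {B : Set E4} (hB : IsCompact B) (hBd : B ⊆ dom p) :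
    ∃ K : NNReal, ∀ φ : M → ℝ, ContMDiff (𝓡 4) 𝓘(ℝ, ℝ) ∞ φ →
      (∀ i, eLpNorm (pd i (loc p φ)) 2 (volume.restrict B)
        ≤ K * (eLpNorm φ 2 (vol g) + eLpNorm (laplacian g φ) 2 (vol g))) ∧
      ∀ i j, eLpNorm (pd i (pd j (loc p φ))) 2 (volume.restrict B)
        ≤ K * (eLpNorm φ 2 (vol g) + eLpNorm (laplacian g φ) 2 (vol g)) := by
  obtain ⟨K1, hK1, h1⟩ := exists_setIntegral_pd_sq_le g hB hBd
  obtain ⟨K2, hK2, h2⟩ := exists_setIntegral_pd_pd_sq_le g hB hBd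
  refine ⟨Real.toNNReal √(K1 + K2), fun φ hφ => ?_⟩
  have hs := sobSq_nonneg (g := g) φ
  have hc := fun i => pd_contDiffOn (isOpen_dom p) (ContMDiff.loc hφ p) i
  refine ⟨fun i => ?_, fun i j => ?_⟩
  · rw [eLpNorm_two_eq (((hc i).continuousOn.mono hBd).pow 2 |>.integrableOn_compact hB)]
    refine sqrt_sobSq_le hφ (add_nonneg hK1 hK2) ((h1 φ hφ i).trans ?_)
    gcongr
    linarith
  · rw [eLpNorm_two_eq (((pd_contDiffOn (isOpen_dom p) (hc j) i).continuousOn.mono hBd).pow 2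
      |>.integrableOn_compact hB)]
    refine sqrt_sobSq_le hφ (add_nonneg hK1 hK2) ((h2 φ hφ i j).trans ?_)
    gcongr
    linarith

end NormComparison

/-! ### Limits of smooth functions -/

section Approx

open Filter

variable {M : Type*} [TopologicalSpace M] [ChartedSpace E4 M] [IsManifold (𝓡 4) ∞ M]
  [T2Space M] [CompactSpace M] [MeasurableSpace M] [BorelSpace M] {g : Metric M}

lemma laplacian_add {f h : M → ℝ} (hf : ContMDiff (𝓡 4) 𝓘(ℝ, ℝ) ∞ f)
    (hh : ContMDiff (𝓡 4) 𝓘(ℝ, ℝ) ∞ h) (x : M) :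
    laplacian g (fun x => f x + h x) x = laplacian g f x + laplacian g h x := by
  have hy := chart_mem_dom (mem_src x)
  have hd := isOpen_dom x
  have e : ∀ f : M → ℝ, laplacian g f x = loc x (laplacian g f) (extChartAt (𝓡 4) x x) := fun f => by
    simp only [loc, Function.comp_apply, symm_chart (mem_src x)]
  have s1 := ContMDiff.loc hf x
  have s2 := ContMDiff.loc hh x
  have d1 := fun z (hz : z ∈ dom x) => differentiableAt_of_contDiffOn hd s1 hz
  have d2 := fun z (hz : z ∈ dom x) => differentiableAt_of_contDiffOn hd s2 hz
  have p1 : ∀ j, ∀ z ∈ dom x, pd j (loc x fun x => f x + h x) z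
      = pd j (loc x f) z + pd j (loc x h) z := fun j z hz => pd_add (d1 z hz) (d2 z hz) j
  have p2 : ∀ i j, pd i (pd j (loc x fun x => f x + h x)) (extChartAt (𝓡 4) x x)
      = pd i (pd j (loc x f)) (extChartAt (𝓡 4) x x)
        + pd i (pd j (loc x h)) (extChartAt (𝓡 4) x x) := fun i j => by
    rw [pd_congr_of_eqOn hd (p1 j) hy i]
    exact pd_add (differentiableAt_of_contDiffOn hd (pd_contDiffOn hd s1 j) hy)
      (differentiableAt_of_contDiffOn hd (pd_contDiffOn hd s2 j) hy) i
  rw [e, e, e, loc_laplacian hf hy, loc_laplacian hh hy, loc_laplacian (g := g) (show ContMDiff (𝓡 4) 𝓘(ℝ, ℝ) ∞ (fun x => f x + h x) from hf.add hh) hy]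
  simp only [p1 _ _ hy, p2, mul_add, Finset.sum_add_distrib]
  ring

lemma laplacian_const_mul (c : ℝ) {f : M → ℝ} (hf : ContMDiff (𝓡 4) 𝓘(ℝ, ℝ) ∞ f) (x : M) :
    laplacian g (fun x => c * f x) x = c * laplacian g f x := by
  have hy := chart_mem_dom (mem_src x)
  have hd := isOpen_dom x
  have e : ∀ f : M → ℝ, laplacian g f x = loc x (laplacian g f) (extChartAt (𝓡 4) x x) := fun f => by
    simp only [loc, Function.comp_apply, symm_chart (mem_src x)]
  have p1 : ∀ j, ∀ z ∈ dom x, pd j (loc x fun x => c * f x) z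
      = c * pd j (loc x f) z := fun j z _ => pd_const_mul c (loc x f) z j
  have p2 : ∀ i j, pd i (pd j (loc x fun x => c * f x)) (extChartAt (𝓡 4) x x)
      = c * pd i (pd j (loc x f)) (extChartAt (𝓡 4) x x) := fun i j => by
    rw [pd_congr_of_eqOn hd (p1 j) hy i]
    exact pd_const_mul c (pd j (loc x f)) _ i
  rw [e, e, loc_laplacian hf hy, loc_laplacian (g := g) (show ContMDiff (𝓡 4) 𝓘(ℝ, ℝ) ∞ (fun x => c * f x) from contMDiff_const.mul hf) hy]
  simp only [p1 _ _ hy, p2, mul_add, Finset.mul_sum]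
  congr 1
  · exact Finset.sum_congr rfl fun i _ => Finset.sum_congr rfl fun j _ => by ring
  · exact Finset.sum_congr rfl fun i _ => by ring

lemma laplacian_sub {f h : M → ℝ} (hf : ContMDiff (𝓡 4) 𝓘(ℝ, ℝ) ∞ f)
    (hh : ContMDiff (𝓡 4) 𝓘(ℝ, ℝ) ∞ h) (x : M) :
    laplacian g (fun x => f x - h x) x = laplacian g f x - laplacian g h x := by
  have hm : ContMDiff (𝓡 4) 𝓘(ℝ, ℝ) ∞ (fun x => (-1 : ℝ) * h x) := contMDiff_const.mul hh
  have h1 := laplacian_add (g := g) hf hm x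
  rw [laplacian_const_mul (-1) hh] at h1
  simpa [sub_eq_add_neg] using h1

variable (g) in
/-- The smooth functions `Φ n` converge fast to `u` in `L²`, and their Laplacians to `w`. -/
structure Approx (u w : M → ℝ) (Φ : ℕ → M → ℝ) : Prop where
  smooth : ∀ n, ContMDiff (𝓡 4) 𝓘(ℝ, ℝ) ∞ (Φ n)
  memLp : MemLp u 2 (vol g)
  memLp' : MemLp w 2 (vol g)
  fast : ∃ C : NNReal, ∀ n, eLpNorm (fun x => Φ n x - u x) 2 (vol g) ≤ C * (2⁻¹ : ENNReal) ^ n ∧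
    eLpNorm (fun x => laplacian g (Φ n) x - w x) 2 (vol g) ≤ C * (2⁻¹ : ENNReal) ^ n

namespace Approx

variable {u w u' w' : M → ℝ} {Φ Φ' : ℕ → M → ℝ}

lemma add (h : Approx g u w Φ) (h' : Approx g u' w' Φ') :
    Approx g (fun x => u x + u' x) (fun x => w x + w' x) (fun n x => Φ n x + Φ' n x) := by
  obtain ⟨C, hC⟩ := h.fast
  obtain ⟨C', hC'⟩ := h'.fast
  refine ⟨fun n => (h.smooth n).add (h'.smooth n), h.memLp.add h'.memLp, h.memLp'.add h'.memLp',
    C + C', fun n => ?_⟩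
  have key : ∀ {a b c d : M → ℝ}, AEStronglyMeasurable (fun x => a x - b x) (vol g) →
      AEStronglyMeasurable (fun x => c x - d x) (vol g) →
      eLpNorm (fun x => a x - b x) 2 (vol g) ≤ C * (2⁻¹ : ENNReal) ^ n →
      eLpNorm (fun x => c x - d x) 2 (vol g) ≤ C' * (2⁻¹ : ENNReal) ^ n →
      eLpNorm (fun x => (a x + c x) - (b x + d x)) 2 (vol g)
        ≤ (C + C' : NNReal) * (2⁻¹ : ENNReal) ^ n := by
    intro a b c d h1 h2 h3 h4
    have : (fun x => (a x + c x) - (b x + d x)) = (fun x => a x - b x) + fun x => c x - d x := by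
      funext x; simp only [Pi.add_apply]; ring
    rw [this, ENNReal.coe_add, add_mul]
    exact (eLpNorm_add_le h1 h2 (by norm_num)).trans (add_le_add h3 h4)
  have m1 := fun (f : M → ℝ) (hf : ContMDiff (𝓡 4) 𝓘(ℝ, ℝ) ∞ f) => (memLp_of_contMDiff g hf).1
  refine ⟨key ((m1 _ (h.smooth n)).sub h.memLp.1) ((m1 _ (h'.smooth n)).sub h'.memLp.1)
    (hC n).1 (hC' n).1, ?_⟩
  simp only [laplacian_add (h.smooth n) (h'.smooth n)]
  exact key ((m1 _ (contMDiff_laplacian (h.smooth n))).sub h.memLp'.1)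
    ((m1 _ (contMDiff_laplacian (h'.smooth n))).sub h'.memLp'.1) (hC n).2 (hC' n).2

lemma const_mul (h : Approx g u w Φ) (c : ℝ) :
    Approx g (fun x => c * u x) (fun x => c * w x) (fun n x => c * Φ n x) := by
  obtain ⟨C, hC⟩ := h.fast
  refine ⟨fun n => contMDiff_const.mul (h.smooth n), h.memLp.const_mul c, h.memLp'.const_mul c,
    ‖c‖₊ * C, fun n => ?_⟩
  have key : ∀ {a b : M → ℝ}, eLpNorm (fun x => a x - b x) 2 (vol g) ≤ C * (2⁻¹ : ENNReal) ^ n →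
      eLpNorm (fun x => c * a x - c * b x) 2 (vol g)
        ≤ (‖c‖₊ * C : NNReal) * (2⁻¹ : ENNReal) ^ n := by
    intro a b h1
    have : (fun x => c * a x - c * b x) = c • (fun x => a x - b x) := by
      funext x; simp only [Pi.smul_apply, smul_eq_mul]; ring
    rw [this, eLpNorm_const_smul, ENNReal.coe_mul, mul_assoc]
    exact mul_le_mul_right h1 _
  refine ⟨key (hC n).1, ?_⟩
  simp only [laplacian_const_mul c (h.smooth n)]
  exact key (hC n).2

lemma cauchy (h : Approx g u w Φ) : ∃ C : NNReal, ∀ N n m, N ≤ n → N ≤ m →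
    eLpNorm (fun x => Φ n x - Φ m x) 2 (vol g)
      + eLpNorm (laplacian g fun x => Φ n x - Φ m x) 2 (vol g) ≤ C * (2⁻¹ : ENNReal) ^ N := by
  obtain ⟨C, hC⟩ := h.fast
  refine ⟨4 * C, fun N n m hn hm => ?_⟩
  have key : ∀ {a b c : M → ℝ}, AEStronglyMeasurable a (vol g) → AEStronglyMeasurable b (vol g) →
      AEStronglyMeasurable c (vol g) →
      eLpNorm (fun x => a x - c x) 2 (vol g) ≤ C * (2⁻¹ : ENNReal) ^ n →
      eLpNorm (fun x => b x - c x) 2 (vol g) ≤ C * (2⁻¹ : ENNReal) ^ m →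
      eLpNorm (fun x => a x - b x) 2 (vol g) ≤ 2 * (C * (2⁻¹ : ENNReal) ^ N) := by
    intro a b c ha hb hc h1 h2
    have : (fun x => a x - b x) = (fun x => a x - c x) - fun x => b x - c x := by
      funext x; simp only [Pi.sub_apply]; ring
    have hp : ∀ k, N ≤ k → (2⁻¹ : ENNReal) ^ k ≤ (2⁻¹ : ENNReal) ^ N := fun k hk =>
      pow_le_pow_right_of_le_one' (by simp) hk
    rw [this, two_mul]
    refine (eLpNorm_sub_le (ha.sub hc) (hb.sub hc) (by norm_num)).trans (add_le_add ?_ ?_)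
    · exact h1.trans (mul_le_mul_right (hp n hn) _)
    · exact h2.trans (mul_le_mul_right (hp m hm) _)
  have m1 := fun (f : M → ℝ) (hf : ContMDiff (𝓡 4) 𝓘(ℝ, ℝ) ∞ f) => (memLp_of_contMDiff g hf).1
  have e1 := key (m1 _ (h.smooth n)) (m1 _ (h.smooth m)) h.memLp.1 (hC n).1 (hC m).1
  have e2 := key (m1 _ (contMDiff_laplacian (h.smooth n))) (m1 _ (contMDiff_laplacian (h.smooth m)))
    h.memLp'.1 (hC n).2 (hC m).2
  have e3 : (laplacian g fun x => Φ n x - Φ m x)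
      = fun x => laplacian g (Φ n) x - laplacian g (Φ m) x :=
    funext fun x => laplacian_sub (h.smooth n) (h.smooth m) x
  rw [e3]
  refine (add_le_add e1 e2).trans_eq ?_
  push_cast
  ring

lemma tendsto (h : Approx g u w Φ) :
    Tendsto (fun n => eLpNorm (fun x => Φ n x - u x) 2 (vol g)) atTop (𝓝 0) ∧
    Tendsto (fun n => eLpNorm (fun x => laplacian g (Φ n) x - w x) 2 (vol g)) atTop (𝓝 0) := by
  obtain ⟨C, hC⟩ := h.fast
  have h0 : Tendsto (fun n : ℕ => (C : ENNReal) * (2⁻¹ : ENNReal) ^ n) atTop (𝓝 0) := by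
    have := ENNReal.Tendsto.const_mul (a := (C : ENNReal))
      (ENNReal.tendsto_pow_atTop_nhds_zero_of_lt_one (r := 2⁻¹) (by simp))
      (Or.inr ENNReal.coe_ne_top)
    simpa using this
  exact ⟨tendsto_of_tendsto_of_tendsto_of_le_of_le tendsto_const_nhds h0 (fun _ => zero_le)
    fun n => (hC n).1, tendsto_of_tendsto_of_tendsto_of_le_of_le tendsto_const_nhds h0
    (fun _ => zero_le) fun n => (hC n).2⟩

lemma pd_fast (h : Approx g u w Φ) (p : M) {B : Set E4} (hB : IsCompact B) (hBd : B ⊆ dom p) :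
    ∃ C : NNReal, ∀ N n m, N ≤ n → N ≤ m →
      (∀ i, eLpNorm (fun y => pd i (loc p (Φ n)) y - pd i (loc p (Φ m)) y) 2 (volume.restrict B)
        ≤ C * (2⁻¹ : ENNReal) ^ N) ∧
      ∀ i j, eLpNorm (fun y => pd i (pd j (loc p (Φ n))) y - pd i (pd j (loc p (Φ m))) y) 2
        (volume.restrict B) ≤ C * (2⁻¹ : ENNReal) ^ N := by
  obtain ⟨C, hC⟩ := h.cauchy
  obtain ⟨K, hK⟩ := exists_eLpNorm_pd_le g hB hBd
  refine ⟨K * C, fun N n m hn hm => ?_⟩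
  have hd := isOpen_dom p
  have hle := mul_le_mul_right (hC N n m hn hm) (K : ENNReal)
  rw [← mul_assoc, ← ENNReal.coe_mul] at hle
  obtain ⟨h1, h2⟩ := hK _ ((h.smooth n).sub (h.smooth m))
  have s := fun n => ContMDiff.loc (h.smooth n) p
  have e1 : ∀ i, ∀ y ∈ dom p, pd i (loc p fun x => Φ n x - Φ m x) y
      = pd i (loc p (Φ n)) y - pd i (loc p (Φ m)) y := fun i y hy =>
    pd_sub (differentiableAt_of_contDiffOn hd (s n) hy)
      (differentiableAt_of_contDiffOn hd (s m) hy) i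
  have e2 : ∀ i j, ∀ y ∈ dom p, pd i (pd j (loc p fun x => Φ n x - Φ m x)) y
      = pd i (pd j (loc p (Φ n))) y - pd i (pd j (loc p (Φ m))) y := fun i j y hy => by
    rw [pd_congr_of_eqOn hd (e1 j) hy i]
    exact pd_sub (differentiableAt_of_contDiffOn hd (pd_contDiffOn hd (s n) j) hy)
      (differentiableAt_of_contDiffOn hd (pd_contDiffOn hd (s m) j) hy) i
  refine ⟨fun i => ?_, fun i j => ?_⟩
  · refine le_trans (le_of_eq (eLpNorm_congr_ae ?_)) ((h1 i).trans hle)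
    filter_upwards [ae_restrict_mem hB.measurableSet] with y hy using (e1 i y (hBd hy)).symm
  · refine le_trans (le_of_eq (eLpNorm_congr_ae ?_)) ((h2 i j).trans hle)
    filter_upwards [ae_restrict_mem hB.measurableSet] with y hy using (e2 i j y (hBd hy)).symm

lemma loc_tendsto (h : Approx g u w Φ) (p : M) {B : Set E4} (hB : IsCompact B) (hBd : B ⊆ dom p) :
    Tendsto (fun n => eLpNorm (fun y => loc p (Φ n) y - loc p u y) 2 (volume.restrict B))
      atTop (𝓝 0) := by
  obtain ⟨C, hC⟩ := exists_eLpNorm_le g hB hBd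
  have h0 := ENNReal.Tendsto.const_mul (a := (C : ENNReal)) h.tendsto.1 (Or.inr ENNReal.coe_ne_top)
  rw [mul_zero] at h0
  refine tendsto_of_tendsto_of_tendsto_of_le_of_le tendsto_const_nhds h0 (fun _ => zero_le)
    fun n => ?_
  exact (hC _ ((memLp_of_contMDiff g (h.smooth n)).1.sub h.memLp.1).restrict).1

lemma locL2 (h : Approx g u w Φ) (p : M) : LocL2 (dom p) (loc p u) := by
  intro B hBd hB
  have hm : MemLp u 2 (vol g) := h.memLp
  obtain ⟨C, hC⟩ := exists_eLpNorm_le g hB hBd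
  refine ⟨?_, ((hC u hm.1.restrict).1).trans_lt (ENNReal.mul_lt_top ENNReal.coe_lt_top hm.2)⟩
  exact ((aestronglyMeasurable_src_iff g p).1 hm.1.restrict).mono_measure
    (Measure.restrict_mono hBd le_rfl)

variable (g) in
/-- The limit of the gradients of `Φ n`. -/
noncomputable def gradLim (Φ : ℕ → M → ℝ) (x : M) : TangentSpace (𝓡 4) x :=
  ∑ i, (∑ j, gramInv g x x i j * limUnder atTop fun n => pderiv x j (Φ n) x) • coordVec x i x

/-- The gradient of the limit is built at x from the chart at x. Convergence of the derivatives in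
one chart implies it in every other, since they differ by a fixed linear map at x. -/
lemma inner_gradLim (hΦ : ∀ n, ContMDiff (𝓡 4) 𝓘(ℝ, ℝ) ∞ (Φ n)) {p : M} {y : E4} (hy : y ∈ dom p)
    {F : Fin 4 → ℝ} (hF : ∀ i, Tendsto (fun n => pd i (loc p (Φ n)) y) atTop (𝓝 (F i)))
    (i : Fin 4) :
    loc p (fun x => g.inner x (gradLim g Φ x) (coordVec p i x)) y = F i := by
  set x := (extChartAt (𝓡 4) p).symm y with hx
  have hxp : x ∈ src p := symm_mem_src hy
  have hF' : ∀ i, Tendsto (fun n => pderiv p i (Φ n) x) atTop (𝓝 (F i)) := fun i => by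
    simpa only [hx, pderiv_symm _ _ _ hy] using hF i
  have hL : ∀ j, Tendsto (fun n => pderiv x j (Φ n) x) atTop
      (𝓝 (limUnder atTop fun n => pderiv x j (Φ n) x)) := by
    intro j
    refine tendsto_nhds_limUnder ⟨∑ a, jac (trans x p) (extChartAt (𝓡 4) x x) a j * F a, ?_⟩
    have e : ∀ n, pderiv x j (Φ n) x = ∑ a, jac (trans x p) (extChartAt (𝓡 4) x x) a j
        * pderiv p a (Φ n) x := fun n =>
      pderiv_change (mem_src x) hxp (ContMDiff.differentiableAt_loc (hΦ n) (chart_mem_dom hxp)) j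
    simp only [e]
    exact tendsto_finsetSum _ fun a _ => (hF' a).const_mul _
  have h1 : g.inner x (gradLim g Φ x) (coordVec p i x) = ∑ a, jac (trans p x)
      (extChartAt (𝓡 4) p x) a i * limUnder atTop fun n => pderiv x a (Φ n) x := by
    rw [coordVec_change hxp (mem_src x) i, map_sum]
    refine Finset.sum_congr rfl fun a _ => ?_
    rw [map_smul, smul_eq_mul, gradLim, inner_sum_gramInv g (mem_src x)]
  have h2 : Tendsto (fun n => pderiv p i (Φ n) x) atTop (𝓝 (∑ a, jac (trans p x)
      (extChartAt (𝓡 4) p x) a i * limUnder atTop fun n => pderiv x a (Φ n) x)) := by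
    have e : ∀ n, pderiv p i (Φ n) x = ∑ a, jac (trans p x) (extChartAt (𝓡 4) p x) a i
        * pderiv x a (Φ n) x := fun n =>
      pderiv_change hxp (mem_src x)
        (ContMDiff.differentiableAt_loc (hΦ n) (chart_mem_dom (mem_src x))) i
    simp only [e]
    exact tendsto_finsetSum _ fun a _ => (hL a).const_mul _
  change g.inner x (gradLim g Φ x) (coordVec p i x) = F i
  rw [h1]
  exact tendsto_nhds_unique h2 (hF' i)

lemma limit_pd (h : Approx g u w Φ) (p : M) (i : Fin 4) :
    (∀ᵐ y, y ∈ dom p → Tendsto (fun n => pd i (loc p (Φ n)) y) atTop (𝓝 (limUnder atTop fun n => pd i (loc p (Φ n)) y))) ∧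
    LocL2 (dom p) (fun y => limUnder atTop fun n => pd i (loc p (Φ n)) y) ∧
    ∀ B, IsCompact B → B ⊆ dom p → Tendsto (fun n => eLpNorm
      (fun y => pd i (loc p (Φ n)) y - limUnder atTop fun n => pd i (loc p (Φ n)) y) 2
      (volume.restrict B)) atTop (𝓝 0) :=
  exists_limit_of_fast (isOpen_dom p) (f := fun n => pd i (loc p (Φ n)))
    (fun n => (pd_contDiffOn (isOpen_dom p) (ContMDiff.loc (h.smooth n) p) i).continuousOn)
    (fun B hB hBd => by
      obtain ⟨C, hC⟩ := h.pd_fast p hB hBd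
      exact ⟨C, fun N n m hn hm => (hC N n m hn hm).1 i⟩)

lemma limit_pd_pd (h : Approx g u w Φ) (p : M) (i j : Fin 4) :
    (∀ᵐ y, y ∈ dom p → Tendsto (fun n => pd i (pd j (loc p (Φ n))) y) atTop (𝓝 (limUnder atTop fun n => pd i (pd j (loc p (Φ n))) y))) ∧
    LocL2 (dom p) (fun y => limUnder atTop fun n => pd i (pd j (loc p (Φ n))) y) ∧
    ∀ B, IsCompact B → B ⊆ dom p → Tendsto (fun n => eLpNorm
      (fun y => pd i (pd j (loc p (Φ n))) y - limUnder atTop fun n => pd i (pd j (loc p (Φ n))) y) 2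
      (volume.restrict B)) atTop (𝓝 0) :=
  exists_limit_of_fast (isOpen_dom p) (f := fun n => pd i (pd j (loc p (Φ n))))
    (fun n => (pd_contDiffOn (isOpen_dom p) (pd_contDiffOn (isOpen_dom p)
      (ContMDiff.loc (h.smooth n) p) j) i).continuousOn)
    (fun B hB hBd => by
      obtain ⟨C, hC⟩ := h.pd_fast p hB hBd
      exact ⟨C, fun N n m hn hm => (hC N n m hn hm).2 i j⟩)

lemma hasWeakPartial (h : Approx g u w Φ) (p : M) (i : Fin 4) :
    HasWeakPartial (dom p) i (loc p u) (fun y => limUnder atTop fun n => pd i (loc p (Φ n)) y) :=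
  HasWeakPartial.of_tendsto
    (fun n => hasWeakPartial_pd (isOpen_dom p) (ContMDiff.loc (h.smooth n) p) i)
    (h.locL2 p) (h.limit_pd p i).2.1 (fun _ hK hKd => h.loc_tendsto p hK hKd) (h.limit_pd p i).2.2

/-- Limits of the first and second derivatives exist locally in L² by the interior estimates, and
weak differentiation is closed. -/
theorem memH2 (h : Approx g u w Φ) : MemH2 u := by
  intro p
  refine ⟨fun i y => limUnder atTop fun n => pd i (loc p (Φ n)) y,
    fun i j y => limUnder atTop fun n => pd j (pd i (loc p (Φ n))) y,
    fun i => h.hasWeakPartial p i, fun i j => ?_⟩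
  exact HasWeakPartial.of_tendsto (fun n => hasWeakPartial_pd (isOpen_dom p)
      (pd_contDiffOn (isOpen_dom p) (ContMDiff.loc (h.smooth n) p) i) j)
    (h.limit_pd p i).2.1 (h.limit_pd_pd p j i).2.1 (h.limit_pd p i).2.2 (h.limit_pd_pd p j i).2.2

lemma LocL2.congr_ae {Ω : Set E4} {f f' : E4 → ℝ} (hf : LocL2 Ω f)
    (h : ∀ᵐ y, y ∈ Ω → f y = f' y) : LocL2 Ω f' := fun C hC hc =>
  (hf C hC hc).ae_eq ((ae_restrict_iff' hc.measurableSet).2 (h.mono fun _ hy hyC => hy (hC hyC)))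

lemma _root_.Paneitz.HasWeakPartial.congr_ae {Ω : Set E4} {i : Fin 4} {f f' f'' : E4 → ℝ}
    (hf : HasWeakPartial Ω i f f') (h : ∀ᵐ y, y ∈ Ω → f' y = f'' y) : HasWeakPartial Ω i f f'' := by
  refine ⟨hf.1, LocL2.congr_ae hf.2.1 h, fun φ hφ hc hs => ?_⟩
  rw [hf.2.2 φ hφ hc hs]
  congr 1
  refine integral_congr_ae ?_
  filter_upwards [h] with y hy
  by_cases hyΩ : y ∈ Ω
  · rw [hy hyΩ]
  · rw [image_eq_zero_of_notMem_tsupport fun hh => hyΩ (hs hh), mul_zero, mul_zero]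

lemma ae_inner_gradLim (h : Approx g u w Φ) (p : M) (i : Fin 4) : ∀ᵐ y, y ∈ dom p →
    limUnder atTop (fun n => pd i (loc p (Φ n)) y)
      = loc p (fun x => g.inner x (gradLim g Φ x) (coordVec p i x)) y := by
  filter_upwards [ae_all_iff.2 fun j => (h.limit_pd p j).1] with y hy hyd
  exact (inner_gradLim h.smooth hyd (fun j => hy j hyd) i).symm

theorem isWeakGrad_gradLim (h : Approx g u w Φ) : IsWeakGrad g u (gradLim g Φ) := fun p i =>
  (h.hasWeakPartial p i).congr_ae (h.ae_inner_gradLim p i)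

/-- The limit of the gradients shows that some weak gradient exists, so the arbitrary choice in
`weakGrad` is a genuine one. -/
theorem isWeakGrad (h : Approx g u w Φ) : IsWeakGrad g u (weakGrad g u) :=
  Classical.epsilon_spec (p := IsWeakGrad g u) ⟨_, h.isWeakGrad_gradLim⟩

lemma ae_inner_weakGrad (h : Approx g u w Φ) (p : M) (i : Fin 4) : ∀ᵐ y, y ∈ dom p →
    limUnder atTop (fun n => pd i (loc p (Φ n)) y)
      = loc p (fun x => g.inner x (weakGrad g u x) (coordVec p i x)) y :=
  (h.hasWeakPartial p i).ae_unique (isOpen_dom p) (h.isWeakGrad p i)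

/-- The gradients converge in `L²` of compact subsets of the charts. -/
theorem tendsto_weakGrad (h : Approx g u w Φ) (p : M) (i : Fin 4) {B : Set E4} (hB : IsCompact B)
    (hBd : B ⊆ dom p) : Tendsto (fun n => eLpNorm (fun y => pd i (loc p (Φ n)) y
      - loc p (fun x => g.inner x (weakGrad g u x) (coordVec p i x)) y) 2 (volume.restrict B))
      atTop (𝓝 0) := by
  refine ((h.limit_pd p i).2.2 B hB hBd).congr fun n => eLpNorm_congr_ae ?_
  filter_upwards [(ae_restrict_iff' hB.measurableSet).2
    ((h.ae_inner_weakGrad p i).mono fun y hy hyB => hy (hBd hyB))] with y hy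
  rw [hy]

theorem isWeakLaplacian (h : Approx g u w Φ) : IsWeakLaplacian g u w := by
  refine ⟨h.memLp', fun φ hφ => ?_⟩
  have hΔ := contMDiff_laplacian (g := g) hφ
  have m := fun (f : M → ℝ) (hf : ContMDiff (𝓡 4) 𝓘(ℝ, ℝ) ∞ f) => memLp_of_contMDiff g hf
  have t1 := tendsto_integral_mul (fun n => m _ (contMDiff_laplacian (h.smooth n))) h.memLp'
    (fun _ => m φ hφ) (m φ hφ) h.tendsto.2 (by simp)
  have t2 := tendsto_integral_mul (fun n => m _ (h.smooth n)) h.memLp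
    (fun _ => m _ hΔ) (m _ hΔ) h.tendsto.1 (by simp)
  refine tendsto_nhds_unique t1 (t2.congr fun n => ?_)
  exact integral_mul_laplacian_comm (h.smooth n) hφ

end Approx

lemma IsWeakLaplacian.ae_unique {u w w' : M → ℝ} (h : IsWeakLaplacian g u w)
    (h' : IsWeakLaplacian g u w') : w =ᵐ[vol g] w' := by
  have i1 := h.1.integrable (by norm_num)
  have i2 := h'.1.integrable (by norm_num)
  refine ae_eq_of_integral_contMDiff_smul_eq (𝓡 4) i1.locallyIntegrable i2.locallyIntegrable
    fun φ hφ _ => ?_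
  simp only [smul_eq_mul, mul_comm (φ _)]
  rw [h.2 φ hφ, h'.2 φ hφ]

lemma Approx.weakLaplacian_ae_eq {u w : M → ℝ} {Φ : ℕ → M → ℝ} (h : Approx g u w Φ) :
    weakLaplacian g u =ᵐ[vol g] w :=
  IsWeakLaplacian.ae_unique
    (Classical.epsilon_spec (p := IsWeakLaplacian g u) ⟨_, h.isWeakLaplacian⟩) h.isWeakLaplacian

end Approx

/-! ### Density of smooth functions in `H²` -/

section Density

open Filter

variable {M : Type*} [TopologicalSpace M] [ChartedSpace E4 M] [IsManifold (𝓡 4) ∞ M]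
  [T2Space M] [CompactSpace M] [MeasurableSpace M] [BorelSpace M] {g : Metric M}

/-- The approximants are taken with error 2⁻ⁿ. Such geometric speed gives almost everywhere
convergence of derivatives without passing to subsequences. -/
lemma exists_approx_of_forall {u w : M → ℝ} (hu : MemLp u 2 (vol g)) (hw : MemLp w 2 (vol g))
    (h : ∀ ε : ENNReal, 0 < ε → ∃ φ : M → ℝ, ContMDiff (𝓡 4) 𝓘(ℝ, ℝ) ∞ φ ∧
      eLpNorm (fun x => φ x - u x) 2 (vol g) ≤ ε ∧
      eLpNorm (fun x => laplacian g φ x - w x) 2 (vol g) ≤ ε) : ∃ Φ, Approx g u w Φ := by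
  have hpos : ∀ n : ℕ, (0 : ENNReal) < 2⁻¹ ^ n := fun n => ENNReal.pow_pos (by simp) n
  choose Φ h1 h2 h3 using fun n : ℕ => h _ (hpos n)
  exact ⟨Φ, h1, hu, hw, 1, fun n => ⟨by simpa using h2 n, by simpa using h3 n⟩⟩

lemma Approx.exists_smooth {u w : M → ℝ} {Φ : ℕ → M → ℝ} (h : Approx g u w Φ) {ε : ENNReal}
    (hε : 0 < ε) : ∃ φ : M → ℝ, ContMDiff (𝓡 4) 𝓘(ℝ, ℝ) ∞ φ ∧
      eLpNorm (fun x => φ x - u x) 2 (vol g) ≤ ε ∧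
      eLpNorm (fun x => laplacian g φ x - w x) 2 (vol g) ≤ ε := by
  obtain ⟨n, h1, h2⟩ := ((h.tendsto.1.eventually (ge_mem_nhds hε)).and
    (h.tendsto.2.eventually (ge_mem_nhds hε))).exists
  exact ⟨Φ n, h.smooth n, h1, h2⟩

/-- The graph of the weak Laplacian is closed. -/
lemma exists_approx_of_tendsto {u w : M → ℝ} {v k : ℕ → M → ℝ} (hu : MemLp u 2 (vol g))
    (hw : MemLp w 2 (vol g)) (h : ∀ n, ∃ Φ, Approx g (v n) (k n) Φ)
    (h1 : Tendsto (fun n => eLpNorm (fun x => v n x - u x) 2 (vol g)) atTop (𝓝 0))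
    (h2 : Tendsto (fun n => eLpNorm (fun x => k n x - w x) 2 (vol g)) atTop (𝓝 0)) :
    ∃ Φ, Approx g u w Φ := by
  refine exists_approx_of_forall hu hw fun ε hε => ?_
  have hε2 : (0 : ENNReal) < ε / 2 := ENNReal.half_pos hε.ne'
  obtain ⟨n, h3, h4⟩ := ((h1.eventually (ge_mem_nhds hε2)).and
    (h2.eventually (ge_mem_nhds hε2))).exists
  obtain ⟨Φ, hΦ⟩ := h n
  obtain ⟨φ, hφ, h5, h6⟩ := hΦ.exists_smooth hε2
  have m := fun (f : M → ℝ) (hf : ContMDiff (𝓡 4) 𝓘(ℝ, ℝ) ∞ f) => (memLp_of_contMDiff g hf).1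
  have key : ∀ {a b c : M → ℝ}, AEStronglyMeasurable a (vol g) → AEStronglyMeasurable b (vol g) →
      AEStronglyMeasurable c (vol g) → eLpNorm (fun x => a x - b x) 2 (vol g) ≤ ε / 2 →
      eLpNorm (fun x => b x - c x) 2 (vol g) ≤ ε / 2 →
      eLpNorm (fun x => a x - c x) 2 (vol g) ≤ ε := by
    intro a b c ha hb hc e1 e2
    have : (fun x => a x - c x) = (fun x => a x - b x) + fun x => b x - c x := by
      funext x; simp only [Pi.add_apply]; ring
    rw [this]
    refine (eLpNorm_add_le (ha.sub hb) (hb.sub hc) (by norm_num)).trans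
      ((add_le_add e1 e2).trans_eq (ENNReal.add_halves ε))
  exact ⟨φ, hφ, key (m φ hφ) hΦ.memLp.1 hu.1 h5 h3,
    key (m _ (contMDiff_laplacian hφ)) hΦ.memLp'.1 hw.1 h6 h4⟩

lemma exists_tendsto_of_cauchy {α : Type*} [MeasurableSpace α] {μ : Measure α} {a : ℕ → α → ℝ}
    (ha : ∀ n, MemLp (a n) 2 μ) {b : ℕ → ENNReal} (hb : Tendsto b atTop (𝓝 0))
    (h : ∀ n m, eLpNorm (fun x => a n x - a m x) 2 μ ≤ b n + b m) :
    ∃ A, MemLp A 2 μ ∧ Tendsto (fun n => eLpNorm (fun x => a n x - A x) 2 μ) atTop (𝓝 0) := by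
  have hc : CauchySeq fun n => (ha n).toLp (a n) := by
    refine EMetric.cauchySeq_iff.2 fun ε hε => ?_
    obtain ⟨N, hN⟩ := eventually_atTop.1 (hb.eventually (gt_mem_nhds (ENNReal.half_pos hε.ne')))
    refine ⟨N, fun n hn m hm => ?_⟩
    rw [Lp.edist_toLp_toLp]
    refine (h n m).trans_lt ?_
    calc b n + b m < ε / 2 + ε / 2 := ENNReal.add_lt_add (hN n hn) (hN m hm)
      _ = ε := ENNReal.add_halves ε
  obtain ⟨A, hA⟩ := cauchySeq_tendsto_of_complete hc
  refine ⟨A, Lp.memLp A, ?_⟩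
  rw [← Lp.toLp_coeFn A (Lp.memLp A)] at hA
  exact (Lp.tendsto_Lp_iff_tendsto_eLpNorm'' a ha A (Lp.memLp A)).1 hA

lemma laplacian_eq_zero {f : M → ℝ} (hf : ContMDiff (𝓡 4) 𝓘(ℝ, ℝ) ∞ f) {x : M}
    (h : f =ᶠ[𝓝 x] fun _ => 0) : laplacian g f x = 0 := by
  have hy := chart_mem_dom (mem_src x)
  have h0 : loc x f =ᶠ[𝓝 (extChartAt (𝓡 4) x x)] fun _ => 0 := by
    have hc := continuousAt_extChartAt_symm (I := 𝓡 4) x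
    exact hc.eventually (p := fun z => f z = 0) (by rw [symm_chart (mem_src x)]; exact h)
  have h1 : ∀ j, pd j (loc x f) =ᶠ[𝓝 (extChartAt (𝓡 4) x x)] fun _ => 0 := fun j => by
    filter_upwards [h0.eventuallyEq_nhds] with y hy
    rw [pd_congr hy]
    exact pd_const _ _ _
  have e : laplacian g f x = loc x (laplacian g f) (extChartAt (𝓡 4) x x) := by
    simp only [loc, Function.comp_apply, symm_chart (mem_src x)]
  rw [e, loc_laplacian hf hy]
  have h2 : ∀ i j, pd i (pd j (loc x f)) (extChartAt (𝓡 4) x x) = 0 := fun i j => by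
    rw [pd_congr (h1 j)]
    exact pd_const _ _ _
  simp only [h2, (h1 _).eq_of_nhds, mul_zero, Finset.sum_const_zero, add_zero]

lemma eLpNorm_mul_le {B : Set E4} (hB : IsCompact B) {c f : E4 → ℝ} {K : ℝ}
    (hc : ∀ y ∈ B, |c y| ≤ K) :
    eLpNorm (fun y => c y * f y) 2 (volume.restrict B)
      ≤ ENNReal.ofReal K * eLpNorm f 2 (volume.restrict B) := by
  refine eLpNorm_le_mul_eLpNorm_of_ae_le_mul ?_ 2
  filter_upwards [ae_restrict_mem hB.measurableSet] with y hy
  rw [norm_mul]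
  exact mul_le_mul_of_nonneg_right (hc y hy) (norm_nonneg _)

variable (g) in
lemma exists_eLpNorm_laplacian_le {p : M} {B : Set E4} (hB : IsCompact B) (hBd : B ⊆ dom p) :
    ∃ K : NNReal, ∀ φ : M → ℝ, ContMDiff (𝓡 4) 𝓘(ℝ, ℝ) ∞ φ → (∀ x, x ∉ piece p B → φ x = 0) →
      eLpNorm (laplacian g φ) 2 (vol g)
        ≤ K * ((∑ i, ∑ j, eLpNorm (pd i (pd j (loc p φ))) 2 (volume.restrict B))
          + ∑ j, eLpNorm (pd j (loc p φ)) 2 (volume.restrict B)) := by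
  obtain ⟨C, hC⟩ := exists_eLpNorm_le g hB hBd
  obtain ⟨K1, hK1, b1⟩ := exists_abs_le hB (ι := Fin 4 × Fin 4)
    (f := fun a => loc p (fun x => gramInv g p x a.1 a.2))
    (fun a => (contDiffOn_loc_gramInv g p a.1 a.2).continuousOn.mono hBd)
  obtain ⟨K2, hK2, b2⟩ := exists_abs_le hB (f := fun j => drift g p j)
    (fun j => (contDiffOn_drift p j).continuousOn.mono hBd)
  refine ⟨C * Real.toNNReal (K1 + K2), fun φ hφ h0 => ?_⟩
  have hd := isOpen_dom p
  have s := ContMDiff.loc hφ p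
  have m1 : ∀ j, AEStronglyMeasurable (pd j (loc p φ)) (volume.restrict B) := fun j =>
    ((pd_contDiffOn hd s j).continuousOn.mono hBd).aestronglyMeasurable hB.measurableSet
  have m2 : ∀ i j, AEStronglyMeasurable (pd i (pd j (loc p φ))) (volume.restrict B) := fun i j =>
    ((pd_contDiffOn hd (pd_contDiffOn hd s j) i).continuousOn.mono hBd).aestronglyMeasurable
      hB.measurableSet
  have n1 : ∀ i j, AEStronglyMeasurable (fun y => loc p (fun x => gramInv g p x i j) y
      * pd i (pd j (loc p φ)) y) (volume.restrict B) := fun i j =>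
    (((contDiffOn_loc_gramInv g p i j).continuousOn.mono hBd).aestronglyMeasurable
      hB.measurableSet).mul (m2 i j)
  have n2 : ∀ j, AEStronglyMeasurable (fun y => drift g p j y * pd j (loc p φ) y)
      (volume.restrict B) := fun j =>
    (((contDiffOn_drift p j).continuousOn.mono hBd).aestronglyMeasurable
      hB.measurableSet).mul (m1 j)
  have hz : ∀ x, x ∉ piece p B → laplacian g φ x = 0 := fun x hx => laplacian_eq_zero hφ (by
    filter_upwards [(isClosed_piece hB hBd).isOpen_compl.mem_nhds hx] with z hz using h0 z hz)
  refine ((hC _ (memLp_of_contMDiff g (contMDiff_laplacian hφ)).1.restrict).2 hz).trans ?_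
  rw [ENNReal.coe_mul, mul_assoc]
  refine mul_le_mul_right ?_ _
  have e : eLpNorm (loc p (laplacian g φ)) 2 (volume.restrict B)
      = eLpNorm ((fun y => ∑ i, ∑ j, loc p (fun x => gramInv g p x i j) y
        * pd i (pd j (loc p φ)) y) + fun y => ∑ j, drift g p j y * pd j (loc p φ) y) 2
        (volume.restrict B) := by
    refine eLpNorm_congr_ae ?_
    filter_upwards [ae_restrict_mem hB.measurableSet] with y hy using loc_laplacian hφ (hBd hy)
  rw [e]
  have o1 : ENNReal.ofReal K1 ≤ (Real.toNNReal (K1 + K2) : ENNReal) :=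
    ENNReal.ofReal_le_ofReal (by linarith)
  have o2 : ENNReal.ofReal K2 ≤ (Real.toNNReal (K1 + K2) : ENNReal) :=
    ENNReal.ofReal_le_ofReal (by linarith)
  have hs2 : ∀ i, AEStronglyMeasurable (fun y => ∑ j, loc p (fun x => gramInv g p x i j) y
        * pd i (pd j (loc p φ)) y) (volume.restrict B) := fun i =>
    Finset.aestronglyMeasurable_fun_sum _ fun j _ => n1 i j
  refine (eLpNorm_add_le (Finset.aestronglyMeasurable_fun_sum _ fun i _ => hs2 i)
    (Finset.aestronglyMeasurable_fun_sum _ fun j _ => n2 j) (by norm_num)).trans ?_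
  rw [mul_add, Finset.mul_sum, Finset.mul_sum]
  refine add_le_add ?_ ?_
  · refine (eLpNorm_finset_sum_le (fun i _ => hs2 i) (by norm_num)).trans
      (Finset.sum_le_sum fun i _ => ?_)
    rw [Finset.mul_sum]
    refine (eLpNorm_finset_sum_le (fun j _ => n1 i j) (by norm_num)).trans
      (Finset.sum_le_sum fun j _ => ?_)
    exact (eLpNorm_mul_le hB (b1 (i, j))).trans (mul_le_mul_left o1 _)
  · refine (eLpNorm_finset_sum_le (fun j _ => n2 j) (by norm_num)).trans
      (Finset.sum_le_sum fun j _ => ?_)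
    exact (eLpNorm_mul_le hB (b2 j)).trans (mul_le_mul_left o2 _)

lemma memLp_piece {p : M} {B : Set E4} (hB : IsCompact B) (hBd : B ⊆ dom p) {f : M → ℝ}
    (hf : ∀ x, x ∉ piece p B → f x = 0) (hm : AEStronglyMeasurable (loc p f) (volume.restrict (dom p)))
    (h : MemLp (loc p f) 2 (volume.restrict B)) : MemLp f 2 (vol g) := by
  have h1 := (aestronglyMeasurable_src_iff g p).2 hm
  obtain ⟨C, hC⟩ := exists_eLpNorm_le g hB hBd
  refine ⟨?_, ((hC f h1).2 hf).trans_lt (ENNReal.mul_lt_top ENNReal.coe_lt_top h.2)⟩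
  have e : (src p).indicator f = f := by
    funext x
    by_cases hx : x ∈ src p
    · rw [Set.indicator_of_mem hx]
    · rw [Set.indicator_of_notMem hx, hf x fun hh => hx hh.1]
  rw [← e]
  exact (aestronglyMeasurable_indicator_iff (isOpen_src p).measurableSet).2 h1

/-- Localized `H²` functions are limits of smooth functions. -/
lemma exists_approx_mul {u θ : M → ℝ} (hu : MemH2 u) {p : M} {B : Set E4} (hB : IsCompact B)
    (hBd : B ⊆ dom p) (hθ : ContMDiff (𝓡 4) 𝓘(ℝ, ℝ) ∞ θ) (hs : SuppIn p B θ) :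
    ∃ w Φ, Approx g (fun x => θ x * u x) w Φ := by
  obtain ⟨f, h, hf, hh⟩ := hu p
  have hd := isOpen_dom p
  have hη : TestFn B (ext0 p θ) := hs.testFn hB hBd (ContMDiff.loc hθ p)
  obtain ⟨K', ψ, F, H, hK', hK'd, hψ, mF, mH, t0, t1, t2⟩ :=
    exists_testFn_approx hd hf hh hη hB hBd
  have hu2 : LocL2 (dom p) (loc p u) := (hf 0).1
  have hmul : MemLp (fun y => ext0 p θ y * loc p u y) 2 := hu2.memLp_mul hη hB hBd
  have eloc : ∀ y ∈ dom p, ext0 p θ y * loc p u y = loc p (fun x => θ x * u x) y := fun y hy => by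
    rw [ext0_apply _ hy]; rfl
  have hBK : IsCompact (B ∪ K') := hB.union hK'
  have hBKd : B ∪ K' ⊆ dom p := Set.union_subset hBd hK'd
  set Φ : ℕ → M → ℝ := fun n => push p (ψ n) with hΦdef
  have hΦ : ∀ n, ContMDiff (𝓡 4) 𝓘(ℝ, ℝ) ∞ (Φ n) := fun n => contMDiff_push (hψ n) hK'd
  have hmu : AEStronglyMeasurable (loc p (fun x => θ x * u x)) (volume.restrict (dom p)) := by
    refine hmul.1.restrict.congr ?_
    filter_upwards [ae_restrict_mem hd.measurableSet] with y hy using eloc y hy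
  have hθu0 : ∀ x, x ∉ piece p B → θ x * u x = 0 := fun x hx => by
    have : θ x = 0 := by by_contra h0; exact hx (hs x h0)
    rw [this, zero_mul]
  have hL : MemLp (fun x => θ x * u x) 2 (vol g) := by
    refine memLp_piece hB hBd hθu0 hmu ((hmul.restrict B).ae_eq ?_)
    filter_upwards [ae_restrict_mem hB.measurableSet] with y hy using eloc y (hBd hy)
  have hΦ0 : ∀ n x, x ∉ piece p K' → Φ n x = 0 := fun n x hx => by
    by_contra h0
    exact hx (suppIn_push (fun y hy => (hψ n).eq_zero hy) x h0)
  -- convergence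
  obtain ⟨C, hC⟩ := exists_eLpNorm_le g hBK hBKd
  have hconv : Tendsto (fun n => eLpNorm (fun x => Φ n x - θ x * u x) 2 (vol g)) atTop (𝓝 0) := by
    have h0 := ENNReal.Tendsto.const_mul (a := (C : ENNReal)) t0 (Or.inr ENNReal.coe_ne_top)
    rw [mul_zero] at h0
    refine tendsto_of_tendsto_of_tendsto_of_le_of_le tendsto_const_nhds h0 (fun _ => zero_le)
      fun n => ?_
    refine ((hC _ ((memLp_of_contMDiff g (hΦ n)).1.sub hL.1).restrict).2 fun x hx => ?_).trans
      (mul_le_mul_right ?_ _)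
    · change Φ n x - θ x * u x = 0
      rw [hΦ0 n x fun hh => hx ⟨hh.1, Or.inr hh.2⟩, hθu0 x fun hh => hx ⟨hh.1, Or.inl hh.2⟩, sub_zero]
    · refine le_trans (le_of_eq (eLpNorm_congr_ae ?_)) (eLpNorm_mono_measure _ Measure.restrict_le_self)
      filter_upwards [ae_restrict_mem hBK.measurableSet] with y hy
      rw [eloc y (hBKd hy), ← loc_push (p := p) (ψ n) (hBKd hy)]
      rfl
  -- the Laplacians
  obtain ⟨K, hK⟩ := exists_eLpNorm_laplacian_le g hK' hK'd
  -- The indices of H are reversed because `H j i` is the limit of ∂_i ∂_j of the approximants.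
  set b : ℕ → ENNReal := fun n => K * ((∑ i, ∑ j, eLpNorm (fun y => pd i (pd j (ψ n)) y - H j i y) 2)
    + ∑ j, eLpNorm (fun y => pd j (ψ n) y - F j y) 2) with hb
  have hb0 : Tendsto b atTop (𝓝 0) := by
    have h1 : Tendsto (fun n => (∑ i, ∑ j, eLpNorm (fun y => pd i (pd j (ψ n)) y - H j i y) 2)
      + ∑ j, eLpNorm (fun y => pd j (ψ n) y - F j y) 2) atTop
      (𝓝 ((∑ _i : Fin 4, ∑ _j : Fin 4, 0) + ∑ _j : Fin 4, 0)) :=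
      (tendsto_finsetSum _ fun i _ => tendsto_finsetSum _ fun j _ => t2 j i).add
        (tendsto_finsetSum _ fun j _ => t1 j)
    simp only [Finset.sum_const_zero, add_zero] at h1
    have := ENNReal.Tendsto.const_mul (a := (K : ENNReal)) h1 (Or.inr ENNReal.coe_ne_top)
    rwa [mul_zero] at this
  have tri : ∀ {a c A : E4 → ℝ}, AEStronglyMeasurable a volume → AEStronglyMeasurable c volume →
      AEStronglyMeasurable A volume → eLpNorm (fun y => a y - c y) 2 (volume.restrict K')
        ≤ eLpNorm (fun y => a y - A y) 2 + eLpNorm (fun y => c y - A y) 2 := by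
    intro a c A ha hc hA
    have : (fun y => a y - c y) = (fun y => a y - A y) - fun y => c y - A y := by
      funext y; simp only [Pi.sub_apply]; ring
    refine (eLpNorm_mono_measure _ Measure.restrict_le_self).trans ?_
    rw [this]
    exact eLpNorm_sub_le (ha.sub hA) (hc.sub hA) (by norm_num)
  have hcau : ∀ n m, eLpNorm (fun x => laplacian g (Φ n) x - laplacian g (Φ m) x) 2 (vol g)
      ≤ b n + b m := by
    intro n m
    have e1 : (fun x => laplacian g (Φ n) x - laplacian g (Φ m) x)
        = laplacian g fun x => Φ n x - Φ m x :=
      (funext fun x => laplacian_sub (hΦ n) (hΦ m) x).symm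
    have q1 : ∀ j, ∀ y ∈ dom p, pd j (loc p fun x => Φ n x - Φ m x) y
        = pd j (ψ n) y - pd j (ψ m) y := fun j y hy => by
      rw [pd_congr_of_eqOn (g := fun y => ψ n y - ψ m y) hd (fun z hz => ?_) hy j]
      · exact pd_sub ((hψ n).differentiableAt y) ((hψ m).differentiableAt y) j
      · exact congrArg₂ (· - ·) (loc_push (ψ n) hz) (loc_push (ψ m) hz)
    have q2 : ∀ i j, ∀ y ∈ dom p, pd i (pd j (loc p fun x => Φ n x - Φ m x)) y
        = pd i (pd j (ψ n)) y - pd i (pd j (ψ m)) y := fun i j y hy => by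
      rw [pd_congr_of_eqOn hd (q1 j) hy i]
      exact pd_sub (((hψ n).pd j).differentiableAt y) (((hψ m).pd j).differentiableAt y) i
    rw [e1]
    refine (hK _ ((hΦ n).sub (hΦ m)) fun x hx => ?_).trans ?_
    · change Φ n x - Φ m x = 0
      rw [hΦ0 n x hx, hΦ0 m x hx, sub_zero]
    · rw [hb]
      simp only
      rw [← mul_add]
      refine mul_le_mul_right ?_ _
      rw [add_add_add_comm]
      refine add_le_add ?_ ?_ <;> rw [← Finset.sum_add_distrib] <;>
        refine Finset.sum_le_sum fun i _ => ?_
      · rw [← Finset.sum_add_distrib]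
        refine Finset.sum_le_sum fun j _ => ?_
        refine le_trans (le_of_eq (eLpNorm_congr_ae ?_)) (tri (((hψ n).pd j).pd i).continuous.aestronglyMeasurable
          (((hψ m).pd j).pd i).continuous.aestronglyMeasurable (mH j i).1)
        filter_upwards [ae_restrict_mem hK'.measurableSet] with y hy using q2 i j y (hK'd hy)
      · refine le_trans (le_of_eq (eLpNorm_congr_ae ?_)) (tri ((hψ n).pd i).continuous.aestronglyMeasurable
          ((hψ m).pd i).continuous.aestronglyMeasurable (mF i).1)
        filter_upwards [ae_restrict_mem hK'.measurableSet] with y hy using q1 i y (hK'd hy)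
  -- The Laplacian of the product is obtained as the L² limit of Laplacians rather than from a
  -- formula.
  obtain ⟨w, hw, htw⟩ := exists_tendsto_of_cauchy
    (fun n => memLp_of_contMDiff g (contMDiff_laplacian (hΦ n))) hb0 hcau
  obtain ⟨Ψ, hΨ⟩ := exists_approx_of_forall hL hw fun ε hε => by
    obtain ⟨n, h1, h2⟩ := ((hconv.eventually (ge_mem_nhds hε)).and
      (htw.eventually (ge_mem_nhds hε))).exists
    exact ⟨Φ n, hΦ n, h1, h2⟩
  exact ⟨w, Ψ, hΨ⟩

lemma approx_of_contMDiff {φ : M → ℝ} (hφ : ContMDiff (𝓡 4) 𝓘(ℝ, ℝ) ∞ φ) :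
    Approx g φ (laplacian g φ) (fun _ => φ) :=
  ⟨fun _ => hφ, memLp_of_contMDiff g hφ, memLp_of_contMDiff g (contMDiff_laplacian hφ), 0,
    fun n => by simp⟩

variable (g) in
-- Density of smooth functions. Each member of the partition of unity localizes u to a chart, where
-- mollification applies, and the finitely many approximations are added. The resulting limit of the
-- Laplacians is a weak Laplacian, hence agrees almost everywhere with the chosen one.
theorem MemH2.exists_approx {u : M → ℝ} (hu : MemH2 u) : ∃ Φ, Approx g u (weakLaplacian g u) Φ := by
  obtain ⟨𝒜⟩ := exists_finAtlas (M := M)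
  have key : ∀ s : Finset M, ∃ w Φ, Approx g (fun x => ∑ p ∈ s, 𝒜.θ p x * u x) w Φ := by
    classical
    intro s
    induction s using Finset.induction_on with
    | empty =>
      simp only [Finset.sum_empty]
      exact ⟨_, _, approx_of_contMDiff contMDiff_const⟩
    | insert p s hp ih =>
      obtain ⟨w, Φ, h⟩ := ih
      obtain ⟨w', Φ', h'⟩ := exists_approx_mul (g := g) hu (𝒜.compact p) (𝒜.subset p)
        (𝒜.smooth p) (𝒜.supp p)
      simp only [Finset.sum_insert hp]
      exact ⟨_, _, h'.add h⟩
  obtain ⟨w, Φ, h⟩ := key 𝒜.ι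
  have e : (fun x => ∑ p ∈ 𝒜.ι, 𝒜.θ p x * u x) = u := funext fun x => (𝒜.eq_sum u x).symm
  rw [e] at h
  have hw := h.weakLaplacian_ae_eq
  refine ⟨Φ, h.smooth, h.memLp, h.memLp'.ae_eq hw.symm, ?_⟩
  obtain ⟨C, hC⟩ := h.fast
  refine ⟨C, fun n => ⟨(hC n).1, le_trans (le_of_eq (eLpNorm_congr_ae ?_)) (hC n).2⟩⟩
  filter_upwards [hw] with x hx
  rw [hx]

end Density

/-! ### Quadratic expressions in square integrable vector fields -/

section Tensor

open Filter

variable {M : Type*} [TopologicalSpace M] [ChartedSpace E4 M] [IsManifold (𝓡 4) ∞ M]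

/-- The covariant component `g(X, ∂_i)` in the chart at `p`. -/
noncomputable def fieldComp (g : Metric M) (p : M) (i : Fin 4) (X : ∀ x : M, TangentSpace (𝓡 4) x) :
    E4 → ℝ := loc p (fun x => g.inner x (X x) (coordVec p i x))

/-- Vector fields in `L²`. -/
def L2Field (g : Metric M) (X : ∀ x : M, TangentSpace (𝓡 4) x) : Prop :=
  ∀ p i, LocL2 (dom p) (fieldComp g p i X)

/-- Convergence of vector fields in `L²`. -/
def FieldTendsto (g : Metric M) (X : ℕ → ∀ x : M, TangentSpace (𝓡 4) x)
    (Y : ∀ x : M, TangentSpace (𝓡 4) x) : Prop :=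
  ∀ p i, ∀ B : Set E4, IsCompact B → B ⊆ dom p → Tendsto (fun n => eLpNorm
    (fun y => fieldComp g p i (X n) y - fieldComp g p i Y y) 2 (volume.restrict B)) atTop (𝓝 0)

/-- `q` is a covariant tensor of order two with continuous coefficients. -/
def IsTensor (g : Metric M)
    (q : ∀ x : M, TangentSpace (𝓡 4) x → TangentSpace (𝓡 4) x → ℝ) : Prop :=
  ∀ p : M, ∃ S : Fin 4 → Fin 4 → E4 → ℝ, (∀ i j, ContinuousOn (S i j) (dom p)) ∧
    ∀ (X Y : ∀ x : M, TangentSpace (𝓡 4) x), ∀ y ∈ dom p, loc p (fun x => q x (X x) (Y x)) y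
      = ∑ i, ∑ j, S i j y * fieldComp g p i X y * fieldComp g p j Y y

variable {g : Metric M} {q : ∀ x : M, TangentSpace (𝓡 4) x → TangentSpace (𝓡 4) x → ℝ}

/-- In covariant components the metric has coefficients g^ij. Covariant components are used because
weak gradients are characterized through g(X, ∂_i). -/
lemma isTensor_inner : IsTensor g fun x v w => g.inner x v w := by
  intro p
  refine ⟨fun i j => loc p (fun x => gramInv g p x i j),
    fun i j => (contDiffOn_loc_gramInv g p i j).continuousOn, fun X Y y hy => ?_⟩
  have h := inner_eq_sum_coordVec (g := g) (symm_mem_src hy) (X _) (Y _)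
  refine h.trans (Finset.sum_congr rfl fun i _ => ?_)
  rw [coordComp_eq_sum g (symm_mem_src hy), Finset.mul_sum]
  refine Finset.sum_congr rfl fun j _ => ?_
  simp only [loc, fieldComp, Function.comp_apply]
  ring

lemma sum_bilinear_pullback (R a : Fin 4 → Fin 4 → ℝ) (x y : Fin 4 → ℝ) :
    ∑ k, ∑ l, R k l * (∑ i, a k i * x i) * (∑ j, a l j * y j)
      = ∑ i, ∑ j, (∑ k, ∑ l, R k l * a k i * a l j) * x i * y j := by
  simp only [Finset.sum_mul, Finset.mul_sum]
  have h1 : ∀ k, ∑ l, ∑ j, ∑ i, R k l * (a k i * x i) * (a l j * y j)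
      = ∑ i, ∑ j, ∑ l, R k l * a k i * a l j * x i * y j := by
    intro k
    calc _ = ∑ j, ∑ l, ∑ i, R k l * (a k i * x i) * (a l j * y j) := Finset.sum_comm
      _ = ∑ j, ∑ i, ∑ l, R k l * (a k i * x i) * (a l j * y j) :=
        Finset.sum_congr rfl fun j _ => Finset.sum_comm
      _ = ∑ i, ∑ j, ∑ l, R k l * (a k i * x i) * (a l j * y j) := Finset.sum_comm
      _ = _ := Finset.sum_congr rfl fun i _ => Finset.sum_congr rfl fun j _ =>
        Finset.sum_congr rfl fun l _ => by ring
  simp only [h1]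
  rw [Finset.sum_comm]
  exact Finset.sum_congr rfl fun i _ => Finset.sum_comm

/-- The coefficients are those of the Ricci tensor with both indices raised. -/
lemma isTensor_ricci : IsTensor g (ricci g) := by
  intro p
  refine ⟨fun i j y => ∑ k, ∑ l, loc p (ricciComp g p k l) y * loc p (fun x => gramInv g p x k i) y
    * loc p (fun x => gramInv g p x l j) y, fun i j => ?_, fun X Y y hy => ?_⟩
  · exact continuousOn_finsetSum _ fun k _ => continuousOn_finsetSum _ fun l _ =>
      ((contDiffOn_loc_ricciComp g p k l).continuousOn.mul
        (contDiffOn_loc_gramInv g p k i).continuousOn).mul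
        (contDiffOn_loc_gramInv g p l j).continuousOn
  · have h := ricci_eq g (symm_mem_src hy) (X _) (Y _)
    refine h.trans ?_
    simp only [coordComp_eq_sum g (symm_mem_src hy)]
    exact sum_bilinear_pullback _ _ _ _

lemma IsTensor.mul_left (hq : IsTensor g q) {f : M → ℝ} (hf : ∀ p, ContinuousOn (loc p f) (dom p)) :
    IsTensor g fun x v w => f x * q x v w := by
  intro p
  obtain ⟨S, hS, h⟩ := hq p
  refine ⟨fun i j y => loc p f y * S i j y, fun i j => (hf p).mul (hS i j), fun X Y y hy => ?_⟩
  have := congrArg (loc p f y * ·) (h X Y y hy)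
  refine Eq.trans this ?_
  simp only [Finset.mul_sum, mul_assoc]

variable [T2Space M] [CompactSpace M] [MeasurableSpace M] [BorelSpace M]

lemma integrable_piece {p : M} {B : Set E4} (hB : IsCompact B) (hBd : B ⊆ dom p) {f : M → ℝ}
    (hf : ∀ x, x ∉ piece p B → f x = 0) (hm : AEStronglyMeasurable (loc p f) (volume.restrict (dom p)))
    (h : IntegrableOn (loc p f) B) : Integrable f (vol g) := by
  have h1 := (aestronglyMeasurable_src_iff g p).2 hm
  have e : (src p).indicator f = f := by
    funext x
    by_cases hx : x ∈ src p
    · rw [Set.indicator_of_mem hx]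
    · rw [Set.indicator_of_notMem hx, hf x fun hh => hx hh.1]
  refine ⟨by rw [← e]; exact (aestronglyMeasurable_indicator_iff (isOpen_src p).measurableSet).2 h1, ?_⟩
  obtain ⟨C, hC, hle⟩ := exists_lintegral_le g hB hBd
  have e2 : ∫⁻ x, ‖f x‖ₑ ∂(vol g) = ∫⁻ x in piece p B, ‖f x‖ₑ ∂(vol g) := by
    rw [← lintegral_indicator (measurableSet_piece hB.measurableSet)]
    refine lintegral_congr fun x => ?_
    by_cases hx : x ∈ piece p B
    · rw [Set.indicator_of_mem hx]
    · rw [Set.indicator_of_notMem hx, hf x hx, enorm_zero]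
  rw [HasFiniteIntegral, e2]
  exact ((hle _ h1.enorm).1).trans_lt (ENNReal.mul_lt_top hC.lt_top h.2)

lemma LocL2.aestronglyMeasurable {Ω : Set E4} (hΩ : IsOpen Ω) {f : E4 → ℝ} (hf : LocL2 Ω f) :
    AEStronglyMeasurable f (volume.restrict Ω) :=
  (hf.locallyIntegrableOn hΩ).aestronglyMeasurable

/-- The chart expression of a localized quadratic expression. -/
lemma localized_tensor {p : M} {S : Fin 4 → Fin 4 → E4 → ℝ}
    (hS : ∀ i j, ContinuousOn (S i j) (dom p)) (h : ∀ (X Y : ∀ x : M, TangentSpace (𝓡 4) x),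
      ∀ y ∈ dom p, loc p (fun x => q x (X x) (Y x)) y
        = ∑ i, ∑ j, S i j y * fieldComp g p i X y * fieldComp g p j Y y)
    {B : Set E4} (hB : IsCompact B) (hBd : B ⊆ dom p) {θ : M → ℝ}
    (hθ : ContMDiff (𝓡 4) 𝓘(ℝ, ℝ) ∞ θ) (hs : SuppIn p B θ) :
    ∃ c : Fin 4 → Fin 4 → E4 → ℝ, (∀ i j, ContinuousOn (c i j) B) ∧
      ∀ X Y, L2Field g X → L2Field g Y → Integrable (fun x => θ x * q x (X x) (Y x)) (vol g) ∧
        ∫ x, θ x * q x (X x) (Y x) ∂(vol g)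
          = ∑ i, ∑ j, ∫ y in B, (c i j y * fieldComp g p i X y) * fieldComp g p j Y y := by
  have hd := isOpen_dom p
  have hc : ∀ i j, ContinuousOn (fun y => loc p θ y * (loc p (density g p) y * S i j y)) B :=
    fun i j => ((ContMDiff.loc hθ p).continuousOn.mul
      ((contDiffOn_loc_density g p).continuousOn.mul (hS i j))).mono hBd
  have prodI : ∀ {c : E4 → ℝ}, ContinuousOn c B → ∀ {X Y}, L2Field g X → L2Field g Y → ∀ i j,
      IntegrableOn (fun y => (c y * fieldComp g p i X y) * fieldComp g p j Y y) B := by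
    intro c hcc X Y hX hY i j
    obtain ⟨K, hK⟩ := hB.exists_bound_of_continuousOn hcc
    have h1 : MemLp (fun y => c y * fieldComp g p i X y) 2 (volume.restrict B) := by
      refine ⟨(hcc.aestronglyMeasurable hB.measurableSet).mul (hX p i B hBd hB).1, ?_⟩
      exact (eLpNorm_mul_le hB (K := K) hK).trans_lt
        (ENNReal.mul_lt_top ENNReal.ofReal_lt_top (hX p i B hBd hB).2)
    exact h1.integrable_mul (hY p j B hBd hB)
  refine ⟨_, hc, fun X Y hX hY => ⟨?_, ?_⟩⟩
  · have h0 : ∀ x, x ∉ piece p B → θ x * q x (X x) (Y x) = 0 := fun x hx => by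
      have : θ x = 0 := by by_contra h0; exact hx (hs x h0)
      rw [this, zero_mul]
    have e : ∀ y ∈ dom p, loc p (fun x => θ x * q x (X x) (Y x)) y = ∑ i, ∑ j,
        ((loc p θ y * S i j y) * fieldComp g p i X y) * fieldComp g p j Y y := fun y hy => by
      refine (congrArg (loc p θ y * ·) (h X Y y hy)).trans ?_
      simp only [Finset.mul_sum, mul_assoc]
    refine integrable_piece hB hBd h0 ?_ ?_
    · have : AEStronglyMeasurable (fun y => ∑ i, ∑ j,
          ((loc p θ y * S i j y) * fieldComp g p i X y) * fieldComp g p j Y y)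
          (volume.restrict (dom p)) := by
        refine Finset.aestronglyMeasurable_fun_sum _ fun i _ =>
          Finset.aestronglyMeasurable_fun_sum _ fun j _ => ?_
        exact ((((ContMDiff.loc hθ p).continuousOn.mul (hS i j)).aestronglyMeasurable
          hd.measurableSet).mul (LocL2.aestronglyMeasurable hd (hX p i))).mul
          (LocL2.aestronglyMeasurable hd (hY p j))
      refine this.congr ?_
      filter_upwards [ae_restrict_mem hd.measurableSet] with y hy using (e y hy).symm
    · have : IntegrableOn (fun y => ∑ i, ∑ j,
          ((loc p θ y * S i j y) * fieldComp g p i X y) * fieldComp g p j Y y) B :=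
        integrable_finsetSum _ fun i _ => integrable_finsetSum _ fun j _ =>
          prodI (((ContMDiff.loc hθ p).continuousOn.mul (hS i j)).mono hBd) hX hY i j
      refine this.congr_fun (fun y hy => (e y (hBd hy)).symm) hB.measurableSet
  · have h1 := hs.integral_mul g (fun x => q x (X x) (Y x))
    rw [h1, ← setIntegral_eq_integral_of_forall_compl_eq_zero (s := B) fun y hy => by
      rw [hs.ext0_eq_zero hy, zero_mul]]
    have h2 : ∫ y in B, ext0 p θ y * (loc p (density g p) y * loc p (fun x => q x (X x) (Y x)) y)
        = ∫ y in B, ∑ i, ∑ j, (loc p θ y * (loc p (density g p) y * S i j y)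
          * fieldComp g p i X y) * fieldComp g p j Y y := by
      refine setIntegral_congr_fun hB.measurableSet fun y hy => ?_
      simp only [ext0_apply θ (hBd hy), h X Y y (hBd hy), Finset.mul_sum]
      exact Finset.sum_congr rfl fun i _ => Finset.sum_congr rfl fun j _ => by ring
    refine h2.trans ?_
    rw [integral_finsetSum _ fun i _ => integrable_finsetSum _ fun j _ =>
      prodI (hc i j) hX hY i j]
    exact Finset.sum_congr rfl fun i _ => integral_finsetSum _ fun j _ => prodI (hc i j) hX hY i j

lemma IsTensor.integrable (hq : IsTensor g q) {X Y : ∀ x : M, TangentSpace (𝓡 4) x}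
    (hX : L2Field g X) (hY : L2Field g Y) : Integrable (fun x => q x (X x) (Y x)) (vol g) := by
  obtain ⟨𝒜⟩ := exists_finAtlas (M := M)
  have h : Integrable (fun x => ∑ p ∈ 𝒜.ι, 𝒜.θ p x * q x (X x) (Y x)) (vol g) :=
    integrable_finsetSum _ fun p _ => by
      obtain ⟨S, hS, hh⟩ := hq p
      obtain ⟨c, -, h1⟩ := localized_tensor hS hh (𝒜.compact p) (𝒜.subset p) (𝒜.smooth p) (𝒜.supp p)
      exact (h1 X Y hX hY).1
  exact h.congr (Eventually.of_forall fun x => (𝒜.eq_sum (fun x => q x (X x) (Y x)) x).symm)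

/-- After localization the integral is a finite sum of L² pairings of components, with coefficients
bounded on compact sets; each pairing is continuous. -/
theorem IsTensor.tendsto_integral (hq : IsTensor g q) {X Y : ℕ → ∀ x : M, TangentSpace (𝓡 4) x}
    {X' Y' : ∀ x : M, TangentSpace (𝓡 4) x} (hX : ∀ n, L2Field g (X n)) (hX' : L2Field g X')
    (hY : ∀ n, L2Field g (Y n)) (hY' : L2Field g Y') (tX : FieldTendsto g X X')
    (tY : FieldTendsto g Y Y') : Tendsto (fun n => ∫ x, q x (X n x) (Y n x) ∂(vol g)) atTop
      (𝓝 (∫ x, q x (X' x) (Y' x) ∂(vol g))) := by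
  obtain ⟨𝒜⟩ := exists_finAtlas (M := M)
  have hp : ∀ p ∈ 𝒜.ι, ∃ c : Fin 4 → Fin 4 → E4 → ℝ, (∀ i j, ContinuousOn (c i j) (𝒜.B p)) ∧
      ∀ X Y, L2Field g X → L2Field g Y → Integrable (fun x => 𝒜.θ p x * q x (X x) (Y x)) (vol g) ∧
        ∫ x, 𝒜.θ p x * q x (X x) (Y x) ∂(vol g) = ∑ i, ∑ j, ∫ y in 𝒜.B p,
          (c i j y * fieldComp g p i X y) * fieldComp g p j Y y := fun p _ => by
    obtain ⟨S, hS, hh⟩ := hq p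
    exact localized_tensor hS hh (𝒜.compact p) (𝒜.subset p) (𝒜.smooth p) (𝒜.supp p)
  have e : ∀ X Y, L2Field g X → L2Field g Y → ∫ x, q x (X x) (Y x) ∂(vol g)
      = ∑ p ∈ 𝒜.ι, ∫ x, 𝒜.θ p x * q x (X x) (Y x) ∂(vol g) := by
    intro X Y hX hY
    rw [← integral_finsetSum _ fun p hpι => ((hp p hpι).choose_spec.2 X Y hX hY).1]
    exact integral_congr_ae (Eventually.of_forall fun x => 𝒜.eq_sum (fun x => q x (X x) (Y x)) x)
  rw [e X' Y' hX' hY']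
  simp only [fun n => e (X n) (Y n) (hX n) (hY n)]
  refine tendsto_finsetSum _ fun p hpι => ?_
  obtain ⟨c, hc, h⟩ := hp p hpι
  have hB := 𝒜.compact p
  have hBd := 𝒜.subset p
  rw [(h X' Y' hX' hY').2]
  simp only [fun n => (h (X n) (Y n) (hX n) (hY n)).2]
  refine tendsto_finsetSum _ fun i _ => tendsto_finsetSum _ fun j _ => ?_
  obtain ⟨K, hK⟩ := hB.exists_bound_of_continuousOn (hc i j)
  have hm : ∀ {X}, L2Field g X →
      MemLp (fun y => c i j y * fieldComp g p i X y) 2 (volume.restrict (𝒜.B p)) := by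
    intro X hX
    refine ⟨((hc i j).aestronglyMeasurable hB.measurableSet).mul (hX p i _ hBd hB).1, ?_⟩
    exact (eLpNorm_mul_le hB (K := K) hK).trans_lt
      (ENNReal.mul_lt_top ENNReal.ofReal_lt_top (hX p i _ hBd hB).2)
  refine tendsto_integral_mul (fun n => hm (hX n)) (hm hX') (fun n => hY n p j _ hBd hB)
    (hY' p j _ hBd hB) ?_ (tY p j _ hB hBd)
  have h0 := ENNReal.Tendsto.const_mul (a := ENNReal.ofReal K) (tX p i _ hB hBd)
    (Or.inr ENNReal.ofReal_ne_top)
  rw [mul_zero] at h0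
  refine tendsto_of_tendsto_of_tendsto_of_le_of_le tendsto_const_nhds h0 (fun _ => zero_le)
    fun n => ?_
  refine le_trans (le_of_eq ?_) (eLpNorm_mul_le hB (K := K) hK)
  simp only [mul_sub]

lemma fieldComp_grad {f : M → ℝ} (hf : ContMDiff (𝓡 4) 𝓘(ℝ, ℝ) ∞ f) {p : M} {y : E4}
    (hy : y ∈ dom p) (i : Fin 4) : fieldComp g p i (grad g f) y = pd i (loc p f) y := by
  rw [← pderiv_symm p i f hy]
  exact inner_grad g (symm_mem_src hy)
    (ContMDiff.differentiableAt_loc hf (chart_mem_dom (symm_mem_src hy))) i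

lemma l2Field_grad {f : M → ℝ} (hf : ContMDiff (𝓡 4) 𝓘(ℝ, ℝ) ∞ f) : L2Field g (grad g f) :=
  fun p i => ContinuousOn.locL2 ((pd_contDiffOn (isOpen_dom p) (ContMDiff.loc hf p) i).continuousOn.congr
    fun _ hy => fieldComp_grad hf hy i)

lemma Approx.l2Field {u w : M → ℝ} {Φ : ℕ → M → ℝ} (h : Approx g u w Φ) :
    L2Field g (weakGrad g u) := fun p i => (h.isWeakGrad p i).2.1

lemma Approx.fieldTendsto {u w : M → ℝ} {Φ : ℕ → M → ℝ} (h : Approx g u w Φ) :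
    FieldTendsto g (fun n => grad g (Φ n)) (weakGrad g u) := fun p i B hB hBd =>
  (h.tendsto_weakGrad p i hB hBd).congr fun n => eLpNorm_congr_ae (by
    filter_upwards [ae_restrict_mem hB.measurableSet] with y hy
    rw [fieldComp_grad (h.smooth n) (hBd hy)]
    rfl)

lemma continuousOn_loc {f : M → ℝ} (hf : ContMDiff (𝓡 4) 𝓘(ℝ, ℝ) ∞ f) (p : M) :
    ContinuousOn (loc p f) (dom p) := (ContMDiff.loc hf p).continuousOn

/-- The Paneitz form is the limit of the Paneitz forms of smooth approximations. -/
theorem Approx.tendsto_form {u w v k : M → ℝ} {Φ Ψ : ℕ → M → ℝ} (h : Approx g u w Φ)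
    (h' : Approx g v k Ψ) : Tendsto (fun n => ∫ x, Φ n x * paneitz g (Ψ n) x ∂(vol g)) atTop
      (𝓝 (form g u v)) := by
  have m := fun (f : M → ℝ) (hf : ContMDiff (𝓡 4) 𝓘(ℝ, ℝ) ∞ f) => memLp_of_contMDiff g hf
  have t1 := tendsto_integral_mul (fun n => m _ (contMDiff_laplacian (h.smooth n))) h.memLp'
    (fun n => m _ (contMDiff_laplacian (h'.smooth n))) h'.memLp' h.tendsto.2 h'.tendsto.2
  have e1 : ∫ x, weakLaplacian g u x * weakLaplacian g v x ∂(vol g) = ∫ x, w x * k x ∂(vol g) := by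
    refine integral_congr_ae ?_
    filter_upwards [h.weakLaplacian_ae_eq, h'.weakLaplacian_ae_eq] with x h1 h2
    rw [h1, h2]
  have t2 := (isTensor_inner (g := g)).mul_left (continuousOn_loc (contMDiff_scalarCurv g))
    |>.tendsto_integral (fun n => l2Field_grad (h.smooth n)) h.l2Field
    (fun n => l2Field_grad (h'.smooth n)) h'.l2Field h.fieldTendsto h'.fieldTendsto
  have t3 := (isTensor_ricci (g := g)).mul_left (f := fun _ => 2) (fun _ => continuousOn_const)
    |>.tendsto_integral (fun n => l2Field_grad (h.smooth n)) h.l2Field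
    (fun n => l2Field_grad (h'.smooth n)) h'.l2Field h.fieldTendsto h'.fieldTendsto
  rw [form, e1]
  refine ((t1.add (t2.const_mul (2 / 3))).sub t3).congr fun n => ?_
  exact (integral_mul_paneitz (h.smooth n) (h'.smooth n)).symm

end Tensor

/-! ### The Paneitz form on `H²` -/

section Form

open Filter

variable {M : Type*} [TopologicalSpace M] [ChartedSpace E4 M] [IsManifold (𝓡 4) ∞ M]
  [T2Space M] [CompactSpace M] [MeasurableSpace M] [BorelSpace M] {g : Metric M}

lemma Approx.congr_ae {u u' w w' : M → ℝ} {Φ : ℕ → M → ℝ} (h : Approx g u w Φ)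
    (hu : u =ᵐ[vol g] u') (hw : w =ᵐ[vol g] w') : Approx g u' w' Φ := by
  obtain ⟨C, hC⟩ := h.fast
  refine ⟨h.smooth, h.memLp.ae_eq hu, h.memLp'.ae_eq hw, C, fun n =>
    ⟨le_trans (le_of_eq (eLpNorm_congr_ae ?_)) (hC n).1,
      le_trans (le_of_eq (eLpNorm_congr_ae ?_)) (hC n).2⟩⟩
  · filter_upwards [hu] with x hx
    rw [hx]
  · filter_upwards [hw] with x hx
    rw [hx]

variable (g) in
lemma MemH2.memLp {u : M → ℝ} (hu : MemH2 u) : MemLp u 2 (vol g) := by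
  obtain ⟨Φ, h⟩ := hu.exists_approx g
  exact h.memLp

lemma memH2_of_contMDiff (g : Metric M) {φ : M → ℝ} (hφ : ContMDiff (𝓡 4) 𝓘(ℝ, ℝ) ∞ φ) :
    MemH2 φ := (approx_of_contMDiff (g := g) hφ).memH2

lemma MemH2.add (g : Metric M) {u v : M → ℝ} (hu : MemH2 u) (hv : MemH2 v) : MemH2 fun x => u x + v x := by
  obtain ⟨Φ, h⟩ := hu.exists_approx g
  obtain ⟨Ψ, h'⟩ := hv.exists_approx g
  exact (h.add h').memH2

lemma MemH2.const_mul (g : Metric M) {u : M → ℝ} (hu : MemH2 u) (c : ℝ) : MemH2 fun x => c * u x := by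
  obtain ⟨Φ, h⟩ := hu.exists_approx g
  exact (h.const_mul c).memH2

lemma Approx.sub {u u' w w' : M → ℝ} {Φ Φ' : ℕ → M → ℝ} (h : Approx g u w Φ)
    (h' : Approx g u' w' Φ') :
    Approx g (fun x => u x - u' x) (fun x => w x - w' x) (fun n x => Φ n x - Φ' n x) := by
  have := h.add (h'.const_mul (-1))
  simpa only [neg_one_mul, ← sub_eq_add_neg] using this

lemma MemH2.sub (g : Metric M) {u v : M → ℝ} (hu : MemH2 u) (hv : MemH2 v) : MemH2 fun x => u x - v x := by
  obtain ⟨Φ, h⟩ := hu.exists_approx g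
  obtain ⟨Ψ, h'⟩ := hv.exists_approx g
  exact (h.sub h').memH2

lemma form_comm (u v : M → ℝ) : form g u v = form g v u := by
  simp only [form, mul_comm (weakLaplacian g u _), g.symm _ (weakGrad g u _),
    ricci_symm g _ (weakGrad g u _)]

/-- Additivity cannot be read off the definition, whose weak derivatives are arbitrary choices. It
passes to the limit from smooth approximations, as do the other algebraic properties. -/
lemma form_add_left {u u' v : M → ℝ} (hu : MemH2 u) (hu' : MemH2 u') (hv : MemH2 v) :
    form g (fun x => u x + u' x) v = form g u v + form g u' v := by
  obtain ⟨Φ, h⟩ := hu.exists_approx g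
  obtain ⟨Φ', h'⟩ := hu'.exists_approx g
  obtain ⟨Ψ, k⟩ := hv.exists_approx g
  refine tendsto_nhds_unique ((h.add h').tendsto_form k)
    (((h.tendsto_form k).add (h'.tendsto_form k)).congr fun n => ?_)
  have hP := contMDiff_paneitz (g := g) (k.smooth n)
  have i1 : Integrable (fun x => Φ n x * paneitz g (Ψ n) x) (vol g) :=
    integrable_of_contMDiff ((h.smooth n).mul hP)
  have i2 : Integrable (fun x => Φ' n x * paneitz g (Ψ n) x) (vol g) :=
    integrable_of_contMDiff ((h'.smooth n).mul hP)
  rw [← integral_add i1 i2]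
  simp only [add_mul]

lemma form_const_mul_left {u v : M → ℝ} (hu : MemH2 u) (hv : MemH2 v) (c : ℝ) :
    form g (fun x => c * u x) v = c * form g u v := by
  obtain ⟨Φ, h⟩ := hu.exists_approx g
  obtain ⟨Ψ, k⟩ := hv.exists_approx g
  refine tendsto_nhds_unique ((h.const_mul c).tendsto_form k)
    (((h.tendsto_form k).const_mul c).congr fun n => ?_)
  rw [← integral_const_mul]
  simp only [mul_assoc]

lemma form_add_mul {u v : M → ℝ} (hu : MemH2 u) (hv : MemH2 v) (c : ℝ) :
    form g (fun x => u x + c * v x) (fun x => u x + c * v x)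
      = form g u u + 2 * c * form g u v + c ^ 2 * form g v v := by
  have hcv := hv.const_mul g c
  have hs := hu.add g hcv
  rw [form_add_left hu hcv hs, form_comm u, form_comm _ (fun x => u x + c * v x),
    form_add_left hu hcv hu, form_add_left hu hcv hcv, form_const_mul_left hv hu,
    form_const_mul_left hv hcv, form_comm v (fun x => c * v x), form_const_mul_left hv hv,
    form_comm u (fun x => c * v x), form_const_mul_left hv hu, form_comm v u]
  ring

lemma form_sub {u v : M → ℝ} (hu : MemH2 u) (hv : MemH2 v) :
    form g (fun x => u x - v x) (fun x => u x - v x)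
      = form g u u - 2 * form g u v + form g v v := by
  have h := form_add_mul (g := g) hu hv (-1)
  simp only [neg_one_mul, ← sub_eq_add_neg] at h
  rw [h]
  ring

lemma form_add {u v : M → ℝ} (hu : MemH2 u) (hv : MemH2 v) :
    form g (fun x => u x + v x) (fun x => u x + v x)
      = form g u u + 2 * form g u v + form g v v := by
  have h := form_add_mul (g := g) hu hv 1
  simp only [one_mul] at h
  rw [h]
  ring

lemma form_const_mul_self {u : M → ℝ} (hu : MemH2 u) (c : ℝ) :
    form g (fun x => c * u x) (fun x => c * u x) = c ^ 2 * form g u u := by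
  rw [form_const_mul_left hu (hu.const_mul g c), form_comm, form_const_mul_left hu hu]
  ring

/-- Nonnegativity is assumed on smooth functions only and extends by density. -/
lemma form_nonneg (hP : PaneitzNonneg g) {u : M → ℝ} (hu : MemH2 u) : 0 ≤ form g u u := by
  obtain ⟨Φ, h⟩ := hu.exists_approx g
  exact ge_of_tendsto (h.tendsto_form h) (Eventually.of_forall fun n => hP _ (h.smooth n))

/-- Connects the form with the weak equation P_g u = 0 that defines the kernel. -/
lemma form_contMDiff {u φ : M → ℝ} (hu : MemH2 u) (hφ : ContMDiff (𝓡 4) 𝓘(ℝ, ℝ) ∞ φ) :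
    form g u φ = ∫ x, u x * paneitz g φ x ∂(vol g) := by
  obtain ⟨Φ, h⟩ := hu.exists_approx g
  have hP := memLp_of_contMDiff g (contMDiff_paneitz (g := g) hφ)
  exact tendsto_nhds_unique (h.tendsto_form (approx_of_contMDiff hφ))
    (tendsto_integral_mul (fun n => memLp_of_contMDiff g (h.smooth n)) h.memLp (fun _ => hP) hP
      h.tendsto.1 (by simp))

lemma form_sq_le (hP : PaneitzNonneg g) {u v : M → ℝ} (hu : MemH2 u) (hv : MemH2 v) :
    form g u v ^ 2 ≤ form g u u * form g v v := by
  have h : ∀ c : ℝ, 0 ≤ form g v v * (c * c) + 2 * form g u v * c + form g u u := fun c => by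
    have := form_nonneg hP (hu.add g (hv.const_mul g c))
    rw [form_add_mul hu hv] at this
    linarith
  have := discrim_le_zero h
  unfold discrim at this
  linarith

lemma form_sub_le (hP : PaneitzNonneg g) {u v : M → ℝ} (hu : MemH2 u) (hv : MemH2 v) :
    form g (fun x => u x - v x) (fun x => u x - v x) ≤ 2 * form g u u + 2 * form g v v := by
  have h := form_nonneg hP (hu.add g hv)
  rw [form_add hu hv] at h
  rw [form_sub hu hv]
  linarith

/-! ### The norm of `H²` -/

variable (g) in
/-- The square of the norm of `H²`. -/
noncomputable def hNormSq (u : M → ℝ) : ℝ :=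
  (∫ x, u x ^ 2 ∂(vol g)) + ∫ x, weakLaplacian g u x ^ 2 ∂(vol g)

lemma hNormSq_nonneg (u : M → ℝ) : 0 ≤ hNormSq g u :=
  add_nonneg (integral_nonneg fun _ => sq_nonneg _) (integral_nonneg fun _ => sq_nonneg _)

lemma integral_sq_le_hNormSq (u : M → ℝ) : ∫ x, u x ^ 2 ∂(vol g) ≤ hNormSq g u :=
  le_add_of_nonneg_right (integral_nonneg fun _ => sq_nonneg _)

lemma Approx.hNormSq_eq {u w : M → ℝ} {Φ : ℕ → M → ℝ} (h : Approx g u w Φ) :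
    hNormSq g u = (∫ x, u x ^ 2 ∂(vol g)) + ∫ x, w x ^ 2 ∂(vol g) := by
  rw [hNormSq]
  congr 1
  refine integral_congr_ae ?_
  filter_upwards [h.weakLaplacian_ae_eq] with x hx
  rw [hx]

lemma hNormSq_const_mul {u : M → ℝ} (hu : MemH2 u) (c : ℝ) :
    hNormSq g (fun x => c * u x) = c ^ 2 * hNormSq g u := by
  obtain ⟨Φ, h⟩ := hu.exists_approx g
  rw [(h.const_mul c).hNormSq_eq, h.hNormSq_eq]
  simp only [mul_pow, integral_const_mul, mul_add]

lemma Approx.tendsto_integral_sq {u w : M → ℝ} {Φ : ℕ → M → ℝ} (h : Approx g u w Φ) :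
    Tendsto (fun n => ∫ x, Φ n x ^ 2 ∂(vol g)) atTop (𝓝 (∫ x, u x ^ 2 ∂(vol g))) := by
  have t := tendsto_integral_mul (fun n => memLp_of_contMDiff g (h.smooth n)) h.memLp
    (fun n => memLp_of_contMDiff g (h.smooth n)) h.memLp h.tendsto.1 h.tendsto.1
  simpa only [← pow_two] using t

lemma Approx.tendsto_sobSq {u w : M → ℝ} {Φ : ℕ → M → ℝ} (h : Approx g u w Φ) :
    Tendsto (fun n => sobSq g (Φ n)) atTop (𝓝 (hNormSq g u)) := by
  rw [h.hNormSq_eq]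
  have m := fun n => memLp_of_contMDiff g (contMDiff_laplacian (g := g) (h.smooth n))
  have t := tendsto_integral_mul m h.memLp' m h.memLp' h.tendsto.2 h.tendsto.2
  simp only [← pow_two] at t
  exact h.tendsto_integral_sq.add t

variable (g) in
-- In each chart of a finite atlas the Ricci components and g^ii are bounded on compact pieces, and
-- components of v are bounded by `coordComp_sq_le`; there are 16 terms.
lemma exists_ricci_le : ∃ K, 0 ≤ K ∧ ∀ (x : M) (v : TangentSpace (𝓡 4) x),
    |ricci g x v v| ≤ K * g.inner x v v := by
  obtain ⟨𝒜⟩ := exists_finAtlas (M := M)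
  have hp : ∀ p : M, ∃ K, 0 ≤ K ∧ ∀ x, x ∈ piece p (𝒜.B p) → ∀ v : TangentSpace (𝓡 4) x,
      |ricci g x v v| ≤ K * g.inner x v v := by
    intro p
    obtain ⟨K1, hK1, b1⟩ := exists_abs_le (𝒜.compact p) (ι := Fin 4 × Fin 4)
      (f := fun a => loc p (ricciComp g p a.1 a.2))
      (fun a => (contDiffOn_loc_ricciComp g p a.1 a.2).continuousOn.mono (𝒜.subset p))
    obtain ⟨K2, hK2, b2⟩ := exists_abs_le (𝒜.compact p)
      (f := fun i => loc p (fun x => gramInv g p x i i))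
      (fun i => (contDiffOn_loc_gramInv g p i i).continuousOn.mono (𝒜.subset p))
    refine ⟨16 * (K1 * K2), by positivity, fun x hx v => ?_⟩
    have c1 : ∀ i j, |ricciComp g p i j x| ≤ K1 := fun i j => by
      have := b1 (i, j) _ hx.2
      simpa only [loc, Function.comp_apply, symm_chart hx.1] using this
    have c2 : ∀ i, gramInv g p x i i ≤ K2 := fun i => by
      have := (le_abs_self _).trans (b2 i _ hx.2)
      simpa only [loc, Function.comp_apply, symm_chart hx.1] using this
    have hv := inner_self_nonneg g x v
    have c3 : ∀ i, coordComp p i x v ^ 2 ≤ K2 * g.inner x v v := fun i =>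
      (coordComp_sq_le g hx.1 v i).trans (mul_le_mul_of_nonneg_right (c2 i) hv)
    have c4 : ∀ i j, |ricciComp g p i j x * coordComp p i x v * coordComp p j x v|
        ≤ K1 * K2 * g.inner x v v := by
      intro i j
      rw [mul_assoc, abs_mul, mul_assoc]
      refine mul_le_mul (c1 i j) ?_ (abs_nonneg _) hK1
      rw [abs_le]
      constructor <;> nlinarith [c3 i, c3 j, sq_nonneg (coordComp p i x v + coordComp p j x v),
        sq_nonneg (coordComp p i x v - coordComp p j x v)]
    rw [ricci_eq g hx.1]
    refine (Finset.abs_sum_le_sum_abs _ _).trans ?_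
    refine (Finset.sum_le_sum fun i _ => (Finset.abs_sum_le_sum_abs _ _).trans
      (Finset.sum_le_sum fun j _ => c4 i j)).trans (le_of_eq ?_)
    simp only [Finset.sum_const, Finset.card_univ, Fintype.card_fin, nsmul_eq_mul]
    push_cast
    ring
  choose K hK hh using hp
  refine ⟨∑ p ∈ 𝒜.ι, K p, Finset.sum_nonneg fun p _ => hK p, fun x v => ?_⟩
  obtain ⟨p, hp, hx⟩ := 𝒜.exists_mem x
  exact (hh p x hx v).trans (mul_le_mul_of_nonneg_right
    (Finset.single_le_sum (f := K) (fun q _ => hK q) hp) (inner_self_nonneg g x v))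

variable (g) in
-- The curvature terms of the form are of first order, hence dominated by the Dirichlet integral.
lemma exists_abs_paneitz_sub_le : ∃ K, 0 ≤ K ∧ ∀ φ : M → ℝ, ContMDiff (𝓡 4) 𝓘(ℝ, ℝ) ∞ φ →
    |(∫ x, φ x * paneitz g φ x ∂(vol g)) - ∫ x, laplacian g φ x ^ 2 ∂(vol g)|
      ≤ K * ∫ x, g.inner x (grad g φ x) (grad g φ x) ∂(vol g) := by
  obtain ⟨K, hK, hr⟩ := exists_ricci_le g
  obtain ⟨R, hR⟩ := isCompact_univ.exists_bound_of_continuousOn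
    (contMDiff_scalarCurv g).continuous.continuousOn
  have hR' : ∀ x, |scalarCurv g x| ≤ |R| := fun x => (hR x trivial).trans (le_abs_self R)
  refine ⟨2 / 3 * |R| + 2 * K, by positivity, fun φ hφ => ?_⟩
  have hl := l2Field_grad (g := g) hφ
  have i1 := (isTensor_inner (g := g)).integrable hl hl
  have i2 := (isTensor_inner (g := g)).mul_left (continuousOn_loc (contMDiff_scalarCurv g))
    |>.integrable hl hl
  have i3 := (isTensor_ricci (g := g)).mul_left (f := fun _ => 2) (fun _ => continuousOn_const)
    |>.integrable hl hl
  have e : (∫ x, φ x * paneitz g φ x ∂(vol g)) - ∫ x, laplacian g φ x ^ 2 ∂(vol g)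
      = ∫ x, (2 / 3 * (scalarCurv g x * g.inner x (grad g φ x) (grad g φ x))
        - 2 * ricci g x (grad g φ x) (grad g φ x)) ∂(vol g) := by
    rw [integral_mul_paneitz hφ hφ, integral_sub (i2.const_mul _) i3, integral_const_mul (2 / 3)]
    simp only [pow_two]
    ring
  rw [e, ← integral_const_mul, ← Real.norm_eq_abs]
  refine norm_integral_le_of_norm_le (i1.const_mul _) (Eventually.of_forall fun x => ?_)
  have hv := inner_self_nonneg g x (grad g φ x)
  have a1 := hr x (grad g φ x)
  have a2 : |scalarCurv g x * g.inner x (grad g φ x) (grad g φ x)|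
      ≤ |R| * g.inner x (grad g φ x) (grad g φ x) := by
    rw [abs_mul, abs_of_nonneg hv]
    exact mul_le_mul_of_nonneg_right (hR' x) hv
  rw [abs_le] at a1 a2
  rw [Real.norm_eq_abs, abs_le]
  constructor <;> linarith [a1.1, a1.2, a2.1, a2.2]

variable (g) in
/-- Gårding's inequality, and the boundedness of the Paneitz form. -/
lemma exists_garding : ∃ C, 0 ≤ C ∧ ∀ u : M → ℝ, MemH2 u →
    hNormSq g u ≤ 2 * form g u u + C * ∫ x, u x ^ 2 ∂(vol g) ∧ form g u u ≤ C * hNormSq g u := by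
  obtain ⟨K, hK, h⟩ := exists_abs_paneitz_sub_le g
  -- With this weight the Dirichlet integral contributes at most half of ∫ (Δφ)², which is absorbed.
  set ε : ℝ := (2 * (K + 1))⁻¹ with hε
  have hε0 : 0 < ε := by positivity
  have hKε : K * ε ≤ 1 / 2 := by
    rw [hε, ← div_eq_mul_inv, div_le_div_iff₀ (by positivity) (by norm_num)]
    linarith
  set D : ℝ := K * (4 * ε)⁻¹ with hD
  have hD0 : 0 ≤ D := by positivity
  refine ⟨2 * D + K + 2, by positivity, fun u hu => ?_⟩
  obtain ⟨Φ, hΦ⟩ := hu.exists_approx g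
  have key : ∀ φ : M → ℝ, ContMDiff (𝓡 4) 𝓘(ℝ, ℝ) ∞ φ →
      sobSq g φ ≤ 2 * (∫ x, φ x * paneitz g φ x ∂(vol g))
        + (2 * D + K + 2) * ∫ x, φ x ^ 2 ∂(vol g) ∧
      ∫ x, φ x * paneitz g φ x ∂(vol g) ≤ (2 * D + K + 2) * sobSq g φ := by
    intro φ hφ
    have h1 := abs_le.1 (h φ hφ)
    have h2 := mul_le_mul_of_nonneg_left (integral_grad_sq_le (g := g) hφ hε0) hK
    have h3 := mul_le_mul_of_nonneg_left (integral_grad_sq_le_sobSq (g := g) hφ) hK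
    have p1 : 0 ≤ ∫ x, φ x ^ 2 ∂(vol g) := integral_nonneg fun _ => sq_nonneg _
    have p2 : 0 ≤ ∫ x, laplacian g φ x ^ 2 ∂(vol g) := integral_nonneg fun _ => sq_nonneg _
    have h4 := mul_le_mul_of_nonneg_right hKε p2
    have h5 : sobSq g φ = (∫ x, φ x ^ 2 ∂(vol g)) + ∫ x, laplacian g φ x ^ 2 ∂(vol g) := rfl
    have h6 : K * (ε * (∫ x, laplacian g φ x ^ 2 ∂(vol g)) + (4 * ε)⁻¹ * ∫ x, φ x ^ 2 ∂(vol g))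
        = K * ε * (∫ x, laplacian g φ x ^ 2 ∂(vol g)) + D * ∫ x, φ x ^ 2 ∂(vol g) := by
      rw [hD]; ring
    have h7 := mul_nonneg hK p1
    have h8 := mul_nonneg hD0 p1
    have h9 := mul_nonneg hD0 p2
    constructor
    · nlinarith [h1.1]
    · rw [h5] at h3 ⊢
      nlinarith [h1.2]
  exact ⟨le_of_tendsto_of_tendsto' hΦ.tendsto_sobSq (((hΦ.tendsto_form hΦ).const_mul 2).add
      (hΦ.tendsto_integral_sq.const_mul _)) fun n => (key _ (hΦ.smooth n)).1,
    le_of_tendsto_of_tendsto' (hΦ.tendsto_form hΦ) (hΦ.tendsto_sobSq.const_mul _)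
      fun n => (key _ (hΦ.smooth n)).2⟩

end Form

/-! ### Compactness and coercivity -/

section Coercivity

open Filter

variable {M : Type*} [TopologicalSpace M] [ChartedSpace E4 M] [IsManifold (𝓡 4) ∞ M]
  [T2Space M] [CompactSpace M] [MeasurableSpace M] [BorelSpace M] {g : Metric M}

variable (g) in
/-- Functionals on test functions in a chart as functionals on functions on the manifold. -/
lemma exists_integral_eq {p : M} {B : Set E4} (hB : IsCompact B) (hBd : B ⊆ dom p) {θ : M → ℝ}
    (hθ : ContMDiff (𝓡 4) 𝓘(ℝ, ℝ) ∞ θ) (hs : SuppIn p B θ) {w : E4 → ℝ} (hw : Continuous w) :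
    ∃ ζ : M → ℝ, MemLp ζ 2 (vol g) ∧ ∀ φ : M → ℝ,
      ∫ y, w y * ext0 p (fun x => θ x * φ x) y = ∫ x, ζ x * φ x ∂(vol g) := by
  -- Dividing by the density compensates for the passage from Lebesgue to Riemannian volume; the
  -- cutoff makes the result extend by zero.
  set κ : E4 → ℝ := fun y => ext0 p θ y * (w y / loc p (density g p) y) with hκ
  have hρ : ∀ y ∈ dom p, loc p (density g p) y ≠ 0 := fun y hy => (loc_density_pos hy).ne'
  have h0 : ∀ y, y ∉ B → κ y = 0 := fun y hy => by
    rw [hκ]; simp only [hs.ext0_eq_zero hy, zero_mul]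
  have hc : ContinuousOn κ (dom p) :=
    ((hs.testFn hB hBd (ContMDiff.loc hθ p)).continuous.continuousOn).mul
      (hw.continuousOn.div (contDiffOn_loc_density g p).continuousOn hρ)
  have hc' : ContinuousOn (loc p (push p κ)) (dom p) := hc.congr fun y hy => loc_push κ hy
  refine ⟨push p κ, memLp_piece hB hBd (fun x hx => ?_)
    (hc'.aestronglyMeasurable (isOpen_dom p).measurableSet)
    (ContinuousOn.memLp_restrict (hc'.mono hBd) hB 2), fun φ => ?_⟩
  · by_contra hh
    exact hx (suppIn_push h0 x hh)
  · rw [(suppIn_push h0).integral_mul g φ, ext0_push h0 hBd]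
    refine integral_congr_ae (Eventually.of_forall fun y => ?_)
    simp only [hκ]
    by_cases hy : y ∈ dom p
    · have := hρ y hy
      rw [ext0_apply _ hy, ext0_apply _ hy]
      change w y * (loc p θ y * loc p φ y) = _
      field_simp
    · rw [ext0, ext0, Set.indicator_of_notMem hy, Set.indicator_of_notMem hy]
      ring

variable (g) in
-- The Euclidean inequality for θφ read in the chart. Its first derivatives are controlled by the
-- Sobolev norm of φ, and its functionals are represented by functions on M.
lemma exists_localized_compactness {p : M} {B : Set E4} (hB : IsCompact B) (hBd : B ⊆ dom p)
    {θ : M → ℝ} (hθ : ContMDiff (𝓡 4) 𝓘(ℝ, ℝ) ∞ θ) (hs : SuppIn p B θ) {ε : ℝ} (hε : 0 < ε) :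
    ∃ (W : Finset (M → ℝ)) (C : ℝ), 0 ≤ C ∧ (∀ ζ ∈ W, MemLp ζ 2 (vol g)) ∧ ∀ φ : M → ℝ,
      ContMDiff (𝓡 4) 𝓘(ℝ, ℝ) ∞ φ → ∫ x, (θ x * φ x) ^ 2 ∂(vol g)
        ≤ ε * sobSq g φ + C * ∑ ζ ∈ W, (∫ x, ζ x * φ x ∂(vol g)) ^ 2 := by
  classical
  have hd := isOpen_dom p
  obtain ⟨r, -, R, hR, hρ⟩ := exists_density_bounds g hB hBd
  obtain ⟨K1, hK1, b1⟩ := exists_setIntegral_le g hB hBd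
  obtain ⟨K2, hK2, b2⟩ := exists_setIntegral_pd_sq_le g hB hBd
  have sθ := ContMDiff.loc hθ p
  obtain ⟨L, hL, bL⟩ := exists_abs_le hB (ι := Option (Fin 4))
    (f := fun a => a.elim (loc p θ) fun i => pd i (loc p θ)) (fun a => by
      cases a with
      | none => exact sθ.continuousOn.mono hBd
      | some i => exact (pd_contDiffOn hd sθ i).continuousOn.mono hBd)
  have bθ : ∀ y ∈ B, loc p θ y ^ 2 ≤ L ^ 2 := fun y hy => sq_le_sq.2 (by
    rw [abs_of_nonneg hL]; exact bL none y hy)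
  have bpθ : ∀ i, ∀ y ∈ B, pd i (loc p θ) y ^ 2 ≤ L ^ 2 := fun i y hy => sq_le_sq.2 (by
    rw [abs_of_nonneg hL]; exact bL (some i) y hy)
  set D : ℝ := L ^ 2 * K1 + 4 * (2 * (L ^ 2 * K1 + L ^ 2 * K2)) with hD
  have hD0 : 0 ≤ D := by positivity
  -- Passing between M and the chart multiplies the small term by at most R D.
  have hδ : 0 < ε / (R * D + 1) := by positivity
  obtain ⟨s, w, C, hw, hcomp⟩ := exists_compactness_inequality hB hδ
  choose ζ hζ hζφ using fun m => exists_integral_eq g hB hBd hθ hs (hw m)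
  refine ⟨s.image ζ, R * |C| * s.card, by positivity, fun k hk => ?_, fun φ hφ => ?_⟩
  · obtain ⟨m, -, rfl⟩ := Finset.mem_image.1 hk
    exact hζ m
  set v : E4 → ℝ := ext0 p (fun x => θ x * φ x) with hv
  have hsm : ContMDiff (𝓡 4) 𝓘(ℝ, ℝ) ∞ (fun x => θ x * φ x) := hθ.mul hφ
  have hs' : SuppIn p B (fun x => θ x * φ x) := hs.mul_right φ
  have hvT : TestFn B v := hs'.testFn hB hBd (ContMDiff.loc hsm p)
  have sφ := ContMDiff.loc hφ p
  have hv1 : ∀ y ∈ B, v y = loc p θ y * loc p φ y := fun y hy => ext0_apply _ (hBd hy)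
  have hv2 : ∀ i, ∀ y ∈ B, pd i v y
      = pd i (loc p θ) y * loc p φ y + loc p θ y * pd i (loc p φ) y := fun i y hy => by
    rw [hv, pd_ext0 _ i (hBd hy)]
    exact pd_mul (differentiableAt_of_contDiffOn hd sθ (hBd hy))
      (differentiableAt_of_contDiffOn hd sφ (hBd hy)) i
  have conB : ∀ {f : E4 → ℝ}, ContinuousOn f (dom p) → IntegrableOn f B := fun hf =>
    (hf.mono hBd).integrableOn_compact hB
  have i1 : IntegrableOn (fun y => loc p φ y ^ 2) B := conB (sφ.continuousOn.pow 2)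
  have i2 : ∀ i, IntegrableOn (fun y => pd i (loc p φ) y ^ 2) B := fun i =>
    conB ((pd_contDiffOn hd sφ i).continuousOn.pow 2)
  have e1 : ∫ y in B, loc p φ y ^ 2 ≤ K1 * sobSq g φ := by
    refine (b1 (fun x => φ x ^ 2) (hφ.continuous.pow 2) fun x => sq_nonneg _).trans
      (mul_le_mul_of_nonneg_left ?_ hK1)
    exact le_add_of_nonneg_right (integral_nonneg fun _ => sq_nonneg _)
  have z1 : ∀ {f : E4 → ℝ}, (∀ y, y ∉ B → f y = 0) → ∫ y in B, f y = ∫ y, f y := fun h =>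
    setIntegral_eq_integral_of_forall_compl_eq_zero h
  have f1 : ∫ y, v y ^ 2 ≤ L ^ 2 * K1 * sobSq g φ := by
    rw [← z1 fun y hy => by rw [hvT.eq_zero hy]; ring, mul_assoc]
    refine le_trans ?_ (mul_le_mul_of_nonneg_left e1 (sq_nonneg L))
    rw [← integral_const_mul]
    refine setIntegral_mono_on hvT.integrable_sq.integrableOn (i1.const_mul _) hB.measurableSet
      fun y hy => ?_
    rw [hv1 y hy, mul_pow]
    exact mul_le_mul_of_nonneg_right (bθ y hy) (sq_nonneg _)
  have f2 : ∀ i, ∫ y, pd i v y ^ 2 ≤ 2 * (L ^ 2 * K1 + L ^ 2 * K2) * sobSq g φ := by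
    intro i
    rw [← z1 fun y hy => by rw [(hvT.pd i).eq_zero hy]; ring]
    have h1 : ∫ y in B, pd i v y ^ 2
        ≤ ∫ y in B, (2 * L ^ 2 * loc p φ y ^ 2 + 2 * L ^ 2 * pd i (loc p φ) y ^ 2) := by
      refine setIntegral_mono_on (hvT.pd i).integrable_sq.integrableOn
        ((i1.const_mul _).add ((i2 i).const_mul _)) hB.measurableSet fun y hy => ?_
      rw [hv2 i y hy]
      have q1 := mul_le_mul_of_nonneg_right (bθ y hy) (sq_nonneg (pd i (loc p φ) y))
      have q2 := mul_le_mul_of_nonneg_right (bpθ i y hy) (sq_nonneg (loc p φ y))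
      nlinarith [sq_nonneg (pd i (loc p θ) y * loc p φ y - loc p θ y * pd i (loc p φ) y)]
    rw [integral_add (i1.const_mul _) ((i2 i).const_mul _), integral_const_mul,
      integral_const_mul] at h1
    have q1 := mul_le_mul_of_nonneg_left e1 (by positivity : 0 ≤ 2 * L ^ 2)
    have q2 := mul_le_mul_of_nonneg_left (b2 φ hφ i) (by positivity : 0 ≤ 2 * L ^ 2)
    linarith
  have f3 : (∫ y, v y ^ 2) + ∑ i, ∫ y, pd i v y ^ 2 ≤ D * sobSq g φ := by
    have : ∑ i, ∫ y, pd i v y ^ 2 ≤ ∑ _i : Fin 4, 2 * (L ^ 2 * K1 + L ^ 2 * K2) * sobSq g φ :=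
      Finset.sum_le_sum fun i _ => f2 i
    simp only [Finset.sum_const, Finset.card_univ, Fintype.card_fin, nsmul_eq_mul] at this
    push_cast at this
    rw [hD]
    linarith
  have f4 : ∫ x, (θ x * φ x) ^ 2 ∂(vol g) ≤ R * ∫ y, v y ^ 2 := by
    simp only [pow_two]
    rw [hs'.integral_mul g, ← integral_const_mul, ← hv,
      ← z1 fun y hy => by rw [hvT.eq_zero hy, zero_mul],
      ← z1 (f := fun y => R * (v y * v y)) fun y hy => by rw [hvT.eq_zero hy]; ring]
    have hle : ∀ y ∈ B, v y * (loc p (density g p) y * loc p (fun x => θ x * φ x) y)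
        ≤ R * (v y * v y) := fun y hy => by
      have : loc p (fun x => θ x * φ x) y = v y := (ext0_apply _ (hBd hy)).symm
      rw [this]
      nlinarith [(hρ y hy).2, mul_self_nonneg (v y)]
    refine setIntegral_mono_on ?_ ?_ hB.measurableSet hle
    · exact ((hvT.continuous.continuousOn).mul (((contDiffOn_loc_density g p).continuousOn.mul
        (ContMDiff.loc hsm p).continuousOn).mono hBd)).integrableOn_compact hB
    · have := (hvT.integrable_sq.const_mul R).integrableOn (s := B)
      simpa only [pow_two] using this
  have f5 : ∑ m ∈ s, (∫ y, w m y * v y) ^ 2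
      ≤ s.card * ∑ k ∈ s.image ζ, (∫ x, k x * φ x ∂(vol g)) ^ 2 := by
    rw [← nsmul_eq_mul]
    refine Finset.sum_le_card_nsmul _ _ _ fun m hm => ?_
    rw [hv, hζφ m φ]
    exact Finset.single_le_sum (f := fun k : M → ℝ => (∫ x, k x * φ x ∂(vol g)) ^ 2)
      (fun k _ => sq_nonneg _) (Finset.mem_image_of_mem ζ hm)
  have hS : 0 ≤ sobSq g φ := sobSq_nonneg φ
  have hsum : 0 ≤ ∑ m ∈ s, (∫ y, w m y * v y) ^ 2 := Finset.sum_nonneg fun _ _ => sq_nonneg _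
  have f6 : R * (ε / (R * D + 1) * (D * sobSq g φ)) ≤ ε * sobSq g φ := by
    have : R * (ε / (R * D + 1) * (D * sobSq g φ)) = (R * D / (R * D + 1)) * (ε * sobSq g φ) := by
      field_simp
    rw [this]
    refine mul_le_of_le_one_left (by positivity) ?_
    rw [div_le_one (by positivity)]
    linarith
  calc ∫ x, (θ x * φ x) ^ 2 ∂(vol g) ≤ R * ∫ y, v y ^ 2 := f4
    _ ≤ R * (ε / (R * D + 1) * (D * sobSq g φ) + |C| * (s.card *
        ∑ k ∈ s.image ζ, (∫ x, k x * φ x ∂(vol g)) ^ 2)) := by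
      refine mul_le_mul_of_nonneg_left ((hcomp v hvT).trans (add_le_add ?_ ?_)) hR.le
      · exact mul_le_mul_of_nonneg_left f3 hδ.le
      · exact (mul_le_mul_of_nonneg_right (le_abs_self C) hsum).trans
          (mul_le_mul_of_nonneg_left f5 (abs_nonneg C))
    _ ≤ _ := by
      rw [mul_add]
      refine add_le_add f6 (le_of_eq ?_)
      ring

variable (g) in
/-- The `L²` norm is controlled by a small multiple of the `H²` norm and finitely many
functionals. -/
lemma exists_compactness {ε : ℝ} (hε : 0 < ε) : ∃ (W : Finset (M → ℝ)) (C : ℝ), 0 ≤ C ∧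
    (∀ ζ ∈ W, MemLp ζ 2 (vol g)) ∧ ∀ u : M → ℝ, MemH2 u → ∫ x, u x ^ 2 ∂(vol g)
      ≤ ε * hNormSq g u + C * ∑ ζ ∈ W, (∫ x, ζ x * u x ∂(vol g)) ^ 2 := by
  classical
  obtain ⟨𝒜⟩ := exists_finAtlas (M := M)
  set N : ℝ := (Finset.card 𝒜.ι : ℝ) with hN
  -- One factor N comes from Cauchy–Schwarz for the decomposition into N pieces, the other from
  -- summing their small terms.
  have hδ : 0 < ε / (N * N + 1) := by positivity
  choose W C hC hW h using fun p => exists_localized_compactness g (𝒜.compact p) (𝒜.subset p)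
    (𝒜.smooth p) (𝒜.supp p) hδ
  have key : ∀ φ : M → ℝ, ContMDiff (𝓡 4) 𝓘(ℝ, ℝ) ∞ φ → ∫ x, φ x ^ 2 ∂(vol g)
      ≤ ε * sobSq g φ + (N * ∑ p ∈ 𝒜.ι, C p) * ∑ ζ ∈ 𝒜.ι.biUnion W,
        (∫ x, ζ x * φ x ∂(vol g)) ^ 2 := by
    intro φ hφ
    have hi : ∀ p, Integrable (fun x => (𝒜.θ p x * φ x) ^ 2) (vol g) := fun p =>
      integrable_of_contMDiff (((𝒜.smooth p).mul hφ).pow 2)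
    have h1 : ∫ x, φ x ^ 2 ∂(vol g) ≤ N * ∑ p ∈ 𝒜.ι, ∫ x, (𝒜.θ p x * φ x) ^ 2 ∂(vol g) := by
      rw [← integral_finsetSum _ fun p _ => hi p, ← integral_const_mul]
      refine integral_mono (integrable_of_contMDiff (hφ.pow 2))
        ((integrable_finsetSum _ fun p _ => hi p).const_mul _) fun x => ?_
      exact (congrArg (· ^ 2) (𝒜.eq_sum φ x)).le.trans sq_sum_le_card_mul_sum_sq
    have hS : 0 ≤ sobSq g φ := sobSq_nonneg φ
    set T : ℝ := ∑ ζ ∈ 𝒜.ι.biUnion W, (∫ x, ζ x * φ x ∂(vol g)) ^ 2 with hT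
    have h2 : ∀ p ∈ 𝒜.ι, ∫ x, (𝒜.θ p x * φ x) ^ 2 ∂(vol g)
        ≤ ε / (N * N + 1) * sobSq g φ + C p * T := fun p hp => by
      refine (h p φ hφ).trans (add_le_add le_rfl (mul_le_mul_of_nonneg_left ?_ (hC p)))
      exact Finset.sum_le_sum_of_subset_of_nonneg (Finset.subset_biUnion_of_mem W hp)
        fun _ _ _ => sq_nonneg _
    have h3 := Finset.sum_le_sum h2
    rw [Finset.sum_add_distrib, Finset.sum_const, nsmul_eq_mul, ← Finset.sum_mul] at h3
    have h4 : N * (N * (ε / (N * N + 1) * sobSq g φ)) ≤ ε * sobSq g φ := by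
      have : N * (N * (ε / (N * N + 1) * sobSq g φ)) = (N * N / (N * N + 1)) * (ε * sobSq g φ) := by
        field_simp
      rw [this]
      refine mul_le_of_le_one_left (by positivity) ?_
      rw [div_le_one (by positivity)]
      linarith
    have h5 := mul_le_mul_of_nonneg_left h3 (by positivity : 0 ≤ N)
    rw [mul_add] at h5
    refine h1.trans (h5.trans (add_le_add h4 (le_of_eq ?_)))
    ring
  have hWm : ∀ ζ ∈ 𝒜.ι.biUnion W, MemLp ζ 2 (vol g) := fun ζ hζ => by
    obtain ⟨p, -, hp⟩ := Finset.mem_biUnion.1 hζ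
    exact hW p ζ hp
  refine ⟨𝒜.ι.biUnion W, N * ∑ p ∈ 𝒜.ι, C p,
    mul_nonneg (Nat.cast_nonneg _) (Finset.sum_nonneg fun p _ => hC p), hWm,
    fun u hu => ?_⟩
  obtain ⟨Φ, hΦ⟩ := hu.exists_approx g
  refine le_of_tendsto_of_tendsto' hΦ.tendsto_integral_sq ((hΦ.tendsto_sobSq.const_mul ε).add
    ((tendsto_finsetSum _ fun ζ hζ => ?_).const_mul _)) fun n => key _ (hΦ.smooth n)
  exact (tendsto_integral_mul (fun _ => hWm ζ hζ) (hWm ζ hζ)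
    (fun n => memLp_of_contMDiff g (hΦ.smooth n)) hΦ.memLp (by simp) hΦ.tendsto.1).pow 2

variable (g) in
-- The L² term in Gårding's inequality is replaced by half of the H² norm, which is absorbed, plus
-- finitely many functionals. Up to a finite-dimensional error the form alone is thus coercive.
lemma exists_garding_compact : ∃ (W : Finset (M → ℝ)) (C : ℝ), 0 ≤ C ∧
    (∀ ζ ∈ W, MemLp ζ 2 (vol g)) ∧ ∀ u : M → ℝ, MemH2 u → hNormSq g u
      ≤ 4 * form g u u + C * ∑ ζ ∈ W, (∫ x, ζ x * u x ∂(vol g)) ^ 2 := by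
  obtain ⟨C, hC, h⟩ := exists_garding g
  obtain ⟨W, D, hD, hW, h2⟩ := exists_compactness g (ε := 1 / (2 * (C + 1))) (by positivity)
  refine ⟨W, 2 * C * D, by positivity, hW, fun u hu => ?_⟩
  have h3 := (h u hu).1
  have h4 := mul_le_mul_of_nonneg_left (h2 u hu) hC
  have h5 : C * (1 / (2 * (C + 1)) * hNormSq g u) ≤ 1 / 2 * hNormSq g u := by
    rw [← mul_assoc]
    refine mul_le_mul_of_nonneg_right ?_ (hNormSq_nonneg u)
    rw [mul_one_div, div_le_div_iff₀ (by positivity) (by norm_num)]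
    linarith
  nlinarith

/-- `H²` is complete. -/
theorem exists_limit_of_cauchy {u : ℕ → M → ℝ} (hu : ∀ n, MemH2 (u n)) {b : ℕ → ℝ}
    (hb0 : ∀ n, 0 ≤ b n) (hb : Tendsto b atTop (𝓝 0))
    (h : ∀ n m, hNormSq g (fun x => u n x - u m x) ≤ b n + b m) :
    ∃ v, MemH2 v ∧ Tendsto (fun n => eLpNorm (fun x => u n x - v x) 2 (vol g)) atTop (𝓝 0) ∧
      Tendsto (fun n => hNormSq g (fun x => u n x - v x)) atTop (𝓝 0) := by
  choose Φ hΦ using fun n => (hu n).exists_approx g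
  have hb' : Tendsto (fun n => ENNReal.ofReal √(b n)) atTop (𝓝 0) := by
    have := ENNReal.tendsto_ofReal ((Real.continuous_sqrt.tendsto 0).comp hb)
    simpa using this
  have key : ∀ {a : M → ℝ} {n m}, MemLp a 2 (vol g) → ∫ x, a x ^ 2 ∂(vol g) ≤ b n + b m →
      eLpNorm a 2 (vol g) ≤ ENNReal.ofReal √(b n) + ENNReal.ofReal √(b m) := by
    intro a n m ha h1
    rw [eLpNorm_two_eq ha.integrable_sq, ← ENNReal.ofReal_add (Real.sqrt_nonneg _)
      (Real.sqrt_nonneg _)]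
    refine ENNReal.ofReal_le_ofReal ((Real.sqrt_le_sqrt h1).trans ?_)
    refine Real.sqrt_le_iff.2 ⟨by positivity, ?_⟩
    nlinarith [Real.sq_sqrt (hb0 n), Real.sq_sqrt (hb0 m), Real.sqrt_nonneg (b n),
      Real.sqrt_nonneg (b m), mul_nonneg (Real.sqrt_nonneg (b n)) (Real.sqrt_nonneg (b m))]
  have hs := fun n m => ((hΦ n).sub (hΦ m)).hNormSq_eq
  obtain ⟨v, hv, tv⟩ := exists_tendsto_of_cauchy (fun n => (hΦ n).memLp) hb' fun n m =>
    key ((hΦ n).memLp.sub (hΦ m).memLp) (le_trans (by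
      rw [hs]; exact le_add_of_nonneg_right (integral_nonneg fun _ => sq_nonneg _)) (h n m))
  obtain ⟨w, hw, tw⟩ := exists_tendsto_of_cauchy (fun n => (hΦ n).memLp') hb' fun n m =>
    key ((hΦ n).memLp'.sub (hΦ m).memLp') (le_trans (by
      rw [hs]; exact le_add_of_nonneg_left (integral_nonneg fun _ => sq_nonneg _)) (h n m))
  -- The graph of the weak Laplacian is closed, so the L² limit of the Laplacians belongs to the
  -- limit function.
  obtain ⟨Ψ, hΨ⟩ := exists_approx_of_tendsto hv hw (fun n => ⟨_, hΦ n⟩) tv tw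
  refine ⟨v, hΨ.memH2, tv, ?_⟩
  simp only [((hΦ _).sub hΨ).hNormSq_eq]
  have t0 : ∀ {a : ℕ → M → ℝ} {A : M → ℝ}, (∀ n, MemLp (a n) 2 (vol g)) → MemLp A 2 (vol g) →
      Tendsto (fun n => eLpNorm (fun x => a n x - A x) 2 (vol g)) atTop (𝓝 0) →
      Tendsto (fun n => ∫ x, (a n x - A x) ^ 2 ∂(vol g)) atTop (𝓝 0) := by
    intro a A ha hA h0
    have := tendsto_integral_mul (A := fun _ => 0) (B := fun _ => 0) (fun n => (ha n).sub hA)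
      MemLp.zero' (fun n => (ha n).sub hA) MemLp.zero' (by simpa using h0) (by simpa using h0)
    simpa [pow_two] using this
  simpa using (t0 (fun n => (hΦ n).memLp) hv tv).add (t0 (fun n => (hΦ n).memLp') hw tw)

lemma tendsto_integral_mul_left {u : ℕ → M → ℝ} {v : M → ℝ} (hu : ∀ n, MemH2 (u n)) (hv : MemH2 v)
    (h : Tendsto (fun n => eLpNorm (fun x => u n x - v x) 2 (vol g)) atTop (𝓝 0)) {ζ : M → ℝ}
    (hζ : MemLp ζ 2 (vol g)) : Tendsto (fun n => ∫ x, ζ x * u n x ∂(vol g)) atTop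
      (𝓝 (∫ x, ζ x * v x ∂(vol g))) :=
  tendsto_integral_mul (fun _ => hζ) hζ (fun n => (hu n).memLp g) (hv.memLp g) (by simp) h

lemma sq_integral_mul_le {α : Type*} [MeasurableSpace α] {μ : Measure α} {a b : α → ℝ}
    (ha : MemLp a 2 μ) (hb : MemLp b 2 μ) :
    (∫ x, a x * b x ∂μ) ^ 2 ≤ (∫ x, a x ^ 2 ∂μ) * ∫ x, b x ^ 2 ∂μ := by
  have := discrim_le_zero (a := ∫ x, b x ^ 2 ∂μ) (b := 2 * ∫ x, a x * b x ∂μ)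
    (c := ∫ x, a x ^ 2 ∂μ) fun t => by
    have i1 : Integrable (fun x => t * t * b x ^ 2) μ := hb.integrable_sq.const_mul (t * t)
    have i2 : Integrable (fun x => 2 * t * (a x * b x)) μ := (ha.integrable_mul hb).const_mul (2 * t)
    have e : (∫ x, b x ^ 2 ∂μ) * (t * t) + 2 * (∫ x, a x * b x ∂μ) * t + ∫ x, a x ^ 2 ∂μ
        = ∫ x, (a x + t * b x) ^ 2 ∂μ := by
      calc _ = (∫ x, t * t * b x ^ 2 ∂μ) + (∫ x, 2 * t * (a x * b x) ∂μ) + ∫ x, a x ^ 2 ∂μ := by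
            rw [integral_const_mul, integral_const_mul]; ring
        _ = ∫ x, (t * t * b x ^ 2 + 2 * t * (a x * b x)) + a x ^ 2 ∂μ := by
            rw [← integral_add i1 i2]; exact (integral_add (i1.add i2) ha.integrable_sq).symm
        _ = _ := integral_congr_ae (Eventually.of_forall fun x => by simp only; ring)
    rw [e]
    exact integral_nonneg fun _ => sq_nonneg _
  unfold discrim at this
  linarith

variable (g) in
/-- The Paneitz form is coercive on `H²_Q`. -/
theorem exists_coercive (hP : PaneitzNonneg g)
    (hker : ∀ u ∈ paneitzKer g, ∃ c : ℝ, u =ᵐ[vol g] fun _ => c) (hκ : 0 < kappa g) :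
    ∃ c, 0 ≤ c ∧ ∀ u ∈ H2Q g, hNormSq g u ≤ c * form g u u := by
  by_contra! hcon
  obtain ⟨W, C, hC, hW, hgard⟩ := exists_garding_compact g
  choose v hvQ hv using fun n : ℕ => hcon (n + 1) (by positivity)
  have hpos : ∀ n, 0 < hNormSq g (v n) := fun n =>
    (mul_nonneg (by positivity) (form_nonneg hP (hvQ n).1)).trans_lt (hv n)
  -- Normalization to H² norm 1; the negated inequality then bounds the form by 1 / (n + 1).
  set r : ℕ → ℝ := fun n => (√(hNormSq g (v n)))⁻¹ with hr
  set u : ℕ → M → ℝ := fun n x => r n * v n x with hu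
  have hr2 : ∀ n, r n ^ 2 = (hNormSq g (v n))⁻¹ := fun n => by
    simp only [hr, inv_pow, Real.sq_sqrt (hpos n).le]
  have huH : ∀ n, MemH2 (u n) := fun n => (hvQ n).1.const_mul g (r n)
  have hu1 : ∀ n, hNormSq g (u n) = 1 := fun n => by
    simp only [hu]
    rw [hNormSq_const_mul (hvQ n).1, hr2, inv_mul_cancel₀ (hpos n).ne']
  have huF : ∀ n : ℕ, form g (u n) (u n) ≤ 1 / ((n : ℝ) + 1) := fun n => by
    simp only [hu]
    rw [form_const_mul_self (hvQ n).1, hr2, inv_mul_eq_div, div_le_div_iff₀ (hpos n) (by positivity)]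
    linarith [(hv n).le]
  have huQ : ∀ n, ∫ x, qCurv g x * u n x ∂(vol g) = 0 := fun n => by
    have : ∫ x, qCurv g x * u n x ∂(vol g) = r n * ∫ x, qCurv g x * v n x ∂(vol g) := by
      rw [← integral_const_mul]
      exact integral_congr_ae (Eventually.of_forall fun x => by simp only [hu]; ring)
    rw [this, (hvQ n).2, mul_zero]
  -- a convergent subsequence of the functionals
  set ℓ : ℕ → W → ℝ := fun n ζ => ∫ x, ζ.1 x * u n x ∂(vol g) with hℓ
  have hbd : ∀ n, ℓ n ∈ Set.Icc (fun ζ : W => -√(∫ x, ζ.1 x ^ 2 ∂(vol g)))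
      (fun ζ : W => √(∫ x, ζ.1 x ^ 2 ∂(vol g))) := by
    intro n
    have h1 : ∀ ζ : W, |ℓ n ζ| ≤ √(∫ x, ζ.1 x ^ 2 ∂(vol g)) := fun ζ => by
      refine Real.abs_le_sqrt ?_
      have hcs := sq_integral_mul_le (hW ζ.1 ζ.2) ((huH n).memLp g)
      refine hcs.trans (mul_le_of_le_one_right (integral_nonneg fun _ => sq_nonneg _) ?_)
      exact (integral_sq_le_hNormSq (g := g) (u n)).trans (hu1 n).le
    exact ⟨fun ζ => (abs_le.1 (h1 ζ)).1, fun ζ => (abs_le.1 (h1 ζ)).2⟩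
  obtain ⟨a, -, s, hs, ta⟩ := isCompact_Icc.tendsto_subseq hbd
  -- The bound for differences from `exists_garding_compact`: 8 is 4 times the 2 of `form_sub_le`,
  -- and the last 2 comes from (x − y)² ≤ 2 (x − a)² + 2 (y − a)².
  set b : ℕ → ℝ := fun n => 8 / ((s n : ℝ) + 1) + C * ∑ ζ : W, 2 * (ℓ (s n) ζ - a ζ) ^ 2 with hb
  have hb0 : ∀ n, 0 ≤ b n := fun n => add_nonneg (by positivity)
    (mul_nonneg hC (Finset.sum_nonneg fun ζ _ => by positivity))
  have tb : Tendsto b atTop (𝓝 0) := by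
    have t1 : Tendsto (fun n => 8 * (1 / ((s n : ℝ) + 1))) atTop (𝓝 (8 * 0)) :=
      (tendsto_one_div_add_atTop_nhds_zero_nat.comp hs.tendsto_atTop).const_mul 8
    have t2 : Tendsto (fun n => C * ∑ ζ : W, 2 * (ℓ (s n) ζ - a ζ) ^ 2) atTop
        (𝓝 (C * ∑ ζ : W, 2 * (a ζ - a ζ) ^ 2)) :=
      (tendsto_finsetSum _ fun ζ _ => (((((tendsto_pi_nhds.1 ta) ζ).sub_const (a ζ)).pow 2).const_mul
        2)).const_mul C
    have := t1.add t2
    simp only [sub_self, mul_zero, add_zero, ne_eq, OfNat.ofNat_ne_zero, not_false_eq_true, zero_pow,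
      Finset.sum_const_zero] at this
    refine this.congr fun n => ?_
    simp only [hb, mul_one_div]
  obtain ⟨w, hwH, tw, twN⟩ := exists_limit_of_cauchy (g := g) (fun n => huH (s n)) hb0 tb fun n m => by
    refine (hgard _ ((huH _).sub g (huH _))).trans ?_
    have h1 := (form_sub_le hP (huH (s n)) (huH (s m)))
    have h2 := huF (s n)
    have h3 := huF (s m)
    have h4 : ∑ ζ ∈ W, (∫ x, ζ x * (u (s n) x - u (s m) x) ∂(vol g)) ^ 2
        ≤ ∑ ζ : W, (2 * (ℓ (s n) ζ - a ζ) ^ 2 + 2 * (ℓ (s m) ζ - a ζ) ^ 2) := by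
      rw [← Finset.sum_coe_sort W]
      refine Finset.sum_le_sum fun ζ _ => ?_
      have e : ∫ x, ζ.1 x * (u (s n) x - u (s m) x) ∂(vol g) = ℓ (s n) ζ - ℓ (s m) ζ := by
        have i := fun k => (hW ζ.1 ζ.2).integrable_mul ((huH k).memLp g)
        simp only [mul_sub]
        exact integral_sub (i (s n)) (i (s m))
      rw [e]
      nlinarith [sq_nonneg (ℓ (s n) ζ - a ζ + (ℓ (s m) ζ - a ζ))]
    rw [Finset.sum_add_distrib] at h4
    have h5 := mul_le_mul_of_nonneg_left h4 hC
    simp only [hb]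
    have e8 : ∀ k : ℕ, 8 / ((k : ℝ) + 1) = 8 * (1 / ((k : ℝ) + 1)) := fun k => by ring
    rw [e8, e8]
    linarith
  -- the limit is in the kernel
  have hwK : w ∈ paneitzKer g := by
    refine ⟨hwH, fun φ hφ => ?_⟩
    have hφH := memH2_of_contMDiff g hφ
    have t1 : Tendsto (fun n => form g (u (s n)) φ) atTop (𝓝 (∫ x, w x * paneitz g φ x ∂(vol g))) := by
      have hPφ := memLp_of_contMDiff g (contMDiff_paneitz (g := g) hφ)
      have := tendsto_integral_mul_left (fun n => huH (s n)) hwH tw hPφ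
      simp only [mul_comm (paneitz g φ _)] at this
      exact this.congr fun n => (form_contMDiff (huH _) hφ).symm
    -- Cauchy–Schwarz for the nonnegative form, whose diagonal values on the sequence tend to zero.
    have t2 : Tendsto (fun n => form g (u (s n)) φ) atTop (𝓝 0) := by
      have t3 : Tendsto (fun n => √(1 / ((s n : ℝ) + 1) * form g φ φ)) atTop (𝓝 0) := by
        have := (Real.continuous_sqrt.tendsto _).comp
          ((tendsto_one_div_add_atTop_nhds_zero_nat (𝕜 := ℝ).comp hs.tendsto_atTop).mul_const
            (form g φ φ))
        simpa [Function.comp_def] using this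
      refine squeeze_zero_norm (fun n => ?_) t3
      rw [Real.norm_eq_abs]
      exact Real.abs_le_sqrt ((form_sq_le hP (huH _) hφH).trans
        (mul_le_mul_of_nonneg_right (huF _) (form_nonneg hP hφH)))
    exact tendsto_nhds_unique t1 t2
  obtain ⟨c, hc⟩ := hker w hwK
  have hQ := memLp_of_contMDiff g (contMDiff_qCurv (g := g))
  have hwQ : ∫ x, qCurv g x * w x ∂(vol g) = 0 := by
    refine tendsto_nhds_unique (tendsto_integral_mul_left (fun n => huH (s n)) hwH tw hQ) ?_
    simp only [huQ]
    exact tendsto_const_nhds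
  -- The constraint survives in the limit and reads κ c = 0.
  have hc0 : c = 0 := by
    have e : ∫ x, qCurv g x * w x ∂(vol g) = kappa g * c := by
      rw [kappa, ← integral_mul_const]
      refine integral_congr_ae ?_
      filter_upwards [hc] with x hx
      rw [hx]
    rw [e] at hwQ
    exact (mul_eq_zero.1 hwQ).resolve_left hκ.ne'
  -- Since the limit vanishes almost everywhere, the norms of the differences are still 1,
  -- contradicting convergence in H².
  have hcong : ∀ n, hNormSq g (fun x => u (s n) x - w x) = 1 := fun n => by
    obtain ⟨Φ, hΦ⟩ := (huH (s n)).exists_approx g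
    have h2 := hΦ.congr_ae (u' := fun x => u (s n) x - w x) (by
      filter_upwards [hc] with x hx
      rw [hx, hc0, sub_zero]) (ae_eq_refl _)
    rw [← hu1 (s n), h2.hNormSq_eq, hΦ.hNormSq_eq]
    congr 1
    refine integral_congr_ae ?_
    filter_upwards [hc] with x hx
    rw [hx, hc0, sub_zero]
  simp only [hcong] at twN
  exact one_ne_zero (tendsto_nhds_unique tendsto_const_nhds twN)

end Coercivity

/-! ### Exponential integrability -/

section Exp

open Filter

variable {M : Type*} [TopologicalSpace M] [ChartedSpace E4 M] [IsManifold (𝓡 4) ∞ M]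
  [T2Space M] [CompactSpace M] [MeasurableSpace M] [BorelSpace M] {g : Metric M}

variable (g) in
-- Bounds the second derivatives on the whole space after the cutoff, which is what the Sobolev
-- inequality for gradients requires.
lemma exists_eLpNorm_cutoff_le {p : M} {C : Set E4} (hC : IsCompact C) (hCd : C ⊆ dom p)
    {χ : E4 → ℝ} (hχ : TestFn C χ) : ∃ K : NNReal, ∀ φ : M → ℝ, ContMDiff (𝓡 4) 𝓘(ℝ, ℝ) ∞ φ →
      ∀ i j, eLpNorm (pd i (pd j (fun y => χ y * loc p φ y))) 2 volume
        ≤ K * (eLpNorm φ 2 (vol g) + eLpNorm (laplacian g φ) 2 (vol g)) := by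
  have hd := isOpen_dom p
  obtain ⟨K0, h0⟩ := exists_eLpNorm_le g hC hCd
  obtain ⟨K1, h1⟩ := exists_eLpNorm_pd_le g hC hCd
  obtain ⟨L0, -, b0⟩ := exists_abs_le hC (ι := Unit) (f := fun _ => χ)
    (fun _ => hχ.continuous.continuousOn)
  obtain ⟨L1, -, b1⟩ := exists_abs_le hC (f := fun i => pd i χ)
    (fun i => (hχ.pd i).continuous.continuousOn)
  obtain ⟨L2, -, b2⟩ := exists_abs_le hC (ι := Fin 4 × Fin 4) (f := fun a => pd a.1 (pd a.2 χ))
    (fun a => ((hχ.pd a.2).pd a.1).continuous.continuousOn)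
  refine ⟨L2.toNNReal * K0 + 2 * (L1.toNNReal * K1) + L0.toNNReal * K1, fun φ hφ i j => ?_⟩
  have s := ContMDiff.loc hφ p
  set N : ENNReal := eLpNorm φ 2 (vol g) + eLpNorm (laplacian g φ) 2 (vol g) with hN
  have hT := hχ.mul_contDiffOn hd hCd s
  have e1 : eLpNorm (pd i (pd j (fun y => χ y * loc p φ y))) 2 volume
      = eLpNorm (pd i (pd j (fun y => χ y * loc p φ y))) 2 (volume.restrict C) := by
    rw [← eLpNorm_indicator_eq_eLpNorm_restrict hC.measurableSet]
    congr 1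
    funext y
    by_cases hy : y ∈ C
    · rw [Set.indicator_of_mem hy]
    · rw [Set.indicator_of_notMem hy, ((hT.pd j).pd i).eq_zero hy]
  have e2 : eLpNorm (pd i (pd j (fun y => χ y * loc p φ y))) 2 (volume.restrict C)
      = eLpNorm (((fun y => pd i (pd j χ) y * loc p φ y) + fun y => pd j χ y * pd i (loc p φ) y)
        + ((fun y => pd i χ y * pd j (loc p φ) y) + fun y => χ y * pd i (pd j (loc p φ)) y)) 2
        (volume.restrict C) := by
    refine eLpNorm_congr_ae ?_
    filter_upwards [ae_restrict_mem hC.measurableSet] with y hy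
    exact pd_pd_mul hd hχ.smooth s (hCd hy) i j
  have m : ∀ {a b : E4 → ℝ}, Continuous a → ContinuousOn b (dom p) →
      AEStronglyMeasurable (fun y => a y * b y) (volume.restrict C) := fun ha hb =>
    (ha.continuousOn.mul (hb.mono hCd)).aestronglyMeasurable hC.measurableSet
  have cp := fun k => (pd_contDiffOn hd s k).continuousOn
  have cpp := (pd_contDiffOn hd (pd_contDiffOn hd s j) i).continuousOn
  have m1 := m ((hχ.pd j).pd i).continuous s.continuousOn
  have m2 := m (hχ.pd j).continuous (cp i)
  have m3 := m (hχ.pd i).continuous (cp j)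
  have m4 := m hχ.continuous cpp
  rw [e1, e2]
  refine (eLpNorm_add_le (m1.add m2) (m3.add m4) (by norm_num)).trans ?_
  refine (add_le_add (eLpNorm_add_le m1 m2 (by norm_num))
    (eLpNorm_add_le m3 m4 (by norm_num))).trans ?_
  have hφN : eLpNorm (loc p φ) 2 (volume.restrict C) ≤ K0 * N :=
    ((h0 φ (memLp_of_contMDiff g hφ).1.restrict).1).trans (mul_le_mul_right le_self_add _)
  have a1 := (eLpNorm_mul_le (f := loc p φ) hC (b2 (i, j))).trans (mul_le_mul_right hφN _)
  have a2 := (eLpNorm_mul_le (f := pd i (loc p φ)) hC (b1 j)).trans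
    (mul_le_mul_right ((h1 φ hφ).1 i) _)
  have a3 := (eLpNorm_mul_le (f := pd j (loc p φ)) hC (b1 i)).trans
    (mul_le_mul_right ((h1 φ hφ).1 j) _)
  have a4 := (eLpNorm_mul_le (f := pd i (pd j (loc p φ))) hC (b0 ())).trans
    (mul_le_mul_right ((h1 φ hφ).2 i j) _)
  refine (add_le_add (add_le_add a1 a2) (add_le_add a3 a4)).trans_eq ?_
  simp only [ENNReal.ofReal]
  push_cast
  ring

lemma exists_tendsto_ae {α : Type*} [MeasurableSpace α] {μ : Measure α} {a : ℕ → α → ℝ} {A : α → ℝ}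
    (ha : ∀ n, MemLp (a n) 2 μ) (hA : MemLp A 2 μ)
    (h : Tendsto (fun n => eLpNorm (fun x => a n x - A x) 2 μ) atTop (𝓝 0)) :
    ∃ s : ℕ → ℕ, StrictMono s ∧ ∀ᵐ x ∂μ, Tendsto (fun n => a (s n) x) atTop (𝓝 (A x)) :=
  (tendstoInMeasure_of_tendsto_eLpNorm two_ne_zero (fun n => (ha n).1) hA.1 h).exists_seq_tendsto_ae

variable (g) in
-- In each chart the cut-off approximants are test functions, Cauchy for second derivatives in L²
-- and hence for gradients in L⁴. Their almost everywhere limit is therefore exponentially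
-- integrable, and finitely many charts cover M.
theorem MemH2.integrable_exp_abs {u : M → ℝ} (hu : MemH2 u) :
    Integrable (fun x => Real.exp (4 * |u x|)) (vol g) := by
  obtain ⟨Φ, hΦ⟩ := hu.exists_approx g
  obtain ⟨𝒜⟩ := exists_finAtlas (M := M)
  obtain ⟨Cc, hCc⟩ := hΦ.cauchy
  obtain ⟨s, hs, hlim⟩ := exists_tendsto_ae (fun n => memLp_of_contMDiff g (hΦ.smooth n)) hΦ.memLp
    hΦ.tendsto.1
  have hmeas : AEStronglyMeasurable (fun x => Real.exp (4 * |u x|)) (vol g) :=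
    Real.continuous_exp.comp_aestronglyMeasurable ((continuous_abs.comp_aestronglyMeasurable
      hΦ.memLp.1).const_mul 4)
  have hp : ∀ p ∈ 𝒜.ι, IntegrableOn (fun x => Real.exp (4 * |u x|)) (piece p (𝒜.B p)) (vol g) := by
    intro p _
    have hB := 𝒜.compact p
    have hBd := 𝒜.subset p
    have hd := isOpen_dom p
    obtain ⟨χ, C, hC, hCd, hχ, h1, -⟩ := exists_cutoff hB hd hBd
    obtain ⟨K, hK⟩ := exists_eLpNorm_cutoff_le g hC hCd hχ
    obtain ⟨S, hS⟩ := exists_gradient_sobolev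
    have hT : ∀ n, TestFn C (fun y => χ y * loc p (Φ (s n)) y) := fun n =>
      hχ.mul_contDiffOn hd hCd (ContMDiff.loc (hΦ.smooth _) p)
    -- The factor 16 below counts the second derivatives in the Sobolev inequality for gradients.
    have hcau : ∀ ε : NNReal, 0 < ε → ∃ N, ∀ n ≥ N, eLpNorm (fderiv ℝ (fun y =>
        χ y * loc p (Φ (s n)) y - χ y * loc p (Φ (s N)) y)) 4 volume ≤ ε := by
      intro ε hε
      have t0 : Tendsto (fun N : ℕ => ((S * (16 * (K * Cc)) : NNReal) : ENNReal)
          * (2⁻¹ : ENNReal) ^ N) atTop (𝓝 0) := by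
        have := ENNReal.Tendsto.const_mul (a := ((S * (16 * (K * Cc)) : NNReal) : ENNReal))
          (ENNReal.tendsto_pow_atTop_nhds_zero_of_lt_one (r := 2⁻¹) (by simp))
          (Or.inr ENNReal.coe_ne_top)
        rwa [mul_zero] at this
      obtain ⟨N, hN⟩ := (t0.eventually (ge_mem_nhds (ENNReal.coe_pos.2 hε))).exists
      refine ⟨N, fun n hn => ?_⟩
      have hsm : ContMDiff (𝓡 4) 𝓘(ℝ, ℝ) ∞ (fun x => Φ (s n) x - Φ (s N) x) :=
        (hΦ.smooth _).sub (hΦ.smooth _)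
      have e : (fun y => χ y * loc p (Φ (s n)) y - χ y * loc p (Φ (s N)) y)
          = fun y => χ y * loc p (fun x => Φ (s n) x - Φ (s N) x) y :=
        funext fun y => (mul_sub _ _ _).symm
      refine (hS C _ ((hT n).sub (hT N))).trans (le_trans ?_ hN)
      have hle : ∀ i j, eLpNorm (pd i (pd j (fun y => χ y * loc p (Φ (s n)) y
          - χ y * loc p (Φ (s N)) y))) 2 volume ≤ K * (Cc * (2⁻¹ : ENNReal) ^ N) := fun i j => by
        rw [e]
        exact (hK _ hsm i j).trans (mul_le_mul_right
          (hCc N _ _ ((hs.id_le N).trans (hs.monotone hn)) (hs.id_le N)) _)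
      refine (mul_le_mul_right (Finset.sum_le_sum fun i _ => Finset.sum_le_sum fun j _ => hle i j)
        _).trans_eq ?_
      simp only [Finset.sum_const, Finset.card_univ, Fintype.card_fin, nsmul_eq_mul]
      push_cast
      ring
    have hlim' : ∀ᵐ y ∂(volume.restrict C), Tendsto (fun n => χ y * loc p (Φ (s n)) y) atTop
        (𝓝 (χ y * loc p u y)) := by
      rw [ae_restrict_iff' hC.measurableSet]
      filter_upwards [ae_dom_of_ae g hlim p] with y hy hyC using (hy (hCd hyC)).const_mul (χ y)
    have hint := integrableOn_exp_of_tendsto hC hT hcau hlim'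
    have h1' : ∀ y ∈ 𝒜.B p, χ y = 1 := fun y hy => h1.self_of_nhdsSet y hy
    have hBC : 𝒜.B p ⊆ C := fun y hy => by
      by_contra h
      have := h1' y hy
      rw [hχ.eq_zero h] at this
      exact zero_ne_one (α := ℝ) this
    rw [← integrable_indicator_iff (measurableSet_piece hB.measurableSet)]
    refine integrable_piece hB hBd (fun x hx => Set.indicator_of_notMem hx _) ?_ ?_
    · exact (aestronglyMeasurable_src_iff g p).1
        (hmeas.indicator (measurableSet_piece hB.measurableSet)).restrict
    · refine (hint.mono_set hBC).congr_fun (fun y hy => ?_) hB.measurableSet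
      have hm : (extChartAt (𝓡 4) p).symm y ∈ piece p (𝒜.B p) :=
        ⟨symm_mem_src (hBd hy), by rw [Set.mem_preimage, chart_symm (hBd hy)]; exact hy⟩
      simp only [h1' y hy, one_mul]
      exact (Set.indicator_of_mem hm (fun x => Real.exp (4 * |u x|))).symm
  have hU : ⋃ p ∈ 𝒜.ι, piece p (𝒜.B p) = Set.univ := by
    refine Set.eq_univ_of_forall fun x => ?_
    obtain ⟨p, hpι, hx⟩ := 𝒜.exists_mem x
    exact Set.mem_biUnion hpι hx
  rw [← integrableOn_univ, ← hU]
  exact (integrableOn_finset_iUnion (s := 𝒜.ι)).2 hp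

lemma integrable_mul_exp {K : M → ℝ} (hK : Continuous K) {u : M → ℝ} (hu : MemH2 u) :
    Integrable (fun x => K x * Real.exp (4 * u x)) (vol g) := by
  obtain ⟨C, hC⟩ := isCompact_univ.exists_bound_of_continuousOn hK.continuousOn
  refine ((hu.integrable_exp_abs g).const_mul C).mono' (hK.aestronglyMeasurable.mul
    (Real.continuous_exp.comp_aestronglyMeasurable ((hu.memLp g).1.const_mul 4)))
    (Eventually.of_forall fun x => ?_)
  rw [norm_mul, Real.norm_of_nonneg (Real.exp_nonneg _)]
  refine mul_le_mul (hC x trivial) (Real.exp_le_exp.2 ?_) (Real.exp_nonneg _)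
    ((norm_nonneg _).trans (hC x trivial))
  linarith [le_abs_self (u x)]

end Exp

/-! ### The obstacle problem -/

section Obstacle

open Filter

variable {M : Type*} [TopologicalSpace M] [ChartedSpace E4 M] [IsManifold (𝓡 4) ∞ M]
  [T2Space M] [CompactSpace M] [MeasurableSpace M] [BorelSpace M] {g : Metric M}

lemma integrable_qCurv_mul {u : M → ℝ} (hu : MemH2 u) :
    Integrable (fun x => qCurv g x * u x) (vol g) :=
  (memLp_of_contMDiff g contMDiff_qCurv).integrable_mul (hu.memLp g)

lemma midpoint_mem_H2Q {u v : M → ℝ} (hu : u ∈ H2Q g) (hv : v ∈ H2Q g) :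
    (fun x => 1 / 2 * (u x + v x)) ∈ H2Q g := by
  refine ⟨(hu.1.add g hv.1).const_mul g _, ?_⟩
  have e : ∫ x, qCurv g x * (1 / 2 * (u x + v x)) ∂(vol g)
      = 1 / 2 * ((∫ x, qCurv g x * u x ∂(vol g)) + ∫ x, qCurv g x * v x ∂(vol g)) := by
    rw [← integral_add (integrable_qCurv_mul hu.1) (integrable_qCurv_mul hv.1),
      ← integral_const_mul]
    exact integral_congr_ae (Eventually.of_forall fun x => by simp only; ring)
  rw [e, hu.2, hv.2]
  ring

lemma sub_mem_H2Q {u v : M → ℝ} (hu : u ∈ H2Q g) (hv : v ∈ H2Q g) :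
    (fun x => u x - v x) ∈ H2Q g := by
  refine ⟨hu.1.sub g hv.1, ?_⟩
  simp only [mul_sub]
  rw [integral_sub (integrable_qCurv_mul hu.1) (integrable_qCurv_mul hv.1), hu.2, hv.2, sub_zero]

/-- The midpoint of two competitors is again a competitor. Hence near-minimizers are close to each
other, which yields both existence and uniqueness in the obstacle problem. -/
lemma form_parallelogram {u v : M → ℝ} (hu : MemH2 u) (hv : MemH2 v) :
    form g (fun x => u x - v x) (fun x => u x - v x) = 2 * form g u u + 2 * form g v v
      - 4 * form g (fun x => 1 / 2 * (u x + v x)) (fun x => 1 / 2 * (u x + v x)) := by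
  rw [form_const_mul_self (hu.add g hv), form_add hu hv, form_sub hu hv]
  ring

/-- Coercivity bounds the L² norm of the difference by a nonpositive number. -/
lemma ae_eq_of_form_sub {c : ℝ} (hc : ∀ u ∈ H2Q g, hNormSq g u ≤ c * form g u u) (hc0 : 0 ≤ c)
    {u v : M → ℝ} (hu : u ∈ H2Q g) (hv : v ∈ H2Q g)
    (h : form g (fun x => u x - v x) (fun x => u x - v x) ≤ 0) : u =ᵐ[vol g] v := by
  have hm := sub_mem_H2Q hu hv
  have h0 : ∫ x, (u x - v x) ^ 2 ∂(vol g) = 0 := le_antisymm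
    (((integral_sq_le_hNormSq _).trans (hc _ hm)).trans (mul_nonpos_of_nonneg_of_nonpos hc0 h))
    (integral_nonneg fun _ => sq_nonneg _)
  have h1 := (integral_eq_zero_iff_of_nonneg (fun _ => sq_nonneg _) (hm.1.memLp g).integrable_sq).1 h0
  filter_upwards [h1] with x hx
  exact sub_eq_zero.1 (pow_eq_zero_iff two_ne_zero |>.1 hx)

/-- Uniqueness in the obstacle problem. -/
lemma IsObstacleSol.ae_eq {c : ℝ} (hc : ∀ u ∈ H2Q g, hNormSq g u ≤ c * form g u u) (hc0 : 0 ≤ c)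
    {u v w : M → ℝ} (hv : IsObstacleSol g u v) (hw : w ∈ H2Q g) (huw : u ≤ᵐ[vol g] w)
    (h : form g w w ≤ form g v v) : v =ᵐ[vol g] w := by
  refine ae_eq_of_form_sub hc hc0 hv.1.1 hw ?_
  -- The midpoint is admissible, so its energy is at least that of v; the parallelogram identity
  -- then makes the energy of the difference nonpositive.
  have h1 := hv.2 _ (midpoint_mem_H2Q hv.1.1 hw) (by
    filter_upwards [hv.1.2, huw] with x h1 h2
    linarith)
  rw [form_parallelogram hv.1.1.1 hw.1]
  linarith

/-- Existence in the obstacle problem. -/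
theorem exists_isObstacleSol (hP : PaneitzNonneg g) {c : ℝ}
    (hc : ∀ u ∈ H2Q g, hNormSq g u ≤ c * form g u u) (hc0 : 0 ≤ c) {u : M → ℝ} (hu : u ∈ H2Q g) :
    ∃ v, IsObstacleSol g u v := by
  set S : Set (M → ℝ) := {v | v ∈ H2Q g ∧ u ≤ᵐ[vol g] v} with hS
  set m : ℝ := sInf ((fun v => form g v v) '' S) with hm
  have hbdd : BddBelow ((fun v => form g v v) '' S) :=
    ⟨0, by rintro _ ⟨v, hv, rfl⟩; exact form_nonneg hP hv.1.1⟩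
  have hne : ((fun v => form g v v) '' S).Nonempty := ⟨_, u, ⟨hu, EventuallyLE.refl _ _⟩, rfl⟩
  have hmle : ∀ v ∈ S, m ≤ form g v v := fun v hv => csInf_le hbdd ⟨v, hv, rfl⟩
  have hex : ∀ n : ℕ, ∃ v ∈ S, form g v v < m + 1 / ((n : ℝ) + 1) := fun n => by
    obtain ⟨_, ⟨v, hv, rfl⟩, h⟩ := exists_lt_of_csInf_lt hne
      (show m < m + 1 / ((n : ℝ) + 1) by simpa using (by positivity : 0 < 1 / ((n : ℝ) + 1)))
    exact ⟨v, hv, h⟩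
  choose v hvS hv using hex
  have hvH : ∀ n, MemH2 (v n) := fun n => (hvS n).1.1
  have tδ : Tendsto (fun n : ℕ => 1 / ((n : ℝ) + 1)) atTop (𝓝 0) :=
    tendsto_one_div_add_atTop_nhds_zero_nat
  -- A minimizing sequence is Cauchy: midpoints have energy at least m, so the energy of a
  -- difference is at most twice the sum of the two excesses, and coercivity controls the norm.
  obtain ⟨w, hwH, tw, twN⟩ := exists_limit_of_cauchy (g := g) (b := fun n => c * (2 * (1 / ((n : ℝ) + 1))))
    hvH (fun n => by positivity) (by simpa using (tδ.const_mul 2).const_mul c) fun n k => by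
      refine (hc _ (sub_mem_H2Q (hvS n).1 (hvS k).1)).trans ?_
      rw [← mul_add]
      refine mul_le_mul_of_nonneg_left ?_ hc0
      rw [form_parallelogram (hvH n) (hvH k)]
      have := hmle _ (show _ ∈ S from ⟨midpoint_mem_H2Q (hvS n).1 (hvS k).1, by
        filter_upwards [(hvS n).2, (hvS k).2] with x h1 h2
        linarith⟩)
      linarith [hv n, hv k]
  have hwQ : w ∈ H2Q g := by
    refine ⟨hwH, tendsto_nhds_unique (tendsto_integral_mul_left hvH hwH tw
      (memLp_of_contMDiff g contMDiff_qCurv)) ?_⟩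
    simp only [(hvS _).1.2]
    exact tendsto_const_nhds
  -- The constraint `u ≤ w` is pointwise; an almost everywhere convergent subsequence carries it to
  -- the limit.
  obtain ⟨s, -, hs⟩ := exists_tendsto_ae (fun n => (hvH n).memLp g) (hwH.memLp g) tw
  have huw : u ≤ᵐ[vol g] w := by
    filter_upwards [hs, ae_all_iff.2 fun n => (hvS n).2] with x h1 h2
    exact ge_of_tendsto' h1 fun n => h2 (s n)
  obtain ⟨D, -, hD⟩ := exists_garding g
  have hzH : ∀ n, MemH2 (fun x => v n x - w x) := fun n => (hvH n).sub g hwH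
  have tz : Tendsto (fun n => form g (fun x => v n x - w x) (fun x => v n x - w x)) atTop (𝓝 0) :=
    squeeze_zero (fun n => form_nonneg hP (hzH n)) (fun n => (hD _ (hzH n)).2)
      (by simpa using twN.const_mul D)
  -- Write w = v_n − (v_n − w), expand, and estimate the cross term by Cauchy–Schwarz. The energy of
  -- v_n is at most m + 1 because 1 / (n + 1) ≤ 1.
  have hle : ∀ n : ℕ, form g w w ≤ (m + 1 / ((n : ℝ) + 1)) + 2 * √((m + 1)
      * form g (fun x => v n x - w x) (fun x => v n x - w x))
      + form g (fun x => v n x - w x) (fun x => v n x - w x) := by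
    intro n
    have e : form g w w = form g (fun x => v n x - (v n x - w x)) (fun x => v n x - (v n x - w x)) := by
      simp only [sub_sub_cancel]
    have h1 : |form g (v n) (fun x => v n x - w x)| ≤ √((m + 1)
        * form g (fun x => v n x - w x) (fun x => v n x - w x)) := by
      refine Real.abs_le_sqrt ((form_sq_le hP (hvH n) (hzH n)).trans
        (mul_le_mul_of_nonneg_right ?_ (form_nonneg hP (hzH n))))
      have : 1 / ((n : ℝ) + 1) ≤ 1 := by
        rw [div_le_one (by positivity)]; linarith [(Nat.cast_nonneg n : (0 : ℝ) ≤ n)]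
      linarith [hv n]
    rw [e, form_sub (hvH n) (hzH n)]
    linarith [(abs_le.1 h1).1, hv n]
  have hwm : form g w w ≤ m := by
    have t1 : Tendsto (fun n : ℕ => (m + 1 / ((n : ℝ) + 1)) + 2 * √((m + 1)
        * form g (fun x => v n x - w x) (fun x => v n x - w x))
        + form g (fun x => v n x - w x) (fun x => v n x - w x)) atTop
        (𝓝 ((m + 0) + 2 * √((m + 1) * 0) + 0)) :=
      ((tδ.const_add m).add (((Real.continuous_sqrt.tendsto _).comp (tz.const_mul (m + 1))).const_mul
        2)).add tz
    simp only [mul_zero, Real.sqrt_zero, add_zero] at t1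
    exact ge_of_tendsto' t1 hle
  exact ⟨w, ⟨hwQ, huw⟩, fun v' hv' huv' => hwm.trans (hmle v' ⟨hv', huv'⟩)⟩

end Obstacle

end Paneitz

/-! ### Comparison of the two functionals -/

theorem proposition4p5 {M : Type*} [TopologicalSpace M] [T2Space M] [CompactSpace M]
    [ChartedSpace Paneitz.E4 M] [IsManifold (𝓡 4) ∞ M] [MeasurableSpace M] [BorelSpace M]
    (g : Paneitz.Metric M)
    (K : M → ℝ) (hK : ContMDiff (𝓡 4) 𝓘(ℝ, ℝ) ∞ K) (hKpos : ∀ x, 0 < K x)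
    (hP : Paneitz.PaneitzNonneg g)
    (hker : ∀ u ∈ Paneitz.paneitzKer g, ∃ c : ℝ, u =ᵐ[Paneitz.vol g] fun _ => c)
    (t : ℝ) (ht : 0 < t) (ht1 : t ≤ 1)
    (hκ : 0 < Paneitz.kappa g) (hκ' : Paneitz.kappa g ≤ 8 * Real.pi ^ 2)
    (u : M → ℝ) :
    (u ∈ Paneitz.H2Q g ∧ IsMinOn (Paneitz.J g K t) (Paneitz.H2Q g) u) ↔
      (u ∈ Paneitz.H2Q g ∧ IsMinOn (Paneitz.I g K t) (Paneitz.H2Q g) u) := by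
  obtain ⟨c, hc0, hc⟩ := Paneitz.exists_coercive g hP hker hκ
  have hT : ∀ v ∈ Paneitz.H2Q g, Paneitz.IsObstacleSol g v (Paneitz.obstacleMap g v) :=
    fun v hv => Classical.epsilon_spec (p := Paneitz.IsObstacleSol g v)
      (Paneitz.exists_isObstacleSol hP hc hc0 hv)
  have hTQ : ∀ v ∈ Paneitz.H2Q g, Paneitz.obstacleMap g v ∈ Paneitz.H2Q g := fun v hv =>
    (hT v hv).1.1
  set E : (M → ℝ) → ℝ := fun v => ∫ x, K x * Real.exp (4 * v x) ∂(Paneitz.vol g) with hE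
  -- Finiteness is essential: the Bochner integral of a non-integrable function is 0, and
  -- monotonicity would fail.
  have hint : ∀ v ∈ Paneitz.H2Q g,
      Integrable (fun x => K x * Real.exp (4 * v x)) (Paneitz.vol g) := fun v hv =>
    Paneitz.integrable_mul_exp hK.continuous hv.1
  -- A nonzero total Q-curvature excludes the zero measure, so the arguments of the logarithms are
  -- strictly positive.
  have hvol : Paneitz.vol g ≠ 0 := fun h => by
    rw [Paneitz.kappa, h, integral_zero_measure] at hκ
    exact lt_irrefl _ hκ
  have hEpos : ∀ v ∈ Paneitz.H2Q g, 0 < E v := fun v hv => by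
    refine (integral_pos_iff_support_of_nonneg
      (fun x => (mul_pos (hKpos x) (Real.exp_pos _)).le) (hint v hv)).2 ?_
    have : Function.support (fun x => K x * Real.exp (4 * v x)) = Set.univ :=
      Set.eq_univ_of_forall fun x => (mul_pos (hKpos x) (Real.exp_pos _)).ne'
    rw [this]
    exact Measure.measure_univ_pos.2 hvol
  have hlog : ∀ v ∈ Paneitz.H2Q g, ∀ w ∈ Paneitz.H2Q g, v ≤ᵐ[Paneitz.vol g] w →
      t * Paneitz.kappa g * Real.log (E v) ≤ t * Paneitz.kappa g * Real.log (E w) := by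
    intro v hv w hw hvw
    refine mul_le_mul_of_nonneg_left (Real.log_le_log (hEpos v hv) ?_) (mul_pos ht hκ).le
    refine integral_mono_ae (hint v hv) (hint w hw) ?_
    filter_upwards [hvw] with x hx
    exact mul_le_mul_of_nonneg_left (Real.exp_le_exp.2 (by linarith)) (hKpos x).le
  have hJ : ∀ v ∈ Paneitz.H2Q g, Paneitz.J g K t v
      = Paneitz.form g v v - t * Paneitz.kappa g * Real.log (E v) := fun v hv => by
    rw [Paneitz.J, hv.2, mul_zero, add_zero]
  have hI : ∀ v, Paneitz.I g K t v = Paneitz.form g v v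
      - t * Paneitz.kappa g * Real.log (E (Paneitz.obstacleMap g v)) := fun _ => rfl
  have hIJ : ∀ v ∈ Paneitz.H2Q g, Paneitz.I g K t v ≤ Paneitz.J g K t v := fun v hv => by
    rw [hI, hJ v hv]
    linarith [hlog v hv _ (hTQ v hv) (hT v hv).1.2]
  have hform : ∀ v ∈ Paneitz.H2Q g, Paneitz.form g (Paneitz.obstacleMap g v)
      (Paneitz.obstacleMap g v) ≤ Paneitz.form g v v := fun v hv =>
    (hT v hv).2 v hv (Filter.EventuallyLE.refl _ _)
  -- The exponential terms coincide, and v is a competitor in its own obstacle problem.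
  have hJT : ∀ v ∈ Paneitz.H2Q g,
      Paneitz.J g K t (Paneitz.obstacleMap g v) ≤ Paneitz.I g K t v := fun v hv => by
    rw [hI, hJ _ (hTQ v hv)]
    linarith [hform v hv]
  have hEcongr : ∀ v w : M → ℝ, v =ᵐ[Paneitz.vol g] w → E v = E w := fun v w h => by
    refine integral_congr_ae ?_
    filter_upwards [h] with x hx
    rw [hx]
  constructor
  · rintro ⟨hu, hmin⟩
    exact ⟨hu, fun v hv => (hIJ u hu).trans ((hmin (hTQ v hv)).trans (hJT v hv))⟩
  · rintro ⟨hu, hmin⟩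
    set w := Paneitz.obstacleMap g u with hw
    have hwQ : w ∈ Paneitz.H2Q g := hTQ u hu
    -- T is idempotent: T(w) lies above w, hence above u, and has energy at most that of w = T(u),
    -- so it also solves the problem for u.
    have hTw : w =ᵐ[Paneitz.vol g] Paneitz.obstacleMap g w :=
      (hT u hu).ae_eq hc hc0 (hTQ w hwQ) ((hT u hu).1.2.trans (hT w hwQ).1.2) (hform w hwQ)
    have h1 : Paneitz.I g K t w = Paneitz.J g K t w := by
      rw [hI, hJ w hwQ, hEcongr _ _ hTw]
    have h2 : Paneitz.I g K t u ≤ Paneitz.J g K t w := h1 ▸ hmin hwQ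
    -- I_t(u) and J_t(w) carry the same logarithmic term, so only the energies remain.
    have h3 : Paneitz.form g u u ≤ Paneitz.form g w w := by
      rw [hI, hJ w hwQ] at h2
      linarith
    -- u is admissible above itself and its energy does not exceed the minimum, so uniqueness
    -- applies.
    have h4 : w =ᵐ[Paneitz.vol g] u :=
      (hT u hu).ae_eq hc hc0 hu (Filter.EventuallyLE.refl _ _) h3
    have h5 : Paneitz.J g K t u = Paneitz.I g K t u := by
      rw [hI, hJ u hu, hEcongr _ _ h4]
    exact ⟨hu, fun v hv => h5.le.trans ((hmin hv).trans (hIJ v hv))⟩
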